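/- **Theorem 4.2 (Stability of the energy-dissipation inequality and convergence).** *Setting.* Let $T>0$, let $(X,\sigma)$ be a topological space and $Q=[0,T]\times X$. For a complete extended distance $d:X\times X\to[0,\infty]$, a curve $u:[\alpha,\beta]\to X$ is absolutely continuous (AC) if $d(u(s),u(t))\le\int_s^t m$ for all $\alpha\le s\le t\le\beta$ and some $m\in L^1(\alpha,\beta)$; $|\dot u|_d(t)=\lim_{\tau\downarrow0}d(u(t+\tau),u(t))/\tau$ is its metric derivative. An AC curve $(\mathsf t,\mathsf u)$ in $Q$ is time-ordered if $\mathsf t$ is nondecreasing. An *evolution system* $(X,d,E,F,P)$ consists of a complete extended distance $d$ and functionals $E:Q\to(-\infty,\infty]$, $F:Q\to[0,\infty]$, $P:Q\times[0,\infty]\to[-\infty,\infty]$ such that $E$, $F$ and $P(\cdot,f)$, $f\in[0,\infty)$, are Lebesgue measurable along time-ordered AC curves and $P(q,\cdot)$ is nondecreasing and upper semicontinuous. It is an *upper gradient system* if for every time-ordered AC curve $\mathsf q=(\mathsf t,\mathsf u):[\alpha,\beta]\to Q$ and every Lebesgue measurable $G:[\alpha,\beta]\to[0,\infty]$ with $E(\mathsf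 q(\alpha))<\infty$, $G\ge F\circ\mathsf q$ and $\int_\alpha^\beta[P(\mathsf q,G)]_-\dot{\mathsf t}\,ds<\infty$, $$E(\mathsf q(\alpha))+\int_\alpha^\beta P(\mathsf q,G)\,\dot{\mathsf t}\,ds\le E(\mathsf q(\beta))+\int_\alpha^\beta G\,|\dot{\mathsf u}|_d\,ds .$$ A *metric dissipation function* is a convex $\psi:[0,\infty)\to[0,\infty)$ with $\psi(0)=0$ and $L=\lim_{v\to\infty}\psi(v)/v\in(0,\infty]$; it has $L$-linear growth if $L<\infty$. Put $\psi^*(f)=\sup_{v\ge0}(fv-\psi(v))$. An AC curve $u:[0,T]\to X$ satisfies the $\psi$-*energy-dissipation inequality* with a Borel map $G:[0,T]\to[0,\infty]$ if $E(0,u(0))<\infty$, $G(t)\ge F(t,u(t))$ on $[0,T]$, $\int_0^T[P(t,u(t),G(t))]_+dt<\infty$ and for every $t\in[0,T]$ $$E(t,u(t))+\int_0^t\big(\psi(|\dot u|_d)+\psi^*(G)\big)dr\le E(0,u(0))+\int_0^tP(r,u(r),G(r))\,dr .$$ *BV notions.* $u\in BV(0,T;(X,d))$ means that the pointwise $d$-variation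 of $u:[0,T]\to X$ is finite. Then $u(t_\pm)$ are its one-sided $d$-limits ($u(0_-)=u(0)$, $u(T_+)=u(T)$), $J_u=\{t\in[0,T]:u(t)\ne u(t_-)\text{ or }u(t)\ne u(t_+)\}$, and $C_u$ (the Cantor part) is the part, singular with respect to Lebesgue measure $\mathscr L^1$, of the restriction to $\mathbb R\setminus J_u$ of the distributional derivative of $V_u$, where $V_u(t)$ is $0$ for $t<0$, the variation of $u$ on $[0,t]$ for $t\in[0,T]$, and the variation of $u$ on $[0,T]$ for $t>T$. With $\mathfrak f=\max(F,L)$ let $$\Delta_t(x,y)=\inf\Big\{\int_{r_0}^{r_1}\mathfrak f(t,\vartheta(r))\,|\dot\vartheta|_d(r)\,dr:\ \vartheta:[r_0,r_1]\to X\ \text{AC},\ \vartheta(r_0)=x,\ \vartheta(r_1)=y\Big\},$$ and for $\alpha<\beta$ let $$\mathrm{Jmp}(u;[\alpha,\beta])=\Delta_\alpha(u(\alpha),u(\alpha_+))+\sum_{t\in J_u\cap(\alpha,\beta)}\big[\Delta_t(u(t_-),u(t))+\Delta_t(u(t),u(t_+))\big]+\Delta_\beta(u(\beta_-),u(\beta)),$$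 while $\mathrm{Jmp}(u;[\alpha,\alpha])=0$. For a Borel map $G:[0,T]\to[0,\infty]$ put $$D(u,G;[\alpha,\beta])=\int_\alpha^\beta\big(\psi(|\dot u|_d)+\psi^*(G)\big)dr+L\,C_u([\alpha,\beta])+\mathrm{Jmp}(u;[\alpha,\beta]).$$ Consider the conditions * (A) $E(0,u(0))<\infty$, $G(t)\ge F(t,u(t))$ on $[0,T]$, $t\mapsto P(t,u(t),G(t))$ is Lebesgue measurable with $\int_0^T[P(t,u(t),G(t))]_+dt<\infty$, and ($\mathrm S_{\rm loc}$): $G(t)\le L$ for $(\mathscr L^1+C_u)$-a.e. $t\in[0,T]$; * (ED) $E(t,u(t))+D(u,G;[0,t])\le E(0,u(0))+\int_0^tP(r,u(r),G(r))\,dr$ for every $t\in[0,T]$; * (EB) $E(t_2,u(t_2))+D(u,G;[t_1,t_2])=E(t_1,u(t_1))+\int_{t_1}^{t_2}P(r,u(r),G(r))\,dr$ for all $0\le t_1\le t_2\le T$. A curve $u\in BV(0,T;(X,d))$ satisfies the *BV energy-dissipation inequality* if (A) and (ED) hold for some Borel $G$; it is a *BV solution* of an upper gradient system if (A) and (EB)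 hold for some Borel $G$. *Hypotheses.* Let $(X,d_h,E_h,F_h,P_h)$, $h\in\mathbb N$, and $(X,d,E,F,P)$ be evolution systems, let $\psi_h,\psi$ be metric dissipation functions with $\psi_h\to\psi$ pointwise on $[0,\infty)$, $\psi$ having $L$-linear growth, and let $\bar u_h\to\bar u$ in $(X,\sigma)$. For some constants $a<L$, $b\ge0$ put $\tilde E_h(t,x)=E_h(t,x)+a\,d_h(x,\bar u_h)+b$, and suppose that the following hold (for every infinite $H\subset\mathbb N$; limits are for $h\to\infty$, $h\in H$; points $(t_h,x_h)$ are in $Q$): * (C1) $\tilde E_h\ge0$ on $Q$ for every $h$. * (C2) If $\sup_{h\in H}\tilde E_h(t_h,x_h)<\infty$, there is an infinite $H'\subset H$ along which $(t_h,x_h)$ converges in $[0,T]\times(X,\sigma)$. * (C3) If $(t^i_h,x^i_h)\to(t^i,x^i)$ and $\sup_{h\in H}\tilde E_h(t^i_h,x^i_h)<\infty$ for $i=1,2$, then $\liminf d_h(x^1_h,x^2_h)\ge d(x^1,x^2)$. * (C4$_E$) If $t\in[0,T]$, $x_h\to x$ and $\sup_{h\in H}\tilde E_h(t,x_h)<\infty$,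 then $\liminf E_h(t,x_h)\ge E(t,x)$. * (C4$_{FP}$) If in addition $f_h\ge F_h(t,x_h)$ and $f_h\to f$ in $[0,\infty)$, then $f\ge F(t,x)$ and $\limsup P_h(t,x_h,f_h)\le P(t,x,f)$. * (C4$_F$) If $t_h\to t$, $x_h\to x$, $\sup_{h\in H}\tilde E_h(t_h,x_h)<\infty$ and $\sup_{h\in H}E_h(t_h,x_h)<\infty$, then $\liminf F_h(t_h,x_h)\ge F(t,x)$. Let $H\subset\mathbb N$ be infinite. For $h\in H$ let $u_h$ be an AC curve in $(X,d_h)$ that satisfies the $\psi_h$-energy-dissipation inequality of the $h$-th system with a Borel map $G_h$, and $u_h(0)=\bar u_h$. Suppose that $u_h(t)\to u(t)$ in $(X,\sigma)$ for every $t\in[0,T]$, that $E_h(0,\bar u_h)\to E(0,\bar u)<\infty$, and that the functions $r\mapsto[P_h(r,u_h(r),G_h(r))]_+$, $h\in H$, are equi-integrable in $(0,T)$. *Conclusions.* 1. $u\in BV(0,T;(X,d))$ and $F(t,u(t))\le L$ for every $t\in[0,T]\setminus J_u$. 2. If $\int_0^T[P(t,u(t),L)]_+dt<\infty$, then $u$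 satisfies the BV energy-dissipation inequality (that is, (A), including ($\mathrm S_{\rm loc}$), and (ED) hold for some Borel $G$). 3. If $(X,d,E,F,P)$ is an upper gradient system, then $\int_0^T[P(t,u(t),L)]_+dt<\infty$, $u$ is a BV solution, and $\lim_{h\in H}E_h(t,u_h(t))=E(t,u(t))$ for every $t\in[0,T]$. -/

import Mathlib

open MeasureTheory Set Filter Topology
open scoped ENNReal NNReal

namespace Evolution

noncomputable section

/-! ### Curves in a complete extended metric space

An extended metric space is an `EMetricSpace`; curves on an interval `[α, β]` are functions on `ℝ`
of which only the values in `[α, β]` matter. -/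

section Curves

variable {X : Type*} [EMetricSpace X]

/-- `u : [α, β] → X` is absolutely continuous: there is `m ∈ L¹(α, β)` with
`d(u(s), u(t)) ≤ ∫ₛᵗ m` for all `α ≤ s ≤ t ≤ β`. -/
def IsAC (u : ℝ → X) (α β : ℝ) : Prop :=
  ∃ m : ℝ → ℝ≥0∞, Measurable m ∧ ∫⁻ r in Icc α β, m r ≠ ⊤ ∧
    ∀ s t, α ≤ s → s ≤ t → t ≤ β → edist (u s) (u t) ≤ ∫⁻ r in Icc s t, m r

/-- The metric derivative `|u̇|(t) = lim_{τ ↓ 0} d(u(t + τ), u(t)) / |τ|`. The limit exists and is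
finite at almost every `t` for curves that are absolutely continuous or of bounded variation; the
upper limit is a total version of it. -/
def metricDeriv (u : ℝ → X) (t : ℝ) : ℝ≥0∞ :=
  limsup (fun τ : ℝ => edist (u (t + τ)) (u t) / ENNReal.ofReal |τ|) (𝓝[>] 0)

/-- The curve on `[0, T]`, extended to `ℝ` by its end values. -/
def extendCurve (T : ℝ) (u : ℝ → X) (t : ℝ) : X := u (max 0 (min t T))

/-- Left limit `u(t₋)` of a curve on `[0, T]`, with `u(0₋) = u(0)`. -/
def limL (T : ℝ) (u : ℝ → X) (t : ℝ) : X := Function.leftLim (extendCurve T u) t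

/-- Right limit `u(t₊)` of a curve on `[0, T]`, with `u(T₊) = u(T)`. -/
def limR (T : ℝ) (u : ℝ → X) (t : ℝ) : X := Function.rightLim (extendCurve T u) t

/-- The pointwise jump set `J_u`. -/
def jumpSet (T : ℝ) (u : ℝ → X) : Set ℝ :=
  {t | t ∈ Icc 0 T ∧ (u t ≠ limL T u t ∨ u t ≠ limR T u t)}

/-- The function `V_u`: it is `0` for `t < 0`, the variation of `u` on `[0, t]` for `t ∈ [0, T]`,
and the variation of `u` on `[0, T]` for `t > T`. -/
def variationFun (T : ℝ) (u : ℝ → X) (t : ℝ) : ℝ := (eVariationOn u (Icc 0 (min t T))).toReal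

/-- For a curve of bounded variation `V_u` is monotone. -/
theorem variationFun_monotone (T : ℝ) (u : ℝ → X) (hu : BoundedVariationOn u (Icc 0 T)) :
    Monotone (variationFun T u) := by
  intro s t hst
  have h1 : Icc 0 (min t T) ⊆ Icc 0 T := Icc_subset_Icc_right (min_le_right _ _)
  refine ENNReal.toReal_mono (hu.mono h1) (eVariationOn.mono u ?_)
  exact Icc_subset_Icc_right (min_le_min_right _ hst)

open Classical in
/-- The distributional derivative of the monotone function `V_u`. -/
def variationMeasure (T : ℝ) (u : ℝ → X) : Measure ℝ :=
  if hV : Monotone (variationFun T u) then hV.stieltjesFunction.measure else 0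

/-- The diffuse part of the variation measure: what remains off the jump set. -/
def diffuseMeasure (T : ℝ) (u : ℝ → X) : Measure ℝ :=
  (variationMeasure T u).restrict (jumpSet T u)ᶜ

/-- The Cantor part: the part of the diffuse measure that is singular to Lebesgue measure. -/
def cantorMeasure (T : ℝ) (u : ℝ → X) : Measure ℝ :=
  (diffuseMeasure T u).singularPart volume

/-- The cost of a transition from `x` to `y`: the infimum of the lengths `∫ f(ϑ(r)) |ϑ̇|(r) dr` of
the absolutely continuous curves `ϑ` from `x` to `y`, for the conformal factor `f`. -/
def transitionCost (f : X → ℝ≥0∞) (x y : X) : ℝ≥0∞ :=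
  ⨅ (r₀ : ℝ) (r₁ : ℝ) (θ : ℝ → X)
    (_ : r₀ ≤ r₁ ∧ IsAC θ r₀ r₁ ∧ θ r₀ = x ∧ θ r₁ = y),
    ∫⁻ r in Icc r₀ r₁, f (θ r) * metricDeriv θ r

open Classical in
/-- The jump functional `Jmp_{d, f}(u; [α, β])` of a curve on `[0, T]`, for a time-dependent
conformal factor `f`; an interval that is a single point carries no jump. -/
def jumpCost (T : ℝ) (f : ℝ → X → ℝ≥0∞) (u : ℝ → X) (α β : ℝ) : ℝ≥0∞ :=
  if α < β then
    transitionCost (f α) (u α) (limR T u α)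
      + ∑' t : ↥(jumpSet T u ∩ Ioo α β),
          (transitionCost (f t) (limL T u t) (u t) + transitionCost (f t) (u t) (limR T u t))
      + transitionCost (f β) (limL T u β) (u β)
  else 0

/-- `s ↦ (t(s), u(s))` is a time-ordered absolutely continuous curve `[α, β] → [0, T] × X`. -/
structure IsTimeOrderedAC (T : ℝ) (t : ℝ → ℝ) (u : ℝ → X) (α β : ℝ) : Prop where
  mem : ∀ s ∈ Icc α β, t s ∈ Icc 0 T
  mono : MonotoneOn t (Icc α β)
  ac_time : IsAC t α β
  ac_space : IsAC u α β

/-- `G : [0, T] × X → Y` is measurable along time-ordered absolutely continuous curves: its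
composition with such a curve is Lebesgue measurable. -/
def MeasurableAlongAC (T : ℝ) {Y : Type*} [MeasurableSpace Y] (G : ℝ → X → Y) : Prop :=
  ∀ (α β : ℝ) (t : ℝ → ℝ) (u : ℝ → X), α ≤ β → IsTimeOrderedAC T t u α β →
    AEMeasurable (fun s => G (t s) (u s)) (volume.restrict (Icc α β))

end Curves

/-! ### Integrals and dissipation functions -/

/-- The integral `∫_s g = ∫_s g₊ - ∫_s g₋` of an extended real function; it is used only where one
of the two integrals is finite. -/
def eIntegral (s : Set ℝ) (g : ℝ → EReal) : EReal :=
  ((∫⁻ r in s, (g r).toENNReal : ℝ≥0∞) : EReal) - ((∫⁻ r in s, (-g r).toENNReal : ℝ≥0∞) : EReal)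

/-- `ψ : [0, ∞) → [0, ∞)` is a metric dissipation function whose slope at infinity is
`L ∈ (0, ∞]`; it has `L`-linear growth when `L < ∞`. -/
structure IsMetricDissipation (ψ : ℝ≥0 → ℝ≥0) (L : ℝ≥0∞) : Prop where
  convex : ConvexOn ℝ≥0 univ ψ
  zero : ψ 0 = 0
  slope_pos : 0 < L
  tendsto_slope : Tendsto (fun v : ℝ≥0 => (ψ v : ℝ≥0∞) / (v : ℝ≥0∞)) atTop (𝓝 L)

/-- The dual `ψ*(f) = sup_{v ≥ 0} (f v - ψ(v))`. The value at `v = 0` is `0`, so the truncated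
subtraction of `[0, ∞]` does not change the supremum. -/
def dual (ψ : ℝ≥0 → ℝ≥0) (f : ℝ≥0∞) : ℝ≥0∞ := ⨆ v : ℝ≥0, f * (v : ℝ≥0∞) - (ψ v : ℝ≥0∞)

/-! ### Evolution systems -/

/-- An evolution system `(X, d, E, F, P)` in the time interval `[0, T]`. The functionals are given
on `ℝ × X`; only their values on `[0, T] × X` matter. -/
structure EvolutionSystem (X : Type*) (T : ℝ) where
  /-- the extended distance `d` -/
  metric : EMetricSpace X
  complete : @CompleteSpace X metric.toUniformSpace
  /-- the energy `E : [0, T] × X → (-∞, ∞]` -/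
  energy : ℝ → X → EReal
  energy_ne_bot : ∀ t ∈ Icc 0 T, ∀ x, energy t x ≠ ⊥
  energy_meas : MeasurableAlongAC T energy
  /-- the slope `F : [0, T] × X → [0, ∞]` -/
  slope : ℝ → X → ℝ≥0∞
  slope_meas : MeasurableAlongAC T slope
  /-- the power `P : [0, T] × X × [0, ∞] → [-∞, ∞]` -/
  power : ℝ → X → ℝ≥0∞ → EReal
  power_meas : ∀ f : ℝ≥0, MeasurableAlongAC T (fun t x => power t x f)
  power_mono : ∀ t ∈ Icc 0 T, ∀ x, Monotone (power t x)
  power_usc : ∀ t ∈ Icc 0 T, ∀ x, UpperSemicontinuous (power t x)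

namespace EvolutionSystem

variable {X : Type*} {T : ℝ} (S : EvolutionSystem X T)

/-- The extended distance. -/
def dist (x y : X) : ℝ≥0∞ := @edist X S.metric.toPseudoEMetricSpace.toEDist x y

/-- Absolutely continuous curves of the system. -/
def AC (u : ℝ → X) (α β : ℝ) : Prop := @IsAC X S.metric u α β

/-- The metric derivative for the distance of the system. -/
def speed (u : ℝ → X) (t : ℝ) : ℝ≥0∞ := @metricDeriv X S.metric u t

/-- `u ∈ BV(0, T; (X, d))`: the variation on `[0, T]` is finite (`X` is complete). -/
def BV (u : ℝ → X) : Prop :=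
  @BoundedVariationOn ℝ _ X S.metric.toPseudoEMetricSpace u (Icc 0 T)

/-- The jump set `J_u`. -/
def jumps (u : ℝ → X) : Set ℝ := @jumpSet X S.metric T u

/-- The Cantor part of the variation measure of `u`. -/
def cantor (u : ℝ → X) : Measure ℝ := @cantorMeasure X S.metric T u

/-- The jump functional for the conformal factor `max(F, L)`. -/
def jump (L : ℝ≥0) (u : ℝ → X) (α β : ℝ) : ℝ≥0∞ :=
  @jumpCost X S.metric T (fun t x => S.slope t x ⊔ (L : ℝ≥0∞)) u α β

/-- The system is an irreversible upper gradient system. -/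
def IsUpperGradient : Prop :=
  ∀ (α β : ℝ) (t : ℝ → ℝ) (u : ℝ → X) (F : ℝ → ℝ≥0∞), α ≤ β →
    @IsTimeOrderedAC X S.metric T t u α β →
    AEMeasurable F (volume.restrict (Icc α β)) →
    S.energy (t α) (u α) < ⊤ →
    (∀ s ∈ Icc α β, S.slope (t s) (u s) ≤ F s) →
    ∫⁻ s in Icc α β, (-(S.power (t s) (u s) (F s))).toENNReal * ENNReal.ofReal (deriv t s) ≠ ⊤ →
    S.energy (t α) (u α)
        + eIntegral (Icc α β) (fun s => S.power (t s) (u s) (F s) * ((deriv t s : ℝ) : EReal))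
      ≤ S.energy (t β) (u β)
        + ((∫⁻ s in Icc α β, F s * S.speed u s : ℝ≥0∞) : EReal)

/-- The absolutely continuous curve `u` satisfies the `ψ`-`ψ*` energy-dissipation inequality, with
the map `F`. -/
structure EnergyDissipation (ψ : ℝ≥0 → ℝ≥0) (u : ℝ → X) (F : ℝ → ℝ≥0∞) : Prop where
  ac : S.AC u 0 T
  measurable : Measurable F
  initial : S.energy 0 (u 0) < ⊤
  slope_le : ∀ t ∈ Icc 0 T, S.slope t (u t) ≤ F t
  power_int : ∫⁻ t in Icc 0 T, (S.power t (u t) (F t)).toENNReal ≠ ⊤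
  ineq : ∀ t ∈ Icc 0 T,
    S.energy t (u t)
        + ((∫⁻ r in Icc 0 t, ((ψ (S.speed u r).toNNReal : ℝ≥0∞) + dual ψ (F r)) : ℝ≥0∞) : EReal)
      ≤ S.energy 0 (u 0) + eIntegral (Icc 0 t) (fun r => S.power r (u r) (F r))

/-- What the two notions for curves of bounded variation below have in common: `u` is of bounded
variation with finite initial energy, `F` is a Borel map that dominates the slope along `u`, the
power along `u` has integrable positive part, and the local stability condition
`F ≤ L` holds almost everywhere for the sum of Lebesgue measure and the Cantor part. -/
structure BVAdmissible (L : ℝ≥0) (u : ℝ → X) (F : ℝ → ℝ≥0∞) : Prop where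
  bv : S.BV u
  measurable : Measurable F
  initial : S.energy 0 (u 0) < ⊤
  slope_le : ∀ t ∈ Icc 0 T, S.slope t (u t) ≤ F t
  power_meas : AEMeasurable (fun t => S.power t (u t) (F t)) (volume.restrict (Icc 0 T))
  power_int : ∫⁻ t in Icc 0 T, (S.power t (u t) (F t)).toENNReal ≠ ⊤
  stable : ∀ᵐ t ∂((volume + S.cantor u).restrict (Icc 0 T)), F t ≤ (L : ℝ≥0∞)

/-- The total dissipation of `u` on `[α, β]`: the viscous part, `L` times the Cantor part, and the
jump part. -/
def bvDissipation (ψ : ℝ≥0 → ℝ≥0) (L : ℝ≥0) (u : ℝ → X) (F : ℝ → ℝ≥0∞) (α β : ℝ) : ℝ≥0∞ :=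
  (∫⁻ r in Icc α β, ((ψ (S.speed u r).toNNReal : ℝ≥0∞) + dual ψ (F r)))
    + (L : ℝ≥0∞) * S.cantor u (Icc α β) + S.jump L u α β

/-- `u` satisfies the energy-dissipation inequality for curves of bounded variation, with the
map `F`, together with the local stability condition. -/
structure BVEnergyDissipation (ψ : ℝ≥0 → ℝ≥0) (L : ℝ≥0) (u : ℝ → X) (F : ℝ → ℝ≥0∞) : Prop where
  admissible : S.BVAdmissible L u F
  ineq : ∀ t ∈ Icc 0 T,
    S.energy t (u t) + (S.bvDissipation ψ L u F 0 t : EReal)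
      ≤ S.energy 0 (u 0) + eIntegral (Icc 0 t) (fun r => S.power r (u r) (F r))

/-- `u` satisfies the conditions of a solution of bounded variation (local stability and energy
balance on every subinterval), with the map `F`. -/
structure BVBalance (ψ : ℝ≥0 → ℝ≥0) (L : ℝ≥0) (u : ℝ → X) (F : ℝ → ℝ≥0∞) : Prop where
  admissible : S.BVAdmissible L u F
  balance : ∀ t₁ t₂, 0 ≤ t₁ → t₁ ≤ t₂ → t₂ ≤ T →
    S.energy t₂ (u t₂) + (S.bvDissipation ψ L u F t₁ t₂ : EReal)
      = S.energy t₁ (u t₁) + eIntegral (Icc t₁ t₂) (fun r => S.power r (u r) (F r))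

/-- `u` is a solution of bounded variation of an upper gradient system. -/
def IsBVSolution (ψ : ℝ≥0 → ℝ≥0) (L : ℝ≥0) (u : ℝ → X) : Prop :=
  S.IsUpperGradient ∧ ∃ F : ℝ → ℝ≥0∞, S.BVBalance ψ L u F

/-- The positive part of `t ↦ P(t, u(t), L)` is integrable on `(0, T)`. -/
def PowerBound (L : ℝ≥0) (u : ℝ → X) : Prop :=
  ∫⁻ t in Icc 0 T, (S.power t (u t) (L : ℝ≥0∞)).toENNReal ≠ ⊤

end EvolutionSystem

/-! ### Families of evolution systems -/

/-- The limit `h → ∞`, `h ∈ H`, for an infinite set `H ⊆ ℕ`. -/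
def along (H : Set ℕ) : Filter ℕ := atTop ⊓ 𝓟 H

/-- Equi-integrability on `(0, T)` of a family, indexed by `h ∈ H`, of functions with values in
`[0, ∞]`; as `(0, T)` is bounded, the integrals are then uniformly bounded as well. -/
def EquiIntegrable (H : Set ℕ) (T : ℝ) (g : ℕ → ℝ → ℝ≥0∞) : Prop :=
  ∀ ε : ℝ≥0, 0 < ε → ∃ δ : ℝ≥0, 0 < δ ∧ ∀ h ∈ H, ∀ A : Set ℝ, MeasurableSet A → A ⊆ Ioo 0 T →
    volume A ≤ δ → ∫⁻ r in A, g h r ≤ ε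

section Family

variable {X : Type*} {T : ℝ}

/-- `Ẽ_h(t, x) = E_h(t, x) + a d_h(x, ū_h) + b`. -/
def shiftedEnergy (S : ℕ → EvolutionSystem X T) (ubar : ℕ → X) (a b : ℝ) (h : ℕ) (t : ℝ) (x : X) :
    EReal :=
  (S h).energy t x + (a : EReal) * ((S h).dist x (ubar h) : EReal) + (b : EReal)

/-- (C1): the shifted energies are nonnegative. -/
def CondC1 (S : ℕ → EvolutionSystem X T) (ubar : ℕ → X) (a b : ℝ) : Prop :=
  ∀ h, ∀ t ∈ Icc 0 T, ∀ x, 0 ≤ shiftedEnergy S ubar a b h t x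

/-- The shifted energies are bounded above along the points `(t_h, x_h)`, `h ∈ H`, which lie in
`[0, T] × X`. -/
def BoundedAlong (S : ℕ → EvolutionSystem X T) (ubar : ℕ → X) (a b : ℝ) (H : Set ℕ) (t : ℕ → ℝ)
    (x : ℕ → X) : Prop :=
  (∀ h ∈ H, t h ∈ Icc 0 T) ∧ ∃ C : ℝ, ∀ h ∈ H, shiftedEnergy S ubar a b h (t h) (x h) ≤ (C : EReal)

variable [TopologicalSpace X]

/-- (C2): the shifted energies are equi-coercive. -/
def CondC2 (S : ℕ → EvolutionSystem X T) (ubar : ℕ → X) (a b : ℝ) : Prop :=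
  ∀ (H : Set ℕ) (t : ℕ → ℝ) (x : ℕ → X), H.Infinite → BoundedAlong S ubar a b H t x →
    ∃ H' ⊆ H, H'.Infinite ∧ ∃ (t' : ℝ) (x' : X),
      Tendsto t (along H') (𝓝 t') ∧ Tendsto x (along H') (𝓝 x')

/-- (C3): the lower limit inequality for the distances. -/
def CondC3 (S : ℕ → EvolutionSystem X T) (S' : EvolutionSystem X T) (ubar : ℕ → X) (a b : ℝ) :
    Prop :=
  ∀ (H : Set ℕ) (t₁ t₂ : ℕ → ℝ) (x₁ x₂ : ℕ → X) (s₁ s₂ : ℝ) (y₁ y₂ : X), H.Infinite →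
    BoundedAlong S ubar a b H t₁ x₁ → BoundedAlong S ubar a b H t₂ x₂ →
    Tendsto t₁ (along H) (𝓝 s₁) → Tendsto x₁ (along H) (𝓝 y₁) →
    Tendsto t₂ (along H) (𝓝 s₂) → Tendsto x₂ (along H) (𝓝 y₂) →
    S'.dist y₁ y₂ ≤ liminf (fun h => (S h).dist (x₁ h) (x₂ h)) (along H)

/-- (C4), energies: the lower limit inequality at a fixed time. -/
def CondC4E (S : ℕ → EvolutionSystem X T) (S' : EvolutionSystem X T) (ubar : ℕ → X) (a b : ℝ) :
    Prop :=
  ∀ (H : Set ℕ) (t : ℝ) (x : ℕ → X) (y : X), H.Infinite →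
    BoundedAlong S ubar a b H (fun _ => t) x → Tendsto x (along H) (𝓝 y) →
    S'.energy t y ≤ liminf (fun h => (S h).energy t (x h)) (along H)

/-- (C4), slopes and powers: the closedness and upper limit condition at a fixed time. -/
def CondC4FP (S : ℕ → EvolutionSystem X T) (S' : EvolutionSystem X T) (ubar : ℕ → X) (a b : ℝ) :
    Prop :=
  ∀ (H : Set ℕ) (t : ℝ) (x : ℕ → X) (y : X) (f : ℕ → ℝ≥0) (f' : ℝ≥0), H.Infinite →
    BoundedAlong S ubar a b H (fun _ => t) x → Tendsto x (along H) (𝓝 y) →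
    (∀ h ∈ H, (S h).slope t (x h) ≤ (f h : ℝ≥0∞)) → Tendsto f (along H) (𝓝 f') →
    S'.slope t y ≤ (f' : ℝ≥0∞) ∧
      limsup (fun h => (S h).power t (x h) (f h : ℝ≥0∞)) (along H) ≤ S'.power t y (f' : ℝ≥0∞)

/-- (C4), slopes: the lower limit inequality along converging times. -/
def CondC4F (S : ℕ → EvolutionSystem X T) (S' : EvolutionSystem X T) (ubar : ℕ → X) (a b : ℝ) :
    Prop :=
  ∀ (H : Set ℕ) (t : ℕ → ℝ) (s : ℝ) (x : ℕ → X) (y : X), H.Infinite →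
    BoundedAlong S ubar a b H t x → (∃ C : ℝ, ∀ h ∈ H, (S h).energy (t h) (x h) ≤ (C : EReal)) →
    Tendsto t (along H) (𝓝 s) → Tendsto x (along H) (𝓝 y) →
    S'.slope s y ≤ liminf (fun h => (S h).slope (t h) (x h)) (along H)

end Family

end

end Evolution

open Evolution

namespace Evolution

noncomputable section

/-! ### Stieltjes measures, extraction of subsequences, monotone functions -/

/-! The curves `u_h` may steepen into jumps, but their graphs do not degenerate when they are
parametrized by time plus arc length. With `σ_h(t) = t + ` length of `u_h` up to `t`, and `τ_h` its
inverse, both `τ_h` and `θ_h = u_h ∘ τ_h` are 1-Lipschitz. The lengths are uniformly bounded: for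
large `h` the functions `ψ_h` grow at some rate strictly between `max(a, 0)` and `L`, which absorbs
the term `a d_h` in the shifted energy. Helly's theorem, and an Arzelà-Ascoli argument in which (C2)
gives compactness and (C3) replaces a common metric, produce a limit `(τ, θ)` with `u = θ ∘ σ`
(`IsLipParam`, `Approx.exists_paramApprox`). Hence `u` has bounded variation, and the fibers of `τ`
over the discontinuities ("gaps") of `σ` fill the jumps.

Lower bound. The dissipations, seen as measures in time, converge to the Stieltjes measure of a
monotone `N`. Its Lebesgue density is bounded below through chords of `ψ`, which are linear in the
speed and hence see only distances, and through Fatou's lemma for slopes and powers (`chord_le`,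
`density_le_rnDeriv`). On Lebesgue null sets it dominates the image under `τ` of the length weighted
by `max(F, L)`: Young's inequality gives the weight `F`, the linear growth of `ψ` the weight `L`
(`exists_length_le`, `fiber_length_le`). The two bounds live on complementary sets and add up
(`dissipation_le`). The null set is the set of gaps together with a carrier of the Cantor part;
these yield the jump term and `L` times the Cantor part.

Powers. Only the positive parts are controlled, so the power is carried as `(k - P)⁺ ≥ 0`, at the
price of an error `ω k` that tends to zero by equi-integrability. Bounded duals force the limits of
the slopes below `L`. These limits are not measurable in time and depend on `k`; they are replaced
by a measurable minimizer of `ψ*(g) + (P(L)⁺ - P(g))⁺` over `F ≤ g ≤ L` (`exists_selection`,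
`exists_limit_slope`), after which `k` tends to infinity (`limit_ineq`).

Upper gradient systems. The upper gradient inequality along `(τ, θ)` is the reverse estimate
(`IsUpperGradient.along`). It bounds the power, forces equality and identifies every limit of the
energies. If a half fiber over a jump were not an optimal transition, a cheaper curve spliced into
it would contradict the two inequalities (`fiber_length_le_transitionCost`); hence the weighted
length of the fibers is exactly the jump functional. -/

theorem le_stieltjes_measure (ν : Measure ℝ) (f : StieltjesFunction ℝ)
    (h : ∀ a b, a < b → ν (Ioc a b) ≤ ENNReal.ofReal (f b - f a)) : ν ≤ f.measure := by
  -- The outer measure of `f` is the largest one below the length function, so bounds on half-open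
  -- intervals suffice. The bottom set in `length_eq` is harmless, as `ℝ` has no least element.
  have key : ν.toOuterMeasure ≤ f.outer := by
    refine OuterMeasure.le_ofFunction.2 fun s => ?_
    rw [f.length_eq]
    refine le_iInf fun a => le_iInf fun b => le_iInf fun hs => ?_
    have hs' : s ⊆ Ioc a b := by
      intro x hx
      exact hs ⟨hx, notMem_botSet_of_lt (sub_one_lt x)⟩
    refine (measure_mono hs').trans ?_
    rcases lt_or_ge a b with hab | hab
    · exact h a b hab
    · simp [Ioc_eq_empty (not_lt.2 hab)]
  refine Measure.le_iff.2 fun s _ => ?_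
  rw [StieltjesFunction.measure]
  exact key s

/-- Lebesgue's differentiation theorem for right-hand averages. -/
theorem ae_tendsto_lintegral_div_right {m : ℝ → ℝ≥0∞} (hm : AEMeasurable m)
    (hfin : ∫⁻ r, m r ≠ ⊤) :
    ∀ᵐ t, Tendsto (fun τ : ℝ => (∫⁻ r in Icc t (t + τ), m r) / ENNReal.ofReal |τ|) (𝓝[>] 0)
      (𝓝 (m t)) := by
  have h := (IsUnifLocDoublingMeasure.vitaliFamily (volume : Measure ℝ) 1).ae_tendsto_lintegral_div
    hm hfin
  filter_upwards [h] with t ht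
  have h1 : Tendsto (fun τ : ℝ => t + τ) (𝓝[>] 0) (𝓝[>] t) := by
    have : Tendsto (fun τ : ℝ => t + τ) (𝓝[>] 0) (𝓝[>] (t + 0)) := by
      refine tendsto_nhdsWithin_iff.2 ⟨?_, ?_⟩
      · exact ((continuous_const.add continuous_id).tendsto 0).mono_left nhdsWithin_le_nhds
      · filter_upwards [self_mem_nhdsWithin] with τ hτ
        simpa using hτ
    simpa using this
  have h2 := ht.comp ((Real.tendsto_Icc_vitaliFamily_right t).comp h1)
  refine h2.congr' ?_
  filter_upwards [self_mem_nhdsWithin] with τ hτ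
  simp [abs_of_pos (show (0 : ℝ) < τ from hτ)]

/-- Diagonal extraction for countably many hereditary properties of subsequences. -/
theorem exists_strictMono_forall {P : ℕ → (ℕ → ℕ) → Prop}
    (hsub : ∀ i φ (χ : ℕ → ℕ), P i φ → StrictMono χ → P i (φ ∘ χ))
    (htail : ∀ i φ k, P i (fun n => φ (n + k)) → P i φ)
    (hex : ∀ (i : ℕ) (φ : ℕ → ℕ), StrictMono φ → ∃ χ : ℕ → ℕ, StrictMono χ ∧ P i (φ ∘ χ)) :
    ∃ φ : ℕ → ℕ, StrictMono φ ∧ ∀ i, P i φ := by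
  choose! c hc hP using hex
  -- `Φ i` extracts successively for the properties `0, …, i`; from index `i` on, the diagonal is a
  -- subsequence of `Φ i`.
  let Φ : ℕ → ℕ → ℕ := fun i => Nat.rec (id ∘ c 0 id) (fun j ψ => ψ ∘ c (j + 1) ψ) i
  have hΦ0 : Φ 0 = id ∘ c 0 id := rfl
  have hΦs : ∀ i, Φ (i + 1) = Φ i ∘ c (i + 1) (Φ i) := fun i => rfl
  have hmono : ∀ i, StrictMono (Φ i) := by
    intro i
    induction i with
    | zero => rw [hΦ0]; exact strictMono_id.comp (hc 0 id strictMono_id)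
    | succ j ih => rw [hΦs]; exact ih.comp (hc _ _ ih)
  have hPΦ : ∀ i, P i (Φ i) := by
    intro i
    cases i with
    | zero => rw [hΦ0]; exact hP 0 id strictMono_id
    | succ j => rw [hΦs]; exact hP _ _ (hmono j)
  have hrel : ∀ i k, ∃ χ : ℕ → ℕ, StrictMono χ ∧ Φ (i + k) = Φ i ∘ χ := by
    intro i k
    induction k with
    | zero => exact ⟨id, strictMono_id, rfl⟩
    | succ k ih =>
      obtain ⟨χ, hχ, h⟩ := ih
      refine ⟨χ ∘ c (i + k + 1) (Φ (i + k)), hχ.comp (hc _ _ (hmono _)), ?_⟩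
      rw [← add_assoc, hΦs, ← Function.comp_assoc, ← h]
  have hdiag : StrictMono fun n => Φ n n := by
    refine strictMono_nat_of_lt_succ fun n => ?_
    rw [hΦs]
    exact hmono n ((Nat.lt_succ_self n).trans_le ((hc _ _ (hmono n)).id_le _))
  refine ⟨fun n => Φ n n, hdiag, fun i => htail i _ i ?_⟩
  choose χ hχ hχe using hrel i
  have he : (fun n => Φ (n + i) (n + i)) = Φ i ∘ fun n => χ n (n + i) := by
    funext n
    have := hχe n
    simp only [Function.comp]
    rw [add_comm n i, this]
    rfl
  rw [he]
  refine hsub i _ _ (hPΦ i) ?_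
  intro a b hab
  have h1 : Φ i (χ a (a + i)) = Φ (i + a) (a + i) := by rw [hχe a]; rfl
  have h2 : Φ i (χ b (b + i)) = Φ (i + b) (b + i) := by rw [hχe b]; rfl
  refine (hmono i).lt_iff_lt.1 ?_
  rw [h1, h2, add_comm a i, add_comm b i]
  exact hdiag (by omega)

/-- Diagonal extraction of convergent subsequences at countably many places. -/
theorem exists_strictMono_forall_tendsto {Y : Type*} [TopologicalSpace Y] (x : ℕ → ℕ → Y)
    (hex : ∀ (i : ℕ) (φ : ℕ → ℕ), StrictMono φ → ∃ χ : ℕ → ℕ, StrictMono χ ∧ ∃ y,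
      Tendsto (fun n => x i (φ (χ n))) atTop (𝓝 y)) :
    ∃ φ : ℕ → ℕ, StrictMono φ ∧ ∀ i, ∃ y, Tendsto (fun n => x i (φ n)) atTop (𝓝 y) := by
  refine exists_strictMono_forall (P := fun i φ => ∃ y, Tendsto (fun n => x i (φ n)) atTop (𝓝 y))
    ?_ ?_ hex
  · rintro i φ χ ⟨y, hy⟩ hχ
    exact ⟨y, hy.comp hχ.tendsto_atTop⟩
  · rintro i φ k ⟨y, hy⟩
    exact ⟨y, (tendsto_add_atTop_iff_nat k).1 hy⟩

/-- At each point the values stay in a compact interval, so the diagonal extraction applies along an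
enumeration of the set. -/
theorem exists_strictMono_tendsto_on_countable (f : ℕ → ℝ → ℝ) (C : ℝ → ℝ)
    (hC : ∀ n x, |f n x| ≤ C x) (s : Set ℝ) (hs : s.Countable) :
    ∃ φ : ℕ → ℕ, StrictMono φ ∧ ∀ x ∈ s, ∃ y, Tendsto (fun n => f (φ n) x) atTop (𝓝 y) := by
  rcases s.eq_empty_or_nonempty with rfl | hne
  · exact ⟨id, strictMono_id, by simp⟩
  obtain ⟨e, he⟩ := hs.exists_eq_range hne
  obtain ⟨φ, hφ, h⟩ := exists_strictMono_forall_tendsto (fun i n => f n (e i)) (by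
    intro i φ _
    obtain ⟨y, -, χ, hχ, hy⟩ := (isCompact_Icc (a := -C (e i)) (b := C (e i))).tendsto_subseq
      (x := fun n => f (φ n) (e i)) (fun n => abs_le.1 (hC _ _))
    exact ⟨χ, hχ, y, hy⟩)
  refine ⟨φ, hφ, ?_⟩
  rw [he]
  rintro _ ⟨i, rfl⟩
  exact h i

/-- Helly's selection theorem. -/
theorem helly_selection (f : ℕ → ℝ → ℝ) (hf : ∀ n, Monotone (f n)) (C : ℝ → ℝ)
    (hC : ∀ n x, |f n x| ≤ C x) :
    ∃ φ : ℕ → ℕ, StrictMono φ ∧ ∃ g : ℝ → ℝ, Monotone g ∧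
      ∀ x, Tendsto (fun n => f (φ n) x) atTop (𝓝 (g x)) := by
  obtain ⟨φ, hφ, h⟩ := exists_strictMono_tendsto_on_countable f C hC
    (range ((↑) : ℚ → ℝ)) (countable_range _)
  have hbd : ∀ (φ : ℕ → ℕ) x, IsBoundedUnder (· ≤ ·) atTop (fun n => f (φ n) x) := fun φ x =>
    isBoundedUnder_of ⟨C x, fun n => (abs_le.1 (hC _ _)).2⟩
  have hbd' : ∀ (φ : ℕ → ℕ) x, IsBoundedUnder (· ≥ ·) atTop (fun n => f (φ n) x) := fun φ x =>
    isBoundedUnder_of ⟨-C x, fun n => (abs_le.1 (hC _ _)).1⟩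
  let g₀ : ℝ → ℝ := fun x => liminf (fun n => f (φ n) x) atTop
  have hg₀ : Monotone g₀ := fun x y hxy =>
    liminf_le_liminf (Eventually.of_forall fun n => hf _ hxy) (hbd' φ x)
      (hbd φ y).isCoboundedUnder_ge
  have hrat : ∀ q : ℚ, Tendsto (fun n => f (φ n) q) atTop (𝓝 (g₀ q)) := by
    intro q
    obtain ⟨y, hy⟩ := h q (mem_range_self q)
    have : g₀ q = y := hy.liminf_eq
    rwa [this]
  -- At a continuity point of `g₀` monotonicity squeezes the value between those at two nearby
  -- rationals, where convergence is known.
  have hcont : ∀ x, ContinuousAt g₀ x → Tendsto (fun n => f (φ n) x) atTop (𝓝 (g₀ x)) := by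
    intro x hx
    refine Metric.tendsto_atTop'.2 fun ε hε => ?_
    obtain ⟨δ, hδ, hd⟩ := Metric.continuousAt_iff.1 hx (ε / 2) (half_pos hε)
    obtain ⟨p, hp1, hp2⟩ := exists_rat_btwn (show x - δ < x by linarith)
    obtain ⟨q, hq1, hq2⟩ := exists_rat_btwn (show x < x + δ by linarith)
    have h1 := hd (x := p) (by rw [Real.dist_eq, abs_lt]; constructor <;> linarith)
    have h2 := hd (x := q) (by rw [Real.dist_eq, abs_lt]; constructor <;> linarith)
    rw [Real.dist_eq, abs_lt] at h1 h2
    have e1 := (tendsto_order.1 (hrat p)).1 (g₀ x - ε) (by linarith)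
    have e2 := (tendsto_order.1 (hrat q)).2 (g₀ x + ε) (by linarith)
    obtain ⟨N, hN⟩ := eventually_atTop.1 (e1.and e2)
    refine ⟨N, fun n hn => ?_⟩
    obtain ⟨a1, a2⟩ := hN n hn.le
    have b1 := hf (φ n) hp2.le
    have b2 := hf (φ n) hq1.le
    rw [Real.dist_eq, abs_lt]
    constructor <;> linarith
  -- The discontinuities of `g₀` are countable; a second extraction settles them.
  obtain ⟨χ, hχ, h'⟩ := exists_strictMono_tendsto_on_countable (fun n => f (φ n)) C
    (fun n x => hC _ _) _ hg₀.countable_not_continuousAt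
  refine ⟨φ ∘ χ, hφ.comp hχ, fun x => liminf (fun n => f (φ (χ n)) x) atTop, ?_, ?_⟩
  · exact fun x y hxy => liminf_le_liminf (Eventually.of_forall fun n => hf _ hxy)
      (hbd' (φ ∘ χ) x) (hbd (φ ∘ χ) y).isCoboundedUnder_ge
  · intro x
    have : ∃ y, Tendsto (fun n => f (φ (χ n)) x) atTop (𝓝 y) := by
      by_cases hx : ContinuousAt g₀ x
      · exact ⟨_, (hcont x hx).comp hχ.tendsto_atTop⟩
      · exact h' x hx
    obtain ⟨y, hy⟩ := this
    have e : liminf (fun n => f (φ (χ n)) x) atTop = y := hy.liminf_eq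
    simp only [Function.comp]
    rwa [e]

end

noncomputable section

/-! ### The metric derivative of absolutely continuous curves -/

theorem absolutelyContinuousOnInterval_of_dist_le {f g : ℝ → ℝ} {a b : ℝ}
    (hg : AbsolutelyContinuousOnInterval g a b)
    (h : ∀ x ∈ uIcc a b, ∀ y ∈ uIcc a b, dist (f x) (f y) ≤ dist (g x) (g y)) :
    AbsolutelyContinuousOnInterval f a b := by
  unfold AbsolutelyContinuousOnInterval at hg ⊢
  refine squeeze_zero' (Eventually.of_forall fun E => Finset.sum_nonneg fun _ _ => dist_nonneg) ?_ hg
  filter_upwards [mem_inf_of_right (mem_principal_self _)] with E hE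
  refine Finset.sum_le_sum fun i hi => ?_
  exact h _ (hE.1 i hi).1 _ (hE.1 i hi).2

section

variable {X : Type*} [EMetricSpace X] {u : ℝ → X} {α β : ℝ}

/-- At a Lebesgue point of `ω` the mean values of the integral bound converge to `ω t`, and they
dominate the difference quotients. -/
theorem limsup_metric_quotient_le {ω : ℝ → ℝ≥0∞} {t : ℝ}
    (ht : t ∈ Ico α β)
    (hω : ∀ s t, α ≤ s → s ≤ t → t ≤ β → edist (u s) (u t) ≤ ∫⁻ r in Icc s t, ω r)
    (hlim : Tendsto (fun τ : ℝ => (∫⁻ r in Icc t (t + τ), ω r) / ENNReal.ofReal |τ|) (𝓝[>] 0)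
      (𝓝 (ω t))) :
    limsup (fun τ : ℝ => edist (u (t + τ)) (u t) / ENNReal.ofReal |τ|) (𝓝[>] 0) ≤ ω t := by
  rw [← hlim.limsup_eq]
  refine limsup_le_limsup ?_
  have : Ioo (0 : ℝ) (β - t) ∈ 𝓝[>] (0 : ℝ) := Ioo_mem_nhdsGT (by linarith [ht.2])
  filter_upwards [this] with τ hτ
  gcongr
  rw [edist_comm]
  exact hω _ _ ht.1 (by linarith [hτ.1]) (by linarith [hτ.2])

/-- The metric derivative of an absolutely continuous curve exists almost everywhere, and it is
the smallest function that controls the distances. -/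
theorem IsAC.exists_speed (h : IsAC u α β) :
    ∃ ω : ℝ → ℝ≥0∞, Measurable ω ∧ ∫⁻ r, ω r ≠ ⊤ ∧
      (∀ s t, α ≤ s → s ≤ t → t ≤ β → edist (u s) (u t) ≤ ∫⁻ r in Icc s t, ω r) ∧
      ∀ᵐ t ∂volume.restrict (Icc α β),
        Tendsto (fun τ : ℝ => edist (u (t + τ)) (u t) / ENNReal.ofReal |τ|) (𝓝[>] 0)
          (𝓝 (ω t)) := by
  rcases le_or_gt β α with hαβ | hαβ
  · refine ⟨0, measurable_const, by simp, ?_, ?_⟩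
    · intro s t h1 h2 h3
      have : s = t := by linarith
      simp [this]
    · have : volume.restrict (Icc α β) = 0 := by simp [hαβ]
      rw [this]; simp
  obtain ⟨m, hm, hmfin, hd⟩ := h
  set m₀ : ℝ → ℝ≥0∞ := (Icc α β).indicator m with hm₀
  have hm₀m : Measurable m₀ := hm.indicator measurableSet_Icc
  have hm₀fin : ∫⁻ r, m₀ r ≠ ⊤ := by rwa [lintegral_indicator measurableSet_Icc]
  have hd₀ : ∀ s t, α ≤ s → s ≤ t → t ≤ β → edist (u s) (u t) ≤ ∫⁻ r in Icc s t, m₀ r := by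
    intro s t h1 h2 h3
    refine (hd s t h1 h2 h3).trans_eq (setLIntegral_congr_fun measurableSet_Icc fun r hr => ?_)
    have hr' : r ∈ Icc α β := ⟨h1.trans hr.1, hr.2.trans h3⟩
    simp only [hm₀, Set.indicator_of_mem hr']
  let m₁ : ℝ → ℝ := fun r => (m₀ r).toReal
  have hm₁ : Integrable m₁ volume := integrable_toReal_of_lintegral_ne_top hm₀m.aemeasurable hm₀fin
  have hm₁i : ∀ s t, s ≤ t → ∫ r in s..t, m₁ r = (∫⁻ r in Icc s t, m₀ r).toReal := by
    intro s t hst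
    rw [intervalIntegral.integral_of_le hst, ← integral_Icc_eq_integral_Ioc,
      integral_toReal hm₀m.aemeasurable]
    exact ae_restrict_of_ae (ae_lt_top hm₀m hm₀fin)
  have hfin : ∀ s t, ∫⁻ r in Icc s t, m₀ r ≠ ⊤ := fun s t =>
    ne_top_of_le_ne_top hm₀fin (setLIntegral_le_lintegral _ _)
  -- Clamping lets every rational serve as a reference point of the curve.
  let cl : ℝ → ℝ := fun x => max α (min x β)
  have hclm : ∀ x, cl x ∈ Icc α β := fun x =>
    ⟨le_max_left _ _, max_le hαβ.le (min_le_right _ _)⟩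
  have hcl : ∀ x ∈ Icc α β, cl x = x := fun x hx => by
    simp only [cl]; rw [min_eq_left hx.2, max_eq_right hx.1]
  have hed : ∀ s ∈ Icc α β, ∀ t ∈ Icc α β, edist (u s) (u t) ≠ ⊤ := by
    intro s hs t ht
    rcases le_total s t with hst | hst
    · exact ne_top_of_le_ne_top (hfin s t) (hd₀ s t hs.1 hst ht.2)
    · rw [edist_comm]
      exact ne_top_of_le_ne_top (hfin t s) (hd₀ t s ht.1 hst hs.2)
  let φ : ℚ → ℝ → ℝ := fun q t => (edist (u (cl q)) (u (cl t))).toReal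
  have hφlip : ∀ q s t, s ∈ Icc α β → t ∈ Icc α β →
      |φ q s - φ q t| ≤ (edist (u s) (u t)).toReal := by
    intro q s t hs ht
    simp only [φ, hcl s hs, hcl t ht]
    have h1 := hed _ (hclm q) s hs
    have h2 := hed _ (hclm q) t ht
    have h3 := hed s hs t ht
    rw [abs_sub_le_iff]
    constructor
    · rw [sub_le_iff_le_add, ← ENNReal.toReal_add h3 h2]
      refine ENNReal.toReal_mono (ENNReal.add_ne_top.2 ⟨h3, h2⟩) ?_
      rw [add_comm, edist_comm (u s)]
      exact edist_triangle _ _ _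
    · rw [sub_le_iff_le_add, ← ENNReal.toReal_add h3 h1]
      refine ENNReal.toReal_mono (ENNReal.add_ne_top.2 ⟨h3, h1⟩) ?_
      rw [add_comm]
      exact edist_triangle _ _ _
  have hAC : ∀ q, AbsolutelyContinuousOnInterval (φ q) α β := by
    intro q
    have hΦ := (hm₁.intervalIntegrable (a := α) (b := β)).absolutelyContinuousOnInterval_intervalIntegral
      (c := α) (by simp)
    refine absolutelyContinuousOnInterval_of_dist_le hΦ ?_
    rw [uIcc_of_le hαβ.le]
    have key : ∀ x ∈ Icc α β, ∀ y ∈ Icc α β, x ≤ y → dist (φ q x) (φ q y) ≤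
        dist (∫ r in α..x, m₁ r) (∫ r in α..y, m₁ r) := by
      intro x hx y hy hxy
      rw [Real.dist_eq, dist_comm, Real.dist_eq, intervalIntegral.integral_interval_sub_left
        hm₁.intervalIntegrable hm₁.intervalIntegrable, hm₁i x y hxy]
      refine (hφlip q x y hx hy).trans ((ENNReal.toReal_mono (hfin x y)
        (hd₀ x y hx.1 hxy hy.2)).trans (le_abs_self _))
    intro x hx y hy
    rcases le_total x y with hxy | hxy
    · exact key x hx y hy hxy
    · rw [dist_comm, dist_comm (∫ r in α..x, m₁ r)]
      exact key y hy x hx hxy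
  -- The distances to a dense set of points of the curve recover the metric: the supremum of the
  -- derivatives of these countably many scalar functions turns out to be the metric derivative.
  let ω : ℝ → ℝ≥0∞ := (Ioo α β).indicator fun t => ⨆ q : ℚ, ‖deriv (φ q) t‖ₑ
  have hωm : Measurable ω :=
    (Measurable.iSup fun q => (measurable_deriv (φ q)).enorm).indicator measurableSet_Ioo
  have hIoo : ∀ᵐ t ∂volume.restrict (Icc α β), t ∈ Ioo α β := by
    rw [← restrict_Ioo_eq_restrict_Icc]
    exact ae_restrict_mem measurableSet_Ioo
  have hlow : ∀ᵐ t ∂volume.restrict (Icc α β), ω t ≤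
      liminf (fun τ : ℝ => edist (u (t + τ)) (u t) / ENNReal.ofReal |τ|) (𝓝[>] 0) := by
    have hdiff : ∀ᵐ t ∂volume.restrict (Icc α β), ∀ q, DifferentiableAt ℝ (φ q) t := by
      rw [ae_all_iff]
      intro q
      rw [ae_restrict_iff' measurableSet_Icc]
      filter_upwards [(hAC q).ae_differentiableAt] with t ht htm
      exact ht (by rwa [uIcc_of_le hαβ.le])
    filter_upwards [hdiff, hIoo] with t ht htI
    simp only [ω, indicator_of_mem htI]
    refine iSup_le fun q => ?_
    have h1 := ((ht q).hasDerivAt.tendsto_slope_zero_right).enorm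
    rw [← h1.liminf_eq]
    refine liminf_le_liminf ?_
    have : Ioo (0 : ℝ) (β - t) ∈ 𝓝[>] (0 : ℝ) := Ioo_mem_nhdsGT (by linarith [htI.2])
    filter_upwards [this] with τ hτ
    have ht' : t ∈ Icc α β := ⟨htI.1.le, htI.2.le⟩
    have htτ : t + τ ∈ Icc α β := ⟨by linarith [htI.1, hτ.1], by linarith [hτ.2]⟩
    rw [smul_eq_mul, enorm_mul, enorm_inv hτ.1.ne', mul_comm, ← div_eq_mul_inv,
      ← Real.enorm_eq_ofReal_abs]
    gcongr
    rw [Real.enorm_eq_ofReal_abs]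
    exact ENNReal.ofReal_le_of_le_toReal (hφlip q _ _ htτ ht')
  have hωm₀ : ∀ᵐ t, ω t ≤ m₀ t := by
    have := ae_restrict_of_ae (s := Icc α β) (ae_tendsto_lintegral_div_right hm₀m.aemeasurable hm₀fin)
    have h' : ∀ᵐ t ∂volume.restrict (Icc α β), ω t ≤ m₀ t := by
      filter_upwards [hlow, this, hIoo] with t h1 h2 h3
      exact h1.trans ((liminf_le_limsup).trans
        (limsup_metric_quotient_le ⟨h3.1.le, h3.2⟩ hd₀ h2))
    rw [ae_restrict_iff' measurableSet_Icc] at h'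
    filter_upwards [h'] with t ht
    by_cases htm : t ∈ Icc α β
    · exact ht htm
    · have : t ∉ Ioo α β := fun h => htm (Ioo_subset_Icc_self h)
      simp [ω, this]
  have hωfin : ∫⁻ r, ω r ≠ ⊤ := ne_top_of_le_ne_top hm₀fin (lintegral_mono_ae hωm₀)
  -- With a rational left end point the distance is one of the scalar functions, hence the integral
  -- of its derivative.
  have hrat : ∀ (q : ℚ) (t : ℝ), α ≤ q → (q : ℝ) ≤ t → t ≤ β →
      edist (u q) (u t) ≤ ∫⁻ r in Icc (q : ℝ) t, ω r := by
    intro q t h1 h2 h3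
    have hq : (q : ℝ) ∈ Icc α β := ⟨h1, h2.trans h3⟩
    have ht : t ∈ Icc α β := ⟨h1.trans h2, h3⟩
    have hsub : uIcc (q : ℝ) t ⊆ uIcc α β := by
      rw [uIcc_of_le h2, uIcc_of_le hαβ.le]; exact Icc_subset_Icc h1 h3
    have hF := ((hAC q).mono hsub).integral_deriv_eq_sub
    have h0 : φ q q = 0 := by simp [φ]
    have h4 : φ q t = (edist (u q) (u t)).toReal := by simp only [φ, hcl q hq, hcl t ht]
    rw [h0, sub_zero, h4, intervalIntegral.integral_of_le h2, ← restrict_Ioo_eq_restrict_Ioc] at hF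
    rw [← ENNReal.ofReal_toReal (hed _ hq _ ht), ← hF]
    calc ENNReal.ofReal (∫ r in Ioo (q : ℝ) t, deriv (φ q) r)
        ≤ ‖∫ r in Ioo (q : ℝ) t, deriv (φ q) r‖ₑ := by
          rw [Real.enorm_eq_ofReal_abs]; exact ENNReal.ofReal_le_ofReal (le_abs_self _)
      _ ≤ ∫⁻ r in Ioo (q : ℝ) t, ‖deriv (φ q) r‖ₑ := enorm_integral_le_lintegral_enorm _
      _ ≤ ∫⁻ r in Ioo (q : ℝ) t, ω r := by
          refine setLIntegral_mono hωm fun r hr => ?_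
          have : r ∈ Ioo α β := ⟨h1.trans_lt hr.1, hr.2.trans_le h3⟩
          simp only [ω, indicator_of_mem this]
          exact le_iSup (fun q : ℚ => ‖deriv (φ q) r‖ₑ) q
      _ ≤ ∫⁻ r in Icc (q : ℝ) t, ω r := lintegral_mono_set Ioo_subset_Icc_self
  -- A general left end point is moved to a nearby rational; the error is an integral of `m₀` over a
  -- short interval.
  have hdω : ∀ s t, α ≤ s → s ≤ t → t ≤ β → edist (u s) (u t) ≤ ∫⁻ r in Icc s t, ω r := by
    intro s t h1 h2 h3
    rcases h2.eq_or_lt with rfl | h2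
    · simp
    refine ENNReal.le_of_forall_pos_le_add fun ε hε _ => ?_
    obtain ⟨δ, hδ, hδ'⟩ := exists_pos_setLIntegral_lt_of_measure_lt hm₀fin
      (ε := (ε : ℝ≥0∞)) (by exact_mod_cast hε.ne')
    obtain ⟨η, hη, hηδ⟩ : ∃ η : ℝ, 0 < η ∧ ENNReal.ofReal η < δ := by
      obtain ⟨r, hr0, hr⟩ := ENNReal.lt_iff_exists_nnreal_btwn.1 hδ
      exact ⟨r, by exact_mod_cast hr0, by simpa using hr⟩
    obtain ⟨q, hq1, hq2⟩ := exists_rat_btwn (show s < min t (s + η) from lt_min h2 (by linarith))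
    have hqt : (q : ℝ) ≤ t := (hq2.trans_le (min_le_left _ _)).le
    have hqη : (q : ℝ) < s + η := hq2.trans_le (min_le_right _ _)
    have hsmall : ∫⁻ r in Icc s (q : ℝ), m₀ r < ε := by
      refine hδ' _ ?_
      rw [Real.volume_Icc]
      exact (ENNReal.ofReal_le_ofReal (by linarith)).trans_lt hηδ
    calc edist (u s) (u t) ≤ edist (u s) (u q) + edist (u q) (u t) := edist_triangle _ _ _
      _ ≤ ε + ∫⁻ r in Icc s t, ω r := by
        refine add_le_add ((hd₀ _ _ h1 hq1.le (hqt.trans h3)).trans hsmall.le) ?_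
        exact (hrat q t (h1.trans hq1.le) hqt h3).trans
          (lintegral_mono_set (Icc_subset_Icc_left hq1.le))
      _ = _ := add_comm _ _
  refine ⟨ω, hωm, hωfin, hdω, ?_⟩
  have hL := ae_restrict_of_ae (s := Icc α β) (ae_tendsto_lintegral_div_right hωm.aemeasurable hωfin)
  filter_upwards [hlow, hL, hIoo] with t h1 h2 h3
  exact tendsto_of_le_liminf_of_limsup_le h1 (limsup_metric_quotient_le ⟨h3.1.le, h3.2⟩ hdω h2)

theorem IsAC.aemeasurable_metricDeriv (h : IsAC u α β) :
    AEMeasurable (metricDeriv u) (volume.restrict (Icc α β)) := by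
  obtain ⟨ω, hω, -, -, hlim⟩ := h.exists_speed
  refine ⟨ω, hω, ?_⟩
  filter_upwards [hlim] with t ht
  exact ht.limsup_eq

theorem IsAC.metricDeriv_lt_top (h : IsAC u α β) :
    ∀ᵐ t ∂volume.restrict (Icc α β), metricDeriv u t < ⊤ := by
  obtain ⟨ω, hω, hfin, -, hlim⟩ := h.exists_speed
  filter_upwards [hlim, ae_restrict_of_ae (ae_lt_top hω hfin)] with t ht h'
  have : metricDeriv u t = ω t := ht.limsup_eq
  rwa [this]

theorem IsAC.edist_le_lintegral_metricDeriv (h : IsAC u α β) {s t : ℝ} (hs : α ≤ s)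
    (hst : s ≤ t) (ht : t ≤ β) : edist (u s) (u t) ≤ ∫⁻ r in Icc s t, metricDeriv u r := by
  obtain ⟨ω, hω, hfin, hd, hlim⟩ := h.exists_speed
  refine (hd s t hs hst ht).trans_eq (lintegral_congr_ae ?_)
  filter_upwards [ae_restrict_of_ae_restrict_of_subset (Icc_subset_Icc hs ht) hlim] with r hr
  exact hr.limsup_eq.symm

theorem IsAC.lintegral_metricDeriv_ne_top (h : IsAC u α β) :
    ∫⁻ r in Icc α β, metricDeriv u r ≠ ⊤ := by
  obtain ⟨ω, hω, hfin, hd, hlim⟩ := h.exists_speed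
  have : ∫⁻ r in Icc α β, metricDeriv u r = ∫⁻ r in Icc α β, ω r := by
    refine lintegral_congr_ae ?_
    filter_upwards [hlim] with r hr
    exact hr.limsup_eq
  rw [this]
  exact ne_top_of_le_ne_top hfin (setLIntegral_le_lintegral _ _)

theorem IsAC.ae_tendsto_metricDeriv (h : IsAC u α β) :
    ∀ᵐ t ∂volume.restrict (Icc α β),
      Tendsto (fun τ : ℝ => edist (u (t + τ)) (u t) / ENNReal.ofReal |τ|) (𝓝[>] 0)
        (𝓝 (metricDeriv u t)) := by
  obtain ⟨ω, hω, hfin, hd, hlim⟩ := h.exists_speed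
  filter_upwards [hlim] with t ht
  have : metricDeriv u t = ω t := ht.limsup_eq
  rwa [this]

/-- A curve that is `1`-Lipschitz is absolutely continuous, with metric derivative at most `1`. -/
theorem IsAC.of_edist_le (h : ∀ s t, s ≤ t → edist (u s) (u t) ≤ ENNReal.ofReal (t - s))
    (α β : ℝ) : IsAC u α β :=
  ⟨1, measurable_const, by simp, fun s t _ h2 _ => by simpa using h s t h2⟩

theorem metricDeriv_le_one (h : ∀ s t, s ≤ t → edist (u s) (u t) ≤ ENNReal.ofReal (t - s))
    (t : ℝ) : metricDeriv u t ≤ 1 := by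
  refine limsup_le_of_le (by isBoundedDefault) ?_
  filter_upwards [self_mem_nhdsWithin] with τ hτ
  have hτ : (0 : ℝ) < τ := hτ
  refine ENNReal.div_le_of_le_mul ?_
  rw [one_mul, edist_comm, abs_of_pos hτ]
  simpa using h t (t + τ) (by linarith)

theorem metricDeriv_const (x : X) (t : ℝ) : metricDeriv (fun _ => x) t = 0 := by
  simp [metricDeriv]

end

end

noncomputable section

/-! ### Dissipation functions -/

section Dissipation

variable {ψ : ℝ≥0 → ℝ≥0} {L : ℝ≥0}

/-- Convexity multiplied out over the reals, so that neither division nor the truncated subtraction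
of `ℝ≥0` appears. -/
theorem convex_three_points (hc : ConvexOn ℝ≥0 univ ψ) {x y z : ℝ≥0} (hxy : x ≤ y) (hyz : y ≤ z)
    (hxz : x < z) :
    ((z : ℝ) - x) * ψ y ≤ ((z : ℝ) - y) * ψ x + ((y : ℝ) - x) * ψ z := by
  have hpos : (0 : ℝ) < (z : ℝ) - x := sub_pos.2 (by exact_mod_cast hxz)
  have hd : ((z - x : ℝ≥0) : ℝ) = z - x := NNReal.coe_sub hxz.le
  have hzx : z - x ≠ 0 := by
    intro h; rw [h] at hd; rw [← hd] at hpos; simp at hpos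
  have hsum : (z - y) / (z - x) + (y - x) / (z - x) = 1 := by
    rw [← add_div, tsub_add_tsub_cancel hyz hxy, div_self hzx]
  have h := hc.2 (mem_univ x) (mem_univ z) zero_le zero_le hsum
  have he : ((z - y) / (z - x)) • x + ((y - x) / (z - x)) • z = y := by
    rw [← NNReal.coe_inj]
    simp only [smul_eq_mul, NNReal.coe_add, NNReal.coe_mul, NNReal.coe_div, hd,
      NNReal.coe_sub hyz, NNReal.coe_sub hxy]
    field_simp
    ring
  rw [he] at h
  have h' : (ψ y : ℝ) ≤ ((z : ℝ) - y) / (z - x) * ψ x + ((y : ℝ) - x) / (z - x) * ψ z := by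
    have := NNReal.coe_le_coe.2 h
    simpa only [smul_eq_mul, NNReal.coe_add, NNReal.coe_mul, NNReal.coe_div, hd,
      NNReal.coe_sub hyz, NNReal.coe_sub hxy] using this
  calc ((z : ℝ) - x) * ψ y
      ≤ ((z : ℝ) - x) * (((z : ℝ) - y) / (z - x) * ψ x + ((y : ℝ) - x) / (z - x) * ψ z) := by
        gcongr
    _ = _ := by field_simp

theorem convex_monotone (hc : ConvexOn ℝ≥0 univ ψ) (h0 : ψ 0 = 0) : Monotone ψ := by
  intro x y hxy
  rcases hxy.eq_or_lt with rfl | hlt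
  · exact le_rfl
  have hy : 0 < y := zero_le.trans_lt hlt
  have h := convex_three_points hc zero_le hxy hy
  simp only [h0, NNReal.coe_zero, sub_zero, mul_zero, zero_add] at h
  have hy' : (0 : ℝ) < y := by exact_mod_cast hy
  have hxy' : (x : ℝ) ≤ y := by exact_mod_cast hxy
  have : (y : ℝ) * ψ x ≤ y * ψ y := h.trans (by gcongr)
  exact_mod_cast le_of_mul_le_mul_left this hy'

/-- The slope of the chord between two points of the graph. -/
def chordSlope (ψ : ℝ≥0 → ℝ≥0) (v₁ v₂ : ℝ≥0) : ℝ≥0 := (ψ v₂ - ψ v₁) / (v₂ - v₁)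

/-- Outside `[v₁, v₂]` the chord line lies below the graph; inside, monotonicity of `ψ` is enough,
since the line has been lowered by `κ (v₂ - v₁)`. The bound is linear in `v` and stable under
pointwise convergence, which is what the lower semicontinuity argument needs; the loss disappears as
`v₁` tends to `v₂`. -/
theorem chord_bound (hc : ConvexOn ℝ≥0 univ ψ) (h0 : ψ 0 = 0) {v₁ v₂ : ℝ≥0} (h : v₁ < v₂)
    (v : ℝ≥0) : ψ v₁ + chordSlope ψ v₁ v₂ * v ≤ ψ v + chordSlope ψ v₁ v₂ * v₂ := by
  have hm := convex_monotone hc h0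
  have hpos : (0 : ℝ) < (v₂ : ℝ) - v₁ := sub_pos.2 (by exact_mod_cast h)
  have hk : (chordSlope ψ v₁ v₂ : ℝ) = (ψ v₂ - ψ v₁) / (v₂ - v₁) := by
    rw [chordSlope, NNReal.coe_div, NNReal.coe_sub h.le, NNReal.coe_sub (hm h.le)]
  set k := chordSlope ψ v₁ v₂
  rcases le_total v v₂ with hv | hv
  · rcases le_total v v₁ with hv1 | hv1
    · rcases hv1.eq_or_lt with rfl | hlt
      · gcongr
      have h3 := convex_three_points hc hlt.le h.le (hlt.trans h)
      rw [← NNReal.coe_le_coe]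
      push_cast
      have hkk : (k : ℝ) * (v₂ - v₁) = ψ v₂ - ψ v₁ := by rw [hk]; field_simp
      have hlt' : (v : ℝ) < v₁ := by exact_mod_cast hlt
      have : ((v₂ : ℝ) - v₁) * (ψ v₁ + k * (v - v₁)) ≤ ((v₂ : ℝ) - v₁) * ψ v := by
        have e : ((v₂ : ℝ) - v₁) * (ψ v₁ + k * (v - v₁))
            = (v₂ - v₁) * ψ v₁ + (ψ v₂ - ψ v₁) * (v - v₁) := by rw [← hkk]; ring
        rw [e]; nlinarith
      have h4 := le_of_mul_le_mul_left this hpos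
      have h5 : 0 ≤ (k : ℝ) * (v₂ - v₁) := by positivity
      nlinarith
    · gcongr
      exact hm hv1
  · have h3 := convex_three_points hc h.le hv (h.trans_le hv)
    rw [← NNReal.coe_le_coe]
    push_cast
    have hkk : (k : ℝ) * (v₂ - v₁) = ψ v₂ - ψ v₁ := by rw [hk]; field_simp
    have : ((v₂ : ℝ) - v₁) * (ψ v₂ + k * (v - v₂)) ≤ ((v₂ : ℝ) - v₁) * ψ v := by
      have e : ((v₂ : ℝ) - v₁) * (ψ v₂ + k * (v - v₂))
          = (v₂ - v₁) * ψ v₂ + (ψ v₂ - ψ v₁) * (v - v₂) := by rw [← hkk]; ring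
      rw [e]; nlinarith
    have h4 := le_of_mul_le_mul_left this hpos
    have h5 : (ψ v₁ : ℝ) ≤ ψ v₂ := by exact_mod_cast hm h.le
    nlinarith

theorem tendsto_chordSlope {ψn : ℕ → ℝ≥0 → ℝ≥0} (hlim : ∀ v, Tendsto (fun n => ψn n v) atTop
    (𝓝 (ψ v))) (v₁ v₂ : ℝ≥0) :
    Tendsto (fun n => chordSlope (ψn n) v₁ v₂) atTop (𝓝 (chordSlope ψ v₁ v₂)) := by
  have : Tendsto (fun n => (ψn n v₂ - ψn n v₁) * (v₂ - v₁)⁻¹) atTop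
      (𝓝 ((ψ v₂ - ψ v₁) * (v₂ - v₁)⁻¹)) :=
    ((hlim v₂).sub (hlim v₁)).mul_const _
  simpa only [chordSlope, div_eq_mul_inv] using this

/-- A convex function cannot jump up at an interior point: the three-point inequality for `v < x < x
+ 1` gives `ψ x ≤ c` as `v` tends to `x`. -/
theorem convex_left_approx (hc : ConvexOn ℝ≥0 univ ψ) {x c : ℝ≥0} (hx : 0 < x) (h : c < ψ x) :
    ∃ v < x, c < ψ v := by
  by_contra! hcon
  have key : ∀ v < x, ((x : ℝ) + 1 - v) * ψ x ≤ c + ((x : ℝ) - v) * ψ (x + 1) := by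
    intro v hv
    have h3 := convex_three_points hc hv.le (le_add_of_nonneg_right zero_le_one : x ≤ x + 1)
      (hv.trans_le (le_add_of_nonneg_right zero_le_one))
    push_cast at h3
    have : (ψ v : ℝ) ≤ c := by exact_mod_cast hcon v hv
    have e : (x : ℝ) + 1 - x = 1 := by ring
    rw [e, one_mul] at h3
    linarith
  have hlim : Tendsto (fun v : ℝ => c + ((x : ℝ) - v) * ψ (x + 1) - ((x : ℝ) + 1 - v) * ψ x)
      (𝓝[<] (x : ℝ)) (𝓝 (c + ((x : ℝ) - x) * ψ (x + 1) - ((x : ℝ) + 1 - x) * ψ x)) := by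
    refine Tendsto.mono_left (Continuous.tendsto (by fun_prop) _) nhdsWithin_le_nhds
  have hge := ge_of_tendsto hlim (b := 0) (by
    filter_upwards [Ioo_mem_nhdsLT (show (0 : ℝ) < x by exact_mod_cast hx)] with v hv
    have := key v.toNNReal (by
      rw [← NNReal.coe_lt_coe, Real.coe_toNNReal v hv.1.le]; exact hv.2)
    rw [Real.coe_toNNReal v hv.1.le] at this
    linarith)
  have hc' : (c : ℝ) < ψ x := by exact_mod_cast h
  nlinarith

theorem dual_mono (ψ : ℝ≥0 → ℝ≥0) : Monotone (dual ψ) := fun _ _ h =>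
  iSup_mono fun _ => by gcongr

theorem young_le (ψ : ℝ≥0 → ℝ≥0) (g : ℝ≥0∞) (v : ℝ≥0) : g * v ≤ ψ v + dual ψ g := by
  have : g * v - ψ v ≤ dual ψ g := le_iSup (fun v : ℝ≥0 => g * (v : ℝ≥0∞) - (ψ v : ℝ≥0∞)) v
  rw [add_comm]
  exact tsub_le_iff_right.1 this

theorem dual_le_iff {g c : ℝ≥0∞} : dual ψ g ≤ c ↔ ∀ v : ℝ≥0, g * v ≤ c + ψ v := by
  simp only [dual, iSup_le_iff, tsub_le_iff_right]

theorem measurable_dual (ψ : ℝ≥0 → ℝ≥0) : Measurable (dual ψ) :=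
  (dual_mono ψ).measurable

theorem dual_convex (a b : ℝ≥0) (hab : a + b = 1) (f g : ℝ≥0∞) :
    dual ψ (a * f + b * g) ≤ a * dual ψ f + b * dual ψ g := by
  refine dual_le_iff.2 fun v => ?_
  calc (a * f + b * g) * v = a * (f * v) + b * (g * v) := by ring
    _ ≤ a * (ψ v + dual ψ f) + b * (ψ v + dual ψ g) := by
      gcongr <;> exact young_le _ _ _
    _ = a * dual ψ f + b * dual ψ g + (a + b : ℝ≥0) * ψ v := by push_cast; ring
    _ = _ := by rw [hab]; simp

/-- For fixed `v` the affine term converges and stays below the dual; the supremum over `v` is taken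
last. -/
theorem dual_liminf {ψn : ℕ → ℝ≥0 → ℝ≥0} (hlim : ∀ v, Tendsto (fun n => ψn n v) atTop
    (𝓝 (ψ v))) {g : ℕ → ℝ≥0} {g' : ℝ≥0} (hg : Tendsto g atTop (𝓝 g')) :
    dual ψ g' ≤ liminf (fun n => dual (ψn n) (g n)) atTop := by
  refine iSup_le fun v => ?_
  have h1 : Tendsto (fun n => (g n : ℝ≥0∞) * v - ψn n v) atTop (𝓝 (g' * v - ψ v)) := by
    have : Tendsto (fun n => g n * v - ψn n v) atTop (𝓝 (g' * v - ψ v)) :=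
      (hg.mul_const v).sub (hlim v)
    have := ENNReal.tendsto_coe.2 this
    simpa only [ENNReal.coe_sub, ENNReal.coe_mul] using this
  rw [← h1.liminf_eq]
  exact liminf_le_liminf (Eventually.of_forall fun n =>
    le_iSup (fun v : ℝ≥0 => (g n : ℝ≥0∞) * (v : ℝ≥0∞) - (ψn n v : ℝ≥0∞)) v)

namespace IsMetricDissipation

theorem exists_slope (h : IsMetricDissipation ψ (L : ℝ≥0∞)) {κ : ℝ≥0} (hκ : κ < L) :
    ∃ v, 0 < v ∧ κ * v < ψ v := by
  have h1 := (tendsto_order.1 h.tendsto_slope).1 κ (by exact_mod_cast hκ)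
  obtain ⟨v, hv, hv0⟩ := (h1.and (eventually_gt_atTop 0)).exists
  refine ⟨v, hv0, ?_⟩
  have hv0' : (v : ℝ≥0∞) ≠ 0 := by exact_mod_cast hv0.ne'
  have := (ENNReal.lt_div_iff_mul_lt (Or.inl hv0') (Or.inl (by simp))).1 hv
  exact_mod_cast this

/-- By convexity and `ψ 0 = 0` the quotient `ψ v / v` is nondecreasing, so it stays below its limit.
-/
theorem le_mul (h : IsMetricDissipation ψ (L : ℝ≥0∞)) (v : ℝ≥0) : ψ v ≤ L * v := by
  rcases eq_or_ne v 0 with rfl | hv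
  · simp [h.zero]
  have hv0 : (v : ℝ≥0∞) ≠ 0 := by exact_mod_cast hv
  have hle : (ψ v : ℝ≥0∞) / v ≤ L := by
    refine ge_of_tendsto h.tendsto_slope ?_
    filter_upwards [eventually_gt_atTop v] with w hw
    have hw0 : 0 < w := zero_le.trans_lt hw
    have h3 := convex_three_points h.convex zero_le hw.le hw0
    simp only [h.zero, NNReal.coe_zero, sub_zero, mul_zero, zero_add] at h3
    have h4 : w * ψ v ≤ v * ψ w := by exact_mod_cast h3
    have hw0' : (w : ℝ≥0∞) ≠ 0 := by exact_mod_cast hw0.ne'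
    rw [ENNReal.div_le_iff hv0 (by simp), ← ENNReal.mul_div_right_comm,
      ENNReal.le_div_iff_mul_le (Or.inl hw0') (Or.inl (by simp)), mul_comm, mul_comm (ψ w : ℝ≥0∞)]
    exact_mod_cast h4
  have := (ENNReal.div_le_iff hv0 (by simp)).1 hle
  exact_mod_cast this

/-- Choose `v₀` where the chord from the origin is steeper than `f`. Up to `v₀` the product `f v` is
at most `f v₀`; beyond it, its growth is absorbed by `ψ`. -/
theorem dual_lt_top (h : IsMetricDissipation ψ (L : ℝ≥0∞)) {f : ℝ≥0} (hf : f < L) :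
    dual ψ f < ⊤ := by
  obtain ⟨v₀, hv₀, hs⟩ := h.exists_slope hf
  have hk : f ≤ chordSlope ψ 0 v₀ := by
    rw [chordSlope, h.zero, tsub_zero, tsub_zero, le_div_iff₀ hv₀]; exact hs.le
  refine lt_of_le_of_lt (b := ((f * v₀ : ℝ≥0) : ℝ≥0∞)) (dual_le_iff.2 fun v => ?_) ENNReal.coe_lt_top
  norm_cast
  rcases le_total v v₀ with hv | hv
  · exact le_add_right (by gcongr)
  · have h3 := chord_bound h.convex h.zero hv₀ v
    rw [h.zero, zero_add] at h3
    rw [← NNReal.coe_le_coe] at h3 ⊢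
    push_cast at h3 ⊢
    have hk' : (f : ℝ) ≤ chordSlope ψ 0 v₀ := by exact_mod_cast hk
    have hv' : (v₀ : ℝ) ≤ v := by exact_mod_cast hv
    nlinarith

/-- Right continuity of the dual below the slope at infinity. -/
theorem exists_dual_lt (h : IsMetricDissipation ψ (L : ℝ≥0∞)) {f : ℝ≥0} (hf : f < L) {c : ℝ≥0∞}
    (hc : dual ψ f < c) : ∃ q, f < q ∧ q < L ∧ dual ψ q < c := by
  obtain ⟨f₁, hf₁, hf₁L⟩ := exists_between hf
  have hfin := h.dual_lt_top hf₁L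
  have hfinf := h.dual_lt_top hf
  -- Convexity bounds the dual on the segment from `f` to `f₁` by a function that tends to `dual ψ
  -- f`; this uses that the dual is finite at `f₁ < L`.
  have hlim : Tendsto (fun s : ℝ≥0 => ((1 - s : ℝ≥0) : ℝ≥0∞) * dual ψ f + s * dual ψ f₁) (𝓝 0)
      (𝓝 (((1 - 0 : ℝ≥0) : ℝ≥0∞) * dual ψ f + (0 : ℝ≥0) * dual ψ f₁)) := by
    refine Tendsto.add ?_ ?_
    · refine ENNReal.Tendsto.mul_const ?_ (Or.inr hfinf.ne)
      exact ENNReal.tendsto_coe.2 ((continuous_const.sub continuous_id).tendsto 0)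
    · exact ENNReal.Tendsto.mul_const (ENNReal.tendsto_coe.2 tendsto_id) (Or.inr hfin.ne)
  simp only [tsub_zero, ENNReal.coe_one, one_mul, ENNReal.coe_zero, zero_mul, add_zero] at hlim
  have hev := (tendsto_order.1 hlim).2 c hc
  have hne : (𝓝[>] (0 : ℝ≥0)).NeBot := inferInstance
  have hev' : ∀ᶠ s in 𝓝[>] (0 : ℝ≥0), ((1 - s : ℝ≥0) : ℝ≥0∞) * dual ψ f + s * dual ψ f₁ < c :=
    nhdsWithin_le_nhds hev
  obtain ⟨s, hs, hs0, hs1⟩ := (hev'.and (Ioo_mem_nhdsGT (zero_lt_one (α := ℝ≥0)))).exists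
  have hsum : 1 - s + s = 1 := tsub_add_cancel_of_le hs1.le
  have e : f + s * (f₁ - f) = (1 - s) * f + s * f₁ := by
    rw [← NNReal.coe_inj]
    push_cast [NNReal.coe_sub hs1.le, NNReal.coe_sub hf₁.le]
    ring
  refine ⟨(1 - s) * f + s * f₁, ?_, ?_, ?_⟩
  · rw [← e]
    have : 0 < s * (f₁ - f) := mul_pos hs0 (tsub_pos_of_lt hf₁)
    exact lt_add_of_pos_right _ this
  · refine lt_of_le_of_lt ?_ hf₁L
    rw [← e]
    calc f + s * (f₁ - f) ≤ f + 1 * (f₁ - f) := by gcongr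
      _ = f₁ := by rw [one_mul, add_tsub_cancel_of_le hf₁.le]
  · refine lt_of_le_of_lt ?_ hs
    have := dual_convex (ψ := ψ) (1 - s) s hsum f f₁
    exact_mod_cast this

/-- Where the dual of `ψn` stays bounded, the arguments are asymptotically at most the slope at
infinity of the limit. -/
theorem le_of_dual_bounded (h : IsMetricDissipation ψ (L : ℝ≥0∞)) {ψn : ℕ → ℝ≥0 → ℝ≥0}
    (hlim : ∀ v, Tendsto (fun n => ψn n v) atTop (𝓝 (ψ v))) {g : ℕ → ℝ≥0∞} {C : ℝ≥0}
    (hg : ∀ n, dual (ψn n) (g n) ≤ C) : limsup g atTop ≤ L := by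
  -- Young's inequality at a fixed velocity bounds `g n` by `(ψn n v + C) / v`, whose limit is at
  -- most `L + C / v`; afterwards `v` tends to infinity.
  have key : ∀ v : ℝ≥0, 0 < v → limsup g atTop ≤ L + C / v := by
    intro v hv
    have hv0 : (v : ℝ≥0∞) ≠ 0 := by exact_mod_cast hv.ne'
    have h1 : ∀ n, g n ≤ (ψn n v + C) / v := fun n => by
      rw [ENNReal.le_div_iff_mul_le (Or.inl hv0) (Or.inl (by simp))]
      exact (young_le (ψn n) (g n) v).trans (by gcongr; exact hg n)
    have h2 : Tendsto (fun n => ((ψn n v : ℝ≥0∞) + C) / v) atTop (𝓝 ((ψ v + C) / v)) :=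
      ENNReal.Tendsto.div_const ((ENNReal.tendsto_coe.2 (hlim v)).add_const _) (Or.inr hv0)
    calc limsup g atTop ≤ limsup (fun n => ((ψn n v : ℝ≥0∞) + C) / v) atTop :=
          limsup_le_limsup (Eventually.of_forall h1)
      _ = (ψ v + C) / v := h2.limsup_eq
      _ = ψ v / v + C / v := ENNReal.add_div
      _ ≤ L + C / v := by
        gcongr
        refine ENNReal.div_le_of_le_mul ?_
        exact_mod_cast h.le_mul v
  have h3 : Tendsto (fun n : ℕ => (L : ℝ≥0∞) + C / ((n + 1 : ℕ) : ℝ≥0)) atTop (𝓝 (L + 0)) := by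
    refine tendsto_const_nhds.add ?_
    have := (ENNReal.Tendsto.const_div (a := (C : ℝ≥0∞)) ENNReal.tendsto_nat_nhds_top
      (Or.inr (by simp))).comp (tendsto_add_atTop_nat 1)
    simpa [Function.comp_def] using this
  rw [add_zero] at h3
  exact ge_of_tendsto h3 (Eventually.of_forall fun n => key _ (by positivity))

end IsMetricDissipation

end Dissipation

end

noncomputable section

/-! ### Lipschitz parametrizations of curves of bounded variation -/

theorem clamp_mem {T : ℝ} (hT : 0 ≤ T) (t : ℝ) : max 0 (min t T) ∈ Icc 0 T :=
  ⟨le_max_left _ _, max_le hT (min_le_right _ _)⟩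

theorem clamp_eq {T t : ℝ} (ht : t ∈ Icc 0 T) : max 0 (min t T) = t := by
  rw [min_eq_left ht.2, max_eq_right ht.1]

theorem clamp_mono (T : ℝ) : Monotone fun t : ℝ => max 0 (min t T) := fun _ _ h =>
  max_le_max le_rfl (min_le_min_right _ h)

theorem clamp_sub_le (T : ℝ) {s t : ℝ} (h : s ≤ t) :
    max 0 (min t T) - max 0 (min s T) ≤ t - s := by
  rcases le_total s T with h1 | h1 <;> rcases le_total t T with h2 | h2 <;>
  rcases le_total 0 s with h3 | h3 <;> rcases le_total 0 t with h4 | h4 <;>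
  rcases le_total 0 T with h5 | h5 <;> simp [h1, h2, h3, h4, h5] <;> linarith

/-- `s ↦ (τ(s), θ(s))` is a Lipschitz parametrization of the graph of the curve `u` on `[0, T]`
(extended by constants), with the jumps filled; `σ` is a right inverse of `τ`. -/
structure IsLipParam {X : Type*} [EMetricSpace X] (T : ℝ) (u : ℝ → X) (τ σ : ℝ → ℝ) (θ : ℝ → X) :
    Prop where
  T_pos : 0 < T
  sub_le : ∀ s t, s ≤ t → t - s ≤ σ t - σ s
  left : ∀ t, t ≤ 0 → σ t = t
  right : ∀ t, T ≤ t → σ t = σ T + (t - T)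
  mono : Monotone τ
  lip : ∀ s t, s ≤ t → τ t - τ s ≤ t - s
  inv : ∀ t, τ (σ t) = t
  edist_le : ∀ s t, s ≤ t → edist (θ s) (θ t) ≤ ENNReal.ofReal (t - s)
  comp : ∀ t, θ (σ t) = extendCurve T u t

namespace IsLipParam

variable {X : Type*} [EMetricSpace X] {T : ℝ} {u : ℝ → X} {τ σ : ℝ → ℝ} {θ : ℝ → X}

theorem zero (h : IsLipParam T u τ σ θ) : σ 0 = 0 := h.left 0 le_rfl

theorem strictMono (h : IsLipParam T u τ σ θ) : StrictMono σ := fun s t hst => by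
  have := h.sub_le s t hst.le
  linarith

theorem lipschitz (h : IsLipParam T u τ σ θ) : LipschitzWith 1 τ := by
  refine LipschitzWith.of_le_add fun x y => ?_
  rcases le_total x y with hxy | hxy
  · have := h.mono hxy
    have := dist_nonneg (x := x) (y := y)
    linarith
  · have := h.lip y x hxy
    rw [Real.dist_eq, abs_of_nonneg (by linarith)]
    linarith

theorem continuous (h : IsLipParam T u τ σ θ) : Continuous τ := h.lipschitz.continuous

theorem lipschitz_curve (h : IsLipParam T u τ σ θ) : LipschitzWith 1 θ := by
  intro x y
  rw [ENNReal.coe_one, one_mul]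
  rcases le_total x y with hxy | hxy
  · refine (h.edist_le x y hxy).trans_eq ?_
    rw [edist_comm, edist_dist, Real.dist_eq, abs_of_nonneg (by linarith)]
  · rw [edist_comm]
    refine (h.edist_le y x hxy).trans_eq ?_
    rw [edist_dist, Real.dist_eq, abs_of_nonneg (by linarith)]

theorem tendsto_left (h : IsLipParam T u τ σ θ) (t : ℝ) :
    Tendsto σ (𝓝[<] t) (𝓝 (Function.leftLim σ t)) := h.strictMono.monotone.tendsto_leftLim t

theorem tendsto_right (h : IsLipParam T u τ σ θ) (t : ℝ) :
    Tendsto σ (𝓝[>] t) (𝓝 (Function.rightLim σ t)) := h.strictMono.monotone.tendsto_rightLim t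

theorem inv_leftLim (h : IsLipParam T u τ σ θ) (t : ℝ) : τ (Function.leftLim σ t) = t := by
  have h1 := (h.continuous.tendsto _).comp (h.tendsto_left t)
  have h2 : Tendsto (τ ∘ σ) (𝓝[<] t) (𝓝 t) := by
    have : τ ∘ σ = id := funext h.inv
    rw [this]; exact tendsto_id.mono_left nhdsWithin_le_nhds
  exact tendsto_nhds_unique h1 h2

theorem inv_rightLim (h : IsLipParam T u τ σ θ) (t : ℝ) : τ (Function.rightLim σ t) = t := by
  have h1 := (h.continuous.tendsto _).comp (h.tendsto_right t)
  have h2 : Tendsto (τ ∘ σ) (𝓝[>] t) (𝓝 t) := by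
    have : τ ∘ σ = id := funext h.inv
    rw [this]; exact tendsto_id.mono_left nhdsWithin_le_nhds
  exact tendsto_nhds_unique h1 h2

theorem leftLim_le (h : IsLipParam T u τ σ θ) (t : ℝ) : Function.leftLim σ t ≤ σ t :=
  h.strictMono.monotone.leftLim_le le_rfl

theorem le_rightLim (h : IsLipParam T u τ σ θ) (t : ℝ) : σ t ≤ Function.rightLim σ t :=
  h.strictMono.monotone.le_rightLim le_rfl

/-- The fibers of the time function. -/
theorem eq_iff (h : IsLipParam T u τ σ θ) {s t : ℝ} :
    τ s = t ↔ s ∈ Icc (Function.leftLim σ t) (Function.rightLim σ t) := by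
  constructor
  · rintro rfl
    constructor
    · refine le_of_tendsto (h.tendsto_left (τ s)) ?_
      filter_upwards [self_mem_nhdsWithin] with r hr
      by_contra! hlt
      have := h.mono hlt.le
      rw [h.inv] at this
      exact not_le.2 hr this
    · refine ge_of_tendsto (h.tendsto_right (τ s)) ?_
      filter_upwards [self_mem_nhdsWithin] with r hr
      by_contra! hlt
      have := h.mono hlt.le
      rw [h.inv] at this
      exact not_le.2 hr this
  · rintro ⟨h1, h2⟩
    have a1 := h.mono h1
    have a2 := h.mono h2
    rw [h.inv_leftLim] at a1
    rw [h.inv_rightLim] at a2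
    exact le_antisymm a2 a1

/-- The times at which the right inverse jumps. -/
def gaps (σ : ℝ → ℝ) : Set ℝ := {t | ¬ContinuousAt σ t}

theorem countable_gaps (h : IsLipParam T u τ σ θ) : (gaps σ).Countable :=
  h.strictMono.monotone.countable_not_continuousAt

theorem leftLim_eq_of_notMem (h : IsLipParam T u τ σ θ) {t : ℝ} (ht : t ∉ gaps σ) :
    Function.leftLim σ t = σ t := by
  have hc : ContinuousAt σ t := by simpa [gaps] using ht
  exact tendsto_nhds_unique (h.tendsto_left t) (hc.tendsto.mono_left nhdsWithin_le_nhds)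

theorem rightLim_eq_of_notMem (h : IsLipParam T u τ σ θ) {t : ℝ} (ht : t ∉ gaps σ) :
    Function.rightLim σ t = σ t := by
  have hc : ContinuousAt σ t := by simpa [gaps] using ht
  exact tendsto_nhds_unique (h.tendsto_right t) (hc.tendsto.mono_left nhdsWithin_le_nhds)

theorem inv' (h : IsLipParam T u τ σ θ) {s : ℝ} (hs : τ s ∉ gaps σ) : σ (τ s) = s := by
  have := h.eq_iff.1 (rfl : τ s = τ s)
  rw [h.leftLim_eq_of_notMem hs, h.rightLim_eq_of_notMem hs] at this
  exact le_antisymm this.1 this.2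

theorem curve_eq (h : IsLipParam T u τ σ θ) {s : ℝ} (hs : τ s ∉ gaps σ) :
    θ s = extendCurve T u (τ s) := by
  rw [← h.comp, h.inv' hs]

theorem curve_eq' (h : IsLipParam T u τ σ θ) {s : ℝ} (hs : τ s ∉ gaps σ) (hm : τ s ∈ Icc 0 T) :
    θ s = u (τ s) := by
  rw [h.curve_eq hs, extendCurve, clamp_eq hm]

theorem comp' (h : IsLipParam T u τ σ θ) {t : ℝ} (ht : t ∈ Icc 0 T) : θ (σ t) = u t := by
  rw [h.comp, extendCurve, clamp_eq ht]

theorem mem_Icc (h : IsLipParam T u τ σ θ) {s a b : ℝ} (hs : s ∈ Icc (σ a) (σ b)) :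
    τ s ∈ Icc a b := by
  have h1 := h.mono hs.1
  have h2 := h.mono hs.2
  rw [h.inv] at h1 h2
  exact ⟨h1, h2⟩

theorem limL_eq (h : IsLipParam T u τ σ θ) (t : ℝ) :
    limL T u t = θ (Function.leftLim σ t) := by
  have h1 := (h.lipschitz_curve.continuous.tendsto _).comp (h.tendsto_left t)
  have h2 : θ ∘ σ = extendCurve T u := funext h.comp
  rw [h2] at h1
  exact leftLim_eq_of_tendsto h1

theorem limR_eq (h : IsLipParam T u τ σ θ) (t : ℝ) :
    limR T u t = θ (Function.rightLim σ t) := by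
  have h1 := (h.lipschitz_curve.continuous.tendsto _).comp (h.tendsto_right t)
  have h2 : θ ∘ σ = extendCurve T u := funext h.comp
  rw [h2] at h1
  exact rightLim_eq_of_tendsto h1

/-- Off the gaps the one-sided limits of `σ` agree with its value, and so do those of `θ ∘ σ`. The
inclusion can be strict: both half fibers over a gap may be loops. -/
theorem jumpSet_subset (h : IsLipParam T u τ σ θ) : jumpSet T u ⊆ gaps σ := by
  rintro t ⟨htm, ht⟩
  by_contra hg
  rw [h.limL_eq, h.limR_eq, h.leftLim_eq_of_notMem hg, h.rightLim_eq_of_notMem hg,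
    h.comp' htm] at ht
  simp at ht

/-- On `[0, T]` the curve is the 1-Lipschitz `θ` after the monotone `σ`. This is the source of the
bounded variation of the limit curve. -/
theorem eVariationOn_le (h : IsLipParam T u τ σ θ) {a b : ℝ} (ha : 0 ≤ a) (hab : a ≤ b)
    (hb : b ≤ T) : eVariationOn u (Icc a b) ≤ ENNReal.ofReal (σ b - σ a) := by
  have h1 : eVariationOn u (Icc a b) = eVariationOn (θ ∘ σ) (Icc a b) :=
    eVariationOn.congr fun x hx => (h.comp' ⟨ha.trans hx.1, hx.2.trans hb⟩).symm
  rw [h1]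
  have hm : σ a ≤ σ b := h.strictMono.monotone hab
  calc eVariationOn (θ ∘ σ) (Icc a b) ≤ eVariationOn θ (Icc (σ a) (σ b)) := by
        refine eVariationOn.comp_le_of_monotoneOn _ _ (h.strictMono.monotone.monotoneOn _) ?_
        exact fun x hx => ⟨h.strictMono.monotone hx.1, h.strictMono.monotone hx.2⟩
    _ = eVariationOn (θ ∘ id) (Icc (σ a) (σ b)) := rfl
    _ ≤ (1 : ℝ≥0) * eVariationOn (id : ℝ → ℝ) (Icc (σ a) (σ b)) :=
        (h.lipschitz_curve.lipschitzOnWith (s := univ)).comp_eVariationOn_le (by simp [MapsTo])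
    _ = _ := by rw [eVariationOn_id_Icc, ENNReal.coe_one, one_mul]

theorem boundedVariationOn (h : IsLipParam T u τ σ θ) : BoundedVariationOn u (Icc 0 T) :=
  ne_top_of_le_ne_top ENNReal.ofReal_ne_top (h.eVariationOn_le le_rfl h.T_pos.le le_rfl)

/-! #### Change of variables -/

/-- The time function as a Stieltjes function. -/
def timeStieltjes (h : IsLipParam T u τ σ θ) : StieltjesFunction ℝ where
  toFun := τ
  mono' := h.mono
  right_continuous' _ := h.continuous.continuousWithinAt

theorem timeStieltjes_le (h : IsLipParam T u τ σ θ) : h.timeStieltjes.measure ≤ volume := by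
  have : (volume : Measure ℝ) = StieltjesFunction.id.measure := Real.volume_eq_stieltjes_id
  rw [this]
  refine le_stieltjes_measure _ _ fun a b hab => ?_
  rw [StieltjesFunction.measure_Ioc]
  exact ENNReal.ofReal_le_ofReal (h.lip a b hab.le)

/-- As `τ` is 1-Lipschitz, its Stieltjes measure is absolutely continuous, and the density is the
derivative almost everywhere. -/
theorem timeStieltjes_eq (h : IsLipParam T u τ σ θ) :
    h.timeStieltjes.measure = volume.withDensity fun s => ENNReal.ofReal (deriv τ s) := by
  have hac : h.timeStieltjes.measure ≪ volume :=
    Measure.absolutelyContinuous_of_le h.timeStieltjes_le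
  rw [← Measure.withDensity_rnDeriv_eq _ _ hac]
  refine withDensity_congr_ae ?_
  filter_upwards [h.timeStieltjes.ae_hasDerivAt, Measure.rnDeriv_lt_top h.timeStieltjes.measure
    volume] with s hs hlt
  have h1 : deriv τ s = _ := hs.deriv
  rw [h1, ENNReal.ofReal_toReal hlt.ne]

theorem preimage_Ioc (h : IsLipParam T u τ σ θ) (a b : ℝ) :
    τ ⁻¹' Ioc a b = Ioc (Function.rightLim σ a) (Function.rightLim σ b) := by
  ext s
  simp only [mem_preimage, mem_Ioc]
  constructor
  · rintro ⟨h1, h2⟩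
    constructor
    · by_contra! hle
      have := h.mono hle
      rw [h.inv_rightLim] at this
      linarith
    · rcases h2.eq_or_lt with h2 | h2
      · exact (h.eq_iff.1 h2).2
      · by_contra! hle
        have := h.mono hle.le
        rw [h.inv_rightLim] at this
        linarith
  · rintro ⟨h1, h2⟩
    have a1 := h.mono h1.le
    have a2 := h.mono h2
    rw [h.inv_rightLim] at a1 a2
    refine ⟨lt_of_le_of_ne a1 fun he => ?_, a2⟩
    exact not_le.2 h1 (h.eq_iff.1 he.symm).2

/-- The preimage of `(a, b]` is `(σ(a₊), σ(b₊)]`, and `τ` grows there by exactly `b - a`. -/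
theorem map_time (h : IsLipParam T u τ σ θ) : h.timeStieltjes.measure.map τ = volume := by
  have h1 : ∀ a b, a ≤ b → h.timeStieltjes.measure.map τ (Ioc a b) = ENNReal.ofReal (b - a) := by
    intro a b hab
    rw [Measure.map_apply h.continuous.measurable measurableSet_Ioc]
    rw [h.preimage_Ioc, StieltjesFunction.measure_Ioc]
    change ENNReal.ofReal (τ _ - τ _) = _
    rw [h.inv_rightLim, h.inv_rightLim]
  have hle : h.timeStieltjes.measure.map τ ≤ volume := by
    have : (volume : Measure ℝ) = StieltjesFunction.id.measure := Real.volume_eq_stieltjes_id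
    rw [this]
    exact le_stieltjes_measure _ _ fun a b hab => (h1 a b hab.le).le
  have : IsLocallyFiniteMeasure (h.timeStieltjes.measure.map τ) :=
    ⟨fun x => (Measure.finiteAt_nhds volume x).measure_mono hle⟩
  refine (Real.measure_ext_Ioo_rat fun a b => ?_)
  -- Equality is known on half-open intervals; the right end point is null by the same formula.
  have hlim : ∀ ν : Measure ℝ, (∀ a b, a ≤ b → ν (Ioc a b) = ENNReal.ofReal (b - a)) →
      ν (Ioo (a : ℝ) b) = ENNReal.ofReal (b - a) := by
    intro ν hν
    rcases le_or_gt (b : ℝ) a with hab | hab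
    · rw [Ioo_eq_empty (not_lt.2 hab), measure_empty, ENNReal.ofReal_of_nonpos (by linarith)]
    have hs : ν {(b : ℝ)} = 0 := by
      refine le_antisymm (ENNReal.le_of_forall_pos_le_add fun ε hε _ => ?_) zero_le
      have : ({(b : ℝ)} : Set ℝ) ⊆ Ioc ((b : ℝ) - ε) b := by
        rintro x rfl
        exact ⟨by have : (0 : ℝ) < ε := hε
                  linarith, le_rfl⟩
      refine (measure_mono this).trans ?_
      rw [hν _ _ (by have : (0 : ℝ) < ε := hε
                     linarith), zero_add]
      simp
    rw [← hν a b hab.le, ← Ioo_union_right hab]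
    refine le_antisymm (measure_mono subset_union_left) ?_
    refine (measure_union_le _ _).trans ?_
    rw [hs, add_zero]
  rw [hlim _ h1, Real.volume_Ioo]

theorem timeStieltjes_gaps (h : IsLipParam T u τ σ θ) :
    h.timeStieltjes.measure (τ ⁻¹' gaps σ) = 0 := by
  rw [← Measure.map_apply h.continuous.measurable h.countable_gaps.measurableSet, h.map_time]
  exact h.countable_gaps.measure_zero _

theorem deriv_nonneg (h : IsLipParam T u τ σ θ) (s : ℝ) : 0 ≤ deriv τ s := h.mono.deriv_nonneg

theorem measurableSet_preimage_gaps (h : IsLipParam T u τ σ θ) :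
    MeasurableSet (τ ⁻¹' gaps σ) := h.continuous.measurable h.countable_gaps.measurableSet

/-- The gaps are countable, so `dτ` does not charge the fibers over them. Hence the power is not
felt along a jump. -/
theorem deriv_eq_zero (h : IsLipParam T u τ σ θ) :
    ∀ᵐ s, τ s ∈ gaps σ → deriv τ s = 0 := by
  have h0 := h.timeStieltjes_gaps
  rw [h.timeStieltjes_eq, withDensity_apply _ h.measurableSet_preimage_gaps,
    lintegral_eq_zero_iff (measurable_deriv τ).ennreal_ofReal] at h0
  have := (ae_restrict_iff' h.measurableSet_preimage_gaps).1 h0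
  filter_upwards [this] with s hs hg
  have h1 := hs hg
  simp only [Pi.zero_apply, ENNReal.ofReal_eq_zero] at h1
  exact le_antisymm h1 (h.deriv_nonneg s)

/-- Lets almost-everywhere statements in the parameter be read at `σ t`. A null set `N` pulls back
under `σ ∘ τ` into `N` and the fibers over the gaps, and `dτ` vanishes on both. -/
theorem quasiMeasurePreserving (h : IsLipParam T u τ σ θ) :
    Measure.QuasiMeasurePreserving σ volume volume := by
  refine ⟨h.strictMono.monotone.measurable, Measure.AbsolutelyContinuous.mk fun N hN hN0 => ?_⟩
  rw [Measure.map_apply h.strictMono.monotone.measurable hN, ← h.map_time,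
    Measure.map_apply h.continuous.measurable (h.strictMono.monotone.measurable hN)]
  refine measure_mono_null (t := N ∪ τ ⁻¹' gaps σ) ?_ ?_
  · intro s hs
    by_cases hg : τ s ∈ gaps σ
    · exact Or.inr hg
    · left
      have : σ (τ s) ∈ N := hs
      rwa [h.inv' hg] at this
  · refine measure_union_null ?_ h.timeStieltjes_gaps
    exact le_antisymm ((h.timeStieltjes_le N).trans hN0.le) zero_le

theorem aemeasurable_comp (h : IsLipParam T u τ σ θ) {Y : Type*} [MeasurableSpace Y]
    {g : ℝ → Y} {a b : ℝ} (hg : AEMeasurable g (volume.restrict (Icc (σ a) (σ b)))) :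
    AEMeasurable (fun t => g (σ t)) (volume.restrict (Icc a b)) := by
  have hmaps : MapsTo σ (Icc a b) (Icc (σ a) (σ b)) := fun x hx =>
    ⟨h.strictMono.monotone hx.1, h.strictMono.monotone hx.2⟩
  exact hg.comp_quasiMeasurePreserving (h.quasiMeasurePreserving.restrict hmaps)

/-- Change of variables between the time and the parameter. -/
theorem lintegral_comp (h : IsLipParam T u τ σ θ) {g : ℝ → ℝ≥0∞} {a b : ℝ}
    (hg : AEMeasurable g (volume.restrict (Icc a b))) :
    ∫⁻ s in Icc (σ a) (σ b), g (τ s) * ENNReal.ofReal (deriv τ s) = ∫⁻ t in Icc a b, g t := by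
  have hsub : Icc (σ a) (σ b) ⊆ τ ⁻¹' Icc a b := fun s hs => h.mem_Icc hs
  -- The two sets differ only by parts of the fibers over `a` and `b`, which `dτ` does not see.
  have hae : (Icc (σ a) (σ b) : Set ℝ) =ᵐ[h.timeStieltjes.measure] τ ⁻¹' Icc a b := by
    refine (ae_eq_of_subset_of_measure_ge hsub ?_ measurableSet_Icc.nullMeasurableSet ?_)
    · rw [← Measure.map_apply h.continuous.measurable measurableSet_Icc, h.map_time,
        StieltjesFunction.measure_Icc]
      change _ ≤ ENNReal.ofReal (τ _ - Function.leftLim τ _)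
      rw [(h.continuous.continuousAt).continuousWithinAt.leftLim_eq, h.inv, h.inv, Real.volume_Icc]
    · rw [← Measure.map_apply h.continuous.measurable measurableSet_Icc, h.map_time,
        Real.volume_Icc]
      exact ENNReal.ofReal_ne_top
  have hmap : (h.timeStieltjes.measure.restrict (τ ⁻¹' Icc a b)).map τ
      = volume.restrict (Icc a b) := by
    rw [← Measure.restrict_map h.continuous.measurable measurableSet_Icc, h.map_time]
  have hr : h.timeStieltjes.measure.restrict (Icc (σ a) (σ b))
      = h.timeStieltjes.measure.restrict (τ ⁻¹' Icc a b) := Measure.restrict_congr_set hae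
  rw [← hmap, lintegral_map' (by rw [hmap]; exact hg) h.continuous.aemeasurable, ← hr,
    h.timeStieltjes_eq, restrict_withDensity measurableSet_Icc,
    lintegral_withDensity_eq_lintegral_mul₀' (measurable_deriv τ).ennreal_ofReal.aemeasurable]
  · simp only [Pi.mul_apply, mul_comm]
  · rw [← restrict_withDensity measurableSet_Icc, ← h.timeStieltjes_eq, hr]
    refine AEMeasurable.comp_measurable ?_ h.continuous.measurable
    rw [hmap]; exact hg

end IsLipParam

end

noncomputable section

/-! ### The variation function, its diffuse part and its Cantor part -/

section Variation

variable {X : Type*} [EMetricSpace X] {T : ℝ} {u : ℝ → X}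

theorem variationMeasure_eq (hu : BoundedVariationOn u (Icc 0 T)) :
    variationMeasure T u = (variationFun_monotone T u hu).stieltjesFunction.measure := by
  rw [variationMeasure, dif_pos (variationFun_monotone T u hu)]

theorem ofReal_variationFun_sub (hu : BoundedVariationOn u (Icc 0 T)) {a b : ℝ} (ha : 0 ≤ a)
    (hab : a ≤ b) (hb : b ≤ T) :
    ENNReal.ofReal (variationFun T u b - variationFun T u a) = eVariationOn u (Icc a b) := by
  have h1 : eVariationOn u (Icc 0 a) ≠ ⊤ := hu.mono (Icc_subset_Icc_right (hab.trans hb))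
  have h2 : eVariationOn u (Icc a b) ≠ ⊤ := hu.mono (Icc_subset_Icc ha hb)
  have h3 := eVariationOn.Icc_add_Icc u (s := univ) ha hab (mem_univ _)
  simp only [univ_inter] at h3
  rw [variationFun, variationFun, min_eq_left hb, min_eq_left (hab.trans hb), ← h3,
    ENNReal.toReal_add h1 h2, add_sub_cancel_left, ENNReal.ofReal_toReal h2]

theorem variationFun_clamp (hT : 0 ≤ T) (t : ℝ) :
    variationFun T u (max 0 (min t T)) = variationFun T u t := by
  simp only [variationFun]
  rcases le_total 0 t with h0 | h0
  · rw [max_eq_right (le_min h0 hT), min_assoc, min_self]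
  · rw [min_eq_left (h0.trans hT), max_eq_left h0, min_eq_left hT]
    congr 1
    rw [eVariationOn.subsingleton u (by simp), eVariationOn.subsingleton]
    exact subsingleton_Icc_of_ge h0

theorem ofReal_variationFun_sub' (hT : 0 ≤ T) (hu : BoundedVariationOn u (Icc 0 T)) {a b : ℝ}
    (hab : a ≤ b) :
    ENNReal.ofReal (variationFun T u b - variationFun T u a)
      = eVariationOn u (Icc (max 0 (min a T)) (max 0 (min b T))) := by
  rw [← variationFun_clamp hT b, ← variationFun_clamp hT a]
  exact ofReal_variationFun_sub hu (clamp_mem hT a).1 (clamp_mono T hab) (clamp_mem hT b).2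

theorem edist_extendCurve_le (hT : 0 ≤ T) (hu : BoundedVariationOn u (Icc 0 T)) {a b : ℝ}
    (hab : a ≤ b) : edist (extendCurve T u a) (extendCurve T u b)
      ≤ ENNReal.ofReal (variationFun T u b - variationFun T u a) := by
  rw [ofReal_variationFun_sub' hT hu hab]
  exact eVariationOn.edist_le u (left_mem_Icc.2 (clamp_mono T hab))
    (right_mem_Icc.2 (clamp_mono T hab))

theorem isLocallyFiniteMeasure_variationMeasure (T : ℝ) (u : ℝ → X) :
    IsLocallyFiniteMeasure (variationMeasure T u) := by
  unfold variationMeasure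
  split_ifs <;> infer_instance

/-- On Lebesgue null sets off the jump set the Cantor part is the variation measure. -/
theorem cantorMeasure_of_null {B : Set ℝ} (hB : MeasurableSet B) (h0 : volume B = 0)
    (hJ : Disjoint B (jumpSet T u)) : cantorMeasure T u B = variationMeasure T u B := by
  have := isLocallyFiniteMeasure_variationMeasure T u
  have : SigmaFinite (diffuseMeasure T u) := by unfold diffuseMeasure; infer_instance
  have h1 : diffuseMeasure T u B = variationMeasure T u B := by
    rw [diffuseMeasure, Measure.restrict_apply hB, inter_eq_self_of_subset_left]
    exact hJ.subset_compl_right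
  rw [← h1, ← Measure.singularPart_add_rnDeriv (diffuseMeasure T u) volume, Measure.add_apply]
  rw [withDensity_apply _ hB, setLIntegral_measure_zero _ _ h0, add_zero, cantorMeasure]

theorem cantorMeasure_le (T : ℝ) (u : ℝ → X) : cantorMeasure T u ≤ variationMeasure T u :=
  (Measure.singularPart_le _ _).trans Measure.restrict_le_self

/-- The Cantor part is carried by a Lebesgue null set. -/
theorem exists_cantorMeasure_support (T : ℝ) (u : ℝ → X) :
    ∃ N, MeasurableSet N ∧ volume N = 0 ∧ cantorMeasure T u Nᶜ = 0 := by
  obtain ⟨s, hs, h1, h2⟩ := Measure.mutuallySingular_singularPart (diffuseMeasure T u) volume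
  exact ⟨sᶜ, hs.compl, h2, by simpa [cantorMeasure] using h1⟩

end Variation

namespace IsLipParam

variable {X : Type*} [EMetricSpace X] {T : ℝ} {u : ℝ → X} {τ σ : ℝ → ℝ} {θ : ℝ → X}

theorem variationFun_sub_le (h : IsLipParam T u τ σ θ) {a b : ℝ} (hab : a ≤ b) :
    variationFun T u b - variationFun T u a ≤ σ b - σ a := by
  have h1 := ofReal_variationFun_sub' h.T_pos.le h.boundedVariationOn hab
  have hcl := clamp_mono T hab
  have h2 := h.eVariationOn_le (clamp_mem h.T_pos.le a).1 hcl (clamp_mem h.T_pos.le b).2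
  have hT := h.T_pos
  have hm := h.strictMono.monotone
  -- Clamping to `[0, T]` does not enlarge the increments of `σ`, which has slope one outside.
  have key : ∀ x y, x ≤ y → σ (max 0 (min y T)) - σ (max 0 (min x T)) ≤ σ y - σ x := by
    intro x y hxy
    have e : ∀ x, σ x = σ (max 0 (min x T)) + (x - max 0 (min x T)) := by
      intro x
      rcases le_total x 0 with h0 | h0
      · rw [min_eq_left (h0.trans hT.le), max_eq_left h0, h.zero, h.left x h0]; ring
      · rcases le_total x T with h1 | h1
        · rw [min_eq_left h1, max_eq_right h0]; ring
        · rw [min_eq_right h1, max_eq_right hT.le, h.right x h1]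
    rw [e x, e y]
    have := clamp_sub_le T hxy
    linarith
  have h3 := h1.le.trans (h2.trans (ENNReal.ofReal_le_ofReal (key a b hab)))
  exact (ENNReal.ofReal_le_ofReal_iff (sub_nonneg.2 (hm hab))).1 h3

theorem tendsto_left_curve (h : IsLipParam T u τ σ θ) (t : ℝ) :
    Tendsto (extendCurve T u) (𝓝[<] t) (𝓝 (limL T u t)) := by
  have h1 := (h.lipschitz_curve.continuous.tendsto _).comp (h.tendsto_left t)
  rw [h.limL_eq]
  exact h1.congr h.comp

theorem tendsto_right_curve (h : IsLipParam T u τ σ θ) (t : ℝ) :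
    Tendsto (extendCurve T u) (𝓝[>] t) (𝓝 (limR T u t)) := by
  have h1 := (h.lipschitz_curve.continuous.tendsto _).comp (h.tendsto_right t)
  rw [h.limR_eq]
  exact h1.congr h.comp

/-- The variation function is continuous off the jump set. -/
theorem continuousAt_variationFun (h : IsLipParam T u τ σ θ) {t : ℝ} (ht : t ∉ jumpSet T u) :
    ContinuousAt (variationFun T u) t := by
  have hT := h.T_pos.le
  by_cases htm : t ∈ Icc 0 T
  swap
  -- Outside `[0, T]` the function `σ` is affine, and its increments dominate those of the
  -- variation.
  · have hc : ContinuousAt σ t := by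
      by_cases h0 : t < 0
      · refine continuousAt_id.congr ?_
        filter_upwards [Iio_mem_nhds h0] with x hx
        exact (h.left x (le_of_lt hx)).symm
      · have h1 : T < t := by
          by_contra! hle; exact htm ⟨not_lt.1 h0, hle⟩
        have : ContinuousAt (fun x => σ T + (x - T)) t := by fun_prop
        refine this.congr ?_
        filter_upwards [Ioi_mem_nhds h1] with x hx
        exact (h.right x (le_of_lt hx)).symm
    refine Metric.continuousAt_iff.2 fun ε hε => ?_
    obtain ⟨δ, hδ, hd⟩ := Metric.continuousAt_iff.1 hc ε hε
    refine ⟨δ, hδ, fun {x} hx => lt_of_le_of_lt ?_ (hd hx)⟩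
    have hV := variationFun_monotone T u h.boundedVariationOn
    have hσ := h.strictMono.monotone
    rw [Real.dist_eq, Real.dist_eq]
    rcases le_total x t with hxt | hxt
    · rw [abs_sub_comm, abs_sub_comm (σ x), abs_of_nonneg (sub_nonneg.2 (hV hxt)),
        abs_of_nonneg (sub_nonneg.2 (hσ hxt))]
      exact h.variationFun_sub_le hxt
    · rw [abs_of_nonneg (sub_nonneg.2 (hV hxt)), abs_of_nonneg (sub_nonneg.2 (hσ hxt))]
      exact h.variationFun_sub_le hxt
  have hu : u t = limL T u t ∧ u t = limR T u t := by
    by_contra hcon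
    refine ht ⟨htm, ?_⟩
    by_contra! h'
    exact hcon h'
  have hbv := h.boundedVariationOn
  have heq : ∀ r ∈ Icc 0 T, extendCurve T u r = u r := fun r hr => by
    rw [extendCurve, clamp_eq hr]
  have cl : ContinuousWithinAt u (Icc 0 T ∩ Iic t) t := by
    have h1 := h.tendsto_left_curve t
    rw [← hu.1] at h1
    have h2 : ContinuousWithinAt (extendCurve T u) (Iio t) t := by
      rw [ContinuousWithinAt, heq t htm]; exact h1
    have h3 : ContinuousWithinAt (extendCurve T u) (Iic t) t :=
      continuousWithinAt_Iio_iff_Iic.1 h2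
    exact (h3.mono inter_subset_right).congr (fun r hr => (heq r hr.1).symm) (heq t htm).symm
  have cr : ContinuousWithinAt u (Icc 0 T ∩ Ici t) t := by
    have h1 := h.tendsto_right_curve t
    rw [← hu.2] at h1
    have h2 : ContinuousWithinAt (extendCurve T u) (Ioi t) t := by
      rw [ContinuousWithinAt, heq t htm]; exact h1
    have h3 : ContinuousWithinAt (extendCurve T u) (Ici t) t :=
      continuousWithinAt_Ioi_iff_Ici.1 h2
    exact (h3.mono inter_subset_right).congr (fun r hr => (heq r hr.1).symm) (heq t htm).symm
  -- For a curve of bounded variation, one-sided continuity at `t` makes the variation on one-sided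
  -- intervals shrinking to `t` tend to zero.
  have el := hbv.tendsto_eVariationOn_Icc_zero_left cl
  have er := hbv.tendsto_eVariationOn_Icc_zero_right t cr
  have hclamp : Tendsto (fun x : ℝ => max 0 (min x T)) (𝓝 t) (𝓝[Icc 0 T] t) := by
    refine tendsto_nhdsWithin_iff.2 ⟨?_, Eventually.of_forall fun x => clamp_mem hT x⟩
    have : Continuous fun x : ℝ => max 0 (min x T) := by fun_prop
    have := this.tendsto t
    rwa [clamp_eq htm] at this
  have el' := el.comp hclamp
  have er' := er.comp hclamp
  have hsum : Tendsto (fun x => ENNReal.ofReal |variationFun T u x - variationFun T u t|) (𝓝 t)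
      (𝓝 0) := by
    refine tendsto_of_tendsto_of_tendsto_of_le_of_le tendsto_const_nhds
      (by simpa using el'.add er') (fun _ => zero_le) fun x => ?_
    have hV := variationFun_monotone T u hbv
    rcases le_total x t with hxt | hxt
    · rw [abs_sub_comm, abs_of_nonneg (sub_nonneg.2 (hV hxt)),
        ofReal_variationFun_sub' hT hbv hxt, clamp_eq htm]
      refine le_add_right (eVariationOn.mono u fun r hr => ⟨⟨?_, hr.2.trans htm.2⟩, hr⟩)
      exact (clamp_mem hT x).1.trans hr.1
    · rw [abs_of_nonneg (sub_nonneg.2 (hV hxt)),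
        ofReal_variationFun_sub' hT hbv hxt, clamp_eq htm]
      refine le_add_left (eVariationOn.mono u fun r hr => ⟨⟨htm.1.trans hr.1, ?_⟩, hr⟩)
      exact hr.2.trans (clamp_mem hT x).2
  have hreal := (ENNReal.tendsto_toReal ENNReal.zero_ne_top).comp hsum
  simp only [Function.comp_def, ENNReal.toReal_ofReal (abs_nonneg _), ENNReal.toReal_zero] at hreal
  exact tendsto_iff_dist_tendsto_zero.2 hreal

/-- Jump times are removed from the diffuse measure; at all other times the variation function is
continuous. -/
theorem cantorMeasure_singleton (h : IsLipParam T u τ σ θ) (t : ℝ) :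
    cantorMeasure T u {t} = 0 := by
  refine le_antisymm ((Measure.singularPart_le _ _ _).trans ?_) zero_le
  rw [diffuseMeasure, Measure.restrict_apply (measurableSet_singleton t)]
  by_cases ht : t ∈ jumpSet T u
  · have : ({t} : Set ℝ) ∩ (jumpSet T u)ᶜ = ∅ := by
      ext x; simp only [mem_inter_iff, mem_singleton_iff, mem_compl_iff, mem_empty_iff_false,
        iff_false, not_and, not_not]
      rintro rfl; exact ht
    simp [this]
  · refine (measure_mono inter_subset_left).trans ?_
    rw [variationMeasure_eq h.boundedVariationOn, StieltjesFunction.measure_singleton]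
    have hV := variationFun_monotone T u h.boundedVariationOn
    have hc := h.continuousAt_variationFun ht
    have h1 : hV.stieltjesFunction t = variationFun T u t := by
      rw [Monotone.stieltjesFunction_eq]
      exact hc.continuousWithinAt.rightLim_eq
    have h2 : variationFun T u t ≤ Function.leftLim hV.stieltjesFunction t := by
      refine le_of_tendsto_of_tendsto (hc.tendsto.mono_left nhdsWithin_le_nhds)
        (hV.stieltjesFunction.mono.tendsto_leftLim t) ?_
      exact Eventually.of_forall fun x => by
        rw [Monotone.stieltjesFunction_eq]; exact hV.le_rightLim le_rfl
    rw [h1, ENNReal.ofReal_of_nonpos (by linarith)]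

theorem cantorMeasure_countable (h : IsLipParam T u τ σ θ) {s : Set ℝ} (hs : s.Countable) :
    cantorMeasure T u s = 0 := by
  rw [← biUnion_of_singleton s, measure_biUnion_null_iff hs]
  exact fun t _ => h.cantorMeasure_singleton t

/-! #### Speeds -/

theorem ac (h : IsLipParam T u τ σ θ) (α β : ℝ) : IsAC θ α β := IsAC.of_edist_le h.edist_le α β

theorem ae_tendsto_speed (h : IsLipParam T u τ σ θ) (α β : ℝ) :
    ∀ᵐ s ∂volume.restrict (Icc α β),
      Tendsto (fun ρ : ℝ => edist (θ (s + ρ)) (θ s) / ENNReal.ofReal |ρ|) (𝓝[>] 0)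
        (𝓝 (metricDeriv θ s)) := (h.ac α β).ae_tendsto_metricDeriv

/-- Off the gaps a small time step corresponds to a small positive parameter step. Composing with
this map transfers difference quotients of `θ` and `τ` at `s` to those of `u` at `τ s`. -/
theorem tendsto_increment (h : IsLipParam T u τ σ θ) {s : ℝ} (hs : τ s ∉ gaps σ) :
    Tendsto (fun r : ℝ => σ (τ s + r) - s) (𝓝[>] 0) (𝓝[>] 0) := by
  refine tendsto_nhdsWithin_iff.2 ⟨?_, ?_⟩
  · have hc : ContinuousAt σ (τ s) := by simpa [gaps] using hs
    have h1 : Tendsto (fun r : ℝ => τ s + r) (𝓝[>] 0) (𝓝 (τ s)) := by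
      have : Continuous fun r : ℝ => τ s + r := by fun_prop
      have := this.tendsto 0
      rw [add_zero] at this
      exact this.mono_left nhdsWithin_le_nhds
    have h2 := (hc.tendsto.comp h1).sub_const s
    rwa [h.inv' hs, sub_self] at h2
  · filter_upwards [self_mem_nhdsWithin] with r hr
    have : σ (τ s) < σ (τ s + r) := h.strictMono (by simpa using hr)
    rw [h.inv' hs] at this
    exact sub_pos.2 this

/-- The chain rule for the speeds. -/
theorem metricDeriv_mul (h : IsLipParam T u τ σ θ) {s : ℝ} (hs : τ s ∉ gaps σ)
    (hm : τ s ∈ Ico 0 T) (hd : DifferentiableAt ℝ τ s) (hpos : 0 < deriv τ s)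
    (hlim : Tendsto (fun ρ : ℝ => edist (θ (s + ρ)) (θ s) / ENNReal.ofReal |ρ|) (𝓝[>] 0)
      (𝓝 (metricDeriv θ s))) :
    metricDeriv u (τ s) = metricDeriv θ s / ENNReal.ofReal (deriv τ s) := by
  have hρ := h.tendsto_increment hs
  have h1 := hlim.comp hρ
  have h2 : Tendsto (fun r : ℝ => (σ (τ s + r) - s)⁻¹ * r) (𝓝[>] 0) (𝓝 (deriv τ s)) := by
    have := hd.hasDerivAt.tendsto_slope_zero_right.comp hρ
    refine this.congr fun r => ?_
    simp only [Function.comp, add_sub_cancel, h.inv, smul_eq_mul, add_sub_cancel_left]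
  have h3 : Tendsto (fun r : ℝ => ENNReal.ofReal ((σ (τ s + r) - s)⁻¹ * r)) (𝓝[>] 0)
      (𝓝 (ENNReal.ofReal (deriv τ s))) := (ENNReal.continuous_ofReal.tendsto _).comp h2
  have h4 := ENNReal.Tendsto.div h1 (Or.inr (by simpa using hpos)) h3 (Or.inl ENNReal.ofReal_ne_top)
  refine Tendsto.limsup_eq (h4.congr' ?_)
  filter_upwards [hρ self_mem_nhdsWithin, Ioo_mem_nhdsGT (show (0 : ℝ) < T - τ s by linarith [hm.2])]
    with r hr1 hr
  have hr1 : 0 < σ (τ s + r) - s := hr1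
  have hr0 : 0 < r := hr.1
  have hm1 : τ s ∈ Icc 0 T := ⟨hm.1, hm.2.le⟩
  have hm2 : τ s + r ∈ Icc 0 T := ⟨by linarith [hm.1], by linarith [hr.2]⟩
  have e1 : θ (s + (σ (τ s + r) - s)) = u (τ s + r) := by
    rw [add_sub_cancel, h.comp' hm2]
  simp only [Function.comp]
  rw [e1, h.curve_eq' hs hm1, abs_of_pos hr1, abs_of_pos hr0, ENNReal.ofReal_mul (by positivity),
    ENNReal.ofReal_inv_of_pos hr1, ENNReal.div_eq_inv_mul, ENNReal.div_eq_inv_mul,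
    ENNReal.div_eq_inv_mul, ENNReal.mul_inv (Or.inr ENNReal.ofReal_ne_top)
      (Or.inr (by simpa using hr0)), inv_inv]
  have a1 : ENNReal.ofReal (σ (τ s + r) - s) ≠ 0 := by simpa using hr1
  calc _ = (ENNReal.ofReal (σ (τ s + r) - s) * (ENNReal.ofReal (σ (τ s + r) - s))⁻¹)
        * ((ENNReal.ofReal r)⁻¹ * edist (u (τ s + r)) (u (τ s))) := by ring
    _ = _ := by rw [ENNReal.mul_inv_cancel a1 ENNReal.ofReal_ne_top, one_mul]

/-- Lebesgue measure in time is the image of the density `τ'`. Up to fibers over gaps, the preimage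
of the exceptional times is contained in `{τ' ≤ 0}`, where this density has no mass. -/
theorem ae_deriv_pos (h : IsLipParam T u τ σ θ) : ∀ᵐ t, 0 < deriv τ (σ t) := by
  have hB : MeasurableSet {t | deriv τ (σ t) ≤ 0} :=
    measurableSet_le ((measurable_deriv τ).comp h.strictMono.monotone.measurable) measurable_const
  have : volume {t | deriv τ (σ t) ≤ 0} = 0 := by
    rw [← h.map_time, Measure.map_apply h.continuous.measurable hB]
    have hsub : τ ⁻¹' {t | deriv τ (σ t) ≤ 0} ⊆ {s | deriv τ s ≤ 0} ∪ τ ⁻¹' gaps σ := by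
      intro s hs
      by_cases hg : τ s ∈ gaps σ
      · exact Or.inr hg
      · left
        have : deriv τ (σ (τ s)) ≤ 0 := hs
        rwa [h.inv' hg] at this
    refine measure_mono_null hsub (measure_union_null ?_ h.timeStieltjes_gaps)
    have hm : MeasurableSet {s | deriv τ s ≤ 0} := measurableSet_le (measurable_deriv τ)
      measurable_const
    rw [h.timeStieltjes_eq, withDensity_apply _ hm]
    rw [setLIntegral_congr_fun (g := fun _ => 0) hm (fun s hs => ENNReal.ofReal_of_nonpos hs)]
    simp
  filter_upwards [measure_eq_zero_iff_ae_notMem.1 this] with t ht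
  simpa using ht

theorem ae_metricDeriv_eq (h : IsLipParam T u τ σ θ) :
    ∀ᵐ t ∂volume.restrict (Icc 0 T),
      metricDeriv u t = metricDeriv θ (σ t) / ENNReal.ofReal (deriv τ (σ t)) := by
  have h1 := h.ae_tendsto_speed (σ 0) (σ T)
  rw [ae_restrict_iff' measurableSet_Icc] at h1 ⊢
  have h2 := h.mono.ae_differentiableAt
  filter_upwards [h.quasiMeasurePreserving.ae h1, h.quasiMeasurePreserving.ae h2, h.ae_deriv_pos,
    h.countable_gaps.ae_notMem volume, Measure.ae_ne volume T] with t a1 a2 a3 a4 a5 htm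
  have hσ := h.strictMono.monotone
  have := h.metricDeriv_mul (s := σ t) (by rwa [h.inv])
    (by rw [h.inv]; exact ⟨htm.1, lt_of_le_of_ne htm.2 a5⟩) a2 a3 (a1 ⟨hσ htm.1, hσ htm.2⟩)
  rwa [h.inv] at this

theorem aemeasurable_metricDeriv (h : IsLipParam T u τ σ θ) :
    AEMeasurable (metricDeriv u) (volume.restrict (Icc 0 T)) := by
  have h1 : AEMeasurable (fun t => metricDeriv θ (σ t) / ENNReal.ofReal (deriv τ (σ t)))
      (volume.restrict (Icc 0 T)) :=
    (h.aemeasurable_comp (h.ac _ _).aemeasurable_metricDeriv).div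
      ((measurable_deriv τ).comp h.strictMono.monotone.measurable).ennreal_ofReal.aemeasurable
  exact h1.congr (h.ae_metricDeriv_eq.mono fun _ ht => ht.symm)

/-- Where the time stands still off the gaps, the length of the curve is part of the Cantor
part. -/
theorem lintegral_speed_le_cantor (h : IsLipParam T u τ σ θ) {a b : ℝ} :
    ∫⁻ s in Icc (σ a) (σ b) ∩ (τ ⁻¹' gaps σ)ᶜ ∩ {s | deriv τ s ≤ 0}, metricDeriv θ s
      ≤ cantorMeasure T u (Icc a b) := by
  have hV := variationFun_monotone T u h.boundedVariationOn
  have hT := h.T_pos.le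
  -- `w` is the variation of `u` read in the parameter. Off the gaps its difference quotients
  -- dominate those of `θ`, so its density dominates the speed.
  let w : StieltjesFunction ℝ :=
    { toFun := fun s => hV.stieltjesFunction (τ s)
      mono' := hV.stieltjesFunction.mono.comp h.mono
      right_continuous' := fun s => by
        refine ContinuousWithinAt.comp (t := Ici (τ s)) (hV.stieltjesFunction.right_continuous _)
          h.continuous.continuousWithinAt fun r hr => h.mono hr }
  set D := Icc (σ a) (σ b) ∩ (τ ⁻¹' gaps σ)ᶜ ∩ {s | deriv τ s ≤ 0} with hD
  have hDm : MeasurableSet D := (measurableSet_Icc.inter h.measurableSet_preimage_gaps.compl).inter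
    (measurableSet_le (measurable_deriv τ) measurable_const)
  have hle : ∀ᵐ s ∂volume.restrict D, metricDeriv θ s ≤ w.measure.rnDeriv volume s := by
    have h1 : ∀ᵐ s ∂volume.restrict D, Tendsto (fun ρ : ℝ => edist (θ (s + ρ)) (θ s)
        / ENNReal.ofReal |ρ|) (𝓝[>] 0) (𝓝 (metricDeriv θ s)) :=
      ae_restrict_of_ae_restrict_of_subset (fun s hs => hs.1.1) (h.ae_tendsto_speed (σ a) (σ b))
    filter_upwards [h1, ae_restrict_mem hDm, ae_restrict_of_ae w.ae_hasDerivAt,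
      ae_restrict_of_ae (Measure.rnDeriv_lt_top w.measure volume)] with s hs hsD hw hlt
    have hg : τ s ∉ gaps σ := hsD.1.2
    have hρ := h.tendsto_increment hg
    have hw' : Tendsto (fun ρ : ℝ => ENNReal.ofReal (ρ⁻¹ • (w (s + ρ) - w s))) (𝓝[>] 0)
        (𝓝 (w.measure.rnDeriv volume s)) := by
      rw [← ENNReal.ofReal_toReal hlt.ne]
      exact (ENNReal.continuous_ofReal.tendsto _).comp hw.tendsto_slope_zero_right
    refine le_of_tendsto_of_tendsto (hs.comp hρ) (hw'.comp hρ) ?_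
    filter_upwards [hρ self_mem_nhdsWithin, self_mem_nhdsWithin] with r hr hr0
    have hr : 0 < σ (τ s + r) - s := hr
    have hr0 : (0 : ℝ) < r := hr0
    simp only [Function.comp]
    rw [add_sub_cancel, abs_of_pos hr, smul_eq_mul, ENNReal.ofReal_mul (by positivity),
      ENNReal.ofReal_inv_of_pos hr, ENNReal.div_eq_inv_mul]
    gcongr
    rw [h.comp, h.curve_eq hg, edist_comm]
    refine (edist_extendCurve_le hT h.boundedVariationOn (by linarith)).trans
      (ENNReal.ofReal_le_ofReal ?_)
    change _ ≤ hV.stieltjesFunction (τ (σ (τ s + r))) - hV.stieltjesFunction (τ s)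
    rw [h.inv, hV.stieltjesFunction_eq, hV.stieltjesFunction_eq]
    have e1 : Function.rightLim (variationFun T u) (τ s) = variationFun T u (τ s) :=
      (h.continuousAt_variationFun fun hj => hg (h.jumpSet_subset hj)).continuousWithinAt.rightLim_eq
    have e2 : variationFun T u (τ s + r) ≤ Function.rightLim (variationFun T u) (τ s + r) :=
      hV.le_rightLim le_rfl
    linarith
  let B : Set ℝ := Icc a b ∩ (gaps σ)ᶜ ∩ {t | deriv τ (σ t) ≤ 0}
  have hBm : MeasurableSet B := (measurableSet_Icc.inter h.countable_gaps.measurableSet.compl).inter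
    (measurableSet_le ((measurable_deriv τ).comp h.strictMono.monotone.measurable) measurable_const)
  have hDB : D ⊆ τ ⁻¹' B := by
    intro s hs
    have hg : τ s ∉ gaps σ := hs.1.2
    refine ⟨⟨h.mem_Icc hs.1.1, hg⟩, ?_⟩
    change deriv τ (σ (τ s)) ≤ 0
    rw [h.inv' hg]; exact hs.2
  have hmap : w.measure.map τ ≤ variationMeasure T u := by
    rw [variationMeasure_eq h.boundedVariationOn]
    refine le_stieltjes_measure _ _ fun x y _ => ?_
    rw [Measure.map_apply h.continuous.measurable measurableSet_Ioc, h.preimage_Ioc,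
      StieltjesFunction.measure_Ioc]
    change ENNReal.ofReal (hV.stieltjesFunction (τ _) - hV.stieltjesFunction (τ _)) ≤ _
    rw [h.inv_rightLim, h.inv_rightLim]
  -- Times with `τ'(σ t) ≤ 0` are negligible, and `B` avoids the jumps; so on `B` the variation
  -- measure is its Cantor part.
  have hB0 : volume B = 0 := by
    refine measure_mono_null (t := {t | ¬ 0 < deriv τ (σ t)}) ?_ (ae_iff.1 h.ae_deriv_pos)
    exact fun t ht => not_lt.2 ht.2
  calc ∫⁻ s in D, metricDeriv θ s ≤ ∫⁻ s in D, w.measure.rnDeriv volume s :=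
        lintegral_mono_ae hle
    _ ≤ w.measure D := Measure.setLIntegral_rnDeriv_le _
    _ ≤ w.measure (τ ⁻¹' B) := measure_mono hDB
    _ = w.measure.map τ B := (Measure.map_apply h.continuous.measurable hBm).symm
    _ ≤ variationMeasure T u B := hmap B
    _ = cantorMeasure T u B := (cantorMeasure_of_null hBm hB0 (by
        rw [disjoint_left]
        exact fun t ht hj => ht.1.2 (h.jumpSet_subset hj))).symm
    _ ≤ cantorMeasure T u (Icc a b) := measure_mono fun t ht => ht.1.1

/-- Off the gaps, the weighted length of the parametrized curve is controlled by the weighted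
speed of `u` and by the Cantor part. -/
theorem lintegral_speed_le (h : IsLipParam T u τ σ θ) {a b : ℝ} (ha : 0 ≤ a) (hb : b ≤ T)
    {G : ℝ → ℝ≥0∞} (hG : Measurable G) {L : ℝ≥0} (hGL : ∀ t ∈ Icc a b, t ∉ gaps σ → G t ≤ L) :
    ∫⁻ s in Icc (σ a) (σ b) ∩ (τ ⁻¹' gaps σ)ᶜ, G (τ s) * metricDeriv θ s
      ≤ (∫⁻ t in Icc a b, G t * metricDeriv u t) + L * cantorMeasure T u (Icc a b) := by
  set A := Icc (σ a) (σ b) ∩ (τ ⁻¹' gaps σ)ᶜ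
  have hAm : MeasurableSet A := measurableSet_Icc.inter h.measurableSet_preimage_gaps.compl
  have hP : MeasurableSet {s | deriv τ s ≤ 0} := measurableSet_le (measurable_deriv τ)
    measurable_const
  -- Where `τ' > 0` the chain rule and the change of variables give the speed of `u`; where `τ' ≤ 0`
  -- the length belongs to the Cantor part.
  rw [← lintegral_inter_add_sdiff _ A hP, add_comm]
  refine add_le_add ?_ ?_
  · have hmeas : AEMeasurable (fun t => G t * metricDeriv u t) (volume.restrict (Icc a b)) :=
      hG.aemeasurable.mul (h.aemeasurable_metricDeriv.mono_set (Icc_subset_Icc ha hb))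
    rw [← h.lintegral_comp hmeas]
    refine le_trans ?_ (lintegral_mono_set (s := A \ {s | deriv τ s ≤ 0})
      (fun s hs => hs.1.1))
    refine lintegral_mono_ae ?_
    have h1 : ∀ᵐ s ∂volume.restrict (A \ {s | deriv τ s ≤ 0}), Tendsto (fun ρ : ℝ =>
        edist (θ (s + ρ)) (θ s) / ENNReal.ofReal |ρ|) (𝓝[>] 0) (𝓝 (metricDeriv θ s)) :=
      ae_restrict_of_ae_restrict_of_subset (fun s hs => hs.1.1) (h.ae_tendsto_speed (σ a) (σ b))
    filter_upwards [h1, ae_restrict_mem (hAm.diff hP), ae_restrict_of_ae h.mono.ae_differentiableAt,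
      ae_restrict_of_ae (Measure.ae_ne volume (σ T))] with s a1 a2 a3 a4
    have hg : τ s ∉ gaps σ := a2.1.2
    have hpos : 0 < deriv τ s := not_le.1 a2.2
    have hmem := h.mem_Icc a2.1.1
    have hne : τ s ≠ T := fun he => a4 (by rw [← he, h.inv' hg])
    rw [h.metricDeriv_mul hg ⟨ha.trans hmem.1, lt_of_le_of_ne (hmem.2.trans hb) hne⟩ a3 hpos a1,
      mul_assoc, ENNReal.div_mul_cancel (by simpa using hpos) ENNReal.ofReal_ne_top]
  · calc ∫⁻ s in A ∩ {s | deriv τ s ≤ 0}, G (τ s) * metricDeriv θ s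
        ≤ ∫⁻ s in A ∩ {s | deriv τ s ≤ 0}, L * metricDeriv θ s := by
          refine setLIntegral_mono' (hAm.inter hP) fun s hs => ?_
          gcongr
          exact hGL _ (h.mem_Icc hs.1.1) hs.1.2
      _ = L * ∫⁻ s in A ∩ {s | deriv τ s ≤ 0}, metricDeriv θ s :=
          lintegral_const_mul' _ _ ENNReal.coe_ne_top
      _ ≤ _ := by gcongr; exact h.lintegral_speed_le_cantor

end IsLipParam

end

noncomputable section

/-! ### Time plus arc length as a parameter -/

section

variable {X : Type*} [EMetricSpace X] {T : ℝ} {u : ℝ → X}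

/-- The parametrization of an absolutely continuous curve by time plus arc length. -/
theorem IsAC.exists_lipParam (hT : 0 < T) (h : IsAC u 0 T) :
    ∃ (τ σ : ℝ → ℝ) (θ : ℝ → X) (v : ℝ → ℝ≥0∞), IsLipParam T u τ σ θ ∧
      (∀ s, θ s = extendCurve T u (τ s)) ∧ (∀ s, σ (τ s) = s) ∧ Measurable v ∧
      v =ᵐ[volume.restrict (Icc 0 T)] metricDeriv u ∧
      (∀ t, σ t = t + (∫⁻ r in Iic t, v r).toReal) ∧
      ∫⁻ r, v r = ∫⁻ r in Icc 0 T, metricDeriv u r ∧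
      volume.map τ = volume + volume.withDensity v := by
  obtain ⟨ω, hω, hωfin, hd, hlim⟩ := h.exists_speed
  let v : ℝ → ℝ≥0∞ := (Icc 0 T).indicator ω
  have hv : Measurable v := hω.indicator measurableSet_Icc
  have hvint : ∫⁻ r, v r = ∫⁻ r in Icc 0 T, ω r := lintegral_indicator measurableSet_Icc _
  have hvfin : ∫⁻ r, v r ≠ ⊤ := by
    rw [hvint]; exact ne_top_of_le_ne_top hωfin (setLIntegral_le_lintegral _ _)
  have hfin : ∀ A : Set ℝ, ∫⁻ r in A, v r ≠ ⊤ := fun A =>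
    ne_top_of_le_ne_top hvfin (setLIntegral_le_lintegral _ _)
  have hveq : v =ᵐ[volume.restrict (Icc 0 T)] metricDeriv u := by
    filter_upwards [hlim, ae_restrict_mem measurableSet_Icc] with t ht htm
    simp only [v, indicator_of_mem htm]
    exact ht.limsup_eq.symm
  -- `D t` is the length up to time `t`, constant outside `[0, T]` where `v` vanishes. It is
  -- continuous, so here `σ` is a bijection without gaps; gaps arise only in the limit.
  let D : ℝ → ℝ := fun t => (∫⁻ r in Iic t, v r).toReal
  have hDmono : Monotone D := fun s t hst =>
    ENNReal.toReal_mono (hfin _) (lintegral_mono_set (Iic_subset_Iic.2 hst))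
  have hDsub : ∀ s t, s ≤ t → ENNReal.ofReal (D t - D s) = ∫⁻ r in Ioc s t, v r := by
    intro s t hst
    have : ∫⁻ r in Iic t, v r = (∫⁻ r in Iic s, v r) + ∫⁻ r in Ioc s t, v r := by
      rw [← lintegral_union measurableSet_Ioc (Iic_disjoint_Ioc le_rfl), Iic_union_Ioc_eq_Iic hst]
    simp only [D]
    rw [this, ENNReal.toReal_add (hfin _) (hfin _), add_sub_cancel_left,
      ENNReal.ofReal_toReal (hfin _)]
  have hDcont : Continuous D := by
    have : D = fun t => (∫ r in Iic t, (v r).toReal) := by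
      funext t
      rw [integral_toReal hv.aemeasurable (ae_restrict_of_ae (ae_lt_top hv hvfin))]
    have hint : Integrable (fun r => (v r).toReal) volume :=
      integrable_toReal_of_lintegral_ne_top hv.aemeasurable hvfin
    have e : (fun t => ∫ r in Iic t, (v r).toReal)
        = fun t => (∫ r in Iic (0 : ℝ), (v r).toReal) + ∫ r in (0 : ℝ)..t, (v r).toReal := by
      funext t
      rw [← intervalIntegral.integral_Iic_sub_Iic hint.integrableOn hint.integrableOn]
      ring
    rw [this, e]
    exact continuous_const.add
      (intervalIntegral.continuous_primitive (fun _ _ => hint.intervalIntegrable) 0)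
  let σ : ℝ → ℝ := fun t => t + D t
  have hσ : StrictMono σ := fun s t hst => add_lt_add_of_lt_of_le hst (hDmono hst.le)
  have hσc : Continuous σ := continuous_id.add hDcont
  have hD0 : ∀ t, 0 ≤ D t := fun t => ENNReal.toReal_nonneg
  have hDC : ∀ t, D t ≤ (∫⁻ r, v r).toReal := fun t =>
    ENNReal.toReal_mono hvfin (setLIntegral_le_lintegral _ _)
  have hsurj : Function.Surjective σ := hσc.surjective
    (tendsto_atTop_mono (fun t => le_add_of_nonneg_right (hD0 t)) tendsto_id)
    (tendsto_atBot_mono (fun t => add_le_add le_rfl (hDC t))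
      (tendsto_atBot_add_const_right _ _ tendsto_id))
  let τ : ℝ → ℝ := Function.surjInv hsurj
  have hστ : ∀ s, σ (τ s) = s := Function.surjInv_eq hsurj
  have hτσ : ∀ t, τ (σ t) = t := fun t => hσ.injective (hστ _)
  have hτmono : Monotone τ := fun s t hst => by
    rw [← hσ.le_iff_le, hστ, hστ]; exact hst
  have hlip : ∀ s t, s ≤ t → τ t - τ s ≤ t - s := by
    intro s t hst
    have h1 := hDmono (hτmono hst)
    have h2 : τ s + D (τ s) = s := hστ s
    have h3 : τ t + D (τ t) = t := hστ t
    linarith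
  have hext : ∀ s t, s ≤ t → edist (extendCurve T u s) (extendCurve T u t)
      ≤ ENNReal.ofReal (D t - D s) := by
    intro s t hst
    rw [hDsub s t hst, extendCurve, extendCurve]
    have hm := clamp_mono T hst
    refine (hd _ _ (clamp_mem hT.le s).1 hm (clamp_mem hT.le t).2).trans ?_
    rw [restrict_Ioc_eq_restrict_Icc.symm, ← lintegral_indicator measurableSet_Ioc,
      ← lintegral_indicator measurableSet_Ioc]
    refine lintegral_mono fun r => ?_
    by_cases hr : r ∈ Ioc (max 0 (min s T)) (max 0 (min t T))
    · have hr0 : 0 < r := (le_max_left _ _).trans_lt hr.1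
      have hrT : r ≤ T := hr.2.trans (clamp_mem hT.le t).2
      have hrt : r ≤ t := by
        rcases le_max_iff.1 hr.2 with h' | h'
        · linarith
        · exact h'.trans (min_le_left _ _)
      have hsr : s < r := by
        rcases le_total s T with h' | h'
        · have := (le_max_right 0 (min s T)).trans_lt hr.1
          rwa [min_eq_left h'] at this
        · have := (le_max_right 0 (min s T)).trans_lt hr.1
          rw [min_eq_right h'] at this
          linarith
      have hr' : r ∈ Ioc s t := ⟨hsr, hrt⟩
      have hr'' : r ∈ Icc 0 T := ⟨hr0.le, hrT⟩
      simp only [Set.indicator_of_mem hr, Set.indicator_of_mem hr', v, Set.indicator_of_mem hr'']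
      exact le_rfl
    · simp only [Set.indicator_of_notMem hr]; exact zero_le
  have hDneg : ∀ t, t ≤ 0 → D t = 0 := by
    intro t ht
    simp only [D]
    have : ∫⁻ r in Iic t, v r = 0 := by
      rw [← setLIntegral_congr Iio_ae_eq_Iic]
      rw [setLIntegral_congr_fun (g := fun _ => 0) measurableSet_Iio]
      · simp
      · intro r hr
        have : r ∉ Icc 0 T := fun hr' => by
          have h1 : r < t := hr
          linarith [hr'.1]
        simp only [v, Set.indicator_of_notMem this]
    rw [this]; rfl
  have hDright : ∀ t, T ≤ t → D t = D T := by
    intro t ht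
    have h1 := hDsub T t ht
    have : ∫⁻ r in Ioc T t, v r = 0 := by
      rw [setLIntegral_congr_fun (g := fun _ => 0) measurableSet_Ioc]
      · simp
      · intro r hr
        have : r ∉ Icc 0 T := fun hr' => by linarith [hr'.2, hr.1]
        simp only [v, Set.indicator_of_notMem this]
    rw [this, ENNReal.ofReal_eq_zero] at h1
    have := hDmono ht
    linarith
  have hparam : IsLipParam T u τ σ (fun s => extendCurve T u (τ s)) :=
    { T_pos := hT
      sub_le := fun s t hst => by
        have := hDmono hst
        simp only [σ]; linarith
      left := fun t ht => by simp only [σ]; rw [hDneg t ht, add_zero]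
      right := fun t ht => by simp only [σ]; rw [hDright t ht]; ring
      mono := hτmono
      lip := hlip
      inv := hτσ
      edist_le := fun s t hst => by
        refine (hext _ _ (hτmono hst)).trans (ENNReal.ofReal_le_ofReal ?_)
        have h2 : τ s + D (τ s) = s := hστ s
        have h3 : τ t + D (τ t) = t := hστ t
        have := hτmono hst
        linarith
      comp := fun t => by rw [hτσ] }
  refine ⟨τ, σ, fun s => extendCurve T u (τ s), v, hparam, fun _ => rfl, hστ, hv, hveq, fun _ => rfl, ?_, ?_⟩
  · rw [hvint]
    refine lintegral_congr_ae ?_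
    filter_upwards [hlim] with t ht
    exact ht.limsup_eq.symm
  -- The inverse of `σ` carries Lebesgue measure to `dσ`, whose density is `1 + v`.
  · have hfinm : IsFiniteMeasure (volume.withDensity v) := isFiniteMeasure_withDensity hvfin
    have hIoc : ∀ a b, a < b → volume.map τ (Ioc a b)
        = ((volume : Measure ℝ) + volume.withDensity v) (Ioc a b) := by
      intro a b hab
      have hc : ∀ t, Function.rightLim σ t = σ t := fun t =>
        hσc.continuousAt.continuousWithinAt.rightLim_eq
      rw [Measure.map_apply hparam.continuous.measurable measurableSet_Ioc, hparam.preimage_Ioc,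
        hc, hc, Real.volume_Ioc, Measure.add_apply, Real.volume_Ioc,
        withDensity_apply _ measurableSet_Ioc, ← hDsub a b hab.le,
        ← ENNReal.ofReal_add (by linarith) (sub_nonneg.2 (hDmono hab.le))]
      congr 1
      simp only [σ]; ring
    have hlf : IsLocallyFiniteMeasure (volume.map τ) := by
      refine ⟨fun x => ⟨Ioc (x - 1) (x + 1), Ioc_mem_nhds (by linarith) (by linarith), ?_⟩⟩
      rw [hIoc _ _ (by linarith), Measure.add_apply]
      exact ENNReal.add_lt_top.2 ⟨by simp, measure_lt_top _ _⟩
    exact Measure.ext_of_Ioc _ _ fun a b hab => hIoc a b hab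

end

end

noncomputable section

/-! ### Approximating sequences -/

variable {X : Type*} [TopologicalSpace X] {T : ℝ}

/-- A sequence of absolutely continuous curves `u n` with energy-dissipation inequalities that
converges pointwise to `u'`, together with the limit properties of the systems along the graphs of
these curves. The function `ω` is a modulus of equi-integrability of the powers. -/
structure Approx (S : ℕ → EvolutionSystem X T) (S' : EvolutionSystem X T) (ψn : ℕ → ℝ≥0 → ℝ≥0)
    (ψ : ℝ≥0 → ℝ≥0) (L : ℝ≥0) (u : ℕ → ℝ → X) (G : ℕ → ℝ → ℝ≥0∞) (u' : ℝ → X) (E₀ : ℝ) (C : ℝ≥0)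
    (ω : ℕ → ℝ≥0) : Prop where
  T_pos : 0 < T
  diss : IsMetricDissipation ψ (L : ℝ≥0∞)
  convex : ∀ n, ConvexOn ℝ≥0 univ (ψn n)
  zero : ∀ n, ψn n 0 = 0
  diss_lim : ∀ v, Tendsto (fun n => ψn n v) atTop (𝓝 (ψ v))
  ac : ∀ n, (S n).AC (u n) 0 T
  meas : ∀ n, Measurable (G n)
  slope_le : ∀ n, ∀ t ∈ Icc 0 T, (S n).slope t (u n t) ≤ G n t
  lim : ∀ t ∈ Icc 0 T, Tendsto (fun n => u n t) atTop (𝓝 (u' t))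
  compact : ∀ (φ : ℕ → ℕ) (t : ℕ → ℝ), StrictMono φ → (∀ n, t n ∈ Icc 0 T) →
    ∃ χ : ℕ → ℕ, StrictMono χ ∧ ∃ x, Tendsto (fun n => u (φ (χ n)) (t (χ n))) atTop (𝓝 x)
  dist_le : ∀ (φ : ℕ → ℕ) (s t : ℕ → ℝ) (s' t' : ℝ) (x y : X), StrictMono φ →
    (∀ n, s n ∈ Icc 0 T) → (∀ n, t n ∈ Icc 0 T) →
    Tendsto s atTop (𝓝 s') → Tendsto (fun n => u (φ n) (s n)) atTop (𝓝 x) →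
    Tendsto t atTop (𝓝 t') → Tendsto (fun n => u (φ n) (t n)) atTop (𝓝 y) →
    S'.dist x y ≤ liminf (fun n => (S (φ n)).dist (u (φ n) (s n)) (u (φ n) (t n))) atTop
  slope_lsc : ∀ (φ : ℕ → ℕ) (t : ℕ → ℝ) (t' : ℝ) (x : X), StrictMono φ → (∀ n, t n ∈ Icc 0 T) →
    Tendsto t atTop (𝓝 t') → Tendsto (fun n => u (φ n) (t n)) atTop (𝓝 x) →
    S'.slope t' x ≤ liminf (fun n => (S (φ n)).slope (t n) (u (φ n) (t n))) atTop
  energy_lsc : ∀ (φ : ℕ → ℕ), StrictMono φ → ∀ t ∈ Icc 0 T,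
    S'.energy t (u' t) ≤ liminf (fun n => (S (φ n)).energy t (u (φ n) t)) atTop
  power_usc : ∀ (φ : ℕ → ℕ) (f : ℕ → ℝ≥0) (f' : ℝ≥0), StrictMono φ → ∀ t ∈ Icc 0 T,
    (∀ n, (S (φ n)).slope t (u (φ n) t) ≤ f n) → Tendsto f atTop (𝓝 f') →
    S'.slope t (u' t) ≤ f' ∧
      limsup (fun n => (S (φ n)).power t (u (φ n) t) (f n)) atTop ≤ S'.power t (u' t) f'
  speed_le : ∀ n, ∫⁻ r in Icc 0 T, (S n).speed (u n) r ≤ C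
  power_meas : ∀ n, AEMeasurable (fun r => (S n).power r (u n r) (G n r))
    (volume.restrict (Icc 0 T))
  energy_ge : ∀ n, ∀ t ∈ Icc 0 T, ((-C : ℝ) : EReal) ≤ (S n).energy t (u n t)
  energy_le : ∀ n, ∀ t ∈ Icc 0 T, (S n).energy t (u n t) ≤ ((C : ℝ) : EReal)
  initial : Tendsto (fun n => (S n).energy 0 (u n 0)) atTop (𝓝 (E₀ : EReal))
  modulus : Tendsto ω atTop (𝓝 0)
  -- The power enters as `(k - P)⁺`, to which Fatou's lemma applies; `k t` compensates for the
  -- constant and `ω k` for the part of the power above `k`.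
  ineq : ∀ n (k : ℕ), ∀ t ∈ Icc 0 T, (S n).energy t (u n t)
      + ((∫⁻ r in Icc 0 t, ((ψn n ((S n).speed (u n) r).toNNReal : ℝ≥0∞) + (dual (ψn n) (G n r)
        + (((k : ℝ) : EReal) - (S n).power r (u n r) (G n r)).toENNReal)) : ℝ≥0∞) : EReal)
      ≤ (S n).energy 0 (u n 0) + ((k * t + ω k : ℝ) : EReal)

variable {S : ℕ → EvolutionSystem X T} {S' : EvolutionSystem X T} {ψn : ℕ → ℝ≥0 → ℝ≥0}
  {ψ : ℝ≥0 → ℝ≥0} {L : ℝ≥0} {u : ℕ → ℝ → X} {G : ℕ → ℝ → ℝ≥0∞} {u' : ℝ → X} {E₀ : ℝ} {C : ℝ≥0}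
  {ω : ℕ → ℝ≥0}

theorem Approx.subseq (h : Approx S S' ψn ψ L u G u' E₀ C ω) {φ : ℕ → ℕ} (hφ : StrictMono φ) :
    Approx (fun n => S (φ n)) S' (fun n => ψn (φ n)) ψ L (fun n => u (φ n)) (fun n => G (φ n)) u'
      E₀ C ω where
  T_pos := h.T_pos
  diss := h.diss
  convex _ := h.convex _
  zero _ := h.zero _
  diss_lim v := (h.diss_lim v).comp hφ.tendsto_atTop
  ac _ := h.ac _
  meas _ := h.meas _
  slope_le _ := h.slope_le _
  lim t ht := (h.lim t ht).comp hφ.tendsto_atTop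
  compact χ t hχ := h.compact (φ ∘ χ) t (hφ.comp hχ)
  dist_le χ s t s' t' x y hχ := h.dist_le (φ ∘ χ) s t s' t' x y (hφ.comp hχ)
  slope_lsc χ t t' x hχ := h.slope_lsc (φ ∘ χ) t t' x (hφ.comp hχ)
  energy_lsc χ hχ := h.energy_lsc (φ ∘ χ) (hφ.comp hχ)
  power_usc χ f f' hχ := h.power_usc (φ ∘ χ) f f' (hφ.comp hχ)
  speed_le _ := h.speed_le _
  power_meas _ := h.power_meas _
  energy_ge _ := h.energy_ge _
  energy_le _ := h.energy_le _
  initial := h.initial.comp hφ.tendsto_atTop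
  modulus := h.modulus
  ineq _ := h.ineq _

/-- An approximating sequence whose parametrizations by time plus arc length converge. -/
structure ParamApprox (S : ℕ → EvolutionSystem X T) (S' : EvolutionSystem X T)
    (ψn : ℕ → ℝ≥0 → ℝ≥0) (ψ : ℝ≥0 → ℝ≥0) (L : ℝ≥0) (u : ℕ → ℝ → X) (G : ℕ → ℝ → ℝ≥0∞) (u' : ℝ → X)
    (E₀ : ℝ) (C : ℝ≥0) (ω : ℕ → ℝ≥0) (τn σn : ℕ → ℝ → ℝ) (θn : ℕ → ℝ → X) (vn : ℕ → ℝ → ℝ≥0∞)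
    (τ σ : ℝ → ℝ) (θ : ℝ → X) : Prop extends Approx S S' ψn ψ L u G u' E₀ C ω where
  lipn : ∀ n, @IsLipParam X (S n).metric T (u n) (τn n) (σn n) (θn n)
  curve_eq : ∀ n s, θn n s = extendCurve T (u n) (τn n s)
  speed_meas : ∀ n, Measurable (vn n)
  speed_eq : ∀ n, vn n =ᵐ[volume.restrict (Icc 0 T)] (S n).speed (u n)
  map_eq : ∀ n, (volume : Measure ℝ).map (τn n) = volume + volume.withDensity (vn n)
  lim_time : ∀ s, Tendsto (fun n => τn n s) atTop (𝓝 (τ s))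
  lim_inv : ∀ t, Tendsto (fun n => σn n t) atTop (𝓝 (σ t))
  lim_curve : ∀ (φ : ℕ → ℕ) (s : ℕ → ℝ) (s' : ℝ), StrictMono φ → Tendsto s atTop (𝓝 s') →
    Tendsto (fun n => θn (φ n) (s n)) atTop (𝓝 (θ s'))
  lip : @IsLipParam X S'.metric T u' τ σ θ

theorem tendsto_apply_of_lipschitz {f : ℕ → ℝ → ℝ} {g : ℝ → ℝ}
    (hf : ∀ n, LipschitzWith 1 (f n)) (hlim : ∀ x, Tendsto (fun n => f n x) atTop (𝓝 (g x)))
    {x : ℕ → ℝ} {y : ℝ} (hx : Tendsto x atTop (𝓝 y)) :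
    Tendsto (fun n => f n (x n)) atTop (𝓝 (g y)) := by
  refine tendsto_iff_dist_tendsto_zero.2 ?_
  have h1 := tendsto_iff_dist_tendsto_zero.1 (hlim y)
  have h2 := tendsto_iff_dist_tendsto_zero.1 hx
  refine squeeze_zero (fun _ => dist_nonneg) (fun n => ?_) (by simpa using h2.add h1)
  refine (dist_triangle _ (f n y) _).trans ?_
  gcongr
  simpa using (hf n).dist_le_mul (x n) y

/-- An Arzelà-Ascoli argument without a common metric: compactness comes from the coercivity of the
energies, and equicontinuity from the lower limit inequality, by which limits of 1-Lipschitz curves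
are at distance at most the limit of the parameter differences. -/
theorem Approx.exists_limit_curve (h : Approx S S' ψn ψ L u G u' E₀ C ω) {τn σn : ℕ → ℝ → ℝ}
    {θn : ℕ → ℝ → X} {τ σ : ℝ → ℝ}
    (lipn : ∀ n, @IsLipParam X (S n).metric T (u n) (τn n) (σn n) (θn n))
    (curve_eq : ∀ n s, θn n s = extendCurve T (u n) (τn n s))
    (lim_time : ∀ s, Tendsto (fun n => τn n s) atTop (𝓝 (τ s)))
    (lim_inv : ∀ t, Tendsto (fun n => σn n t) atTop (𝓝 (σ t)))
    (hrat : ∀ q : ℚ, ∃ x, Tendsto (fun n => θn n q) atTop (𝓝 x)) :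
    ∃ θ : ℝ → X, @IsLipParam X S'.metric T u' τ σ θ ∧
      ∀ (φ : ℕ → ℕ) (s : ℕ → ℝ) (s' : ℝ), StrictMono φ → Tendsto s atTop (𝓝 s') →
        Tendsto (fun n => θn (φ n) (s n)) atTop (𝓝 (θ s')) := by
  let := S'.metric
  have hT := h.T_pos.le
  have hτ : ∀ n, LipschitzWith 1 (τn n) := fun n =>
    @IsLipParam.lipschitz X (S n).metric T (u n) (τn n) (σn n) (θn n) (lipn n)
  have htime : ∀ (φ : ℕ → ℕ) (s : ℕ → ℝ) (s' : ℝ), StrictMono φ → Tendsto s atTop (𝓝 s') →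
      Tendsto (fun n => max 0 (min (τn (φ n) (s n)) T)) atTop (𝓝 (max 0 (min (τ s') T))) := by
    intro φ s s' hφ hs
    have h1 := tendsto_apply_of_lipschitz (fun n => hτ (φ n))
      (fun x => (lim_time x).comp hφ.tendsto_atTop) hs
    exact tendsto_const_nhds.max (h1.min tendsto_const_nhds)
  have hcpt : ∀ (φ : ℕ → ℕ) (s : ℕ → ℝ), StrictMono φ →
      ∃ χ : ℕ → ℕ, StrictMono χ ∧ ∃ x, Tendsto (fun n => θn (φ (χ n)) (s (χ n))) atTop (𝓝 x) := by
    intro φ s hφ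
    obtain ⟨χ, hχ, x, hx⟩ := h.compact φ (fun n => max 0 (min (τn (φ n) (s n)) T)) hφ
      fun n => clamp_mem hT _
    exact ⟨χ, hχ, x, by simpa only [curve_eq, extendCurve] using hx⟩
  have hdist : ∀ (φ : ℕ → ℕ) (s t : ℕ → ℝ) (s' t' : ℝ) (x y : X), StrictMono φ →
      Tendsto s atTop (𝓝 s') → Tendsto (fun n => θn (φ n) (s n)) atTop (𝓝 x) →
      Tendsto t atTop (𝓝 t') → Tendsto (fun n => θn (φ n) (t n)) atTop (𝓝 y) →
      edist x y ≤ ENNReal.ofReal |s' - t'| := by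
    intro φ s t s' t' x y hφ hs hx ht hy
    simp only [curve_eq, extendCurve] at hx hy
    have h1 := h.dist_le φ _ _ _ _ x y hφ (fun n => clamp_mem hT (τn (φ n) (s n)))
      (fun n => clamp_mem hT (τn (φ n) (t n))) (htime φ s s' hφ hs) hx (htime φ t t' hφ ht) hy
    have h2 : Tendsto (fun n => ENNReal.ofReal |s n - t n|) atTop
        (𝓝 (ENNReal.ofReal |s' - t'|)) :=
      (ENNReal.continuous_ofReal.tendsto _).comp (hs.sub ht).abs
    rw [← h2.liminf_eq]
    refine h1.trans (liminf_le_liminf (Eventually.of_forall fun n => ?_))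
    have h3 := @IsLipParam.lipschitz_curve X (S (φ n)).metric T (u (φ n)) (τn (φ n)) (σn (φ n))
      (θn (φ n)) (lipn (φ n)) (s n) (t n)
    rw [ENNReal.coe_one, one_mul, edist_dist, Real.dist_eq, curve_eq, curve_eq] at h3
    exact h3
  choose xq hxq using hrat
  choose χ hχ θ hθ using fun s : ℝ => hcpt id (fun _ => s) strictMono_id
  have hq : ∀ (φ : ℕ → ℕ) (s : ℕ → ℝ) (s' : ℝ) (x : X) (q : ℚ), StrictMono φ →
      Tendsto s atTop (𝓝 s') → Tendsto (fun n => θn (φ n) (s n)) atTop (𝓝 x) →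
      edist x (xq q) ≤ ENNReal.ofReal |s' - q| := fun φ s s' x q hφ hs hx =>
    hdist φ s (fun _ => q) s' q x (xq q) hφ hs hx tendsto_const_nhds
      ((hxq q).comp hφ.tendsto_atTop)
  -- Limits along different subsequences cannot be compared with each other directly. Each is
  -- compared with the limit at a nearby rational `q`, where the whole sequence converges; the
  -- distance of `S'` then separates points.
  have huniq : ∀ (φ : ℕ → ℕ) (s : ℕ → ℝ) (s' : ℝ) (x : X), StrictMono φ →
      Tendsto s atTop (𝓝 s') → Tendsto (fun n => θn (φ n) (s n)) atTop (𝓝 x) → x = θ s' := by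
    intro φ s s' x hφ hs hx
    refine edist_le_zero.1 (ENNReal.le_of_forall_pos_le_add fun ε hε _ => ?_)
    have hε' : (0 : ℝ) < ε := hε
    obtain ⟨q, hq1, hq2⟩ := exists_rat_btwn (show s' < s' + ε / 2 by linarith)
    have e : ENNReal.ofReal |s' - q| ≤ ENNReal.ofReal (ε / 2) := by
      refine ENNReal.ofReal_le_ofReal (abs_le.2 ⟨by linarith, by linarith⟩)
    have h1 := (hq φ s s' x q hφ hs hx).trans e
    have h2 := (hq (χ s') (fun _ => s') s' (θ s') q (hχ s') tendsto_const_nhds (hθ s')).trans e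
    calc edist x (θ s') ≤ edist x (xq q) + edist (θ s') (xq q) := edist_triangle_right _ _ _
      _ ≤ ENNReal.ofReal (ε / 2) + ENNReal.ofReal (ε / 2) := add_le_add h1 h2
      _ = 0 + ε := by
        rw [← ENNReal.ofReal_add (by positivity) (by positivity), add_halves, zero_add,
          ENNReal.ofReal_coe_nnreal]
  have hmove : ∀ (φ : ℕ → ℕ) (s : ℕ → ℝ) (s' : ℝ), StrictMono φ → Tendsto s atTop (𝓝 s') →
      Tendsto (fun n => θn (φ n) (s n)) atTop (𝓝 (θ s')) := by
    intro φ s s' hφ hs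
    refine tendsto_of_subseq_tendsto fun ns hns => ?_
    obtain ⟨m, hm, hm'⟩ := strictMono_subseq_of_tendsto_atTop hns
    obtain ⟨c, hc, x, hx⟩ := hcpt (φ ∘ (ns ∘ m)) (fun n => s (ns (m n))) (hφ.comp hm')
    refine ⟨m ∘ c, ?_⟩
    have hlim : Tendsto (fun n => s (ns (m (c n)))) atTop (𝓝 s') :=
      hs.comp (hm'.tendsto_atTop.comp hc.tendsto_atTop)
    have := huniq (φ ∘ (ns ∘ m) ∘ c) _ s' x (hφ.comp (hm'.comp hc)) hlim hx
    rw [← this]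
    exact hx
  refine ⟨θ, ?_, hmove⟩
  have hconst : ∀ s, Tendsto (fun n => θn n s) atTop (𝓝 (θ s)) := fun s =>
    hmove id (fun _ => s) s strictMono_id tendsto_const_nhds
  have l0 : ∀ n, ∀ s t, s ≤ t → t - s ≤ σn n t - σn n s := fun n =>
    @IsLipParam.sub_le X (S n).metric T (u n) (τn n) (σn n) (θn n) (lipn n)
  refine
    { T_pos := h.T_pos
      sub_le := fun s t hst => ge_of_tendsto' ((lim_inv t).sub (lim_inv s)) fun n => l0 n s t hst
      left := fun t ht => ?_
      right := fun t ht => ?_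
      mono := fun s t hst => le_of_tendsto_of_tendsto' (lim_time s) (lim_time t) fun n =>
        @IsLipParam.mono X (S n).metric T (u n) (τn n) (σn n) (θn n) (lipn n) s t hst
      lip := fun s t hst => ?_
      inv := fun t => ?_
      edist_le := fun s t hst => ?_
      comp := fun t => ?_ }
  · refine tendsto_nhds_unique (lim_inv t) (tendsto_const_nhds.congr fun n => ?_)
    exact (@IsLipParam.left X (S n).metric T (u n) (τn n) (σn n) (θn n) (lipn n) t ht).symm
  · refine tendsto_nhds_unique (lim_inv t) (((lim_inv T).add_const (t - T)).congr fun n => ?_)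
    exact (@IsLipParam.right X (S n).metric T (u n) (τn n) (σn n) (θn n) (lipn n) t ht).symm
  · exact le_of_tendsto' ((lim_time t).sub (lim_time s)) fun n =>
      @IsLipParam.lip X (S n).metric T (u n) (τn n) (σn n) (θn n) (lipn n) s t hst
  · refine tendsto_nhds_unique (tendsto_apply_of_lipschitz hτ lim_time (lim_inv t))
      (tendsto_const_nhds.congr fun n => ?_)
    exact (@IsLipParam.inv X (S n).metric T (u n) (τn n) (σn n) (θn n) (lipn n) t).symm
  · refine (hdist id (fun _ => s) (fun _ => t) s t _ _ strictMono_id tendsto_const_nhds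
      (hconst s) tendsto_const_nhds (hconst t)).trans_eq ?_
    rw [abs_sub_comm, abs_of_nonneg (by linarith)]
  · refine (huniq id (fun n => σn n t) (σ t) _ strictMono_id (lim_inv t) ?_).symm
    refine (h.lim _ (clamp_mem hT t)).congr fun n => ?_
    exact (@IsLipParam.comp X (S n).metric T (u n) (τn n) (σn n) (θn n) (lipn n) t).symm

/-- Both `σ_n(t) - t` and `s - τ_n(s)` are nondecreasing with values in `[0, C]`, where `C` bounds
the lengths, so Helly's theorem applies to each; a diagonal extraction settles the curves at
rational parameters. -/
theorem Approx.exists_paramApprox (h : Approx S S' ψn ψ L u G u' E₀ C ω) :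
    ∃ φ : ℕ → ℕ, StrictMono φ ∧ ∃ τn σn θn vn τ σ θ,
      ParamApprox (fun n => S (φ n)) S' (fun n => ψn (φ n)) ψ L (fun n => u (φ n))
        (fun n => G (φ n)) u' E₀ C ω τn σn θn vn τ σ θ := by
  choose τn σn θn vn lipn curve_eq hinv vmeas veq σeq vint map_eq using fun n =>
    @IsAC.exists_lipParam X (S n).metric T (u n) h.T_pos (h.ac n)
  have hC : ∀ n, ∫⁻ r, vn n r ≤ C := fun n => (vint n).trans_le (h.speed_le n)
  have hfin : ∀ n (A : Set ℝ), ∫⁻ r in A, vn n r ≠ ⊤ := fun n A =>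
    ne_top_of_le_ne_top ENNReal.coe_ne_top ((setLIntegral_le_lintegral _ _).trans (hC n))
  have hD0 : ∀ n t, 0 ≤ σn n t - t := fun n t => by
    rw [σeq, add_sub_cancel_left]; exact ENNReal.toReal_nonneg
  have hDC : ∀ n t, σn n t - t ≤ C := fun n t => by
    rw [σeq, add_sub_cancel_left]
    refine ENNReal.toReal_le_coe_of_le_coe ((setLIntegral_le_lintegral _ _).trans (hC n))
  have l0 : ∀ n, ∀ s t, s ≤ t → t - s ≤ σn n t - σn n s := fun n =>
    @IsLipParam.sub_le X (S n).metric T (u n) (τn n) (σn n) (θn n) (lipn n)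
  have l1 : ∀ n, ∀ s t, s ≤ t → τn n t - τn n s ≤ t - s := fun n =>
    @IsLipParam.lip X (S n).metric T (u n) (τn n) (σn n) (θn n) (lipn n)
  obtain ⟨φ₁, hφ₁, D, -, hD⟩ := helly_selection (fun n t => σn n t - t)
    (fun n s t hst => by have := l0 n s t hst; linarith) (fun _ => C)
    (fun n t => by rw [abs_of_nonneg (hD0 n t)]; exact hDC n t)
  obtain ⟨φ₂, hφ₂, ℓ, -, hℓ⟩ := helly_selection (fun n s => s - τn (φ₁ n) s)
    (fun n s t hst => by have := l1 (φ₁ n) s t hst; linarith) (fun _ => C)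
    (fun n s => by
      have h1 := hD0 (φ₁ n) (τn (φ₁ n) s)
      have h2 := hDC (φ₁ n) (τn (φ₁ n) s)
      rw [hinv] at h1 h2
      rw [abs_of_nonneg h1]; exact h2)
  obtain ⟨e, he⟩ := exists_surjective_nat ℚ
  obtain ⟨φ₃, hφ₃, hx⟩ := exists_strictMono_forall_tendsto
    (fun i n => θn (φ₁ (φ₂ n)) (e i)) (by
      intro i χ hχ
      obtain ⟨c, hc, x, hx⟩ := h.compact (fun n => φ₁ (φ₂ (χ n)))
        (fun n => max 0 (min (τn (φ₁ (φ₂ (χ n))) (e i)) T)) (hφ₁.comp (hφ₂.comp hχ))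
        (fun n => clamp_mem h.T_pos.le _)
      exact ⟨c, hc, x, by simpa only [curve_eq, extendCurve] using hx⟩)
  let φ : ℕ → ℕ := fun n => φ₁ (φ₂ (φ₃ n))
  have hφ : StrictMono φ := hφ₁.comp (hφ₂.comp hφ₃)
  have lim_time : ∀ s, Tendsto (fun n => τn (φ n) s) atTop (𝓝 (s - ℓ s)) := by
    intro s
    have := ((hℓ s).comp hφ₃.tendsto_atTop).const_sub s
    simpa [Function.comp_def] using this
  have lim_inv : ∀ t, Tendsto (fun n => σn (φ n) t) atTop (𝓝 (t + D t)) := by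
    intro t
    have := ((hD t).comp (hφ₂.comp hφ₃).tendsto_atTop).const_add t
    simpa [Function.comp_def] using this
  obtain ⟨θ, hθ, hmove⟩ := (h.subseq hφ).exists_limit_curve (τn := fun n => τn (φ n))
    (σn := fun n => σn (φ n)) (θn := fun n => θn (φ n)) (fun n => lipn _) (fun n => curve_eq _)
    lim_time lim_inv (fun q => by
      obtain ⟨i, rfl⟩ := he q
      exact hx i)
  exact ⟨φ, hφ, fun n => τn (φ n), fun n => σn (φ n), fun n => θn (φ n), fun n => vn (φ n), _, _, θ,
    { toApprox := h.subseq hφ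
      lipn := fun n => lipn _
      curve_eq := fun n => curve_eq _
      speed_meas := fun n => vmeas _
      speed_eq := fun n => veq _
      map_eq := fun n => map_eq _
      lim_time := lim_time
      lim_inv := lim_inv
      lim_curve := hmove
      lip := hθ }⟩

end

noncomputable section

/-! ### Limits of sequences of densities -/

theorem liminf_add_liminf_le (a b : ℕ → ℝ≥0∞) :
    liminf a atTop + liminf b atTop ≤ liminf (fun n => a n + b n) atTop := by
  simp only [liminf_eq_iSup_iInf_of_nat]
  rw [ENNReal.iSup_add_iSup_of_monotone]
  · refine iSup_mono fun n => le_iInf₂ fun i hi => ?_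
    exact add_le_add (iInf₂_le i hi) (iInf₂_le i hi)
  · exact fun m n hmn => le_iInf₂ fun i hi => iInf₂_le i (hmn.trans hi)
  · exact fun m n hmn => le_iInf₂ fun i hi => iInf₂_le i (hmn.trans hi)

theorem exists_strictMono_tendsto_liminf (a : ℕ → ℝ≥0∞) :
    ∃ φ : ℕ → ℕ, StrictMono φ ∧ Tendsto (fun n => a (φ n)) atTop (𝓝 (liminf a atTop)) := by
  obtain ⟨g, hg, hg'⟩ := exists_seq_tendsto_liminf (f := atTop) (u := a)
  obtain ⟨φ, hφ, hφ'⟩ := strictMono_subseq_of_tendsto_atTop hg'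
  exact ⟨g ∘ φ, hφ', hg.comp hφ.tendsto_atTop⟩

/-- Helly's theorem for the primitives of nonnegative functions with bounded integrals. -/
theorem helly_lintegral (ν : Measure ℝ) (g : ℕ → ℝ → ℝ≥0∞) (B : ℝ≥0)
    (hB : ∀ n, ∫⁻ r, g n r ∂ν ≤ B) :
    ∃ φ : ℕ → ℕ, StrictMono φ ∧ ∃ N : ℝ → ℝ, Monotone N ∧ (∀ x y, N y - N x ≤ B) ∧
      ∀ p q, p ≤ q → Tendsto (fun n => ∫⁻ r in Ioc p q, g (φ n) r ∂ν) atTop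
        (𝓝 (ENNReal.ofReal (N q - N p))) := by
  have hfin : ∀ n (A : Set ℝ), ∫⁻ r in A, g n r ∂ν ≤ B := fun n A =>
    (setLIntegral_le_lintegral _ _).trans (hB n)
  have hfin' : ∀ n (A : Set ℝ), ∫⁻ r in A, g n r ∂ν ≠ ⊤ := fun n A =>
    ne_top_of_le_ne_top ENNReal.coe_ne_top (hfin n A)
  have hC : ∀ n (A : Set ℝ), (∫⁻ r in A, g n r ∂ν).toReal ≤ B := fun n A =>
    ENNReal.toReal_le_coe_of_le_coe (hfin n A)
  obtain ⟨φ, hφ, N, hN, hlim⟩ := helly_selection (fun n t => (∫⁻ r in Iic t, g n r ∂ν).toReal)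
    (fun n s t hst => ENNReal.toReal_mono (hfin' n _) (lintegral_mono_set (Iic_subset_Iic.2 hst)))
    (fun _ => B) (fun n t => by
      rw [abs_of_nonneg ENNReal.toReal_nonneg]
      exact hC n _)
  refine ⟨φ, hφ, N, hN, fun x y => ?_, fun p q hpq => ?_⟩
  · refine le_of_tendsto' ((hlim y).sub (hlim x)) fun n => ?_
    have := hC (φ n) (Iic y)
    have h0 : 0 ≤ (∫⁻ r in Iic x, g (φ n) r ∂ν).toReal := ENNReal.toReal_nonneg
    linarith
  · refine ((ENNReal.continuous_ofReal.tendsto _).comp ((hlim q).sub (hlim p))).congr fun n => ?_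
    have h1 : ∫⁻ r in Iic q, g (φ n) r ∂ν
        = (∫⁻ r in Iic p, g (φ n) r ∂ν) + ∫⁻ r in Ioc p q, g (φ n) r ∂ν := by
      rw [← Iic_union_Ioc_eq_Iic hpq, lintegral_union measurableSet_Ioc]
      exact disjoint_left.2 fun x hx hx' => not_lt.2 hx hx'.1
    simp only [Function.comp]
    rw [h1, ENNReal.toReal_add (hfin' _ _) (hfin' _ _), add_sub_cancel_left,
      ENNReal.ofReal_toReal (hfin' _ _)]

/-- A comparison of a measure with the Stieltjes measure of a monotone function. -/
theorem le_stieltjes_add_volume {N : ℝ → ℝ} (hN : Monotone N) (ν : Measure ℝ) (c : ℝ≥0)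
    (h : ∀ p q, p < q → ν (Ioo p q) ≤ ENNReal.ofReal (N q - N p) + c * ENNReal.ofReal (q - p)) :
    ν ≤ hN.stieltjesFunction.measure + c • volume := by
  have hvol : (volume : Measure ℝ) = StieltjesFunction.id.measure := Real.volume_eq_stieltjes_id
  rw [hvol, ← StieltjesFunction.measure_smul, ← StieltjesFunction.measure_add]
  refine le_stieltjes_measure _ _ fun a b hab => ?_
  have e : (hN.stieltjesFunction + c • StieltjesFunction.id : StieltjesFunction ℝ) b
      - (hN.stieltjesFunction + c • StieltjesFunction.id : StieltjesFunction ℝ) a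
      = (Function.rightLim N b + c * b) - (Function.rightLim N a + c * a) := rfl
  rw [e]
  -- `N` need not be right-continuous. Open intervals `(a', q)` with `a' > a` and `q` decreasing to
  -- `b` produce exactly the right limits of `N`.
  have h1 : ∀ a', a < a' → a' < b → ν (Ioc a' b)
      ≤ ENNReal.ofReal ((Function.rightLim N b + c * b) - (Function.rightLim N a + c * a)) := by
    intro a' ha hb
    have h2 : Tendsto (fun q => ENNReal.ofReal ((N q + c * q) - (Function.rightLim N a + c * a)))
        (𝓝[>] b) (𝓝 (ENNReal.ofReal ((Function.rightLim N b + c * b)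
          - (Function.rightLim N a + c * a)))) := by
      refine (ENNReal.continuous_ofReal.tendsto _).comp (Tendsto.sub_const ?_ _)
      exact (hN.tendsto_rightLim b).add
        ((continuous_const.mul continuous_id).tendsto b |>.mono_left nhdsWithin_le_nhds)
    refine ge_of_tendsto h2 ?_
    filter_upwards [self_mem_nhdsWithin] with q hq
    have hq : b < q := hq
    have hm : Function.rightLim N a ≤ N a' := hN.rightLim_le ha
    have hm' := hN (hb.trans hq).le
    have hc : (c : ℝ) * a ≤ c * a' := by gcongr
    have hc' : (c : ℝ) * a' ≤ c * q := by gcongr; linarith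
    calc ν (Ioc a' b) ≤ ν (Ioo a' q) := measure_mono fun x hx => ⟨hx.1, hx.2.trans_lt hq⟩
      _ ≤ ENNReal.ofReal (N q - N a') + c * ENNReal.ofReal (q - a') := h _ _ (hb.trans hq)
      _ = ENNReal.ofReal ((N q - N a') + c * (q - a')) := by
        rw [ENNReal.ofReal_add (by linarith) (by nlinarith [c.coe_nonneg]), ENNReal.ofReal_mul c.coe_nonneg,
          ENNReal.ofReal_coe_nnreal]
      _ ≤ _ := ENNReal.ofReal_le_ofReal (by linarith)
  obtain ⟨x, hx, hxa, hxlim⟩ := exists_seq_strictAnti_tendsto' hab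
  have hun : Ioc a b = ⋃ n, Ioc (x n) b := by
    ext y
    simp only [mem_Ioc, mem_iUnion]
    constructor
    · rintro ⟨h1, h2⟩
      obtain ⟨n, hn⟩ := ((tendsto_order.1 hxlim).2 y h1).exists
      exact ⟨n, hn, h2⟩
    · rintro ⟨n, h1, h2⟩
      exact ⟨(hxa n).1.trans h1, h2⟩
  rw [hun, Monotone.measure_iUnion fun m n hmn => Ioc_subset_Ioc_left (hx.antitone hmn)]
  exact iSup_le fun n => h1 _ (hxa n).1 (hxa n).2

/-- Starting to the left of `a` includes a possible atom there; the bound on all increments of `N`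
absorbs the enlargement. -/
theorem stieltjes_Icc_le {N : ℝ → ℝ} (hN : Monotone N) {B : ℝ≥0} (hB : ∀ x y, N y - N x ≤ B)
    (a b : ℝ) : hN.stieltjesFunction.measure (Icc a b) ≤ B := by
  refine (measure_mono (t := Ioc (a - 1) b) fun x hx => ⟨by linarith [hx.1], hx.2⟩).trans ?_
  rw [StieltjesFunction.measure_Ioc, hN.stieltjesFunction_eq, hN.stieltjesFunction_eq]
  refine ENNReal.ofReal_le_coe.2 ?_
  have h1 : Function.rightLim N b ≤ N (b + 1) := hN.rightLim_le (by linarith)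
  have h2 : N (a - 1) ≤ Function.rightLim N (a - 1) := hN.le_rightLim le_rfl
  linarith [hB (a - 1) (b + 1)]

section Density

variable {X : Type*} [EMetricSpace X] {u : ℝ → X} {ψ : ℝ≥0 → ℝ≥0}

/-- A lower bound for the density of a limit of dissipation measures. -/
theorem density_le_rnDeriv {N : ℝ → ℝ} (hN : Monotone N) {m : ℝ → ℝ≥0∞} {t : ℝ}
    (hc : ConvexOn ℝ≥0 univ ψ) (h0 : ψ 0 = 0) (hm : AEMeasurable m (volume.restrict (Icc 0 t)))
    (hfin : ∫⁻ r in Icc 0 t, m r ≠ ⊤)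
    (hle : ∀ a b, 0 ≤ a → a < b → b ≤ t → ∫⁻ r in Icc a b, m r ≤ ENNReal.ofReal (N b - N a))
    (hch : ∀ v₁ v₂ : ℝ≥0, v₁ < v₂ → ∀ a b, 0 ≤ a → a < b → b ≤ t →
      ψ v₁ * ENNReal.ofReal (b - a) + chordSlope ψ v₁ v₂ * edist (u b) (u a) + ∫⁻ r in Icc a b, m r
        ≤ ENNReal.ofReal (N b - N a) + chordSlope ψ v₁ v₂ * v₂ * ENNReal.ofReal (b - a)) :
    ∀ᵐ x ∂volume.restrict (Icc 0 t), metricDeriv u x < ⊤ →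
      (ψ (metricDeriv u x).toNNReal : ℝ≥0∞) + m x
        ≤ hN.stieltjesFunction.measure.rnDeriv volume x := by
  have hm' : AEMeasurable ((Icc 0 t).indicator m) volume :=
    (aemeasurable_indicator_iff measurableSet_Icc).2 hm
  have hfin' : ∫⁻ r, (Icc 0 t).indicator m r ≠ ⊤ := by
    rwa [lintegral_indicator measurableSet_Icc]
  rw [ae_restrict_iff' measurableSet_Icc]
  filter_upwards [hN.ae_hasDerivAt, ae_tendsto_lintegral_div_right hm' hfin',
    Measure.rnDeriv_lt_top hN.stieltjesFunction.measure volume, Measure.ae_ne volume t]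
    with x hd hmx hlt hxt hx hv
  have hd' : Tendsto (fun ρ : ℝ => ENNReal.ofReal (N (x + ρ) - N x) / ENNReal.ofReal |ρ|) (𝓝[>] 0)
      (𝓝 (hN.stieltjesFunction.measure.rnDeriv volume x)) := by
    rw [← ENNReal.ofReal_toReal hlt.ne]
    refine ((ENNReal.continuous_ofReal.tendsto _).comp hd.tendsto_slope_zero_right).congr' ?_
    filter_upwards [self_mem_nhdsWithin] with ρ hρ
    have hρ : (0 : ℝ) < ρ := hρ
    simp only [Function.comp, smul_eq_mul]
    rw [abs_of_pos hρ, ENNReal.ofReal_mul (by positivity), ENNReal.ofReal_inv_of_pos hρ,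
      ENNReal.div_eq_inv_mul]
  rw [indicator_of_mem hx] at hmx
  set D := hN.stieltjesFunction.measure.rnDeriv volume x
  have hsmall : ∀ᶠ ρ : ℝ in 𝓝[>] 0, 0 < ρ ∧ x + ρ ≤ t := by
    have : 0 < t - x := sub_pos.2 (lt_of_le_of_ne hx.2 hxt)
    filter_upwards [Ioo_mem_nhdsGT this] with ρ hρ
    exact ⟨hρ.1, by linarith [hρ.2]⟩
  have hind : ∀ ρ, 0 < ρ → x + ρ ≤ t →
      ∫⁻ r in Icc x (x + ρ), (Icc 0 t).indicator m r = ∫⁻ r in Icc x (x + ρ), m r := by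
    intro ρ hρ hρt
    refine setLIntegral_congr_fun measurableSet_Icc fun r hr => ?_
    exact indicator_of_mem (show r ∈ Icc 0 t from ⟨hx.1.trans hr.1, hr.2.trans hρt⟩) m
  have hmD : m x ≤ D := by
    refine le_of_tendsto_of_tendsto hmx hd' ?_
    filter_upwards [hsmall] with ρ hρ
    rw [hind ρ hρ.1 hρ.2]
    gcongr
    exact hle _ _ hx.1 (by linarith [hρ.1]) hρ.2
  -- The chord inequality divided by the step: the speed is an upper limit of quotients while the
  -- other terms converge, and finiteness permits the subtraction in `[0, ∞]`.
  have key : ∀ v₁ v₂ : ℝ≥0, v₁ < v₂ →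
      chordSlope ψ v₁ v₂ * metricDeriv u x + (ψ v₁ + m x) ≤ D + chordSlope ψ v₁ v₂ * v₂ := by
    intro v₁ v₂ hv12
    set κ := chordSlope ψ v₁ v₂
    have hpt : ∀ᶠ ρ : ℝ in 𝓝[>] 0, κ * (edist (u (x + ρ)) (u x) / ENNReal.ofReal |ρ|)
        + (ψ v₁ + (∫⁻ r in Icc x (x + ρ), (Icc 0 t).indicator m r) / ENNReal.ofReal |ρ|)
        ≤ ENNReal.ofReal (N (x + ρ) - N x) / ENNReal.ofReal |ρ| + κ * v₂ := by
      filter_upwards [hsmall] with ρ hρ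
      have h1 := hch v₁ v₂ hv12 x (x + ρ) hx.1 (by linarith [hρ.1]) hρ.2
      rw [add_sub_cancel_left] at h1
      rw [hind ρ hρ.1 hρ.2, abs_of_pos hρ.1]
      have hr0 : ENNReal.ofReal ρ ≠ 0 := by simpa using hρ.1
      have h2 := mul_le_mul_left h1 (ENNReal.ofReal ρ)⁻¹
      have h3 : ENNReal.ofReal ρ * (ENNReal.ofReal ρ)⁻¹ = 1 :=
        ENNReal.mul_inv_cancel hr0 ENNReal.ofReal_ne_top
      simp only [div_eq_mul_inv]
      calc _ = (ψ v₁ * (ENNReal.ofReal ρ * (ENNReal.ofReal ρ)⁻¹)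
              + κ * edist (u (x + ρ)) (u x) * (ENNReal.ofReal ρ)⁻¹
              + (∫⁻ r in Icc x (x + ρ), m r) * (ENNReal.ofReal ρ)⁻¹) := by rw [h3]; ring
        _ = (ψ v₁ * ENNReal.ofReal ρ + κ * edist (u (x + ρ)) (u x)
              + ∫⁻ r in Icc x (x + ρ), m r) * (ENNReal.ofReal ρ)⁻¹ := by ring
        _ ≤ _ := h2
        _ = ENNReal.ofReal (N (x + ρ) - N x) * (ENNReal.ofReal ρ)⁻¹
              + κ * v₂ * (ENNReal.ofReal ρ * (ENNReal.ofReal ρ)⁻¹) := by ring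
        _ = _ := by rw [h3, mul_one]
    have hR := hd'.add_const ((κ : ℝ≥0∞) * v₂)
    have hQ := hmx.const_add (ψ v₁ : ℝ≥0∞)
    have hRfin : D + κ * v₂ ≠ ⊤ :=
      ENNReal.add_ne_top.2 ⟨hlt.ne, ENNReal.mul_ne_top ENNReal.coe_ne_top ENNReal.coe_ne_top⟩
    have hQR : ψ v₁ + m x ≤ D + κ * v₂ :=
      le_of_tendsto_of_tendsto hQ hR (hpt.mono fun ρ hρ => le_add_self.trans hρ)
    have hsub := ENNReal.Tendsto.sub hR hQ (Or.inl hRfin)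
    have hlim : limsup (fun ρ : ℝ => κ * (edist (u (x + ρ)) (u x) / ENNReal.ofReal |ρ|)) (𝓝[>] 0)
        ≤ D + κ * v₂ - (ψ v₁ + m x) := by
      rw [← hsub.limsup_eq]
      refine limsup_le_limsup ?_
      have hQfin : ∀ᶠ ρ : ℝ in 𝓝[>] 0, ψ v₁ + (∫⁻ r in Icc x (x + ρ), (Icc 0 t).indicator m r)
          / ENNReal.ofReal |ρ| < ⊤ :=
        (tendsto_order.1 hQ).2 _ (lt_of_le_of_lt hQR hRfin.lt_top)
      filter_upwards [hpt, hQfin] with ρ h1 h2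
      exact ENNReal.le_sub_of_add_le_right h2.ne h1
    rw [ENNReal.limsup_const_mul_of_ne_top ENNReal.coe_ne_top] at hlim
    exact add_le_of_le_tsub_right_of_le hQR hlim
  set v := (metricDeriv u x).toNNReal with hvdef
  have hvx : metricDeriv u x = v := (ENNReal.coe_toNNReal hv.ne).symm
  rcases eq_or_ne v 0 with hz | hz
  · rw [hz, h0]
    simpa using hmD
  · have hpos : 0 < v := pos_iff_ne_zero.2 hz
    -- With the chord from `v₁` to the speed itself the slope terms cancel; afterwards `v₁`
    -- increases to `v`.
    have hstep : ∀ v₁ < v, (ψ v₁ : ℝ≥0∞) + m x ≤ D := by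
      intro v₁ hv₁
      have h1 := key v₁ v hv₁
      rw [hvx, add_comm] at h1
      exact (ENNReal.add_le_add_iff_right
        (ENNReal.mul_ne_top ENNReal.coe_ne_top ENNReal.coe_ne_top)).1 h1
    have hmfin : m x ≠ ⊤ := ne_top_of_le_ne_top hlt.ne hmD
    refine add_le_of_le_tsub_right_of_le hmD (le_of_forall_lt fun c hc' => ?_)
    obtain ⟨c, rfl⟩ : ∃ c' : ℝ≥0, c = c' := ⟨c.toNNReal, (ENNReal.coe_toNNReal hc'.ne_top).symm⟩
    obtain ⟨v₁, hv₁, hcv⟩ := convex_left_approx hc hpos (by exact_mod_cast hc')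
    exact lt_of_lt_of_le (by exact_mod_cast hcv)
      (ENNReal.le_sub_of_add_le_right hmfin (hstep v₁ hv₁))

end Density

/-- One point `v₀` with `ψ v₀ > κ v₀` is enough: the inequality passes to `ψn` for large `n`,
convexity propagates it to `v ≥ v₀`, and the constant `κ v₀` covers smaller `v`. -/
theorem IsMetricDissipation.eventually_mul_le {ψ : ℝ≥0 → ℝ≥0} {L : ℝ≥0}
    (h : IsMetricDissipation ψ (L : ℝ≥0∞)) {ψn : ℕ → ℝ≥0 → ℝ≥0}
    (hc : ∀ n, ConvexOn ℝ≥0 univ (ψn n)) (h0 : ∀ n, ψn n 0 = 0)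
    (hlim : ∀ v, Tendsto (fun n => ψn n v) atTop (𝓝 (ψ v))) {κ : ℝ≥0} (hκ : κ < L) :
    ∃ c : ℝ≥0, ∀ᶠ n in atTop, ∀ v, κ * v ≤ ψn n v + c := by
  obtain ⟨v₀, hv₀, hlt⟩ := h.exists_slope hκ
  refine ⟨κ * v₀, ?_⟩
  filter_upwards [(tendsto_order.1 (hlim v₀)).1 _ hlt] with n hn v
  rcases le_total v v₀ with hv | hv
  · exact (mul_le_mul_right hv κ).trans le_add_self
  · have h3 := convex_three_points (hc n) (zero_le (a := v₀)) hv (hv₀.trans_le hv)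
    rw [h0, NNReal.coe_zero, mul_zero, sub_zero, sub_zero, zero_add] at h3
    have hn' : (κ : ℝ) * v₀ ≤ ψn n v₀ := by exact_mod_cast hn.le
    have hv₀' : (0 : ℝ) < v₀ := by exact_mod_cast hv₀
    have : (v₀ : ℝ) * (κ * v) ≤ v₀ * ψn n v := by
      calc (v₀ : ℝ) * (κ * v) = v * (κ * v₀) := by ring
        _ ≤ v * ψn n v₀ := by gcongr
        _ ≤ _ := h3
    have := le_of_mul_le_mul_left this hv₀'
    have h4 : κ * v ≤ ψn n v := by exact_mod_cast this
    exact h4.trans le_self_add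

end

noncomputable section

variable {X : Type*} [TopologicalSpace X] {T : ℝ} {S : ℕ → EvolutionSystem X T}
  {S' : EvolutionSystem X T} {ψn : ℕ → ℝ≥0 → ℝ≥0} {ψ : ℝ≥0 → ℝ≥0} {L : ℝ≥0} {u : ℕ → ℝ → X}
  {G : ℕ → ℝ → ℝ≥0∞} {u' : ℝ → X} {E₀ : ℝ} {C : ℝ≥0} {ω : ℕ → ℝ≥0}

/-! ### Pointwise limits of the slopes and the powers -/

/-- The dissipation of the slopes together with the truncated powers. -/
def slopeCost (S : ℕ → EvolutionSystem X T) (ψn : ℕ → ℝ≥0 → ℝ≥0) (u : ℕ → ℝ → X)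
    (G : ℕ → ℝ → ℝ≥0∞) (k n : ℕ) (r : ℝ) : ℝ≥0∞ :=
  dual (ψn n) (G n r) + (((k : ℝ) : EReal) - (S n).power r (u n r) (G n r)).toENNReal

theorem antitone_sub_toENNReal (k : ℝ) : Antitone fun y : EReal => ((k : EReal) - y).toENNReal :=
  fun _ _ h => EReal.toENNReal_le_toENNReal (EReal.sub_le_sub le_rfl h)

theorem continuous_sub_toENNReal (k : ℝ) :
    Continuous fun y : EReal => ((k : EReal) - y).toENNReal := by
  refine EReal.continuous_toENNReal.comp (continuous_iff_continuousAt.2 fun y => ?_)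
  have h1 : ContinuousAt (fun p : EReal × EReal => p.1 + p.2) ((k : EReal), -y) :=
    EReal.continuousAt_add (Or.inl (EReal.coe_ne_top k)) (Or.inl (EReal.coe_ne_bot k))
  have h2 : ContinuousAt (fun y : EReal => ((k : EReal), -y)) y :=
    continuousAt_const.prodMk continuous_neg.continuousAt
  exact ContinuousAt.comp (f := fun y : EReal => ((k : EReal), -y)) (x := y) h1 h2

theorem aemeasurable_liminf {α : Type*} [MeasurableSpace α] {μ : Measure α} {f : ℕ → α → ℝ≥0∞}
    (hf : ∀ n, AEMeasurable (f n) μ) : AEMeasurable (fun x => liminf (fun n => f n x) atTop) μ := by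
  refine ⟨fun x => liminf (fun n => (hf n).mk (f n) x) atTop,
    Measurable.liminf fun n => (hf n).measurable_mk, ?_⟩
  filter_upwards [ae_all_iff.2 fun n => (hf n).ae_eq_mk] with x hx
  simp only [hx]

namespace Approx

/-- Bounded duals keep the slopes asymptotically below `L`, so along a subsequence realizing the
lower limit they converge to a finite `g`, to which the closedness of slopes and powers applies.
This `g` depends on `r` and `k`, with no measurability. -/
theorem exists_slope_limit (h : Approx S S' ψn ψ L u G u' E₀ C ω) (k : ℕ) {r : ℝ}
    (hr : r ∈ Icc 0 T) (hfin : liminf (fun n => slopeCost S ψn u G k n r) atTop < ⊤) :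
    ∃ g : ℝ≥0, g ≤ L ∧ S'.slope r (u' r) ≤ g ∧
      dual ψ g + (((k : ℝ) : EReal) - S'.power r (u' r) g).toENNReal
        ≤ liminf (fun n => slopeCost S ψn u G k n r) atTop := by
  obtain ⟨φ, hφ, hlim⟩ := exists_strictMono_tendsto_liminf (fun n => slopeCost S ψn u G k n r)
  set c := liminf (fun n => slopeCost S ψn u G k n r) atTop
  obtain ⟨B, hB1, hB2⟩ := ENNReal.lt_iff_exists_nnreal_btwn.1 hfin
  obtain ⟨n₀, hn₀⟩ := eventually_atTop.1 ((tendsto_order.1 hlim).2 _ hB1)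
  let χ : ℕ → ℕ := fun n => φ (n + n₀)
  have hχ : StrictMono χ := fun m n hmn => hφ (by omega)
  have hχlim : Tendsto (fun n => slopeCost S ψn u G k (χ n) r) atTop (𝓝 c) :=
    hlim.comp (tendsto_add_atTop_nat n₀)
  have hbd : ∀ n, dual (ψn (χ n)) (G (χ n) r) ≤ B := fun n =>
    le_self_add.trans (hn₀ (n + n₀) (by omega)).le
  have hL : limsup (fun n => G (χ n) r) atTop ≤ L :=
    h.diss.le_of_dual_bounded (fun v => (h.diss_lim v).comp hχ.tendsto_atTop) hbd
  obtain ⟨g, -, χ', hχ', hg⟩ := isCompact_univ.tendsto_subseq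
    (x := fun n => G (χ n) r) (fun n => mem_univ _)
  have hgL : g ≤ L := by
    rw [← hg.limsup_eq]
    exact (limsup_le_limsup_of_le (u := fun n => G (χ n) r) hχ'.tendsto_atTop).trans hL
  have hgtop : g < ⊤ := hgL.trans_lt ENNReal.coe_lt_top
  obtain ⟨n₁, hn₁⟩ := eventually_atTop.1 ((tendsto_order.1 hg).2 _ hgtop)
  let ρ : ℕ → ℕ := fun n => χ (χ' (n + n₁))
  have hρ : StrictMono ρ := fun m n hmn => hχ (hχ' (by omega))
  have hρfin : ∀ n, G (ρ n) r ≠ ⊤ := fun n => (hn₁ (n + n₁) (by omega)).ne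
  have hρg : Tendsto (fun n => G (ρ n) r) atTop (𝓝 g) := hg.comp (tendsto_add_atTop_nat n₁)
  have hρn : Tendsto (fun n => (G (ρ n) r).toNNReal) atTop (𝓝 g.toNNReal) :=
    (ENNReal.tendsto_toNNReal hgtop.ne).comp hρg
  have hcoe : ∀ n, ((G (ρ n) r).toNNReal : ℝ≥0∞) = G (ρ n) r := fun n =>
    ENNReal.coe_toNNReal (hρfin n)
  have hgc : (g.toNNReal : ℝ≥0∞) = g := ENNReal.coe_toNNReal hgtop.ne
  obtain ⟨h1, h2⟩ := h.power_usc ρ (fun n => (G (ρ n) r).toNNReal) g.toNNReal hρ r hr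
    (fun n => by rw [hcoe]; exact h.slope_le _ r hr) hρn
  refine ⟨g.toNNReal, by rw [← ENNReal.coe_le_coe, hgc]; exact hgL, h1, ?_⟩
  have hρlim : Tendsto (fun n => slopeCost S ψn u G k (ρ n) r) atTop (𝓝 c) :=
    hχlim.comp (hχ'.tendsto_atTop.comp (tendsto_add_atTop_nat n₁))
  rw [← hρlim.liminf_eq]
  refine le_trans ?_ (liminf_add_liminf_le _ _)
  refine add_le_add ?_ ?_
  · have := dual_liminf (fun v => (h.diss_lim v).comp hρ.tendsto_atTop) hρn
    simpa only [hcoe, Function.comp_def] using this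
  · refine (antitone_sub_toENNReal k h2).trans ?_
    dsimp only
    rw [(antitone_sub_toENNReal k).map_limsup_of_continuousAt _
      (continuous_sub_toENNReal k).continuousAt]
    simp only [Function.comp_def, hcoe]
    exact le_rfl

theorem aemeasurable_slopeCost (h : Approx S S' ψn ψ L u G u' E₀ C ω) (k n : ℕ) :
    AEMeasurable (slopeCost S ψn u G k n) (volume.restrict (Icc 0 T)) :=
  ((measurable_dual _).comp (h.meas n)).aemeasurable.add
    ((continuous_sub_toENNReal k).measurable.comp_aemeasurable (h.power_meas n))

/-- The total dissipation of the approximating curves is bounded. -/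
theorem exists_bound (h : Approx S S' ψn ψ L u G u' E₀ C ω) (k : ℕ) :
    ∃ B : ℝ≥0, ∀ n, ∫⁻ r in Icc 0 T, ((ψn n ((S n).speed (u n) r).toNNReal : ℝ≥0∞)
      + slopeCost S ψn u G k n r) ≤ B := by
  have hT : T ∈ Icc 0 T := ⟨h.T_pos.le, le_rfl⟩
  have hB0 : 0 ≤ (2 * C + k * T + ω k : ℝ) := by have := h.T_pos.le; positivity
  refine ⟨(2 * C + k * T + ω k : ℝ).toNNReal, fun n => ?_⟩
  have h1 := h.ineq n k T hT
  have h2 := h.energy_ge n T hT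
  have h3 := h.energy_le n 0 ⟨le_rfl, h.T_pos.le⟩
  set I := ∫⁻ r in Icc 0 T, ((ψn n ((S n).speed (u n) r).toNNReal : ℝ≥0∞) + (dual (ψn n) (G n r)
        + (((k : ℝ) : EReal) - (S n).power r (u n r) (G n r)).toENNReal)) with hI
  have h4 : ((-C : ℝ) : EReal) + (I : EReal) ≤ ((C : ℝ) : EReal) + ((k * T + ω k : ℝ) : EReal) :=
    (add_le_add h2 le_rfl).trans (h1.trans (add_le_add h3 le_rfl))
  change I ≤ _
  have hItop : I ≠ ⊤ := by
    intro htop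
    rw [htop, EReal.coe_ennreal_top, EReal.coe_add_top, ← EReal.coe_add] at h4
    exact EReal.coe_ne_top _ (top_le_iff.1 h4)
  rw [← ENNReal.coe_toNNReal hItop] at h4 ⊢
  have h5 : (-C : ℝ) + I.toNNReal ≤ C + (k * T + ω k) := by
    have e : ((I.toNNReal : ℝ≥0∞) : EReal) = ((I.toNNReal : ℝ) : EReal) := rfl
    rw [e, ← EReal.coe_add, ← EReal.coe_add, EReal.coe_le_coe_iff] at h4
    exact h4
  refine ENNReal.coe_le_coe.2 (NNReal.coe_le_coe.1 ?_)
  rw [Real.coe_toNNReal _ hB0]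
  linarith

/-- Fatou's lemma and the uniform bound on the dissipations. -/
theorem ae_liminf_slopeCost_lt_top (h : Approx S S' ψn ψ L u G u' E₀ C ω) (k : ℕ) :
    ∀ᵐ r ∂volume.restrict (Icc 0 T), liminf (fun n => slopeCost S ψn u G k n r) atTop < ⊤ := by
  obtain ⟨B, hB⟩ := h.exists_bound k
  have hm : AEMeasurable (fun r => liminf (fun n => slopeCost S ψn u G k n r) atTop)
      (volume.restrict (Icc 0 T)) := aemeasurable_liminf (h.aemeasurable_slopeCost k)
  refine ae_lt_top' hm (ne_top_of_le_ne_top (ENNReal.coe_ne_top (r := B)) ?_)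
  refine (lintegral_liminf_le' (h.aemeasurable_slopeCost k)).trans ?_
  refine liminf_le_of_le (by isBoundedDefault) fun b hb => ?_
  obtain ⟨n, hn⟩ := hb.exists
  exact hn.trans ((lintegral_mono fun r => le_add_self).trans (hB n))

/-- Almost everywhere the slopes of the approximating curves do not exceed `L` in the limit. -/
theorem ae_frequently_le (h : Approx S S' ψn ψ L u G u' E₀ C ω) :
    ∀ᵐ r ∂volume.restrict (Icc 0 T), ∀ c : ℝ≥0∞, L < c → ∃ᶠ n in atTop, G n r ≤ c := by
  filter_upwards [h.ae_liminf_slopeCost_lt_top 0] with r hr c hc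
  obtain ⟨φ, hφ, hlim⟩ := exists_strictMono_tendsto_liminf (fun n => slopeCost S ψn u G 0 n r)
  obtain ⟨B, hB1, hB2⟩ := ENNReal.lt_iff_exists_nnreal_btwn.1 hr
  obtain ⟨n₀, hn₀⟩ := eventually_atTop.1 ((tendsto_order.1 hlim).2 _ hB1)
  let χ : ℕ → ℕ := fun n => φ (n + n₀)
  have hχ : StrictMono χ := fun m n hmn => hφ (by omega)
  have hL : limsup (fun n => G (χ n) r) atTop ≤ L :=
    h.diss.le_of_dual_bounded (C := B) (fun v => (h.diss_lim v).comp hχ.tendsto_atTop)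
      fun n => le_self_add.trans (hn₀ (n + n₀) (by omega)).le
  have hev : ∀ᶠ n in atTop, G (χ n) r ≤ c :=
    (eventually_lt_of_limsup_lt (hL.trans_lt hc)).mono fun n hn => hn.le
  exact hχ.tendsto_atTop.frequently hev.frequently

end Approx

namespace ParamApprox

variable {τn σn : ℕ → ℝ → ℝ} {θn : ℕ → ℝ → X} {vn : ℕ → ℝ → ℝ≥0∞} {τ σ : ℝ → ℝ} {θ : ℝ → X}

theorem subseq (h : ParamApprox S S' ψn ψ L u G u' E₀ C ω τn σn θn vn τ σ θ) {φ : ℕ → ℕ}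
    (hφ : StrictMono φ) :
    ParamApprox (fun n => S (φ n)) S' (fun n => ψn (φ n)) ψ L (fun n => u (φ n)) (fun n => G (φ n))
      u' E₀ C ω (fun n => τn (φ n)) (fun n => σn (φ n)) (fun n => θn (φ n)) (fun n => vn (φ n))
      τ σ θ where
  toApprox := h.toApprox.subseq hφ
  lipn _ := h.lipn _
  curve_eq _ := h.curve_eq _
  speed_meas _ := h.speed_meas _
  speed_eq _ := h.speed_eq _
  map_eq _ := h.map_eq _
  lim_time s := (h.lim_time s).comp hφ.tendsto_atTop
  lim_inv s := (h.lim_inv s).comp hφ.tendsto_atTop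
  lim_curve χ s s' hχ := h.lim_curve (φ ∘ χ) s s' (hφ.comp hχ)
  lip := h.lip

/-- The slope is at most `L` at limits of the curve. -/
theorem slope_le_of_tendsto (h : ParamApprox S S' ψn ψ L u G u' E₀ C ω τn σn θn vn τ σ θ) {t s : ℝ}
    {l : Filter ℝ} [l.NeBot] [l.IsCountablyGenerated] (hl : l ≤ 𝓝 t) (hσ : Tendsto σ l (𝓝 s))
    (hfr : ∃ᶠ r in l, r ∈ Icc 0 T ∧ ∀ c : ℝ≥0∞, L < c → ∃ᶠ n in atTop, G n r ≤ c) :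
    S'.slope t (θ s) ≤ L := by
  refine ENNReal.le_of_forall_pos_le_add fun ε hε _ => ?_
  obtain ⟨r, hr, hrP⟩ := exists_seq_forall_of_frequently hfr
  have hLε : (L : ℝ≥0∞) < L + ε :=
    ENNReal.lt_add_right ENNReal.coe_ne_top (by exact_mod_cast hε.ne')
  -- A diagonal choice: at each good time `r j` an index is picked with `G ≤ L + ε` and with `σn`
  -- close to `σ`, so that the points `u (φ j) (r j)` converge to `θ s`.
  have hfreq : ∀ j : ℕ, ∃ᶠ n in atTop,
      G n (r j) ≤ L + ε ∧ |σn n (r j) - σ (r j)| ≤ 1 / ((j : ℝ) + 1) := by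
    intro j
    refine ((hrP j).2 _ hLε).and_eventually ?_
    have : Tendsto (fun n => |σn n (r j) - σ (r j)|) atTop (𝓝 0) := by
      have := ((h.lim_inv (r j)).sub_const (σ (r j))).abs
      simpa using this
    exact this.eventually_le_const (by positivity)
  obtain ⟨φ, hφ, hφP⟩ := extraction_forall_of_frequently hfreq
  have hs : Tendsto (fun j => σn (φ j) (r j)) atTop (𝓝 s) := by
    have h1 : Tendsto (fun j => σn (φ j) (r j) - σ (r j)) atTop (𝓝 0) :=
      squeeze_zero_norm (fun j => (hφP j).2) tendsto_one_div_add_atTop_nhds_zero_nat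
    simpa using h1.add (hσ.comp hr)
  have hcurve := h.lim_curve φ _ s hφ hs
  have heq : ∀ j, θn (φ j) (σn (φ j) (r j)) = u (φ j) (r j) := fun j =>
    @IsLipParam.comp' X (S (φ j)).metric T (u (φ j)) (τn (φ j)) (σn (φ j)) (θn (φ j)) (h.lipn _) _
      (hrP j).1
  simp only [heq] at hcurve
  refine (h.slope_lsc φ r t (θ s) hφ (fun j => (hrP j).1) (hr.mono_right hl) hcurve).trans ?_
  refine liminf_le_of_le (by isBoundedDefault) fun b hb => ?_
  obtain ⟨j, hj⟩ := hb.exists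
  exact hj.trans ((h.slope_le _ _ (hrP j).1).trans (hφP j).1)

/-- Good times have full measure, so they accumulate at every `t < T` from the right; this turns an
almost-everywhere bound into one at each right limit. -/
theorem slope_rightLim_le (h : ParamApprox S S' ψn ψ L u G u' E₀ C ω τn σn θn vn τ σ θ) {t : ℝ}
    (h0 : 0 ≤ t) (ht : t < T) : S'.slope t (θ (Function.rightLim σ t)) ≤ L := by
  let := S'.metric
  refine h.slope_le_of_tendsto nhdsWithin_le_nhds (h.lip.tendsto_right t) ?_
  have h1 := (ae_restrict_iff' measurableSet_Icc).1 h.ae_frequently_le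
  rw [frequently_iff]
  intro U hU
  obtain ⟨b, hb, hbU⟩ := (mem_nhdsGT_iff_exists_Ioo_subset' ht).1 hU
  have hpos : 0 < volume (Ioo t (min b T)) := by
    rw [Real.volume_Ioo]
    simpa using ⟨hb, ht⟩
  obtain ⟨x, hx, hx'⟩ := ((frequently_ae_mem_iff.2 hpos.ne').and_eventually h1).exists
  have hm : x ∈ Icc 0 T := ⟨h0.trans hx.1.le, (hx.2.trans_le (min_le_right _ _)).le⟩
  exact ⟨x, hbU ⟨hx.1, hx.2.trans_le (min_le_left _ _)⟩, hm, hx' hm⟩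

theorem slope_leftLim_le (h : ParamApprox S S' ψn ψ L u G u' E₀ C ω τn σn θn vn τ σ θ) {t : ℝ}
    (h0 : 0 < t) (ht : t ≤ T) : S'.slope t (θ (Function.leftLim σ t)) ≤ L := by
  let := S'.metric
  refine h.slope_le_of_tendsto nhdsWithin_le_nhds (h.lip.tendsto_left t) ?_
  have h1 := (ae_restrict_iff' measurableSet_Icc).1 h.ae_frequently_le
  rw [frequently_iff]
  intro U hU
  obtain ⟨b, hb, hbU⟩ := (mem_nhdsLT_iff_exists_Ioo_subset' h0).1 hU
  have hpos : 0 < volume (Ioo (max b 0) t) := by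
    rw [Real.volume_Ioo]
    simpa using ⟨hb, h0⟩
  obtain ⟨x, hx, hx'⟩ := ((frequently_ae_mem_iff.2 hpos.ne').and_eventually h1).exists
  have hm : x ∈ Icc 0 T := ⟨((le_max_right _ _).trans_lt hx.1).le, hx.2.le.trans ht⟩
  exact ⟨x, hbU ⟨(le_max_left _ _).trans_lt hx.1, hx.2⟩, hm, hx' hm⟩

theorem slope_le_of_notMem_jumps (h : ParamApprox S S' ψn ψ L u G u' E₀ C ω τn σn θn vn τ σ θ)
    {t : ℝ} (ht : t ∈ Icc 0 T) (hj : t ∉ S'.jumps u') : S'.slope t (u' t) ≤ L := by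
  let := S'.metric
  have hj' : u' t = limL T u' t ∧ u' t = limR T u' t := by
    by_contra hcon
    exact hj ⟨ht, not_and_or.1 hcon⟩
  rcases ht.2.lt_or_eq with hlt | rfl
  · rw [hj'.2, h.lip.limR_eq]
    exact h.slope_rightLim_le ht.1 hlt
  · rw [hj'.1, h.lip.limL_eq]
    exact h.slope_leftLim_le h.T_pos le_rfl

end ParamApprox

end

noncomputable section

theorem IsLipParam.isTimeOrderedAC {X : Type*} [EMetricSpace X] {T : ℝ} {u : ℝ → X} {τ σ : ℝ → ℝ}
    {θ : ℝ → X} (h : IsLipParam T u τ σ θ) {α β : ℝ} (hα : 0 ≤ α) (hβ : β ≤ σ T) :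
    IsTimeOrderedAC T τ θ α β where
  mem s hs := h.mem_Icc ⟨h.zero.trans_le (hα.trans hs.1), hs.2.trans hβ⟩
  mono := h.mono.monotoneOn _
  ac_time := IsAC.of_edist_le (fun s t hst => by
    rw [edist_comm, edist_dist, Real.dist_eq, abs_of_nonneg (sub_nonneg.2 (h.mono hst))]
    exact ENNReal.ofReal_le_ofReal (h.lip s t hst)) α β
  ac_space := h.ac α β

variable {X : Type*} [TopologicalSpace X] {T : ℝ} {S : ℕ → EvolutionSystem X T}
  {S' : EvolutionSystem X T} {ψn : ℕ → ℝ≥0 → ℝ≥0} {ψ : ℝ≥0 → ℝ≥0} {L : ℝ≥0} {u : ℕ → ℝ → X}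
  {G : ℕ → ℝ → ℝ≥0∞} {u' : ℝ → X} {E₀ : ℝ} {C : ℝ≥0} {ω : ℕ → ℝ≥0}

/-! ### Lower bounds for the limit of the dissipations -/

namespace ParamApprox

variable {τn σn : ℕ → ℝ → ℝ} {θn : ℕ → ℝ → X} {vn : ℕ → ℝ → ℝ≥0∞} {τ σ : ℝ → ℝ} {θ : ℝ → X}

theorem aemeasurable_speed (h : ParamApprox S S' ψn ψ L u G u' E₀ C ω τn σn θn vn τ σ θ) (n : ℕ) :
    AEMeasurable ((S n).speed (u n)) (volume.restrict (Icc 0 T)) :=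
  ⟨vn n, h.speed_meas n, (h.speed_eq n).symm⟩

theorem ae_speed_lt_top (h : ParamApprox S S' ψn ψ L u G u' E₀ C ω τn σn θn vn τ σ θ) (n : ℕ) :
    ∀ᵐ r ∂volume.restrict (Icc 0 T), (S n).speed (u n) r < ⊤ :=
  @IsAC.metricDeriv_lt_top X (S n).metric (u n) 0 T (h.ac n)

/-- The chord bound is linear in the speed, so after integration only the distance of the end points
remains, and its lower limit is controlled by (C3); Fatou's lemma handles the slopes. -/
theorem chord_le (h : ParamApprox S S' ψn ψ L u G u' E₀ C ω τn σn θn vn τ σ θ) (k : ℕ) {a b D : ℝ}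
    (ha : 0 ≤ a) (hab : a ≤ b) (hb : b ≤ T)
    (hlim : Tendsto (fun n => ∫⁻ r in Icc a b, ((ψn n ((S n).speed (u n) r).toNNReal : ℝ≥0∞)
      + slopeCost S ψn u G k n r)) atTop (𝓝 (ENNReal.ofReal D))) {v₁ v₂ : ℝ≥0} (hv : v₁ < v₂) :
    ψ v₁ * ENNReal.ofReal (b - a) + chordSlope ψ v₁ v₂ * S'.dist (u' b) (u' a)
        + ∫⁻ r in Icc a b, liminf (fun n => slopeCost S ψn u G k n r) atTop
      ≤ ENNReal.ofReal D + chordSlope ψ v₁ v₂ * v₂ * ENNReal.ofReal (b - a) := by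
  have hsub : Icc a b ⊆ Icc 0 T := Icc_subset_Icc ha hb
  have hκ := ENNReal.tendsto_coe.2 (tendsto_chordSlope h.diss_lim v₁ v₂)
  have hψ := ENNReal.tendsto_coe.2 (h.diss_lim v₁)
  set d : ℝ≥0∞ := ENNReal.ofReal (b - a)
  have hR : Tendsto (fun n => (∫⁻ r in Icc a b, ((ψn n ((S n).speed (u n) r).toNNReal : ℝ≥0∞)
      + slopeCost S ψn u G k n r)) + chordSlope (ψn n) v₁ v₂ * v₂ * d) atTop
      (𝓝 (ENNReal.ofReal D + chordSlope ψ v₁ v₂ * v₂ * d)) := by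
    refine hlim.add (ENNReal.Tendsto.mul_const (ENNReal.Tendsto.mul_const hκ
      (Or.inr ENNReal.coe_ne_top)) (Or.inr ENNReal.ofReal_ne_top))
  rw [← hR.liminf_eq]
  have hpt : ∀ n, ψn n v₁ * d + chordSlope (ψn n) v₁ v₂ * (S n).dist (u n b) (u n a)
      + (∫⁻ r in Icc a b, slopeCost S ψn u G k n r)
      ≤ (∫⁻ r in Icc a b, ((ψn n ((S n).speed (u n) r).toNNReal : ℝ≥0∞)
      + slopeCost S ψn u G k n r)) + chordSlope (ψn n) v₁ v₂ * v₂ * d := by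
    intro n
    set κ := chordSlope (ψn n) v₁ v₂
    have hm : AEMeasurable (fun r => (ψn n ((S n).speed (u n) r).toNNReal : ℝ≥0∞))
        (volume.restrict (Icc a b)) :=
      ((convex_monotone (h.convex n) (h.zero n)).measurable.comp_aemeasurable
        ((h.aemeasurable_speed n).mono_set hsub).ennreal_toNNReal).coe_nnreal_ennreal
    have hdist : (S n).dist (u n b) (u n a) ≤ ∫⁻ r in Icc a b, (S n).speed (u n) r := by
      have := @IsAC.edist_le_lintegral_metricDeriv X (S n).metric (u n) 0 T (h.ac n) a b ha hab hb
      have e : (S n).dist (u n b) (u n a) = (S n).dist (u n a) (u n b) :=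
        @edist_comm X (S n).metric.toPseudoEMetricSpace _ _
      rw [e]; exact this
    rw [lintegral_add_left' hm, add_right_comm _ (∫⁻ r in Icc a b, slopeCost S ψn u G k n r)]
    refine add_le_add ?_ le_rfl
    calc ψn n v₁ * d + κ * (S n).dist (u n b) (u n a)
        ≤ ψn n v₁ * d + κ * ∫⁻ r in Icc a b, (S n).speed (u n) r := by gcongr
      _ = ∫⁻ r in Icc a b, (ψn n v₁ + κ * (S n).speed (u n) r) := by
        rw [lintegral_add_left measurable_const, setLIntegral_const, Real.volume_Icc,
          lintegral_const_mul' _ _ ENNReal.coe_ne_top]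
      _ ≤ ∫⁻ r in Icc a b, ((ψn n ((S n).speed (u n) r).toNNReal : ℝ≥0∞) + κ * v₂) := by
        refine lintegral_mono_ae ?_
        filter_upwards [ae_restrict_of_ae_restrict_of_subset hsub (h.ae_speed_lt_top n)] with r hr
        have := chord_bound (h.convex n) (h.zero n) hv ((S n).speed (u n) r).toNNReal
        conv_lhs => rw [← ENNReal.coe_toNNReal hr.ne]
        exact_mod_cast this
      _ = (∫⁻ r in Icc a b, (ψn n ((S n).speed (u n) r).toNNReal : ℝ≥0∞)) + κ * v₂ * d := by
        rw [lintegral_add_right _ measurable_const, setLIntegral_const, Real.volume_Icc]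
  refine le_trans ?_ (liminf_le_liminf (Eventually.of_forall hpt))
  refine le_trans ?_ (liminf_add_liminf_le _ _)
  refine add_le_add (le_trans (add_le_add ?_ ?_) (liminf_add_liminf_le _ _)) ?_
  · exact (ENNReal.Tendsto.mul_const hψ (Or.inr ENNReal.ofReal_ne_top)).liminf_eq.ge
  · refine le_trans ?_ ENNReal.le_liminf_mul
    rw [hκ.liminf_eq]
    refine mul_le_mul_right ?_ _
    exact h.dist_le id (fun _ => b) (fun _ => a) b a _ _ strictMono_id
      (fun _ => ⟨ha.trans hab, hb⟩) (fun _ => ⟨ha, hab.trans hb⟩) tendsto_const_nhds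
      (h.lim b ⟨ha.trans hab, hb⟩) tendsto_const_nhds (h.lim a ⟨ha, hab.trans hb⟩)
  · exact lintegral_liminf_le' fun n => (h.aemeasurable_slopeCost k n).mono_set hsub

/-- A lower bound for the limit of the dissipations by the weighted length of the limit curve. -/
theorem exists_length_le (h : ParamApprox S S' ψn ψ L u G u' E₀ C ω τn σn θn vn τ σ θ) (k : ℕ)
    (K : ℝ≥0) {κ : ℝ≥0} (hκ : κ < L) : ∃ c : ℝ≥0, ∀ a b D : ℝ, 0 ≤ a → a ≤ b → b ≤ T →
    Tendsto (fun n => ∫⁻ r in Icc a b, ((ψn n ((S n).speed (u n) r).toNNReal : ℝ≥0∞)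
      + slopeCost S ψn u G k n r)) atTop (𝓝 (ENNReal.ofReal D)) →
    ∫⁻ s in Ioo (σ a) (σ b), max (min (S'.slope (τ s) (θ s)) K) κ
      ≤ ENNReal.ofReal D + c * ENNReal.ofReal (b - a) := by
  let := S'.metric
  obtain ⟨c, hc⟩ := h.diss.eventually_mul_le h.convex h.zero h.diss_lim hκ
  refine ⟨c + (K + κ), fun a b D ha hab hb hlim => ?_⟩
  have hsub : Icc a b ⊆ Icc 0 T := Icc_subset_Icc ha hb
  -- The upper truncation by `K` makes the time part of the parameter cost only a multiple of `b -
  -- a`; the lower one is by `κ < L`, since `ψn` dominates `κ v` up to a constant only below `L`.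
  let g : ℕ → ℝ → ℝ≥0∞ := fun n r => max (min (G n r) K) κ
  have hg : ∀ n, Measurable (g n) := fun n => ((h.meas n).min measurable_const).max measurable_const
  have hgm : Monotone fun x : ℝ≥0∞ => max (min x K) (κ : ℝ≥0∞) := fun x y hxy =>
    max_le_max (min_le_min_right _ hxy) le_rfl
  have hgc : Continuous fun x : ℝ≥0∞ => max (min x K) (κ : ℝ≥0∞) := by fun_prop
  have hτn : ∀ n, Continuous (τn n) := fun n =>
    @IsLipParam.continuous X (S n).metric T (u n) (τn n) (σn n) (θn n) (h.lipn n)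
  have hmem : ∀ n s, s ∈ Icc (σn n a) (σn n b) → τn n s ∈ Icc a b := fun n s hs =>
    @IsLipParam.mem_Icc X (S n).metric T (u n) (τn n) (σn n) (θn n) (h.lipn n) s a b hs
  have hpt : ∀ᶠ n in atTop, ∀ᵐ r ∂volume.restrict (Icc a b), g n r * (1 + vn n r)
      ≤ ((ψn n ((S n).speed (u n) r).toNNReal : ℝ≥0∞) + slopeCost S ψn u G k n r)
        + ((c + (K + κ) : ℝ≥0) : ℝ≥0∞) := by
    filter_upwards [hc] with n hn
    filter_upwards [ae_restrict_of_ae_restrict_of_subset hsub (h.ae_speed_lt_top n),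
      ae_restrict_of_ae_restrict_of_subset hsub (h.speed_eq n)] with r hr hv
    rw [hv]
    set w := ((S n).speed (u n) r).toNNReal
    have hw : (S n).speed (u n) r = w := (ENNReal.coe_toNNReal hr.ne).symm
    rw [hw, mul_add, mul_one]
    have h1 : g n r ≤ (K : ℝ≥0∞) + κ :=
      max_le ((min_le_right _ _).trans le_self_add) le_add_self
    -- Linear growth of `ψn` where `κ` is the maximum, Young's inequality where the truncated slope
    -- is.
    have h2 : g n r * w ≤ ψn n w + slopeCost S ψn u G k n r + c := by
      rcases le_total (min (G n r) K) (κ : ℝ≥0∞) with hle | hle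
      · have e : g n r = κ := max_eq_right hle
        rw [e]
        calc (κ : ℝ≥0∞) * w ≤ ψn n w + c := by exact_mod_cast hn w
          _ ≤ _ := by gcongr; exact le_self_add
      · have e : g n r = min (G n r) K := max_eq_left hle
        rw [e]
        calc min (G n r) K * w ≤ G n r * w := by gcongr; exact min_le_left _ _
          _ ≤ ψn n w + dual (ψn n) (G n r) := young_le _ _ _
          _ ≤ ψn n w + slopeCost S ψn u G k n r := by gcongr; exact le_self_add
          _ ≤ _ := le_self_add
    calc g n r + g n r * w ≤ (K + κ) + (ψn n w + slopeCost S ψn u G k n r + c) := add_le_add h1 h2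
      _ = _ := by push_cast; ring
  have hint : ∀ᶠ n in atTop, ∫⁻ s, (Ioo (σn n a) (σn n b)).indicator (fun s => g n (τn n s)) s
      ≤ (∫⁻ r in Icc a b, ((ψn n ((S n).speed (u n) r).toNNReal : ℝ≥0∞)
        + slopeCost S ψn u G k n r)) + ((c + (K + κ) : ℝ≥0) : ℝ≥0∞) * ENNReal.ofReal (b - a) := by
    filter_upwards [hpt] with n hn
    rw [lintegral_indicator measurableSet_Ioo]
    -- The image of Lebesgue measure under `τn` has density `1 + vn`.
    calc ∫⁻ s in Ioo (σn n a) (σn n b), g n (τn n s)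
        ≤ ∫⁻ s in τn n ⁻¹' Icc a b, g n (τn n s) :=
          lintegral_mono_set fun s hs => hmem n s ⟨hs.1.le, hs.2.le⟩
      _ = ∫⁻ r in Icc a b, g n r ∂(volume.map (τn n)) :=
          (setLIntegral_map measurableSet_Icc (hg n) (hτn n).measurable).symm
      _ = ∫⁻ r in Icc a b, g n r * (1 + vn n r) := by
        rw [h.map_eq, Measure.restrict_add, lintegral_add_measure,
          restrict_withDensity measurableSet_Icc,
          lintegral_withDensity_eq_lintegral_mul _ (h.speed_meas n) (hg n),
          ← lintegral_add_left (hg n)]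
        refine lintegral_congr fun r => ?_
        simp only [Pi.mul_apply]
        ring
      _ ≤ _ := lintegral_mono_ae hn
      _ = _ := by rw [lintegral_add_right _ measurable_const, setLIntegral_const, Real.volume_Icc]
  have hR := hlim.add_const (((c + (K + κ) : ℝ≥0) : ℝ≥0∞) * ENNReal.ofReal (b - a))
  rw [← hR.liminf_eq]
  refine le_trans ?_ (liminf_le_liminf hint)
  refine le_trans ?_ (lintegral_liminf_le fun n =>
    ((hg n).comp (hτn n).measurable).indicator measurableSet_Ioo)
  rw [← lintegral_indicator measurableSet_Ioo]
  refine lintegral_mono fun s => ?_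
  -- In the open interval `s` eventually lies between `σn n a` and `σn n b`, which could fail at the
  -- end points.
  by_cases hs : s ∈ Ioo (σ a) (σ b)
  swap
  · rw [indicator_of_notMem hs]; exact zero_le
  rw [indicator_of_mem hs]
  have hev : ∀ᶠ n in atTop, s ∈ Ioo (σn n a) (σn n b) :=
    ((tendsto_order.1 (h.lim_inv a)).2 _ hs.1).and ((tendsto_order.1 (h.lim_inv b)).1 _ hs.2)
  have hτs : τ s ∈ Icc 0 T := hsub (h.lip.mem_Icc ⟨hs.1.le, hs.2.le⟩)
  have hclamp : Tendsto (fun n => max 0 (min (τn n s) T)) atTop (𝓝 (τ s)) := by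
    have := ((h.lim_time s).min (tendsto_const_nhds (x := T))).max
      (tendsto_const_nhds (x := (0 : ℝ)))
    rw [max_comm, clamp_eq hτs] at this
    simpa only [max_comm] using this
  have hcurve : Tendsto (fun n => u n (max 0 (min (τn n s) T))) atTop (𝓝 (θ s)) := by
    have := h.lim_curve id (fun _ => s) s strictMono_id tendsto_const_nhds
    simpa only [h.curve_eq, extendCurve, id] using this
  have h1 : S'.slope (τ s) (θ s) ≤ liminf (fun n => G n (τn n s)) atTop := by
    refine (h.slope_lsc id _ _ _ strictMono_id (fun n => clamp_mem h.T_pos.le _) hclamp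
      hcurve).trans (liminf_le_liminf ?_)
    filter_upwards [hev] with n hn
    have hm : τn n s ∈ Icc 0 T := hsub (hmem n s ⟨hn.1.le, hn.2.le⟩)
    simp only [id]
    rw [clamp_eq hm]
    exact h.slope_le n _ hm
  calc max (min (S'.slope (τ s) (θ s)) K) (κ : ℝ≥0∞)
      ≤ max (min (liminf (fun n => G n (τn n s)) atTop) K) (κ : ℝ≥0∞) := hgm h1
    _ = liminf (fun n => g n (τn n s)) atTop := by
      rw [hgm.map_liminf_of_continuousAt _ hgc.continuousAt]; rfl
    _ ≤ _ := by
      refine liminf_le_liminf ?_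
      filter_upwards [hev] with n hn
      rw [indicator_of_mem hn]

theorem aemeasurable_slope (h : ParamApprox S S' ψn ψ L u G u' E₀ C ω τn σn θn vn τ σ θ) :
    AEMeasurable (fun s => S'.slope (τ s) (θ s)) (volume.restrict (Icc 0 (σ T))) := by
  let := S'.metric
  have hσ : 0 ≤ σ T := h.lip.zero.symm.trans_le (h.lip.strictMono.monotone h.T_pos.le)
  exact S'.slope_meas 0 (σ T) τ θ hσ (h.lip.isTimeOrderedAC le_rfl le_rfl)

/-- On Lebesgue null sets of times, the limit of the dissipations controls the weighted length of
the fibers. -/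
theorem fiber_length_le (h : ParamApprox S S' ψn ψ L u G u' E₀ C ω τn σn θn vn τ σ θ) (k : ℕ)
    {t : ℝ} (ht : t ∈ Icc 0 T) {N : ℝ → ℝ} (hN : Monotone N)
    (hlim : ∀ a b, 0 ≤ a → a ≤ b → b ≤ t → Tendsto (fun n => ∫⁻ r in Icc a b,
      ((ψn n ((S n).speed (u n) r).toNNReal : ℝ≥0∞) + slopeCost S ψn u G k n r)) atTop
      (𝓝 (ENNReal.ofReal (N b - N a)))) {A : Set ℝ} (hA : MeasurableSet A) (hA0 : volume A = 0) :
    ∫⁻ s in Icc 0 (σ t) ∩ τ ⁻¹' A, max (S'.slope (τ s) (θ s)) L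
      ≤ hN.stieltjesFunction.measure (Icc 0 t ∩ A) := by
  let := S'.metric
  have hσT : σ t ≤ σ T := h.lip.strictMono.monotone ht.2
  have hFm := h.aemeasurable_slope.mono_set (Icc_subset_Icc_right hσT)
  have hτ := h.lip.continuous.measurable
  have hLpos : 0 < L := by exact_mod_cast h.diss.slope_pos
  -- The truncation levels `j` and `κ j` tend to infinity and to `L`. The constant `c` depends on
  -- `j`, but it multiplies Lebesgue measure, which vanishes on `A`.
  obtain ⟨κ, -, hκ, hκlim⟩ := exists_seq_strictMono_tendsto' hLpos
  have hstep : ∀ j : ℕ, ∫⁻ s in Icc 0 (σ t) ∩ τ ⁻¹' A,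
      max (min (S'.slope (τ s) (θ s)) ((j : ℝ≥0) : ℝ≥0∞)) (κ j)
      ≤ hN.stieltjesFunction.measure (Icc 0 t ∩ A) := by
    intro j
    obtain ⟨c, hc⟩ := h.exists_length_le k j (hκ j).2
    set D : ℝ → ℝ≥0∞ := fun s => max (min (S'.slope (τ s) (θ s)) ((j : ℝ≥0) : ℝ≥0∞)) (κ j)
    set ν : Measure ℝ := ((volume.restrict (Icc 0 (σ t))).withDensity D).map τ with hνdef
    have hν : ∀ B, MeasurableSet B → ν B = ∫⁻ s in τ ⁻¹' B ∩ Icc 0 (σ t), D s := by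
      intro B hB
      rw [hνdef, Measure.map_apply hτ hB, withDensity_apply _ (hτ hB),
        Measure.restrict_restrict (hτ hB)]
    have hle : ν ≤ hN.stieltjesFunction.measure + c • volume := by
      refine le_stieltjes_add_volume hN ν c fun p q hpq => ?_
      rw [hν _ measurableSet_Ioo]
      by_cases hpq' : p ≤ t ∧ 0 ≤ q
      swap
      · have : τ ⁻¹' Ioo p q ∩ Icc 0 (σ t) = ∅ := by
          refine eq_empty_of_forall_notMem fun s hs => hpq' ?_
          have := h.lip.mem_Icc (a := 0) (b := t) (by rw [h.lip.zero]; exact hs.2)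
          exact ⟨hs.1.1.le.trans this.2, this.1.trans hs.1.2.le⟩
        rw [this]; simp
      have hpq2 : max 0 p ≤ min q t := le_min (max_le hpq'.2 hpq.le) (max_le ht.1 hpq'.1)
      have hsub : τ ⁻¹' Ioo p q ∩ Icc 0 (σ t) ⊆ Icc (σ (max 0 p)) (σ (min q t)) := by
        rintro s ⟨hs1, hs2⟩
        constructor
        · rcases le_total 0 p with hp | hp
          · rw [max_eq_right hp]
            by_contra! hlt
            have := h.lip.mono hlt.le
            rw [h.lip.inv] at this
            exact not_lt.2 this hs1.1
          · rw [max_eq_left hp, h.lip.zero]; exact hs2.1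
        · rcases le_total q t with hq | hq
          · rw [min_eq_left hq]
            by_contra! hlt
            have := h.lip.mono hlt.le
            rw [h.lip.inv] at this
            exact not_lt.2 this hs1.2
          · rw [min_eq_right hq]; exact hs2.2
      refine (lintegral_mono_set hsub).trans ?_
      rw [← restrict_Ioo_eq_restrict_Icc]
      refine (hc _ _ _ (le_max_left _ _) hpq2 ((min_le_right _ _).trans ht.2)
        (hlim _ _ (le_max_left _ _) hpq2 (min_le_right _ _))).trans ?_
      have h1 : N (min q t) ≤ N q := hN (min_le_left _ _)
      have h2 : N p ≤ N (max 0 p) := hN (le_max_right _ _)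
      have h3 : min q t ≤ q := min_le_left _ _
      have h4 : p ≤ max 0 p := le_max_right _ _
      gcongr
    have hA' : MeasurableSet (Icc 0 t ∩ A) := measurableSet_Icc.inter hA
    have h1 := hle (Icc 0 t ∩ A)
    rw [hν _ hA', Measure.add_apply, Measure.smul_apply,
      measure_mono_null inter_subset_right hA0, smul_zero, add_zero] at h1
    refine le_trans (lintegral_mono_set ?_) h1
    rintro s ⟨hs1, hs2⟩
    exact ⟨⟨h.lip.mem_Icc (by rwa [h.lip.zero]), hs2⟩, hs1⟩
  have hlimD : ∀ s, Tendsto (fun j : ℕ => max (min (S'.slope (τ s) (θ s)) ((j : ℝ≥0) : ℝ≥0∞))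
      (κ j : ℝ≥0∞)) atTop (𝓝 (max (S'.slope (τ s) (θ s)) L)) := by
    intro s
    have h1 : Tendsto (fun j : ℕ => ((j : ℝ≥0) : ℝ≥0∞)) atTop (𝓝 ⊤) := by
      simpa using ENNReal.tendsto_nat_nhds_top
    have := (tendsto_const_nhds (x := S'.slope (τ s) (θ s)).min h1).max
      (ENNReal.tendsto_coe.2 hκlim)
    rwa [min_eq_left le_top] at this
  calc _ = ∫⁻ s in Icc 0 (σ t) ∩ τ ⁻¹' A, liminf (fun j : ℕ =>
        max (min (S'.slope (τ s) (θ s)) ((j : ℝ≥0) : ℝ≥0∞)) (κ j : ℝ≥0∞)) atTop :=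
        lintegral_congr fun s => (hlimD s).liminf_eq.symm
    _ ≤ liminf (fun j : ℕ => ∫⁻ s in Icc 0 (σ t) ∩ τ ⁻¹' A,
        max (min (S'.slope (τ s) (θ s)) ((j : ℝ≥0) : ℝ≥0∞)) (κ j : ℝ≥0∞)) atTop :=
        lintegral_liminf_le' fun j => ((hFm.mono_set inter_subset_left).min
          aemeasurable_const).max aemeasurable_const
    _ ≤ _ := liminf_le_of_le (by isBoundedDefault) fun b hb => by
        obtain ⟨j, hj⟩ := hb.exists
        exact hj.trans (hstep j)

/-- The lower bound for the dissipations. -/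
theorem dissipation_le (h : ParamApprox S S' ψn ψ L u G u' E₀ C ω τn σn θn vn τ σ θ) (k : ℕ)
    {t : ℝ} (ht : t ∈ Icc 0 T) {A : Set ℝ} (hA : MeasurableSet A) (hA0 : volume A = 0) {B : ℝ≥0}
    (hB : ∀ n, ∫⁻ r in Icc 0 t, ((ψn n ((S n).speed (u n) r).toNNReal : ℝ≥0∞)
      + slopeCost S ψn u G k n r) ≤ B) :
    (∫⁻ r in Icc 0 t, ((ψ (S'.speed u' r).toNNReal : ℝ≥0∞)
        + liminf (fun n => slopeCost S ψn u G k n r) atTop))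
      + ∫⁻ s in Icc 0 (σ t) ∩ τ ⁻¹' A, max (S'.slope (τ s) (θ s)) L ≤ B := by
  let := S'.metric
  obtain ⟨φ, hφ, N, hN, hNB, hNlim⟩ := helly_lintegral (volume.restrict (Icc 0 t)) _ B hB
  have h' := h.subseq hφ
  have hlim : ∀ a b, 0 ≤ a → a ≤ b → b ≤ t → Tendsto (fun n => ∫⁻ r in Icc a b,
      ((ψn (φ n) ((S (φ n)).speed (u (φ n)) r).toNNReal : ℝ≥0∞)
        + slopeCost (fun n => S (φ n)) (fun n => ψn (φ n)) (fun n => u (φ n)) (fun n => G (φ n))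
          k n r)) atTop (𝓝 (ENNReal.ofReal (N b - N a))) := by
    intro a b ha hab hb
    refine (hNlim a b hab).congr fun n => ?_
    rw [Measure.restrict_restrict measurableSet_Ioc, inter_eq_left.2, restrict_Ioc_eq_restrict_Icc]
    · rfl
    · exact fun x hx => ⟨ha.trans hx.1.le, hx.2.trans hb⟩
  set m : ℝ → ℝ≥0∞ := fun r => liminf (fun n => slopeCost (fun n => S (φ n)) (fun n => ψn (φ n))
    (fun n => u (φ n)) (fun n => G (φ n)) k n r) atTop with hmdef
  have hsub : Icc 0 t ⊆ Icc 0 T := Icc_subset_Icc_right ht.2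
  have hmle : ∀ a b, 0 ≤ a → a ≤ b → b ≤ t → ∫⁻ r in Icc a b, m r ≤ ENNReal.ofReal (N b - N a) := by
    intro a b ha hab hb
    rw [← (hlim a b ha hab hb).liminf_eq]
    refine (lintegral_liminf_le' fun n => (h'.aemeasurable_slopeCost k n).mono_set
      (Icc_subset_Icc ha (hb.trans ht.2))).trans (liminf_le_liminf (Eventually.of_forall fun n =>
        lintegral_mono fun r => le_add_self))
  have hdens := density_le_rnDeriv (u := u') hN (m := m) (t := t) h.diss.convex h.diss.zero
    (aemeasurable_liminf fun n => (h'.aemeasurable_slopeCost k n).mono_set hsub)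
    (ne_top_of_le_ne_top ENNReal.ofReal_ne_top (hmle 0 t le_rfl ht.1 le_rfl))
    (fun a b ha hab hb => hmle a b ha hab.le hb)
    (fun v₁ v₂ hv a b ha hab hb => h'.chord_le k ha hab.le (hb.trans ht.2)
      (hlim a b ha hab.le hb) hv)
  have hfin : ∀ᵐ r ∂volume.restrict (Icc 0 t), metricDeriv u' r < ⊤ := by
    filter_upwards [ae_restrict_of_ae_restrict_of_subset hsub h.lip.ae_metricDeriv_eq,
      ae_restrict_of_ae h.lip.ae_deriv_pos] with r h1 h2
    rw [h1]
    exact ENNReal.div_lt_top (ne_top_of_le_ne_top ENNReal.one_ne_top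
      (metricDeriv_le_one h.lip.edist_le _)) (by simpa using h2)
  have hAB : MeasurableSet (Icc 0 t \ A) := measurableSet_Icc.diff hA
  -- The density bound is used off the null set `A` and the length bound on `A`, so the two add up.
  calc _ ≤ hN.stieltjesFunction.measure (Icc 0 t \ A)
        + hN.stieltjesFunction.measure (Icc 0 t ∩ A) := by
        refine add_le_add ?_ (h'.fiber_length_le k ht hN hlim hA hA0)
        have hae : (Icc 0 t \ A : Set ℝ) =ᵐ[volume] Icc 0 t := sdiff_null_ae_eq_self hA0
        calc _ ≤ ∫⁻ r in Icc 0 t, hN.stieltjesFunction.measure.rnDeriv volume r := by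
              refine lintegral_mono_ae ?_
              filter_upwards [hdens, hfin] with r h1 h2
              refine le_trans (add_le_add le_rfl ?_) (h1 h2)
              exact hφ.tendsto_atTop.liminf_le_liminf_comp
          _ = ∫⁻ r in Icc 0 t \ A, hN.stieltjesFunction.measure.rnDeriv volume r :=
              (setLIntegral_congr hae).symm
          _ ≤ _ := Measure.setLIntegral_rnDeriv_le _
    _ = hN.stieltjesFunction.measure (Icc 0 t) := by
        rw [add_comm]; exact measure_inter_add_sdiff _ hA
    _ ≤ B := stieltjes_Icc_le hN hNB 0 t

end ParamApprox

end

noncomputable section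

/-- Measurability is given along absolutely continuous curves only; it reaches `u` through the
filled graph `(τ, θ)`, composed with `σ`. -/
theorem IsLipParam.aemeasurable_along {X : Type*} [EMetricSpace X] {T : ℝ} {u : ℝ → X} {τ σ : ℝ → ℝ}
    {θ : ℝ → X} (h : IsLipParam T u τ σ θ) {Y : Type*} [MeasurableSpace Y] {g : ℝ → X → Y}
    (hg : MeasurableAlongAC T g) :
    AEMeasurable (fun t => g t (u t)) (volume.restrict (Icc 0 T)) := by
  have h0 : σ 0 ≤ σ T := h.strictMono.monotone h.T_pos.le
  have h1 := h.aemeasurable_comp (hg _ _ τ θ h0 (h.isTimeOrderedAC h.zero.ge le_rfl))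
  refine h1.congr ?_
  filter_upwards [ae_restrict_mem measurableSet_Icc] with t ht
  rw [h.inv, h.comp' ht]

/-! ### Selections -/

/-- `L` itself must be listed: it is the right end of the admissible interval `[F, L]`, which may
reduce to this point. -/
theorem exists_dense_seq_mem (L : ℝ≥0) : ∃ q : ℕ → ℝ≥0, q 0 = L ∧
    ∀ a b : ℝ≥0∞, a < b → ∃ i, a < q i ∧ q i < b := by
  refine ⟨fun n => Nat.casesOn n L (TopologicalSpace.denseSeq ℝ≥0), rfl, fun a b hab => ?_⟩
  obtain ⟨x, hax, hxb⟩ := ENNReal.lt_iff_exists_nnreal_btwn.1 hab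
  obtain ⟨y, hxy, hyb⟩ := ENNReal.lt_iff_exists_nnreal_btwn.1 hxb
  obtain ⟨n, hn⟩ := (TopologicalSpace.denseRange_denseSeq ℝ≥0).exists_mem_open
    (isOpen_Ioo (a := x) (b := y)) (nonempty_Ioo.2 (by exact_mod_cast hxy))
  exact ⟨n + 1, hax.trans (by exact_mod_cast hn.1), lt_trans (by exact_mod_cast hn.2) hyb⟩

/-- A monotone upper semicontinuous integrand is measurable along measurable functions. -/
theorem aemeasurable_of_monotone_usc {α : Type*} [MeasurableSpace α] {ν : Measure α}
    {P : α → ℝ≥0∞ → EReal} {G : α → ℝ≥0∞} (hP : ∀ f : ℝ≥0, AEMeasurable (fun r => P r f) ν)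
    (hG : AEMeasurable G ν) (hmono : ∀ᵐ r ∂ν, Monotone (P r))
    (husc : ∀ᵐ r ∂ν, UpperSemicontinuous (P r)) (hfin : ∀ᵐ r ∂ν, G r < ⊤) :
    AEMeasurable (fun r => P r (G r)) ν := by
  obtain ⟨q, -, hq⟩ := exists_dense_seq_mem 0
  -- Monotonicity and upper semicontinuity make `P r` right-continuous, so its value at `G r < ∞` is
  -- the infimum over the dense values above.
  have hm : AEMeasurable (fun r => ⨅ i, {r | hG.mk G r < q i}.piecewise
      (fun r => (hP (q i)).mk _ r) (fun _ => ⊤) r) ν := by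
    refine Measurable.aemeasurable (Measurable.iInf fun i => Measurable.piecewise
      (measurableSet_lt hG.measurable_mk measurable_const) (hP (q i)).measurable_mk
        measurable_const)
  refine hm.congr ?_
  filter_upwards [ae_all_iff.2 fun i => (hP (q i)).ae_eq_mk, hG.ae_eq_mk, hmono, husc, hfin]
    with r h1 h2 h3 h4 h5
  refine le_antisymm (le_of_forall_gt_imp_ge_of_dense fun y hy => ?_) (le_iInf fun i => ?_)
  · have hev := h4 (G r) y hy
    obtain ⟨b, hb, hsub⟩ := (mem_nhdsGT_iff_exists_Ioo_subset' h5).1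
      (mem_nhdsWithin_of_mem_nhds hev)
    obtain ⟨i, hi1, hi2⟩ := hq _ _ hb
    refine iInf_le_of_le i ?_
    have hmem : r ∈ {r | hG.mk G r < q i} := by
      change hG.mk G r < q i
      rwa [← h2]
    rw [piecewise_eq_of_mem _ _ _ hmem, ← h1 i]
    exact (hsub ⟨hi1, hi2⟩ : P r (q i) < y).le
  · by_cases hmem : r ∈ {r | hG.mk G r < q i}
    · rw [piecewise_eq_of_mem _ _ _ hmem, ← h1 i]
      refine h3 ?_
      rw [h2]
      exact (show hG.mk G r < q i from hmem).le
    · rw [piecewise_eq_of_notMem _ _ _ hmem]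
      exact le_top

theorem lowerSemicontinuous_dual (ψ : ℝ≥0 → ℝ≥0) : LowerSemicontinuous (dual ψ) := by
  refine lowerSemicontinuous_iSup fun v => Continuous.lowerSemicontinuous ?_
  exact (ENNReal.continuous_sub_right _).comp (ENNReal.continuous_mul_const ENNReal.coe_ne_top)

/-- The cost `ψ*(g) + (p - P(g))⁺` is lower semicontinuous, hence has a minimizer in `[F, L]`. For
measurability its minimum is computed on a sequence. This loses nothing: `ψ*` is right-continuous
below `L` and `(p - P)⁺` is nonincreasing, so a competitor `g < L` can be moved slightly up. -/
theorem IsMetricDissipation.exists_selection {ψ : ℝ≥0 → ℝ≥0} {L : ℝ≥0}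
    (h : IsMetricDissipation ψ (L : ℝ≥0∞)) {α : Type*} [MeasurableSpace α] {ν : Measure α}
    {P : α → ℝ≥0∞ → EReal} {F : α → ℝ≥0∞} {p : α → ℝ≥0∞}
    (hP : ∀ f : ℝ≥0, AEMeasurable (fun r => P r f) ν) (hF : AEMeasurable F ν)
    (hp : AEMeasurable p ν) (hmono : ∀ᵐ r ∂ν, Monotone (P r))
    (husc : ∀ᵐ r ∂ν, UpperSemicontinuous (P r)) (hFL : ∀ᵐ r ∂ν, F r ≤ L) (hfin : ∀ᵐ r ∂ν, p r < ⊤) :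
    ∃ G : α → ℝ≥0∞, Measurable G ∧ ∀ᵐ r ∂ν, F r ≤ G r ∧ G r ≤ L ∧ ∀ g : ℝ≥0, F r ≤ g → g ≤ L →
      dual ψ (G r) + ((p r : EReal) - P r (G r)).toENNReal
        ≤ dual ψ g + ((p r : EReal) - P r g).toENNReal := by
  obtain ⟨q, hq0, hq⟩ := exists_dense_seq_mem L
  let c : ℕ → α → ℝ≥0∞ := fun i r =>
    dual ψ (q i) + (((hp.mk p r : ℝ≥0∞) : EReal) - (hP (q i)).mk _ r).toENNReal
  have hc : ∀ i, Measurable (c i) := fun i => measurable_const.add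
    (EReal.continuous_toENNReal.measurable.comp (hp.measurable_mk.coe_ereal_ennreal.sub (hP (q i)).measurable_mk))
  let A : ℕ → Set α := fun i => {r | hF.mk F r ≤ q i ∧ q i ≤ L}
  have hA : ∀ i, MeasurableSet (A i) := fun i =>
    (measurableSet_le hF.measurable_mk measurable_const).inter (MeasurableSet.const _)
  let m : α → ℝ≥0∞ := fun r => ⨅ i, (A i).piecewise (c i) (fun _ => ⊤) r
  have hm : Measurable m :=
    Measurable.iInf fun i => Measurable.piecewise (hA i) (hc i) measurable_const
  let ε : ℕ → ℝ≥0∞ := fun n => (n : ℝ≥0∞)⁻¹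
  let A' : ℕ → ℕ → Set α := fun n i => A i ∩ {r | c i r ≤ m r + ε n}
  have hA' : ∀ n i, MeasurableSet (A' n i) := fun n i =>
    (hA i).inter (measurableSet_le (hc i) (hm.add measurable_const))
  -- The infimum of the `ε n`-minimizers in the sequence: measurable, again an `ε n`-minimizer by
  -- closedness, and increasing in `n`; so its supremum is a minimizer.
  let Gn : ℕ → α → ℝ≥0∞ := fun n r => ⨅ i, (A' n i).piecewise (fun _ => (q i : ℝ≥0∞)) (fun _ => ⊤) r
  have hGn : ∀ n, Measurable (Gn n) := fun n =>
    Measurable.iInf fun i => Measurable.piecewise (hA' n i) measurable_const measurable_const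
  refine ⟨fun r => ⨆ n, Gn n r, Measurable.iSup hGn, ?_⟩
  filter_upwards [ae_all_iff.2 fun i => (hP (q i)).ae_eq_mk, hF.ae_eq_mk, hp.ae_eq_mk, hmono, husc,
    hFL, hfin] with r h1 h2 h3 h4 h5 h6 h7
  set f : ℝ≥0∞ → ℝ≥0∞ := fun g => dual ψ g + ((p r : EReal) - P r g).toENNReal with hf
  have hcf : ∀ i, c i r = f (q i) := fun i => by simp only [c, hf]; rw [← h1 i, ← h3]
  have hAi : ∀ i, r ∈ A i ↔ F r ≤ q i ∧ q i ≤ L := fun i => by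
    simp only [A, mem_ofPred_eq]; rw [← h2]
  have hpr : (p r : EReal) = ((p r).toReal : EReal) := by
    rw [← EReal.coe_toReal (x := (p r : EReal)) (by simpa using h7.ne) (by simp)]
    simp
  have hlsc : LowerSemicontinuous f := by
    refine (lowerSemicontinuous_dual ψ).add ?_
    rw [hpr]
    exact (continuous_sub_toENNReal _).comp_upperSemicontinuous_antitone h5
      (antitone_sub_toENNReal _)
  have hmle : ∀ i, F r ≤ q i → q i ≤ L → m r ≤ f (q i) := fun i hi1 hi2 => by
    refine iInf_le_of_le i ?_
    rw [piecewise_eq_of_mem _ _ _ ((hAi i).2 ⟨hi1, hi2⟩), hcf]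
  have hmf : ∀ g : ℝ≥0, F r ≤ g → g ≤ L → m r ≤ f g := by
    intro g hg1 hg2
    rcases hg2.eq_or_lt with rfl | hlt
    · rw [← hq0]; exact hmle 0 (by rwa [hq0]) hq0.le
    refine le_of_forall_gt_imp_ge_of_dense fun y hy => ?_
    have hP' : ((p r : EReal) - P r g).toENNReal ≠ ⊤ :=
      ne_top_of_le_ne_top hy.ne_top (le_add_self.trans le_rfl)
    obtain ⟨x, hx1, hx2, hx3⟩ := h.exists_dual_lt hlt
      (c := y - ((p r : EReal) - P r g).toENNReal) (lt_tsub_iff_right.2 hy)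
    obtain ⟨i, hi1, hi2⟩ := hq g x (by exact_mod_cast hx1)
    have hi2' : q i < x := by exact_mod_cast hi2
    refine (hmle i (hg1.trans hi1.le) (hi2'.trans hx2).le).trans ?_
    calc f (q i) ≤ dual ψ x + ((p r : EReal) - P r g).toENNReal := by
          refine add_le_add (dual_mono ψ hi2.le) ?_
          rw [hpr]
          exact antitone_sub_toENNReal _ (h4 hi1.le)
      _ ≤ y := add_le_of_le_tsub_right_of_le (le_add_self.trans hy.le) hx3.le
  have hclosed : ∀ n, IsClosed {x : ℝ≥0∞ | F r ≤ x ∧ x ≤ L ∧ f x ≤ m r + ε n} := fun n =>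
    (isClosed_le continuous_const continuous_id).inter
      ((isClosed_le continuous_id continuous_const).inter (hlsc.isClosed_preimage _))
  have hmem : ∀ n, Gn n r ∈ {x : ℝ≥0∞ | F r ≤ x ∧ x ≤ L ∧ f x ≤ m r + ε n} := by
    intro n
    have heq : Gn n r = sInf {x : ℝ≥0∞ | ∃ i, r ∈ A' n i ∧ x = q i} := by
      refine le_antisymm (le_sInf ?_) (le_iInf fun i => ?_)
      · rintro x ⟨i, hi, rfl⟩
        refine iInf_le_of_le i ?_
        rw [piecewise_eq_of_mem _ _ _ hi]
      · by_cases hi : r ∈ A' n i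
        · rw [piecewise_eq_of_mem _ _ _ hi]; exact sInf_le ⟨i, hi, rfl⟩
        · rw [piecewise_eq_of_notMem _ _ _ hi]; exact le_top
    have hne : {x : ℝ≥0∞ | ∃ i, r ∈ A' n i ∧ x = q i}.Nonempty := by
      rcases eq_or_ne (m r) ⊤ with htop | htop
      · refine ⟨q 0, 0, ⟨(hAi 0).2 ⟨by rwa [hq0], hq0.le⟩, ?_⟩, rfl⟩
        simp [htop]
      · have hlt : m r < m r + ε n := ENNReal.lt_add_right htop (by simp [ε])
        obtain ⟨i, hi⟩ := iInf_lt_iff.1 hlt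
        by_cases hir : r ∈ A i
        · rw [piecewise_eq_of_mem _ _ _ hir] at hi
          exact ⟨q i, i, ⟨hir, hi.le⟩, rfl⟩
        · rw [piecewise_eq_of_notMem _ _ _ hir] at hi
          exact absurd hi not_top_lt
    rw [heq]
    refine (hclosed n).closure_subset_iff.2 ?_ (csInf_mem_closure hne (OrderBot.bddBelow _))
    rintro x ⟨i, ⟨hi1, hi2⟩, rfl⟩
    have hi2 : c i r ≤ m r + ε n := hi2
    rw [hcf] at hi2
    exact ⟨((hAi i).1 hi1).1, by exact_mod_cast ((hAi i).1 hi1).2, hi2⟩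
  have hanti : Antitone ε := fun a b hab => ENNReal.inv_le_inv.2 (by exact_mod_cast hab)
  have hmonoG : Monotone fun n => Gn n r := by
    intro a b hab
    refine iInf_mono fun i => ?_
    by_cases hi : r ∈ A' b i
    · have hi' : r ∈ A' a i := ⟨hi.1, (show c i r ≤ m r + ε b from hi.2).trans
        (add_le_add le_rfl (hanti hab))⟩
      rw [piecewise_eq_of_mem _ _ _ hi, piecewise_eq_of_mem _ _ _ hi']
    · rw [piecewise_eq_of_notMem _ _ _ hi]; exact le_top
  have hlim : ∀ n, (⨆ n, Gn n r) ∈ {x : ℝ≥0∞ | F r ≤ x ∧ x ≤ L ∧ f x ≤ m r + ε n} := by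
    intro n
    refine (hclosed n).mem_of_tendsto (tendsto_atTop_iSup hmonoG) ?_
    filter_upwards [eventually_ge_atTop n] with k hk
    obtain ⟨a1, a2, a3⟩ := hmem k
    exact ⟨a1, a2, a3.trans (add_le_add le_rfl (hanti hk))⟩
  refine ⟨(hlim 0).1, (hlim 0).2.1, fun g hg1 hg2 => le_trans ?_ (hmf g hg1 hg2)⟩
  have : Tendsto (fun n => m r + ε n) atTop (𝓝 (m r + 0)) :=
    tendsto_const_nhds.add ENNReal.tendsto_inv_nat_nhds_zero
  rw [add_zero] at this
  exact ge_of_tendsto' this fun n => (hlim n).2.2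

end

noncomputable section

/-! ### The fibers of the parametrization over the jumps -/

theorem setLIntegral_Icc_add_Icc (g : ℝ → ℝ≥0∞) {a b c : ℝ} (hab : a ≤ b) (hbc : b ≤ c) :
    ∫⁻ s in Icc a c, g s = (∫⁻ s in Icc a b, g s) + ∫⁻ s in Icc b c, g s := by
  rw [← Icc_union_Ioc_eq_Icc hab hbc, lintegral_union measurableSet_Ioc,
    restrict_Ioc_eq_restrict_Icc]
  exact disjoint_left.2 fun x hx hx' => not_lt.2 hx.2 hx'.1

theorem transitionCost_le {X : Type*} [EMetricSpace X] (f : X → ℝ≥0∞) {θ : ℝ → X} {a b : ℝ}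
    (hab : a ≤ b) (h : IsAC θ a b) :
    transitionCost f (θ a) (θ b) ≤ ∫⁻ s in Icc a b, f (θ s) * metricDeriv θ s := by
  unfold transitionCost
  exact iInf_le_of_le a (iInf_le_of_le b (iInf_le_of_le θ (iInf_le_of_le ⟨hab, h, rfl, rfl⟩ le_rfl)))

theorem transitionCost_self {X : Type*} [EMetricSpace X] (f : X → ℝ≥0∞) (x : X) :
    transitionCost f x x = 0 := by
  refine le_antisymm ((transitionCost_le f (θ := fun _ => x) (le_refl (0 : ℝ))
    ⟨0, measurable_const, by simp, fun _ _ _ _ _ => by simp⟩).trans ?_) zero_le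
  simp

namespace IsLipParam

variable {X : Type*} [EMetricSpace X] {T : ℝ} {u : ℝ → X} {τ σ : ℝ → ℝ} {θ : ℝ → X}

theorem rightLim_le (h : IsLipParam T u τ σ θ) {a b : ℝ} (hab : a < b) :
    Function.rightLim σ a ≤ σ b := h.strictMono.monotone.rightLim_le hab

theorem le_leftLim (h : IsLipParam T u τ σ θ) {a b : ℝ} (hab : a < b) :
    σ a ≤ Function.leftLim σ b := h.strictMono.monotone.le_leftLim hab

theorem setLIntegral_right (h : IsLipParam T u τ σ θ) (g : ℝ → ℝ≥0∞) {a b : ℝ} (hab : a < b) :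
    ∫⁻ s in Icc (σ a) (σ b) ∩ τ ⁻¹' (gaps σ ∩ {a}), g s
      = ∫⁻ s in Icc (σ a) (Function.rightLim σ a), g s := by
  by_cases ha : a ∈ gaps σ
  · rw [inter_eq_right.2 (singleton_subset_iff.2 ha)]
    congr 2
    ext s
    have h1 := h.leftLim_le a
    have h2 := h.rightLim_le hab
    simp only [mem_inter_iff, mem_preimage, mem_singleton_iff, h.eq_iff]
    exact ⟨fun hs => ⟨hs.1.1, hs.2.2⟩, fun hs => ⟨⟨hs.1, hs.2.trans h2⟩, h1.trans hs.1, hs.2⟩⟩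
  · rw [inter_singleton_eq_empty.2 ha, h.rightLim_eq_of_notMem ha]
    simp

theorem setLIntegral_left (h : IsLipParam T u τ σ θ) (g : ℝ → ℝ≥0∞) {a b : ℝ} (hab : a < b) :
    ∫⁻ s in Icc (σ a) (σ b) ∩ τ ⁻¹' (gaps σ ∩ {b}), g s
      = ∫⁻ s in Icc (Function.leftLim σ b) (σ b), g s := by
  by_cases hb : b ∈ gaps σ
  · rw [inter_eq_right.2 (singleton_subset_iff.2 hb)]
    congr 2
    ext s
    have h1 := h.le_rightLim b
    have h2 := h.le_leftLim hab
    simp only [mem_inter_iff, mem_preimage, mem_singleton_iff, h.eq_iff]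
    exact ⟨fun hs => ⟨hs.2.1, hs.1.2⟩, fun hs => ⟨⟨h2.trans hs.1, hs.2⟩, hs.1, hs.2.trans h1⟩⟩
  · rw [inter_singleton_eq_empty.2 hb, h.leftLim_eq_of_notMem hb]
    simp

theorem setLIntegral_middle (h : IsLipParam T u τ σ θ) (g : ℝ → ℝ≥0∞) {a b : ℝ} :
    ∫⁻ s in Icc (σ a) (σ b) ∩ τ ⁻¹' (gaps σ ∩ Ioo a b), g s
      = ∑' r : ↥(gaps σ ∩ Ioo a b), ((∫⁻ s in Icc (Function.leftLim σ r) (σ r), g s)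
        + ∫⁻ s in Icc (σ r) (Function.rightLim σ r), g s) := by
  have hc : (gaps σ ∩ Ioo a b).Countable := h.countable_gaps.mono inter_subset_left
  have hset : Icc (σ a) (σ b) ∩ τ ⁻¹' (gaps σ ∩ Ioo a b) = ⋃ r ∈ gaps σ ∩ Ioo a b, τ ⁻¹' {r} := by
    ext s
    simp only [mem_inter_iff, mem_preimage, mem_iUnion, mem_singleton_iff, exists_prop,
      exists_eq_right']
    refine ⟨fun hs => hs.2, fun hs => ⟨⟨?_, ?_⟩, hs⟩⟩
    · by_contra! hlt
      have := h.mono hlt.le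
      rw [h.inv] at this
      exact not_lt.2 this hs.2.1
    · by_contra! hlt
      have := h.mono hlt.le
      rw [h.inv] at this
      exact not_lt.2 this hs.2.2
  rw [hset, lintegral_biUnion hc (fun r _ => h.continuous.measurable (measurableSet_singleton r))]
  · refine tsum_congr fun r => ?_
    rw [← setLIntegral_Icc_add_Icc g (h.leftLim_le r) (h.le_rightLim r)]
    congr 2
    ext s
    exact h.eq_iff
  · intro r _ r' _ hne
    refine disjoint_left.2 fun s hs hs' => hne ?_
    exact (show τ s = r from hs).symm.trans hs'

/-- The integral over the fibers of the gaps is the sum of the integrals over the half fibers. -/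
theorem setLIntegral_gaps (h : IsLipParam T u τ σ θ) (g : ℝ → ℝ≥0∞) {a b : ℝ} (hab : a < b) :
    ∫⁻ s in Icc (σ a) (σ b) ∩ τ ⁻¹' gaps σ, g s
      = (∫⁻ s in Icc (σ a) (Function.rightLim σ a), g s)
        + (∑' r : ↥(gaps σ ∩ Ioo a b), ((∫⁻ s in Icc (Function.leftLim σ r) (σ r), g s)
          + ∫⁻ s in Icc (σ r) (Function.rightLim σ r), g s))
        + ∫⁻ s in Icc (Function.leftLim σ b) (σ b), g s := by
  rw [← h.setLIntegral_right g hab, ← h.setLIntegral_left g hab, ← h.setLIntegral_middle g]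
  have hm : ∀ B, MeasurableSet B → MeasurableSet (Icc (σ a) (σ b) ∩ τ ⁻¹' (gaps σ ∩ B)) :=
    fun B hB => measurableSet_Icc.inter
      (h.continuous.measurable (h.countable_gaps.measurableSet.inter hB))
  rw [← lintegral_union (hm _ measurableSet_Ioo), ← lintegral_union (hm _ (measurableSet_singleton b))]
  · congr 2
    rw [← inter_union_distrib_left, ← inter_union_distrib_left, ← preimage_union, ← preimage_union,
      ← inter_union_distrib_left, ← inter_union_distrib_left]
    ext s
    simp only [mem_inter_iff, mem_preimage, mem_union, mem_singleton_iff, mem_Ioo]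
    refine ⟨fun hs => ⟨hs.1, hs.2, ?_⟩, fun hs => ⟨hs.1, hs.2.1⟩⟩
    have hst := h.mem_Icc hs.1
    rcases hst.1.eq_or_lt with h1 | h1
    · exact Or.inl (Or.inl h1.symm)
    rcases hst.2.eq_or_lt with h2 | h2
    · exact Or.inr h2
    · exact Or.inl (Or.inr ⟨h1, h2⟩)
  · refine disjoint_left.2 fun s hs hs' => ?_
    have hb : τ s = b := hs'.2.2
    rcases hs with hs | hs
    · exact hab.ne ((show τ s = a from hs.2.2).symm.trans hb)
    · exact hs.2.2.2.ne hb
  · refine disjoint_left.2 fun s hs hs' => ?_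
    exact hs'.2.2.1.ne' hs.2.2

/-- The parameter dominates the arc length, as `θ` has speed at most one. -/
theorem transitionCost_le_setLIntegral (h : IsLipParam T u τ σ θ) (f : X → ℝ≥0∞) {a b : ℝ}
    (hab : a ≤ b) : transitionCost f (θ a) (θ b) ≤ ∫⁻ s in Icc a b, f (θ s) := by
  refine (transitionCost_le f hab (h.ac a b)).trans (lintegral_mono fun s => ?_)
  exact (mul_le_mul_right (metricDeriv_le_one h.edist_le s) _).trans_eq (mul_one _)

/-- The jump functional is controlled by the weighted length of the fibers. -/
theorem jumpCost_le (h : IsLipParam T u τ σ θ) (f : ℝ → X → ℝ≥0∞) {a b : ℝ} (ha : 0 ≤ a)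
    (hb : b ≤ T) :
    jumpCost T f u a b ≤ ∫⁻ s in Icc (σ a) (σ b) ∩ τ ⁻¹' gaps σ, f (τ s) (θ s) := by
  unfold jumpCost
  split_ifs with hab
  swap
  · exact zero_le
  have hfib : ∀ r c d, Icc c d ⊆ Icc (Function.leftLim σ r) (Function.rightLim σ r) → c ≤ d →
      transitionCost (f r) (θ c) (θ d) ≤ ∫⁻ s in Icc c d, f (τ s) (θ s) := by
    intro r c d hsub hcd
    refine (h.transitionCost_le_setLIntegral (f r) hcd).trans_eq ?_
    refine setLIntegral_congr_fun measurableSet_Icc fun s hs => ?_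
    have : τ s = r := h.eq_iff.2 (hsub hs)
    simp only [this]
  have hleft : ∀ r ∈ Icc 0 T, transitionCost (f r) (limL T u r) (u r)
      ≤ ∫⁻ s in Icc (Function.leftLim σ r) (σ r), f (τ s) (θ s) := fun r hr => by
    rw [h.limL_eq, ← h.comp' hr]
    exact hfib r _ _ (Icc_subset_Icc_right (h.le_rightLim r)) (h.leftLim_le r)
  have hright : ∀ r ∈ Icc 0 T, transitionCost (f r) (u r) (limR T u r)
      ≤ ∫⁻ s in Icc (σ r) (Function.rightLim σ r), f (τ s) (θ s) := fun r hr => by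
    rw [h.limR_eq, ← h.comp' hr]
    exact hfib r _ _ (Icc_subset_Icc_left (h.leftLim_le r)) (h.le_rightLim r)
  rw [h.setLIntegral_gaps _ hab]
  refine add_le_add (add_le_add (hright a ⟨ha, hab.le.trans hb⟩) ?_) (hleft b ⟨ha.trans hab.le, hb⟩)
  have hsub : jumpSet T u ∩ Ioo a b ⊆ gaps σ ∩ Ioo a b := inter_subset_inter_left _ h.jumpSet_subset
  refine le_trans (ENNReal.tsum_le_tsum fun r => ?_) (ENNReal.tsum_mono_subtype (fun r : ℝ =>
    (∫⁻ s in Icc (Function.leftLim σ r) (σ r), f (τ s) (θ s))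
      + ∫⁻ s in Icc (σ r) (Function.rightLim σ r), f (τ s) (θ s)) hsub)
  exact add_le_add (hleft r r.2.1.1) (hright r r.2.1.1)

/-- If the half fibers are optimal transitions, then the jump functional controls the weighted
length of the fibers. -/
theorem le_jumpCost (h : IsLipParam T u τ σ θ) (f : ℝ → X → ℝ≥0∞) (g : ℝ → ℝ≥0∞) {a b : ℝ}
    (ha : 0 ≤ a) (hab : a < b) (hb : b ≤ T)
    (hleft : ∀ r, a < r → r ≤ b → ∫⁻ s in Icc (Function.leftLim σ r) (σ r), g s
      ≤ transitionCost (f r) (limL T u r) (u r))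
    (hright : ∀ r, a ≤ r → r < b → ∫⁻ s in Icc (σ r) (Function.rightLim σ r), g s
      ≤ transitionCost (f r) (u r) (limR T u r)) :
    ∫⁻ s in Icc (σ a) (σ b) ∩ τ ⁻¹' gaps σ, g s ≤ jumpCost T f u a b := by
  rw [jumpCost, if_pos hab, h.setLIntegral_gaps _ hab]
  refine add_le_add (add_le_add (hright a le_rfl hab) ?_) (hleft b hab le_rfl)
  calc _ ≤ ∑' r : ↥(gaps σ ∩ Ioo a b), (transitionCost (f r) (limL T u r) (u r)
        + transitionCost (f r) (u r) (limR T u r)) := ENNReal.tsum_le_tsum fun r =>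
        add_le_add (hleft r r.2.2.1 r.2.2.2.le) (hright r r.2.2.1.le r.2.2.2)
    _ = ∑' r : ↥(jumpSet T u ∩ Ioo a b), (transitionCost (f r) (limL T u r) (u r)
        + transitionCost (f r) (u r) (limR T u r)) := by
      rw [tsum_subtype (gaps σ ∩ Ioo a b) fun r => transitionCost (f r) (limL T u r) (u r)
        + transitionCost (f r) (u r) (limR T u r), tsum_subtype (jumpSet T u ∩ Ioo a b) fun r =>
        transitionCost (f r) (limL T u r) (u r) + transitionCost (f r) (u r) (limR T u r)]
      refine tsum_congr fun r => ?_
      by_cases hr : r ∈ gaps σ ∩ Ioo a b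
      · by_cases hj : r ∈ jumpSet T u
        · rw [indicator_of_mem hr, indicator_of_mem (show r ∈ jumpSet T u ∩ Ioo a b from ⟨hj, hr.2⟩)]
        -- At a gap that is not a jump both one-sided limits equal `u r`, so the transitions cost
        -- nothing.
        · rw [indicator_of_mem hr, indicator_of_notMem fun hr' => hj hr'.1]
          have hm : r ∈ Icc 0 T := ⟨ha.trans hr.2.1.le, hr.2.2.le.trans hb⟩
          have hj' : u r = limL T u r ∧ u r = limR T u r := by
            by_contra hcon
            exact hj ⟨hm, not_and_or.1 hcon⟩
          rw [← hj'.1, ← hj'.2, transitionCost_self, add_zero]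
      · rw [indicator_of_notMem hr, indicator_of_notMem fun hr' => hr ⟨h.jumpSet_subset hr'.1, hr'.2⟩]

/-! #### The Cantor part -/

/-- The image of Lebesgue measure under `τ` is `dσ`, and the increments of `σ` dominate those of the
variation function. -/
theorem variationMeasure_le (h : IsLipParam T u τ σ θ) :
    variationMeasure T u ≤ (volume : Measure ℝ).map τ := by
  have hσ := h.strictMono.monotone
  have hV := variationFun_monotone T u h.boundedVariationOn
  have hmap : (volume : Measure ℝ).map τ = hσ.stieltjesFunction.measure := by
    refine (Measure.ext_of_Ioc _ _ fun a b hab => ?_).symm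
    rw [Measure.map_apply h.continuous.measurable measurableSet_Ioc, h.preimage_Ioc,
      StieltjesFunction.measure_Ioc, Real.volume_Ioc]
    rfl
  rw [hmap, variationMeasure_eq h.boundedVariationOn]
  refine le_stieltjes_measure _ _ fun a b hab => ?_
  rw [StieltjesFunction.measure_Ioc]
  refine ENNReal.ofReal_le_ofReal ?_
  simp only [Monotone.stieltjesFunction_eq]
  have h1 : ∀ a' ∈ Ioo a b, Function.rightLim (variationFun T u) b - variationFun T u a'
      ≤ Function.rightLim σ b - σ a' := by
    intro a' ha'
    refine le_of_tendsto_of_tendsto ((hV.tendsto_rightLim b).sub_const _)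
      ((hσ.tendsto_rightLim b).sub_const _) ?_
    filter_upwards [self_mem_nhdsWithin] with q hq
    exact h.variationFun_sub_le (ha'.2.trans hq).le
  refine le_of_tendsto_of_tendsto ((hV.tendsto_rightLim a).const_sub _)
      ((hσ.tendsto_rightLim a).const_sub _) ?_
  filter_upwards [Ioo_mem_nhdsGT hab] with a' ha' using h1 a' ha'

/-- Converts Cantor mass into parameter length, where the weight `max(F, L) ≥ L` is available. The
gaps can be dropped because the Cantor part has no atoms. -/
theorem cantorMeasure_le_volume (h : IsLipParam T u τ σ θ) {N : Set ℝ} (hN : MeasurableSet N)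
    (hcN : cantorMeasure T u Nᶜ = 0) (t : ℝ) :
    cantorMeasure T u (Icc 0 t) ≤ volume (Icc 0 (σ t) ∩ τ ⁻¹' (N \ gaps σ)) := by
  have hg := h.cantorMeasure_countable h.countable_gaps
  have hm : MeasurableSet (Icc 0 t ∩ (N \ gaps σ)) :=
    measurableSet_Icc.inter (hN.diff h.countable_gaps.measurableSet)
  calc cantorMeasure T u (Icc 0 t)
      ≤ cantorMeasure T u ((Icc 0 t ∩ (N \ gaps σ)) ∪ (Nᶜ ∪ gaps σ)) := by
        refine measure_mono fun x hx => ?_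
        by_cases h1 : x ∈ N
        · by_cases h2 : x ∈ gaps σ
          · exact Or.inr (Or.inr h2)
          · exact Or.inl ⟨hx, h1, h2⟩
        · exact Or.inr (Or.inl h1)
    _ ≤ cantorMeasure T u (Icc 0 t ∩ (N \ gaps σ)) := by
        refine (measure_union_le _ _).trans_eq ?_
        rw [measure_union_null hcN hg, add_zero]
    _ ≤ variationMeasure T u (Icc 0 t ∩ (N \ gaps σ)) := cantorMeasure_le T u _
    _ ≤ (volume : Measure ℝ).map τ (Icc 0 t ∩ (N \ gaps σ)) := h.variationMeasure_le _
    _ = volume (τ ⁻¹' (Icc 0 t ∩ (N \ gaps σ))) := Measure.map_apply h.continuous.measurable hm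
    _ ≤ _ := by
        refine measure_mono fun s hs => ⟨?_, hs.2⟩
        rw [← h.inv' hs.2.2, ← h.zero]
        exact ⟨h.strictMono.monotone hs.1.1, h.strictMono.monotone hs.1.2⟩

end IsLipParam

end

noncomputable section

/-! ### Extended real arithmetic -/

theorem le_coe_toENNReal (x : EReal) : x ≤ (x.toENNReal : EReal) := by
  rw [EReal.coe_toENNReal_eq_max]
  exact le_max_right _ _

/-- For finite `y ≤ k` this is an equality; for `y > k` the left side is `k - y + p ≤ p`. It trades
the truncation level `k` for the majorant `p`, which does not depend on `k`. -/
theorem add_toENNReal_sub_le {k : ℝ} (hk : 0 ≤ k) {p : ℝ≥0∞} (hp : p ≠ ⊤) {y : EReal}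
    (hy : y ≤ (p : EReal)) :
    ENNReal.ofReal k + ((p : EReal) - y).toENNReal ≤ ((k : EReal) - y).toENNReal + p := by
  lift p to ℝ≥0 using hp
  induction y with
  | bot => simp
  | top => simp at hy
  | coe y =>
    have e : ((p : ℝ≥0∞) : EReal) = ((p : ℝ) : EReal) := rfl
    rw [e] at hy ⊢
    have hy' : y ≤ p := by exact_mod_cast hy
    rw [← EReal.coe_sub, ← EReal.coe_sub, EReal.toENNReal_of_ne_top (EReal.coe_ne_top _),
      EReal.toENNReal_of_ne_top (EReal.coe_ne_top _), EReal.toReal_coe, EReal.toReal_coe,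
      ← ENNReal.ofReal_add hk (by linarith), ← ENNReal.ofReal_coe_nnreal (p := p)]
    refine le_trans (ENNReal.ofReal_le_ofReal ?_) ENNReal.ofReal_add_le
    linarith

theorem toENNReal_sub_add {p : ℝ≥0∞} (hp : p ≠ ⊤) {y : EReal} (hy : y ≤ (p : EReal)) :
    ((p : EReal) - y).toENNReal + y.toENNReal = p + (-y).toENNReal := by
  lift p to ℝ≥0 using hp
  induction y with
  | bot => simp
  | top => simp at hy
  | coe y =>
    have e : ((p : ℝ≥0∞) : EReal) = ((p : ℝ) : EReal) := rfl
    rw [e] at hy ⊢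
    have hy' : y ≤ p := by exact_mod_cast hy
    rw [← EReal.coe_sub, ← EReal.coe_neg, EReal.toENNReal_of_ne_top (EReal.coe_ne_top _),
      EReal.toENNReal_of_ne_top (EReal.coe_ne_top _), EReal.toENNReal_of_ne_top (EReal.coe_ne_top _),
      EReal.toReal_coe, EReal.toReal_coe, EReal.toReal_coe, ← ENNReal.ofReal_coe_nnreal (p := p)]
    rcases le_total 0 y with h | h
    · rw [← ENNReal.ofReal_add (by linarith) h, ENNReal.ofReal_of_nonpos (p := -y) (by linarith),
        add_zero, sub_add_cancel]
    · rw [← ENNReal.ofReal_add p.coe_nonneg (by linarith), ENNReal.ofReal_of_nonpos h, add_zero]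
      rfl

/-- Shifting by `c` makes both energies nonnegative, so that estimates can be carried out in `[0,
∞]`; here they return to the extended reals. -/
theorem coe_add_le_of_shifted {e E₀ c : ℝ} {D M Q : ℝ≥0∞} (he : -c ≤ e) (hE : -c ≤ E₀) (hQ : Q ≠ ⊤)
    (h : D + M + ENNReal.ofReal (e + c) ≤ ENNReal.ofReal (E₀ + c) + Q) :
    (e : EReal) + (D : EReal) ≤ (E₀ : EReal) + ((Q : EReal) - (M : EReal)) := by
  have hfin : D + M + ENNReal.ofReal (e + c) ≠ ⊤ :=
    ne_top_of_le_ne_top (ENNReal.add_ne_top.2 ⟨ENNReal.ofReal_ne_top, hQ⟩) h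
  have hDM := (ENNReal.add_ne_top.1 hfin).1
  have hD := (ENNReal.add_ne_top.1 hDM).1
  have hM := (ENNReal.add_ne_top.1 hDM).2
  lift D to ℝ≥0 using hD
  lift M to ℝ≥0 using hM
  lift Q to ℝ≥0 using hQ
  have h1 := ENNReal.toReal_mono (ENNReal.add_ne_top.2 ⟨ENNReal.ofReal_ne_top, ENNReal.coe_ne_top⟩) h
  rw [ENNReal.toReal_add hDM ENNReal.ofReal_ne_top, ENNReal.toReal_add ENNReal.coe_ne_top
    ENNReal.coe_ne_top, ENNReal.toReal_add ENNReal.ofReal_ne_top ENNReal.coe_ne_top,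
    ENNReal.toReal_ofReal (by linarith), ENNReal.toReal_ofReal (by linarith)] at h1
  simp only [ENNReal.coe_toReal] at h1
  have e1 : ∀ x : ℝ≥0, ((x : ℝ≥0∞) : EReal) = ((x : ℝ) : EReal) := fun _ => rfl
  rw [e1, e1, e1, ← EReal.coe_add, ← EReal.coe_sub, ← EReal.coe_add, EReal.coe_le_coe_iff]
  linarith

variable {X : Type*} [TopologicalSpace X] {T : ℝ} {S : ℕ → EvolutionSystem X T}
  {S' : EvolutionSystem X T} {ψn : ℕ → ℝ≥0 → ℝ≥0} {ψ : ℝ≥0 → ℝ≥0} {L : ℝ≥0} {u : ℕ → ℝ → X}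
  {G : ℕ → ℝ → ℝ≥0∞} {u' : ℝ → X} {E₀ : ℝ} {C : ℝ≥0} {ω : ℕ → ℝ≥0}

namespace Approx

theorem coe_toReal_energy (h : Approx S S' ψn ψ L u G u' E₀ C ω) (n : ℕ) {t : ℝ}
    (ht : t ∈ Icc 0 T) : (((S n).energy t (u n t)).toReal : EReal) = (S n).energy t (u n t) :=
  EReal.coe_toReal (ne_top_of_le_ne_top (EReal.coe_ne_top _) (h.energy_le n t ht))
    (ne_bot_of_le_ne_bot (EReal.coe_ne_bot _) (h.energy_ge n t ht))

theorem neg_le_toReal_energy (h : Approx S S' ψn ψ L u G u' E₀ C ω) (n : ℕ) {t : ℝ}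
    (ht : t ∈ Icc 0 T) : -(C : ℝ) ≤ ((S n).energy t (u n t)).toReal := by
  have := h.energy_ge n t ht
  rw [← h.coe_toReal_energy n ht] at this
  exact_mod_cast this

theorem toReal_energy_le (h : Approx S S' ψn ψ L u G u' E₀ C ω) (n : ℕ) {t : ℝ}
    (ht : t ∈ Icc 0 T) : ((S n).energy t (u n t)).toReal ≤ C := by
  have := h.energy_le n t ht
  rw [← h.coe_toReal_energy n ht] at this
  exact_mod_cast this

theorem tendsto_toReal_initial (h : Approx S S' ψn ψ L u G u' E₀ C ω) :
    Tendsto (fun n => ((S n).energy 0 (u n 0)).toReal) atTop (𝓝 E₀) :=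
  (EReal.tendsto_toReal (EReal.coe_ne_top _) (EReal.coe_ne_bot _)).comp h.initial

theorem neg_le_initial (h : Approx S S' ψn ψ L u G u' E₀ C ω) : -(C : ℝ) ≤ E₀ :=
  ge_of_tendsto' h.tendsto_toReal_initial fun n => h.neg_le_toReal_energy n ⟨le_rfl, h.T_pos.le⟩

theorem dissipation_le_ofReal (h : Approx S S' ψn ψ L u G u' E₀ C ω) (k n : ℕ) {t : ℝ}
    (ht : t ∈ Icc 0 T) :
    0 ≤ ((S n).energy 0 (u n 0)).toReal - ((S n).energy t (u n t)).toReal + (k * t + ω k) ∧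
    ∫⁻ r in Icc 0 t, ((ψn n ((S n).speed (u n) r).toNNReal : ℝ≥0∞) + slopeCost S ψn u G k n r)
      ≤ ENNReal.ofReal (((S n).energy 0 (u n 0)).toReal - ((S n).energy t (u n t)).toReal
        + (k * t + ω k)) := by
  have h1 := h.ineq n k t ht
  rw [← h.coe_toReal_energy n ht, ← h.coe_toReal_energy n ⟨le_rfl, h.T_pos.le⟩] at h1
  set x := ((S n).energy t (u n t)).toReal
  set y := ((S n).energy 0 (u n 0)).toReal
  change _ ∧ ∫⁻ r in Icc 0 t, ((ψn n ((S n).speed (u n) r).toNNReal : ℝ≥0∞) + (dual (ψn n) (G n r)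
        + (((k : ℝ) : EReal) - (S n).power r (u n r) (G n r)).toENNReal)) ≤ _
  set I := ∫⁻ r in Icc 0 t, ((ψn n ((S n).speed (u n) r).toNNReal : ℝ≥0∞) + (dual (ψn n) (G n r)
        + (((k : ℝ) : EReal) - (S n).power r (u n r) (G n r)).toENNReal)) with hI
  have hItop : I ≠ ⊤ := by
    intro htop
    rw [htop, EReal.coe_ennreal_top, EReal.coe_add_top, ← EReal.coe_add] at h1
    exact EReal.coe_ne_top _ (top_le_iff.1 h1)
  rw [← ENNReal.coe_toNNReal hItop] at h1 ⊢
  have h5 : x + I.toNNReal ≤ y + (k * t + ω k) := by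
    have e : ((I.toNNReal : ℝ≥0∞) : EReal) = ((I.toNNReal : ℝ) : EReal) := rfl
    rw [e, ← EReal.coe_add, ← EReal.coe_add, EReal.coe_le_coe_iff] at h1
    exact h1
  have h6 : (I.toNNReal : ℝ) ≤ y - x + (k * t + ω k) := by linarith
  refine ⟨I.toNNReal.coe_nonneg.trans h6, ?_⟩
  rw [← ENNReal.ofReal_coe_nnreal]
  exact ENNReal.ofReal_le_ofReal h6

/-- Every subsequence has a further subsequence along which the energies converge. -/
theorem exists_energy_limit (h : Approx S S' ψn ψ L u G u' E₀ C ω) {t : ℝ} (ht : t ∈ Icc 0 T) :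
    ∃ φ : ℕ → ℕ, StrictMono φ ∧ ∃ e : ℝ, S'.energy t (u' t) ≤ e ∧
      Tendsto (fun n => (S (φ n)).energy t (u (φ n) t)) atTop (𝓝 (e : EReal)) := by
  obtain ⟨e, -, φ, hφ, he⟩ := (isCompact_Icc (a := -(C : ℝ)) (b := C)).tendsto_subseq
    (x := fun n => ((S n).energy t (u n t)).toReal)
    fun n => ⟨h.neg_le_toReal_energy n ht, h.toReal_energy_le n ht⟩
  have hlim : Tendsto (fun n => (S (φ n)).energy t (u (φ n) t)) atTop (𝓝 (e : EReal)) := by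
    refine ((continuous_coe_real_ereal.tendsto e).comp he).congr fun n => ?_
    exact h.coe_toReal_energy (φ n) ht
  exact ⟨φ, hφ, e, (h.energy_lsc φ hφ t ht).trans_eq hlim.liminf_eq, hlim⟩

theorem neg_le_of_tendsto (h : Approx S S' ψn ψ L u G u' E₀ C ω) {t : ℝ} (ht : t ∈ Icc 0 T)
    {φ : ℕ → ℕ} {e : ℝ}
    (he : Tendsto (fun n => (S (φ n)).energy t (u (φ n) t)) atTop (𝓝 (e : EReal))) :
    -(C : ℝ) ≤ e := by
  have := ge_of_tendsto' he fun n => h.energy_ge (φ n) t ht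
  exact_mod_cast this

end Approx

namespace ParamApprox

variable {τn σn : ℕ → ℝ → ℝ} {θn : ℕ → ℝ → X} {vn : ℕ → ℝ → ℝ≥0∞} {τ σ : ℝ → ℝ} {θ : ℝ → X}

/-- After finitely many indices are dropped, the dissipations are at most `E₀ - e + k t + ω k + ε`.
Here `e` is any subsequential limit of the energies, not yet known to be the energy of the limit. -/
theorem energy_ineq (h : ParamApprox S S' ψn ψ L u G u' E₀ C ω τn σn θn vn τ σ θ) (k : ℕ)
    {t : ℝ} (ht : t ∈ Icc 0 T) {A : Set ℝ} (hA : MeasurableSet A) (hA0 : volume A = 0) {φ : ℕ → ℕ}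
    (hφ : StrictMono φ) {e : ℝ}
    (he : Tendsto (fun n => (S (φ n)).energy t (u (φ n) t)) atTop (𝓝 (e : EReal))) :
    (∫⁻ r in Icc 0 t, ((ψ (S'.speed u' r).toNNReal : ℝ≥0∞)
        + liminf (fun n => slopeCost S ψn u G k n r) atTop))
      + (∫⁻ s in Icc 0 (σ t) ∩ τ ⁻¹' A, max (S'.slope (τ s) (θ s)) L) + ENNReal.ofReal (e + C)
      ≤ ENNReal.ofReal (E₀ + C) + ENNReal.ofReal (k * t + ω k) := by
  have hx : Tendsto (fun n => ((S (φ n)).energy t (u (φ n) t)).toReal) atTop (𝓝 e) :=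
    (EReal.tendsto_toReal (EReal.coe_ne_top _) (EReal.coe_ne_bot _)).comp he
  have hlim := ((h.tendsto_toReal_initial.comp hφ.tendsto_atTop).sub hx).add_const (k * t + ω k)
  have hnn : 0 ≤ E₀ - e + (k * t + ω k) :=
    ge_of_tendsto' hlim fun n => (h.dissipation_le_ofReal k (φ n) ht).1
  have hω : 0 ≤ k * t + ω k := by have := ht.1; positivity
  have hstep : ∀ ε : ℝ, 0 < ε → (∫⁻ r in Icc 0 t, ((ψ (S'.speed u' r).toNNReal : ℝ≥0∞)
        + liminf (fun n => slopeCost S ψn u G k n r) atTop))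
      + (∫⁻ s in Icc 0 (σ t) ∩ τ ⁻¹' A, max (S'.slope (τ s) (θ s)) L)
      ≤ ENNReal.ofReal (E₀ - e + (k * t + ω k) + ε) := by
    intro ε hε
    obtain ⟨n₀, hn₀⟩ := eventually_atTop.1 ((tendsto_order.1 hlim).2
      (E₀ - e + (k * t + ω k) + ε) (by linarith))
    let χ : ℕ → ℕ := fun n => φ (n + n₀)
    have hχ : StrictMono χ := fun m n hmn => hφ (by omega)
    have := (h.subseq hχ).dissipation_le k ht hA hA0 (B := (E₀ - e + (k * t + ω k) + ε).toNNReal)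
      (fun n => (h.dissipation_le_ofReal k (χ n) ht).2.trans
        (ENNReal.ofReal_le_ofReal (hn₀ (n + n₀) (by omega)).le))
    refine le_trans (add_le_add (lintegral_mono fun r => add_le_add le_rfl ?_) le_rfl) this
    exact hχ.tendsto_atTop.liminf_le_liminf_comp
  have hfinal := ENNReal.ofReal_add hnn (show 0 ≤ e + C by linarith [h.neg_le_of_tendsto ht he])
  rw [← ENNReal.ofReal_add (by linarith [h.neg_le_initial]) hω]
  have e2 : E₀ + C + (k * t + ω k) = E₀ - e + (k * t + ω k) + (e + C) := by ring
  rw [e2, hfinal]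
  refine add_le_add ?_ le_rfl
  have hlim' : Tendsto (fun ε : ℝ => ENNReal.ofReal (E₀ - e + (k * t + ω k) + ε)) (𝓝[>] 0)
      (𝓝 (ENNReal.ofReal (E₀ - e + (k * t + ω k) + 0))) :=
    (ENNReal.continuous_ofReal.tendsto _).comp
      ((continuous_const.add continuous_id).tendsto 0 |>.mono_left nhdsWithin_le_nhds)
  rw [add_zero] at hlim'
  refine ge_of_tendsto hlim' ?_
  filter_upwards [self_mem_nhdsWithin] with ε hε using hstep ε hε

theorem slope_le_of_notMem_gaps (h : ParamApprox S S' ψn ψ L u G u' E₀ C ω τn σn θn vn τ σ θ)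
    {t : ℝ} (ht : t ∈ Icc 0 T) (hj : t ∉ IsLipParam.gaps σ) : S'.slope t (u' t) ≤ L :=
  let := S'.metric
  h.slope_le_of_notMem_jumps ht fun hj' => hj (h.lip.jumpSet_subset hj')

/-- The measurable selection of the limit of the slopes. -/
theorem exists_limit_slope (h : ParamApprox S S' ψn ψ L u G u' E₀ C ω τn σn θn vn τ σ θ)
    (hp : S'.PowerBound L u') : ∃ F : ℝ → ℝ≥0∞, Measurable F ∧
      (∀ t ∈ Icc 0 T, S'.slope t (u' t) ≤ F t) ∧ (∀ t ∈ Icc 0 T, t ∉ IsLipParam.gaps σ → F t ≤ L) ∧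
      AEMeasurable (fun t => S'.power t (u' t) (F t)) (volume.restrict (Icc 0 T)) ∧
      ∀ k : ℕ, ∀ᵐ r ∂volume.restrict (Icc 0 T),
        (k : ℝ≥0∞) + (dual ψ (F r) + (((S'.power r (u' r) L).toENNReal : EReal)
          - S'.power r (u' r) (F r)).toENNReal)
        ≤ liminf (fun n => slopeCost S ψn u G k n r) atTop + (S'.power r (u' r) L).toENNReal := by
  let := S'.metric
  set p : ℝ → ℝ≥0∞ := fun r => (S'.power r (u' r) L).toENNReal with hpdef
  have hgaps := h.lip.countable_gaps
  have hmem := ae_restrict_mem (μ := volume) (measurableSet_Icc (a := (0 : ℝ)) (b := T))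
  have hPm : ∀ f : ℝ≥0, AEMeasurable (fun r => S'.power r (u' r) f) (volume.restrict (Icc 0 T)) :=
    fun f => h.lip.aemeasurable_along (S'.power_meas f)
  have hpm : AEMeasurable p (volume.restrict (Icc 0 T)) :=
    EReal.continuous_toENNReal.measurable.comp_aemeasurable (hPm L)
  have hpfin : ∀ᵐ r ∂volume.restrict (Icc 0 T), p r < ⊤ := ae_lt_top' hpm hp
  have hmono : ∀ᵐ r ∂volume.restrict (Icc 0 T), Monotone (S'.power r (u' r)) :=
    hmem.mono fun r hr => S'.power_mono r hr _
  have husc : ∀ᵐ r ∂volume.restrict (Icc 0 T), UpperSemicontinuous (S'.power r (u' r)) :=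
    hmem.mono fun r hr => S'.power_usc r hr _
  have hFL : ∀ᵐ r ∂volume.restrict (Icc 0 T), S'.slope r (u' r) ≤ L := by
    filter_upwards [hmem, hgaps.ae_notMem _] with r hr hg using h.slope_le_of_notMem_gaps hr hg
  obtain ⟨F, hF, hFsel⟩ := h.diss.exists_selection hPm (h.lip.aemeasurable_along S'.slope_meas) hpm
    hmono husc hFL hpfin
  set B : Set ℝ := {r | ¬(r ∈ Icc 0 T → S'.slope r (u' r) ≤ F r ∧ F r ≤ L)}
  have hB0 : volume B = 0 := by
    have h1 : ∀ᵐ r ∂volume.restrict (Icc 0 T), S'.slope r (u' r) ≤ F r ∧ F r ≤ L :=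
      hFsel.mono fun r hr => ⟨hr.1, hr.2.1⟩
    exact (ae_restrict_iff' measurableSet_Icc).1 h1
  set N := toMeasurable volume B
  have hN0 : volume N = 0 := by rw [measure_toMeasurable, hB0]
  have hNm : MeasurableSet N := measurableSet_toMeasurable _ _
  have hgood : ∀ r ∈ Icc 0 T, r ∉ N → S'.slope r (u' r) ≤ F r ∧ F r ≤ L := fun r hr hrN => by
    by_contra hcon
    exact hrN (subset_toMeasurable _ _ fun hcon' => hcon (hcon' hr))
  classical
  -- On the gaps the slope may exceed `L`; `⊤` is safe there since they are countable. On the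
  -- remaining null set, where the selection says nothing, `L` is admissible.
  let F' : ℝ → ℝ≥0∞ := (IsLipParam.gaps σ).piecewise (fun _ => ⊤) (N.piecewise (fun _ => (L : ℝ≥0∞)) F)
  have hF' : Measurable F' :=
    Measurable.piecewise hgaps.measurableSet measurable_const
      (Measurable.piecewise hNm measurable_const hF)
  have hF'eq : ∀ r, r ∉ IsLipParam.gaps σ → r ∉ N → F' r = F r := fun r h1 h2 => by
    simp only [F']
    rw [piecewise_eq_of_notMem _ _ _ h1, piecewise_eq_of_notMem _ _ _ h2]
  have hF'L : ∀ t ∈ Icc 0 T, t ∉ IsLipParam.gaps σ → F' t ≤ L := by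
    intro t ht hg
    by_cases hN : t ∈ N
    · simp only [F']
      rw [piecewise_eq_of_notMem _ _ _ hg, piecewise_eq_of_mem _ _ _ hN]
    · rw [hF'eq t hg hN]
      exact (hgood t ht hN).2
  have hae : ∀ᵐ r ∂volume.restrict (Icc 0 T), F' r = F r := by
    filter_upwards [hgaps.ae_notMem (volume.restrict (Icc 0 T)),
      ae_restrict_of_ae (measure_eq_zero_iff_ae_notMem.1 hN0)] with r h1 h2 using hF'eq r h1 h2
  refine ⟨F', hF', ?_, hF'L, ?_, fun k => ?_⟩
  · intro t ht
    by_cases hg : t ∈ IsLipParam.gaps σ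
    · simp only [F']
      rw [piecewise_eq_of_mem _ _ _ hg]
      exact le_top
    by_cases hN : t ∈ N
    · simp only [F']
      rw [piecewise_eq_of_notMem _ _ _ hg, piecewise_eq_of_mem _ _ _ hN]
      exact h.slope_le_of_notMem_gaps ht hg
    · rw [hF'eq t hg hN]
      exact (hgood t ht hN).1
  · refine aemeasurable_of_monotone_usc hPm hF'.aemeasurable hmono husc ?_
    filter_upwards [hmem, hgaps.ae_notMem _] with r hr hg
    exact (hF'L r hr hg).trans_lt ENNReal.coe_lt_top
  · filter_upwards [hFsel, hae, hmem, hpfin, h.ae_liminf_slopeCost_lt_top k, hmono]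
      with r h1 h2 h3 h4 h5 h6
    rw [h2]
    -- The pointwise limit `g` depends on `k`; `F r` does not, as it minimizes a cost without `k`
    -- among competitors that include `g`.
    obtain ⟨g, hgL, hgF, hg⟩ := h.exists_slope_limit k h3 h5
    have hPg : S'.power r (u' r) g ≤ (p r : EReal) :=
      (h6 (show (g : ℝ≥0∞) ≤ L by exact_mod_cast hgL)).trans (le_coe_toENNReal _)
    have hadd := add_toENNReal_sub_le (k := k) (by positivity) h4.ne hPg
    rw [ENNReal.ofReal_natCast] at hadd
    calc _ ≤ (k : ℝ≥0∞) + (dual ψ g + ((p r : EReal) - S'.power r (u' r) g).toENNReal) :=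
          add_le_add le_rfl (h1.2.2 g hgF hgL)
      _ = dual ψ g + (k + ((p r : EReal) - S'.power r (u' r) g).toENNReal) := by ring
      _ ≤ dual ψ g + ((((k : ℝ) : EReal) - S'.power r (u' r) g).toENNReal + p r) :=
          add_le_add le_rfl hadd
      _ = (dual ψ g + (((k : ℝ) : EReal) - S'.power r (u' r) g).toENNReal) + p r := by ring
      _ ≤ _ := add_le_add hg le_rfl

theorem aemeasurable_limit_speed (h : ParamApprox S S' ψn ψ L u G u' E₀ C ω τn σn θn vn τ σ θ) :
    AEMeasurable (S'.speed u') (volume.restrict (Icc 0 T)) :=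
  @IsLipParam.aemeasurable_metricDeriv X S'.metric T u' τ σ θ h.lip

/-- The energy-dissipation inequality of the limit, with the weighted length of the fibers in place
of the jump functional. -/
theorem limit_ineq (h : ParamApprox S S' ψn ψ L u G u' E₀ C ω τn σn θn vn τ σ θ)
    (hp : S'.PowerBound L u') {F : ℝ → ℝ≥0∞} (hF : Measurable F)
    (hFL : ∀ t ∈ Icc 0 T, t ∉ IsLipParam.gaps σ → F t ≤ L)
    (hPm : AEMeasurable (fun t => S'.power t (u' t) (F t)) (volume.restrict (Icc 0 T)))
    (hk : ∀ k : ℕ, ∀ᵐ r ∂volume.restrict (Icc 0 T),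
        (k : ℝ≥0∞) + (dual ψ (F r) + (((S'.power r (u' r) L).toENNReal : EReal)
          - S'.power r (u' r) (F r)).toENNReal)
        ≤ liminf (fun n => slopeCost S ψn u G k n r) atTop + (S'.power r (u' r) L).toENNReal)
    {t : ℝ} (ht : t ∈ Icc 0 T) {φ : ℕ → ℕ} (hφ : StrictMono φ) {e : ℝ}
    (he : Tendsto (fun n => (S (φ n)).energy t (u (φ n) t)) atTop (𝓝 (e : EReal))) :
    (∫⁻ r in Icc 0 t, ((ψ (S'.speed u' r).toNNReal : ℝ≥0∞) + dual ψ (F r)))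
      + L * S'.cantor u' (Icc 0 t)
      + (∫⁻ s in Icc (σ 0) (σ t) ∩ τ ⁻¹' IsLipParam.gaps σ, max (S'.slope (τ s) (θ s)) L)
      + (∫⁻ r in Icc 0 t, (-S'.power r (u' r) (F r)).toENNReal) + ENNReal.ofReal (e + C)
      ≤ ENNReal.ofReal (E₀ + C) + ∫⁻ r in Icc 0 t, (S'.power r (u' r) (F r)).toENNReal := by
  let := S'.metric
  have hsub : Icc 0 t ⊆ Icc 0 T := Icc_subset_Icc_right ht.2
  set p : ℝ → ℝ≥0∞ := fun r => (S'.power r (u' r) L).toENNReal with hpdef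
  have hpm : AEMeasurable p (volume.restrict (Icc 0 T)) :=
    EReal.continuous_toENNReal.measurable.comp_aemeasurable
      (h.lip.aemeasurable_along (S'.power_meas L))
  have hpt : ∫⁻ r in Icc 0 t, p r ≠ ⊤ := ne_top_of_le_ne_top hp (lintegral_mono_set hsub)
  have hψm : AEMeasurable (fun r => (ψ (S'.speed u' r).toNNReal : ℝ≥0∞))
      (volume.restrict (Icc 0 t)) :=
    ((convex_monotone h.diss.convex h.diss.zero).measurable.comp_aemeasurable
      (h.aemeasurable_limit_speed.mono_set hsub).ennreal_toNNReal).coe_nnreal_ennreal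
  have hdm : AEMeasurable (fun r => dual ψ (F r)) (volume.restrict (Icc 0 t)) :=
    ((measurable_dual ψ).comp hF).aemeasurable
  have hPm' := hPm.mono_set hsub
  -- The null set for the lower bound is the union of the gaps, whose fibers give the jump part, and
  -- a carrier of the Cantor part.
  obtain ⟨N, hN, hN0, hNc⟩ := exists_cantorMeasure_support T u'
  have hAm : MeasurableSet (IsLipParam.gaps σ ∪ N) := h.lip.countable_gaps.measurableSet.union hN
  have hA0 : volume (IsLipParam.gaps σ ∪ N) = 0 :=
    measure_union_null (h.lip.countable_gaps.measure_zero _) hN0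
  set κ := ∫⁻ s in Icc (σ 0) (σ t) ∩ τ ⁻¹' IsLipParam.gaps σ, max (S'.slope (τ s) (θ s)) L
  set Y := ∫⁻ s in Icc 0 (σ t) ∩ τ ⁻¹' (IsLipParam.gaps σ ∪ N), max (S'.slope (τ s) (θ s)) L
  have hY : L * S'.cantor u' (Icc 0 t) + κ ≤ Y := by
    have hset : Icc 0 (σ t) ∩ τ ⁻¹' (IsLipParam.gaps σ ∪ N)
        = (Icc 0 (σ t) ∩ τ ⁻¹' (N \ IsLipParam.gaps σ))
          ∪ (Icc 0 (σ t) ∩ τ ⁻¹' IsLipParam.gaps σ) := by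
      rw [← inter_union_distrib_left, ← preimage_union, sdiff_union_self, union_comm]
    simp only [Y, κ]
    rw [hset, lintegral_union (measurableSet_Icc.inter h.lip.measurableSet_preimage_gaps), h.lip.zero]
    · refine add_le_add ?_ le_rfl
      calc L * S'.cantor u' (Icc 0 t)
          ≤ L * volume (Icc 0 (σ t) ∩ τ ⁻¹' (N \ IsLipParam.gaps σ)) :=
            mul_le_mul_right (h.lip.cantorMeasure_le_volume hN hNc t) _
        _ = ∫⁻ s in Icc 0 (σ t) ∩ τ ⁻¹' (N \ IsLipParam.gaps σ), (L : ℝ≥0∞) :=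
            (setLIntegral_const _ _).symm
        _ ≤ _ := lintegral_mono fun s => le_max_right _ _
    · exact disjoint_left.2 fun s hs hs' => hs.2.2 hs'.2
  set Ψ := ∫⁻ r in Icc 0 t, (ψ (S'.speed u' r).toNNReal : ℝ≥0∞)
  set D := ∫⁻ r in Icc 0 t, dual ψ (F r)
  set R := ∫⁻ r in Icc 0 t, ((p r : EReal) - S'.power r (u' r) (F r)).toENNReal
  set Q := ∫⁻ r in Icc 0 t, p r
  -- The term `k t` appears on both sides and cancels; only `ω k` remains.
  have hkstep : ∀ k : ℕ, Ψ + D + R + Y + ENNReal.ofReal (e + C)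
      ≤ ENNReal.ofReal (E₀ + C) + Q + (ω k : ℝ≥0∞) := by
    intro k
    set W := ∫⁻ r in Icc 0 t, ((ψ (S'.speed u' r).toNNReal : ℝ≥0∞)
        + liminf (fun n => slopeCost S ψn u G k n r) atTop) with hW
    have h1 : W + Y + ENNReal.ofReal (e + C)
        ≤ ENNReal.ofReal (E₀ + C) + ENNReal.ofReal (k * t + ω k) :=
      h.energy_ineq k ht hAm hA0 hφ he
    have h2 : Ψ + D + R + k * ENNReal.ofReal t ≤ W + Q := by
      rw [hW, ← lintegral_add_right' _ (hpm.mono_set hsub)]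
      have e1 : Ψ + D + R + k * ENNReal.ofReal t = ∫⁻ r in Icc 0 t,
          ((ψ (S'.speed u' r).toNNReal : ℝ≥0∞) + ((k : ℝ≥0∞) + (dual ψ (F r)
            + ((p r : EReal) - S'.power r (u' r) (F r)).toENNReal))) := by
        rw [lintegral_add_left' hψm, lintegral_add_left measurable_const, lintegral_add_left' hdm,
          setLIntegral_const, Real.volume_Icc, sub_zero]
        ring
      rw [e1]
      refine lintegral_mono_ae ?_
      filter_upwards [ae_restrict_of_ae_restrict_of_subset hsub (hk k)] with r hr
      rw [add_assoc]
      exact add_le_add le_rfl hr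
    have h3 : ENNReal.ofReal (k * t + ω k) = k * ENNReal.ofReal t + ω k := by
      rw [ENNReal.ofReal_add (by have := ht.1; positivity) (ω k).coe_nonneg,
        ENNReal.ofReal_mul (by positivity), ENNReal.ofReal_natCast, ENNReal.ofReal_coe_nnreal]
    rw [h3] at h1
    have h4 : k * ENNReal.ofReal t ≠ ⊤ :=
      ENNReal.mul_ne_top (ENNReal.natCast_ne_top k) ENNReal.ofReal_ne_top
    refine (ENNReal.add_le_add_iff_right h4).1 ?_
    calc Ψ + D + R + Y + ENNReal.ofReal (e + C) + k * ENNReal.ofReal t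
        = (Ψ + D + R + k * ENNReal.ofReal t) + (Y + ENNReal.ofReal (e + C)) := by ring
      _ ≤ (W + Q) + (Y + ENNReal.ofReal (e + C)) := add_le_add h2 le_rfl
      _ = (W + Y + ENNReal.ofReal (e + C)) + Q := by ring
      _ ≤ (ENNReal.ofReal (E₀ + C) + (k * ENNReal.ofReal t + ω k)) + Q := add_le_add h1 le_rfl
      _ = _ := by ring
  have hlim : Tendsto (fun k => ENNReal.ofReal (E₀ + C) + Q + (ω k : ℝ≥0∞)) atTop
      (𝓝 (ENNReal.ofReal (E₀ + C) + Q + ((0 : ℝ≥0) : ℝ≥0∞))) :=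
    (ENNReal.tendsto_coe.2 h.modulus).const_add _
  rw [ENNReal.coe_zero, add_zero] at hlim
  have hmain := ge_of_tendsto' hlim hkstep
  set M := ∫⁻ r in Icc 0 t, (-S'.power r (u' r) (F r)).toENNReal
  set Z := ∫⁻ r in Icc 0 t, (S'.power r (u' r) (F r)).toENNReal
  -- Undoes the comparison with `p` by `(p - P)⁺ + P⁺ = p + P⁻`; off the gaps `F ≤ L` and
  -- monotonicity give `P ≤ p`.
  have hRZ : R + Z = Q + M := by
    simp only [R, Z, Q, M]
    have hZm : AEMeasurable (fun r => (S'.power r (u' r) (F r)).toENNReal)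
        (volume.restrict (Icc 0 t)) := EReal.continuous_toENNReal.measurable.comp_aemeasurable hPm'
    rw [← lintegral_add_right' _ hZm,
      ← lintegral_add_left' (hpm.mono_set hsub)]
    refine lintegral_congr_ae ?_
    filter_upwards [ae_lt_top' (hpm.mono_set hsub) hpt, ae_restrict_mem measurableSet_Icc,
      h.lip.countable_gaps.ae_notMem _] with r h1 h2 h3
    exact toENNReal_sub_add h1.ne ((S'.power_mono r (hsub h2) _ (hFL r (hsub h2) h3)).trans
      (le_coe_toENNReal _))
  have hsum : (∫⁻ r in Icc 0 t, ((ψ (S'.speed u' r).toNNReal : ℝ≥0∞) + dual ψ (F r))) = Ψ + D :=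
    lintegral_add_left' hψm _
  rw [hsum]
  refine (ENNReal.add_le_add_iff_right hpt).1 ?_
  calc Ψ + D + L * S'.cantor u' (Icc 0 t) + κ + M + ENNReal.ofReal (e + C) + Q
      = Ψ + D + (Q + M) + (L * S'.cantor u' (Icc 0 t) + κ) + ENNReal.ofReal (e + C) := by ring
    _ ≤ Ψ + D + (R + Z) + Y + ENNReal.ofReal (e + C) := by rw [hRZ]; gcongr
    _ = (Ψ + D + R + Y + ENNReal.ofReal (e + C)) + Z := by ring
    _ ≤ (ENNReal.ofReal (E₀ + C) + Q) + Z := add_le_add hmain le_rfl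
    _ = _ := by ring

theorem power_lintegral_ne_top (h : ParamApprox S S' ψn ψ L u G u' E₀ C ω τn σn θn vn τ σ θ)
    (hp : S'.PowerBound L u') {F : ℝ → ℝ≥0∞}
    (hFL : ∀ t ∈ Icc 0 T, t ∉ IsLipParam.gaps σ → F t ≤ L) {A : Set ℝ} (hA : A ⊆ Icc 0 T)
    (hAm : MeasurableSet A) :
    ∫⁻ r in A, (S'.power r (u' r) (F r)).toENNReal ≠ ⊤ := by
  let := S'.metric
  refine ne_top_of_le_ne_top hp ((lintegral_mono_ae ?_).trans (lintegral_mono_set hA))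
  filter_upwards [ae_restrict_mem hAm, h.lip.countable_gaps.ae_notMem _] with r h2 h3
  exact EReal.toENNReal_le_toENNReal (S'.power_mono r (hA h2) _ (hFL r (hA h2) h3))

theorem bvAdmissible (h : ParamApprox S S' ψn ψ L u G u' E₀ C ω τn σn θn vn τ σ θ)
    (hE : S'.energy 0 (u' 0) = E₀) (hp : S'.PowerBound L u') {F : ℝ → ℝ≥0∞} (hF : Measurable F)
    (hF' : ∀ t ∈ Icc 0 T, S'.slope t (u' t) ≤ F t)
    (hFL : ∀ t ∈ Icc 0 T, t ∉ IsLipParam.gaps σ → F t ≤ L)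
    (hPm : AEMeasurable (fun t => S'.power t (u' t) (F t)) (volume.restrict (Icc 0 T))) :
    S'.BVAdmissible L u' F where
  bv := @IsLipParam.boundedVariationOn X S'.metric T u' τ σ θ h.lip
  measurable := hF
  initial := hE ▸ EReal.coe_lt_top E₀
  slope_le := hF'
  power_meas := hPm
  power_int := h.power_lintegral_ne_top hp hFL subset_rfl measurableSet_Icc
  stable := by
    let := S'.metric
    have h0 : ((volume : Measure ℝ) + S'.cantor u') (IsLipParam.gaps σ) = 0 := by
      rw [Measure.add_apply, h.lip.countable_gaps.measure_zero, zero_add]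
      exact h.lip.cantorMeasure_countable h.lip.countable_gaps
    filter_upwards [ae_restrict_mem measurableSet_Icc,
      ae_restrict_of_ae (measure_eq_zero_iff_ae_notMem.1 h0)] with t ht hg using hFL t ht hg

/-- The limit curve satisfies the energy-dissipation inequality for curves of bounded variation. -/
theorem bvEnergyDissipation (h : ParamApprox S S' ψn ψ L u G u' E₀ C ω τn σn θn vn τ σ θ)
    (hE : S'.energy 0 (u' 0) = E₀) (hp : S'.PowerBound L u') :
    ∃ F, S'.BVEnergyDissipation ψ L u' F := by
  let := S'.metric
  obtain ⟨F, hF, hF', hFL, hPm, hk⟩ := h.exists_limit_slope hp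
  refine ⟨F, h.bvAdmissible hE hp hF hF' hFL hPm, fun t ht => ?_⟩
  obtain ⟨φ, hφ, e, hle, he⟩ := h.exists_energy_limit ht
  have hJ : S'.jump L u' 0 t
      ≤ ∫⁻ s in Icc (σ 0) (σ t) ∩ τ ⁻¹' IsLipParam.gaps σ, max (S'.slope (τ s) (θ s)) L :=
    h.lip.jumpCost_le _ le_rfl ht.2
  rw [hE]
  refine (add_le_add hle le_rfl).trans ?_
  refine coe_add_le_of_shifted (h.neg_le_of_tendsto ht he) h.neg_le_initial
    (h.power_lintegral_ne_top hp hFL (Icc_subset_Icc_right ht.2) measurableSet_Icc) ?_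
  refine le_trans ?_ (h.limit_ineq hp hF hFL hPm hk ht hφ he)
  unfold EvolutionSystem.bvDissipation
  gcongr

end ParamApprox

end

noncomputable section

/-! ### Concatenation and reparametrization of curves -/

section Concatenation

variable {X : Type*} [EMetricSpace X] {u v : ℝ → X} {a b c : ℝ}

theorem IsAC.congr (h : IsAC u a b) (heq : EqOn u v (Icc a b)) : IsAC v a b := by
  obtain ⟨m, hm, hmi, hle⟩ := h
  refine ⟨m, hm, hmi, fun s t hs hst ht => ?_⟩
  rw [← heq ⟨hs, hst.trans ht⟩, ← heq ⟨hs.trans hst, ht⟩]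
  exact hle s t hs hst ht

theorem IsAC.trans (h₁ : IsAC u a b) (h₂ : IsAC u b c) : IsAC u a c := by
  obtain ⟨m₁, hm₁, hi₁, hle₁⟩ := h₁
  obtain ⟨m₂, hm₂, hi₂, hle₂⟩ := h₂
  set m : ℝ → ℝ≥0∞ := (Icc a b).indicator m₁ + (Icc b c).indicator m₂ with hmdef
  have hle₁' : ∀ s t, a ≤ s → t ≤ b → ∫⁻ r in Icc s t, m₁ r ≤ ∫⁻ r in Icc s t, m r := by
    intro s t hs ht
    refine setLIntegral_mono' measurableSet_Icc fun r hr => ?_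
    simp only [hmdef, Pi.add_apply]
    rw [indicator_of_mem (show r ∈ Icc a b from ⟨hs.trans hr.1, hr.2.trans ht⟩)]
    exact le_self_add
  have hle₂' : ∀ s t, b ≤ s → t ≤ c → ∫⁻ r in Icc s t, m₂ r ≤ ∫⁻ r in Icc s t, m r := by
    intro s t hs ht
    refine setLIntegral_mono' measurableSet_Icc fun r hr => ?_
    simp only [hmdef, Pi.add_apply]
    rw [indicator_of_mem (show r ∈ Icc b c from ⟨hs.trans hr.1, hr.2.trans ht⟩)]
    exact le_add_self
  refine ⟨m, (hm₁.indicator measurableSet_Icc).add (hm₂.indicator measurableSet_Icc), ?_, ?_⟩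
  · refine ne_top_of_le_ne_top (ENNReal.add_ne_top.2 ⟨hi₁, hi₂⟩)
      ((setLIntegral_le_lintegral (Icc a c) m).trans_eq ?_)
    simp only [hmdef, Pi.add_apply]
    rw [lintegral_add_left (hm₁.indicator measurableSet_Icc), lintegral_indicator measurableSet_Icc,
      lintegral_indicator measurableSet_Icc]
  · intro s t hs hst ht
    rcases le_total t b with htb | htb
    · exact (hle₁ s t hs hst htb).trans (hle₁' s t hs htb)
    rcases le_total b s with hsb | hsb
    · exact (hle₂ s t hsb hst ht).trans (hle₂' s t hsb ht)
    · rw [setLIntegral_Icc_add_Icc m hsb htb]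
      exact (edist_triangle _ (u b) _).trans (add_le_add
        ((hle₁ s b hs hsb le_rfl).trans (hle₁' s b hs le_rfl))
        ((hle₂ b t le_rfl htb ht).trans (hle₂' b t le_rfl ht)))

theorem metricDeriv_congr {t : ℝ} (h : ∀ᶠ s in 𝓝 t, u s = v s) :
    metricDeriv u t = metricDeriv v t := by
  refine limsup_congr ?_
  have hlim : Tendsto (fun ρ : ℝ => t + ρ) (𝓝[>] 0) (𝓝 t) := by
    have : Tendsto (fun ρ : ℝ => t + ρ) (𝓝 0) (𝓝 (t + 0)) :=
      (continuous_const.add continuous_id).tendsto 0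
    rw [add_zero] at this
    exact this.mono_left nhdsWithin_le_nhds
  filter_upwards [hlim.eventually h] with ρ hρ
  rw [hρ, h.self_of_nhds]

theorem setLIntegral_affine (g : ℝ → ℝ≥0∞) {k d s t : ℝ} (hk : 0 < k) :
    ∫⁻ r in Icc (k * s + d) (k * t + d), g r
      = ∫⁻ r in Icc s t, ENNReal.ofReal k * g (k * r + d) := by
  rw [← image_affine_Icc' hk d s t]
  have h := lintegral_image_eq_lintegral_abs_deriv_mul (s := Icc s t) (f := fun x => k * x + d)
    (f' := fun _ => k) measurableSet_Icc
    (fun x _ => (((hasDerivAt_id x).const_mul k).add_const d).hasDerivWithinAt.congr_deriv (by simp))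
    (fun x _ y _ hxy => by
      have : k * x = k * y := by linarith [show k * x + d = k * y + d from hxy]
      exact mul_left_cancel₀ hk.ne' this) g
  rw [abs_of_pos hk] at h
  exact h

/-- One inequality suffices, as reparametrized curves serve only as competitors. -/
theorem metricDeriv_affine_le (u : ℝ → X) {k d : ℝ} (hk : 0 < k) (s : ℝ) :
    metricDeriv (fun r => u (k * r + d)) s ≤ ENNReal.ofReal k * metricDeriv u (k * s + d) := by
  set g : ℝ → ℝ≥0∞ := fun ρ => edist (u (k * s + d + ρ)) (u (k * s + d)) / ENNReal.ofReal |ρ| with hg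
  have hmap : map (fun ρ : ℝ => k * ρ) (𝓝[>] 0) ≤ 𝓝[>] 0 := by
    refine tendsto_nhdsWithin_iff.2 ⟨?_, ?_⟩
    · have : Tendsto (fun ρ : ℝ => k * ρ) (𝓝 0) (𝓝 (k * 0)) :=
        (continuous_const.mul continuous_id).tendsto 0
      rw [mul_zero] at this
      exact this.mono_left nhdsWithin_le_nhds
    · filter_upwards [self_mem_nhdsWithin] with ρ hρ using mul_pos hk hρ
  calc metricDeriv (fun r => u (k * r + d)) s
      = limsup (fun ρ => ENNReal.ofReal k * g (k * ρ)) (𝓝[>] 0) := by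
        refine limsup_congr ?_
        filter_upwards [self_mem_nhdsWithin] with ρ hρ
        have hρ' : 0 < ρ := hρ
        simp only [hg]
        rw [abs_mul, abs_of_pos hk, ENNReal.ofReal_mul hk.le, ENNReal.div_eq_inv_mul,
          ENNReal.div_eq_inv_mul, ENNReal.mul_inv (Or.inr ENNReal.ofReal_ne_top)
            (Or.inl ENNReal.ofReal_ne_top), ← mul_assoc, ← mul_assoc, ENNReal.mul_inv_cancel
            (ENNReal.ofReal_pos.2 hk).ne' ENNReal.ofReal_ne_top, one_mul]
        congr 3
        ring
    _ = ENNReal.ofReal k * limsup (fun ρ => g (k * ρ)) (𝓝[>] 0) :=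
        ENNReal.limsup_const_mul_of_ne_top ENNReal.ofReal_ne_top
    _ ≤ ENNReal.ofReal k * limsup g (𝓝[>] 0) := by
        gcongr
        exact limsup_le_limsup_of_le (f := map (fun ρ : ℝ => k * ρ) (𝓝[>] 0)) (u := g) hmap

/-- Every absolutely continuous curve has a reparametrization on a given interval, which does not
increase weighted lengths. -/
theorem IsAC.exists_reparam (h : IsAC u a b) (hab : a ≤ b) (f : X → ℝ≥0∞) {s t : ℝ} (hst : s < t) :
    ∃ v : ℝ → X, IsAC v s t ∧ v s = u a ∧ v t = u b ∧
      ∫⁻ r in Icc s t, f (v r) * metricDeriv v r ≤ ∫⁻ r in Icc a b, f (u r) * metricDeriv u r := by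
  rcases hab.eq_or_lt with rfl | hlt
  · refine ⟨fun _ => u a, ⟨0, measurable_zero, by simp, by simp⟩, rfl, rfl, ?_⟩
    simp [metricDeriv_const]
  set k := (b - a) / (t - s) with hkdef
  have hk : 0 < k := div_pos (by linarith) (by linarith)
  set d := a - k * s with hddef
  have ha : k * s + d = a := by rw [hddef]; ring
  have hb : k * t + d = b := by
    have : k * (t - s) = b - a := div_mul_cancel₀ _ (by linarith)
    rw [hddef]; linarith
  refine ⟨fun r => u (k * r + d), ?_, congrArg u ha, congrArg u hb, ?_⟩
  · obtain ⟨m, hm, hmi, hle⟩ := h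
    refine ⟨fun r => ENNReal.ofReal k * m (k * r + d), by fun_prop, ?_, fun p q hp hpq hq => ?_⟩
    · rw [← setLIntegral_affine m hk, ha, hb]
      exact hmi
    · rw [← setLIntegral_affine m hk]
      have h1 : k * s ≤ k * p := by gcongr
      have h2 : k * p ≤ k * q := by gcongr
      have h3 : k * q ≤ k * t := by gcongr
      exact hle _ _ (by linarith) (by linarith) (by linarith)
  · calc ∫⁻ r in Icc s t, f (u (k * r + d)) * metricDeriv (fun r => u (k * r + d)) r
        ≤ ∫⁻ r in Icc s t, ENNReal.ofReal k * (f (u (k * r + d)) * metricDeriv u (k * r + d)) := by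
          refine lintegral_mono fun r => ?_
          calc _ ≤ f (u (k * r + d)) * (ENNReal.ofReal k * metricDeriv u (k * r + d)) :=
                mul_le_mul_right (metricDeriv_affine_le u hk r) _
            _ = _ := by ring
      _ = ∫⁻ r in Icc a b, f (u r) * metricDeriv u r := by
          rw [← setLIntegral_affine (fun r => f (u r) * metricDeriv u r) hk, ha, hb]

end Concatenation

namespace IsLipParam

variable {X : Type*} [EMetricSpace X] {T : ℝ} {u : ℝ → X} {τ σ : ℝ → ℝ} {θ : ℝ → X}

/-- The speed of `u` is at most `1 / τ'` at `σ t`; the change of variables turns this into an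
integrand bounded by one. -/
theorem lintegral_metricDeriv_ne_top (h : IsLipParam T u τ σ θ) :
    ∫⁻ t in Icc 0 T, metricDeriv u t ≠ ⊤ := by
  have hσ : Measurable σ := h.strictMono.monotone.measurable
  have hg : Measurable fun t => (ENNReal.ofReal (deriv τ (σ t)))⁻¹ :=
    ((measurable_deriv τ).comp hσ).ennreal_ofReal.inv
  have h1 : ∫⁻ t in Icc 0 T, metricDeriv u t
      ≤ ∫⁻ t in Icc 0 T, (ENNReal.ofReal (deriv τ (σ t)))⁻¹ := by
    refine lintegral_mono_ae ?_
    filter_upwards [h.ae_metricDeriv_eq] with t ht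
    rw [ht, ENNReal.div_eq_inv_mul]
    exact mul_le_of_le_one_right (zero_le) (metricDeriv_le_one h.edist_le _)
  refine ne_top_of_le_ne_top (b := ENNReal.ofReal (σ T - σ 0)) ENNReal.ofReal_ne_top (h1.trans ?_)
  rw [← h.lintegral_comp hg.aemeasurable]
  calc _ ≤ ∫⁻ s in Icc (σ 0) (σ T), 1 := by
        refine lintegral_mono_ae (ae_restrict_of_ae ?_)
        filter_upwards [h.deriv_eq_zero] with s hs
        by_cases hg : τ s ∈ gaps σ
        · rw [hs hg]; simp
        · rw [h.inv' hg]; exact ENNReal.inv_mul_le_one _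
    _ = _ := by simp

theorem cantorMeasure_ne_top (h : IsLipParam T u τ σ θ) (t : ℝ) :
    cantorMeasure T u (Icc 0 t) ≠ ⊤ := by
  obtain ⟨N, hN, -, hNc⟩ := exists_cantorMeasure_support T u
  refine ne_top_of_le_ne_top ?_ ((h.cantorMeasure_le_volume hN hNc t).trans
    (measure_mono inter_subset_left))
  simp

/-- The curve `θ` with the part on `[p, q]` replaced by the curve `η`. -/
theorem exists_replacement (h : IsLipParam T u τ σ θ) {p q b : ℝ} (hp : 0 ≤ p) (hpq : p < q)
    (hqb : q ≤ b) (hb : b ≤ σ T) (f : X → ℝ≥0∞) :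
    ∀ ε : ℝ≥0∞, transitionCost f (θ p) (θ q) < ε → ∃ η : ℝ → X, IsTimeOrderedAC T τ η 0 b ∧
      η 0 = θ 0 ∧ η b = θ b ∧ EqOn η θ (Icc p q)ᶜ ∧
      (∀ s ∉ Icc p q, metricDeriv η s = metricDeriv θ s) ∧
      ∫⁻ s in Icc p q, f (η s) * metricDeriv η s < ε := by
  intro ε hε
  unfold transitionCost at hε
  simp only [iInf_lt_iff] at hε
  obtain ⟨r₀, r₁, ϑ, ⟨h01, hac, h0, h1⟩, hlt⟩ := hε
  obtain ⟨v, hv, hv0, hv1, hvle⟩ := hac.exists_reparam h01 f hpq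
  rw [h0] at hv0
  rw [h1] at hv1
  classical
  -- Only the space component is replaced, the time component stays `τ`. The pieces agree at `p` and
  -- `q`, so the spliced curve is absolutely continuous.
  let η : ℝ → X := (Icc p q).piecewise v θ
  have hηin : EqOn v η (Icc p q) := fun s hs => by
    simp only [η]; rw [piecewise_eq_of_mem _ _ _ hs]
  have hηout : EqOn η θ (Icc p q)ᶜ := fun s hs => by
    simp only [η]; rw [piecewise_eq_of_notMem _ _ _ hs]
  have hle : EqOn θ η (Iic p) := fun s hs => by
    rcases (mem_Iic.1 hs).eq_or_lt with rfl | hs'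
    · rw [← hηin ⟨le_rfl, hpq.le⟩, hv0]
    · exact (hηout fun hs'' => not_le.2 hs' hs''.1).symm
  have hge : EqOn θ η (Ici q) := fun s hs => by
    rcases (mem_Ici.1 hs).eq_or_lt with rfl | hs'
    · rw [← hηin ⟨hpq.le, le_rfl⟩, hv1]
    · exact (hηout fun hs'' => not_le.2 hs' hs''.2).symm
  have hbase := h.isTimeOrderedAC le_rfl hb
  have hACη : IsAC η 0 b :=
    (((h.ac 0 p).congr fun s hs => hle hs.2).trans (hv.congr hηin)).trans
      ((h.ac q b).congr fun s hs => hge hs.1)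
  have hopen : ∀ s ∈ Ioo p q, metricDeriv η s = metricDeriv v s := fun s hs =>
    metricDeriv_congr (by
      filter_upwards [Icc_mem_nhds hs.1 hs.2] with r hr using (hηin hr).symm)
  refine ⟨η, ⟨hbase.mem, hbase.mono, hbase.ac_time, hACη⟩, (hle hp).symm, (hge hqb).symm, hηout,
    fun s hs => metricDeriv_congr ?_, ?_⟩
  · filter_upwards [isClosed_Icc.isOpen_compl.mem_nhds hs] with r hr using hηout hr
  · refine lt_of_le_of_lt (le_trans (le_of_eq ?_) hvle) hlt
    rw [← restrict_Ioo_eq_restrict_Icc]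
    refine setLIntegral_congr_fun measurableSet_Ioo fun s hs => ?_
    rw [hopen s hs, hηin ⟨hs.1.le, hs.2.le⟩]

end IsLipParam

end

noncomputable section

/-! ### The upper gradient inequality along parametrized graphs -/

theorem toENNReal_mul_coe {d : ℝ} (hd : 0 ≤ d) (x : EReal) :
    (x * (d : EReal)).toENNReal = x.toENNReal * ENNReal.ofReal d := by
  rw [EReal.toENNReal_mul' (by exact_mod_cast hd), EReal.real_coe_toENNReal]

/-- The upper gradient inequality for `(τ, η)`, with `max(F, L)` as slope bound on the fibers over
the gaps and the given map elsewhere. Off the fibers the length splits into the speed of `u` and the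
Cantor part. The curve `η` may differ from `θ` on the fibers, so that competitors for the
transitions are covered. -/
theorem EvolutionSystem.IsUpperGradient.along {X : Type*} {T : ℝ} {S : EvolutionSystem X T}
    (hS : S.IsUpperGradient) {u : ℝ → X} {τ σ : ℝ → ℝ} {θ η : ℝ → X}
    (h : @IsLipParam X S.metric T u τ σ θ) {F : ℝ → ℝ≥0∞} {L : ℝ≥0} (hF : Measurable F)
    (hFs : ∀ r ∈ Icc 0 T, S.slope r (u r) ≤ F r)
    (hFL : ∀ r ∈ Icc 0 T, r ∉ IsLipParam.gaps σ → F r ≤ L)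
    (hPm : AEMeasurable (fun r => S.power r (u r) (F r)) (volume.restrict (Icc 0 T)))
    (hE : S.energy 0 (u 0) < ⊤) {t : ℝ} (ht : t ∈ Icc 0 T)
    (hM : ∫⁻ r in Icc 0 t, (-S.power r (u r) (F r)).toENNReal ≠ ⊤)
    (hη : @IsTimeOrderedAC X S.metric T τ η 0 (σ t)) (hη0 : η 0 = u 0) (hηt : η (σ t) = u t)
    (hηθ : ∀ s ∈ Icc 0 (σ t), τ s ∉ IsLipParam.gaps σ → η s = θ s ∧ S.speed η s = S.speed θ s) :
    S.energy 0 (u 0) + eIntegral (Icc 0 t) (fun r => S.power r (u r) (F r))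
      ≤ S.energy t (u t) + (((∫⁻ r in Icc 0 t, F r * S.speed u r) + L * S.cantor u (Icc 0 t)
        + ∫⁻ s in Icc (σ 0) (σ t) ∩ τ ⁻¹' IsLipParam.gaps σ,
            max (S.slope (τ s) (η s)) L * S.speed η s : ℝ≥0∞) : EReal) := by
  let := S.metric
  have hσ0 := h.zero
  have hσt : 0 ≤ σ t := hσ0 ▸ h.strictMono.monotone ht.1
  have hgm := h.measurableSet_preimage_gaps
  have hsub : Icc 0 t ⊆ Icc 0 T := Icc_subset_Icc_right ht.2
  have hτ : ∀ s ∈ Icc 0 (σ t), τ s ∈ Icc 0 t := fun s hs => h.mem_Icc (by rwa [hσ0])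
  have hcurve : ∀ s ∈ Icc 0 (σ t), τ s ∉ IsLipParam.gaps σ → η s = u (τ s) := fun s hs hg =>
    (hηθ s hs hg).1.trans (h.curve_eq' hg (hsub (hτ s hs)))
  classical
  set A : ℝ → ℝ≥0∞ := (τ ⁻¹' IsLipParam.gaps σ).piecewise
    (fun s => max (S.slope (τ s) (η s)) L) (fun s => F (τ s)) with hA
  have hAin : ∀ s, τ s ∈ IsLipParam.gaps σ → A s = max (S.slope (τ s) (η s)) L := fun s hs => by
    rw [hA, piecewise_eq_of_mem _ _ _ (show s ∈ τ ⁻¹' IsLipParam.gaps σ from hs)]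
  have hAout : ∀ s, τ s ∉ IsLipParam.gaps σ → A s = F (τ s) := fun s hs => by
    rw [hA, piecewise_eq_of_notMem _ _ _ (show s ∉ τ ⁻¹' IsLipParam.gaps σ from hs)]
  have hAm : AEMeasurable A (volume.restrict (Icc 0 (σ t))) := by
    rw [hA, ← indicator_add_compl_eq_piecewise]
    exact (((S.slope_meas 0 (σ t) τ η hσt hη).sup aemeasurable_const).indicator hgm).add
      ((hF.comp h.continuous.measurable).aemeasurable.indicator hgm.compl)
  have hAs : ∀ s ∈ Icc 0 (σ t), S.slope (τ s) (η s) ≤ A s := by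
    intro s hs
    by_cases hg : τ s ∈ IsLipParam.gaps σ
    · rw [hAin s hg]; exact le_max_left _ _
    · rw [hAout s hg, hcurve s hs hg]; exact hFs _ (hsub (hτ s hs))
  -- On the fibers over the gaps `τ' = 0` almost everywhere, so the power does not see the changes
  -- made there. The quantifier over `g` serves positive and negative parts at once.
  have hpow : ∀ᵐ s ∂volume.restrict (Icc 0 (σ t)), ∀ g : EReal → EReal,
      (g (S.power (τ s) (η s) (A s))).toENNReal * ENNReal.ofReal (deriv τ s)
        = (g (S.power (τ s) (u (τ s)) (F (τ s)))).toENNReal * ENNReal.ofReal (deriv τ s) := by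
    filter_upwards [ae_restrict_mem measurableSet_Icc, ae_restrict_of_ae h.deriv_eq_zero]
      with s hs hd g
    by_cases hg : τ s ∈ IsLipParam.gaps σ
    · rw [hd hg]; simp
    · rw [hcurve s hs hg, hAout s hg]
  have hpm := hPm.mono_set hsub
  have hplus : ∫⁻ s in Icc 0 (σ t), (S.power (τ s) (η s) (A s)).toENNReal
      * ENNReal.ofReal (deriv τ s) = ∫⁻ r in Icc 0 t, (S.power r (u r) (F r)).toENNReal := by
    rw [← h.lintegral_comp (a := 0) (b := t)
      (g := fun r => (S.power r (u r) (F r)).toENNReal)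
      (EReal.continuous_toENNReal.measurable.comp_aemeasurable hpm), hσ0]
    exact lintegral_congr_ae (hpow.mono fun s hs => hs id)
  have hminus : ∫⁻ s in Icc 0 (σ t), (-S.power (τ s) (η s) (A s)).toENNReal
      * ENNReal.ofReal (deriv τ s) = ∫⁻ r in Icc 0 t, (-S.power r (u r) (F r)).toENNReal := by
    rw [← h.lintegral_comp (a := 0) (b := t)
      (g := fun r => (-S.power r (u r) (F r)).toENNReal)
      (EReal.continuous_toENNReal.measurable.comp_aemeasurable hpm.neg), hσ0]
    exact lintegral_congr_ae (hpow.mono fun s hs => hs fun x => -x)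
  have hτ0 : τ 0 = 0 := by rw [← hσ0, h.inv, hσ0]
  have hmain := hS 0 (σ t) τ η A hσt hη hAm (by rwa [hτ0, hη0]) hAs (by rwa [hminus])
  rw [hτ0, hη0, h.inv, hηt] at hmain
  have hint : eIntegral (Icc 0 (σ t))
        (fun s => S.power (τ s) (η s) (A s) * ((deriv τ s : ℝ) : EReal))
      = eIntegral (Icc 0 t) (fun r => S.power r (u r) (F r)) := by
    unfold eIntegral
    congr 2
    · rw [← hplus]
      exact lintegral_congr fun s => toENNReal_mul_coe (h.deriv_nonneg s) _
    · rw [← hminus]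
      refine lintegral_congr fun s => ?_
      rw [← EReal.neg_mul]
      exact toENNReal_mul_coe (h.deriv_nonneg s) _
  rw [hint] at hmain
  refine hmain.trans (add_le_add le_rfl (EReal.coe_ennreal_le_coe_ennreal_iff.2 ?_))
  rw [← lintegral_inter_add_sdiff _ _ hgm, add_comm, hσ0]
  refine add_le_add ?_ (le_of_eq ?_)
  · have hle := h.lintegral_speed_le le_rfl ht.2 hF fun r hr hg => hFL r (hsub hr) hg
    rw [hσ0] at hle
    refine le_trans (le_of_eq ?_) hle
    refine setLIntegral_congr_fun (measurableSet_Icc.diff hgm) fun s hs => ?_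
    change A s * S.speed η s = F (τ s) * S.speed θ s
    rw [hAout s hs.2, (hηθ s hs.1 hs.2).2]
  · refine setLIntegral_congr_fun (measurableSet_Icc.inter hgm) fun s hs => ?_
    rw [hAin s hs.2]

/-! ### The power bound -/

variable {X : Type*} [TopologicalSpace X] {T : ℝ} {S : ℕ → EvolutionSystem X T}
  {S' : EvolutionSystem X T} {ψn : ℕ → ℝ≥0 → ℝ≥0} {ψ : ℝ≥0 → ℝ≥0} {L : ℝ≥0} {u : ℕ → ℝ → X}
  {G : ℕ → ℝ → ℝ≥0∞} {u' : ℝ → X} {E₀ : ℝ} {C : ℝ≥0} {ω : ℕ → ℝ≥0}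

namespace ParamApprox

variable {τn σn : ℕ → ℝ → ℝ} {θn : ℕ → ℝ → X} {vn : ℕ → ℝ → ℝ≥0∞} {τ σ : ℝ → ℝ} {θ : ℝ → X}

/-- The case `k = 0` of the energy estimate with the gaps as null set; the power bound, not yet
available, is avoided. -/
theorem fiber_length_ne_top (h : ParamApprox S S' ψn ψ L u G u' E₀ C ω τn σn θn vn τ σ θ) {t : ℝ}
    (ht : t ∈ Icc 0 T) : ∫⁻ s in Icc (σ 0) (σ t) ∩ τ ⁻¹' IsLipParam.gaps σ,
      max (S'.slope (τ s) (θ s)) L ≠ ⊤ := by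
  let := S'.metric
  obtain ⟨φ, hφ, e, -, he⟩ := h.exists_energy_limit ht
  have := h.energy_ineq 0 ht h.lip.countable_gaps.measurableSet
    (h.lip.countable_gaps.measure_zero _) hφ he
  have h1 := ne_top_of_le_ne_top
    (ENNReal.add_ne_top.2 ⟨ENNReal.ofReal_ne_top, ENNReal.ofReal_ne_top⟩) this
  rw [h.lip.zero]
  exact (ENNReal.add_ne_top.1 (ENNReal.add_ne_top.1 h1).1).2

/-- Again `k = 0`: the lower limit of the slope costs dominates `(-P(g))⁺` for some `g ≤ L`, and the
power is monotone. -/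
theorem negPart_power_ne_top (h : ParamApprox S S' ψn ψ L u G u' E₀ C ω τn σn θn vn τ σ θ) :
    ∫⁻ r in Icc 0 T, (-S'.power r (u' r) L).toENNReal ≠ ⊤ := by
  let := S'.metric
  have hT : T ∈ Icc 0 T := ⟨h.T_pos.le, le_rfl⟩
  obtain ⟨φ, hφ, e, -, he⟩ := h.exists_energy_limit hT
  have := h.energy_ineq 0 hT h.lip.countable_gaps.measurableSet
    (h.lip.countable_gaps.measure_zero _) hφ he
  have h1 := ne_top_of_le_ne_top
    (ENNReal.add_ne_top.2 ⟨ENNReal.ofReal_ne_top, ENNReal.ofReal_ne_top⟩) this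
  refine ne_top_of_le_ne_top (ENNReal.add_ne_top.1 (ENNReal.add_ne_top.1 h1).1).1
    (lintegral_mono_ae ?_)
  filter_upwards [ae_restrict_mem measurableSet_Icc, h.ae_liminf_slopeCost_lt_top 0] with r hr hr'
  obtain ⟨g, hgL, -, hg⟩ := h.exists_slope_limit 0 hr hr'
  refine le_trans (le_trans ?_ (le_add_self.trans hg)) le_add_self
  refine EReal.toENNReal_le_toENNReal ?_
  rw [Nat.cast_zero, EReal.coe_zero, zero_sub, EReal.neg_le_neg_iff]
  exact S'.power_mono r hr _ (show (g : ℝ≥0∞) ≤ L by exact_mod_cast hgL)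

/-- In the upper gradient inequality with the constant slope `L` off the gaps, the final energy, the
length of `u`, the Cantor part, the fibers and the negative part of the power are all finite; hence
so is the positive part. -/
theorem powerBound (h : ParamApprox S S' ψn ψ L u G u' E₀ C ω τn σn θn vn τ σ θ)
    (hS : S'.IsUpperGradient) (hE : S'.energy 0 (u' 0) = E₀) : S'.PowerBound L u' := by
  let := S'.metric
  have hT : T ∈ Icc 0 T := ⟨h.T_pos.le, le_rfl⟩
  obtain ⟨φ, hφ, e, hle, he⟩ := h.exists_energy_limit hT
  have hc : ∀ f : ℝ≥0, AEMeasurable (fun r => S'.power r (u' r) f) (volume.restrict (Icc 0 T)) :=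
    fun f => h.lip.aemeasurable_along (S'.power_meas f)
  set F : ℝ → ℝ≥0∞ := (IsLipParam.gaps σ).indicator (fun _ => ⊤) + fun _ => (L : ℝ≥0∞) with hFdef
  have hFout : ∀ r, r ∉ IsLipParam.gaps σ → F r = L := fun r hr => by
    simp [hFdef, indicator_of_notMem hr]
  have hFin : ∀ r, r ∈ IsLipParam.gaps σ → F r = ⊤ := fun r hr => by
    simp [hFdef, indicator_of_mem hr]
  have hFm : Measurable F := (measurable_const.indicator h.lip.countable_gaps.measurableSet).add
    measurable_const
  have hae : ∀ᵐ r ∂volume.restrict (Icc 0 T), F r = L := by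
    filter_upwards [h.lip.countable_gaps.ae_notMem _] with r hr using hFout r hr
  have hPM : ∫⁻ r in Icc 0 T, (-S'.power r (u' r) (F r)).toENNReal
      = ∫⁻ r in Icc 0 T, (-S'.power r (u' r) L).toENNReal :=
    lintegral_congr_ae (hae.mono fun r hr => by simp only [hr])
  have hPP : ∫⁻ r in Icc 0 T, (S'.power r (u' r) (F r)).toENNReal
      = ∫⁻ r in Icc 0 T, (S'.power r (u' r) L).toENNReal :=
    lintegral_congr_ae (hae.mono fun r hr => by simp only [hr])
  have hmain := hS.along h.lip (η := θ) (L := L) hFm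
    (fun r hr => by
      by_cases hg : r ∈ IsLipParam.gaps σ
      · rw [hFin r hg]; exact le_top
      · rw [hFout r hg]; exact h.slope_le_of_notMem_gaps hr hg)
    (fun r _ hg => (hFout r hg).le)
    ((hc L).congr (hae.mono fun r hr => by simp only [hr])) (hE ▸ EReal.coe_lt_top E₀) hT
    (by rw [hPM]; exact h.negPart_power_ne_top) (h.lip.isTimeOrderedAC le_rfl le_rfl)
    (by have := h.lip.comp' (t := 0) ⟨le_rfl, h.T_pos.le⟩; rwa [h.lip.zero] at this)
    (h.lip.comp' hT) (fun s _ _ => ⟨rfl, rfl⟩)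
  have h1 : (∫⁻ r in Icc 0 T, F r * S'.speed u' r) ≠ ⊤ := by
    have : (∫⁻ r in Icc 0 T, F r * S'.speed u' r) = L * ∫⁻ r in Icc 0 T, S'.speed u' r := by
      rw [← lintegral_const_mul' _ _ ENNReal.coe_ne_top]
      exact lintegral_congr_ae (hae.mono fun r hr => by simp only [hr])
    rw [this]
    exact ENNReal.mul_ne_top ENNReal.coe_ne_top h.lip.lintegral_metricDeriv_ne_top
  have h2 : (L : ℝ≥0∞) * S'.cantor u' (Icc 0 T) ≠ ⊤ :=
    ENNReal.mul_ne_top ENNReal.coe_ne_top (h.lip.cantorMeasure_ne_top T)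
  have h3 : ∫⁻ s in Icc (σ 0) (σ T) ∩ τ ⁻¹' IsLipParam.gaps σ,
      max (S'.slope (τ s) (θ s)) L * S'.speed θ s ≠ ⊤ := by
    refine ne_top_of_le_ne_top (h.fiber_length_ne_top hT) (lintegral_mono fun s => ?_)
    exact mul_le_of_le_one_right zero_le (metricDeriv_le_one h.lip.edist_le s)
  set R := (∫⁻ r in Icc 0 T, F r * S'.speed u' r) + L * S'.cantor u' (Icc 0 T)
    + ∫⁻ s in Icc (σ 0) (σ T) ∩ τ ⁻¹' IsLipParam.gaps σ, max (S'.slope (τ s) (θ s)) L * S'.speed θ s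
  have hR : R ≠ ⊤ := ENNReal.add_ne_top.2 ⟨ENNReal.add_ne_top.2 ⟨h1, h2⟩, h3⟩
  intro htop
  rw [hE, eIntegral, hPP, hPM, htop] at hmain
  clear_value R
  lift R to ℝ≥0 using hR
  set M := ∫⁻ r in Icc 0 T, (-S'.power r (u' r) L).toENNReal with hMdef
  have hM : M ≠ ⊤ := h.negPart_power_ne_top
  clear_value M
  lift M to ℝ≥0 using hM
  have e1 : ∀ x : ℝ≥0, ((x : ℝ≥0∞) : EReal) = ((x : ℝ) : EReal) := fun _ => rfl
  have h4 := hmain.trans (add_le_add hle le_rfl)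
  rw [e1, e1, EReal.coe_ennreal_top, EReal.top_sub_coe, EReal.coe_add_top, ← EReal.coe_add] at h4
  exact EReal.coe_ne_top _ (top_le_iff.1 h4)

end ParamApprox

end

noncomputable section

/-! ### Optimality of the fibers and energy balance -/

theorem coe_add_coe_le {e : ℝ} {a b : ℝ≥0∞} (h : (e : EReal) + (a : EReal) ≤ (e : EReal) + (b : EReal)) :
    a ≤ b := EReal.coe_ennreal_le_coe_ennreal_iff.1 (EReal.addLECancellable_coe e h)

theorem le_of_add_coe_le {x y : EReal} {D : ℝ≥0∞} (hD : D ≠ ⊤)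
    (h : x + (D : EReal) ≤ y + (D : EReal)) : x ≤ y := by
  lift D to ℝ≥0 using hD
  rw [add_comm x, add_comm y] at h
  exact EReal.addLECancellable_coe (D : ℝ) h

/-- Balances on two intervals with a common starting point are subtracted, which is legitimate
because dissipations and powers are finite. -/
theorem balance_sub {e₁ e₂ e₀ : ℝ} {D₁ D₂ Z₁ Z₂ M₁ M₂ : ℝ≥0∞} (hD : D₁ + D₂ ≠ ⊤)
    (hZ : Z₁ + Z₂ ≠ ⊤) (hM : M₁ + M₂ ≠ ⊤)
    (h₁ : (e₁ : EReal) + (D₁ : EReal) = (e₀ : EReal) + ((Z₁ : EReal) - (M₁ : EReal)))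
    (h₂ : (e₂ : EReal) + ((D₁ + D₂ : ℝ≥0∞) : EReal)
      = (e₀ : EReal) + (((Z₁ + Z₂ : ℝ≥0∞) : EReal) - ((M₁ + M₂ : ℝ≥0∞) : EReal))) :
    (e₂ : EReal) + (D₂ : EReal) = (e₁ : EReal) + ((Z₂ : EReal) - (M₂ : EReal)) := by
  obtain ⟨hD1, hD2⟩ := ENNReal.add_ne_top.1 hD
  obtain ⟨hZ1, hZ2⟩ := ENNReal.add_ne_top.1 hZ
  obtain ⟨hM1, hM2⟩ := ENNReal.add_ne_top.1 hM
  lift D₁ to ℝ≥0 using hD1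
  lift D₂ to ℝ≥0 using hD2
  lift Z₁ to ℝ≥0 using hZ1
  lift Z₂ to ℝ≥0 using hZ2
  lift M₁ to ℝ≥0 using hM1
  lift M₂ to ℝ≥0 using hM2
  have e1 : ∀ x : ℝ≥0, ((x : ℝ≥0∞) : EReal) = ((x : ℝ) : EReal) := fun _ => rfl
  simp only [← ENNReal.coe_add, e1, ← EReal.coe_add, ← EReal.coe_sub, EReal.coe_eq_coe_iff,
    NNReal.coe_add] at h₁ h₂ ⊢
  linarith

namespace IsLipParam

variable {X : Type*} [EMetricSpace X] {T : ℝ} {u : ℝ → X} {τ σ : ℝ → ℝ} {θ : ℝ → X}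

theorem cantorMeasure_Icc_add (h : IsLipParam T u τ σ θ) {a b c : ℝ} (hab : a ≤ b) (hbc : b ≤ c) :
    cantorMeasure T u (Icc a c) = cantorMeasure T u (Icc a b) + cantorMeasure T u (Icc b c) := by
  have : NullSingletonClass (cantorMeasure T u) := ⟨h.cantorMeasure_singleton⟩
  rw [← Icc_union_Ioc_eq_Icc hab hbc, measure_union
    (disjoint_left.2 fun x hx hx' => not_lt.2 hx.2 hx'.1) measurableSet_Ioc,
    measure_congr (Ioc_ae_eq_Icc (a := b) (b := c))]

theorem setLIntegral_gaps_add (h : IsLipParam T u τ σ θ) (g : ℝ → ℝ≥0∞) {a b c : ℝ} (hab : a ≤ b)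
    (hbc : b ≤ c) : ∫⁻ s in Icc (σ a) (σ c) ∩ τ ⁻¹' gaps σ, g s
      = (∫⁻ s in Icc (σ a) (σ b) ∩ τ ⁻¹' gaps σ, g s)
        + ∫⁻ s in Icc (σ b) (σ c) ∩ τ ⁻¹' gaps σ, g s := by
  have e : ∀ p q, ∫⁻ s in Icc p q ∩ τ ⁻¹' gaps σ, g s
      = ∫⁻ s in Icc p q, (τ ⁻¹' gaps σ).indicator g s := fun p q => by
    rw [setLIntegral_indicator h.measurableSet_preimage_gaps, inter_comm]
  rw [e, e, e, setLIntegral_Icc_add_Icc _ (h.strictMono.monotone hab) (h.strictMono.monotone hbc)]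

theorem ae_metricDeriv_lt_top (h : IsLipParam T u τ σ θ) :
    ∀ᵐ t ∂volume.restrict (Icc 0 T), metricDeriv u t < ⊤ :=
  ae_lt_top' h.aemeasurable_metricDeriv h.lintegral_metricDeriv_ne_top

theorem mem_gaps_of_fiber (h : IsLipParam T u τ σ θ) {p q r : ℝ} (hpq : p < q) (hp : τ p = r)
    (hq : τ q = r) : r ∈ gaps σ := by
  by_contra hr
  have h1 := h.inv' (hp.symm ▸ hr)
  have h2 := h.inv' (hq.symm ▸ hr)
  rw [hp] at h1
  rw [hq] at h2
  exact hpq.ne (h1.symm.trans h2)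

end IsLipParam

variable {X : Type*} [TopologicalSpace X] {T : ℝ} {S : ℕ → EvolutionSystem X T}
  {S' : EvolutionSystem X T} {ψn : ℕ → ℝ≥0 → ℝ≥0} {ψ : ℝ≥0 → ℝ≥0} {L : ℝ≥0} {u : ℕ → ℝ → X}
  {G : ℕ → ℝ → ℝ≥0∞} {u' : ℝ → X} {E₀ : ℝ} {C : ℝ≥0} {ω : ℕ → ℝ≥0}

namespace ParamApprox

variable {τn σn : ℕ → ℝ → ℝ} {θn : ℕ → ℝ → X} {vn : ℕ → ℝ → ℝ≥0∞} {τ σ : ℝ → ℝ} {θ : ℝ → X}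

theorem initial_curve (h : ParamApprox S S' ψn ψ L u G u' E₀ C ω τn σn θn vn τ σ θ) :
    θ 0 = u' 0 := by
  let := S'.metric
  have := h.lip.comp' (t := 0) ⟨le_rfl, h.T_pos.le⟩
  rwa [h.lip.zero] at this

/-- Young's inequality. The speed has to be finite almost everywhere, since `toNNReal` sends `⊤` to
`0`. -/
theorem lintegral_mul_speed_le (h : ParamApprox S S' ψn ψ L u G u' E₀ C ω τn σn θn vn τ σ θ)
    (F : ℝ → ℝ≥0∞) {t : ℝ} (ht : t ∈ Icc 0 T) : ∫⁻ r in Icc 0 t, F r * S'.speed u' r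
      ≤ ∫⁻ r in Icc 0 t, ((ψ (S'.speed u' r).toNNReal : ℝ≥0∞) + dual ψ (F r)) := by
  let := S'.metric
  refine lintegral_mono_ae ?_
  filter_upwards [ae_restrict_of_ae_restrict_of_subset (Icc_subset_Icc_right ht.2)
    h.lip.ae_metricDeriv_lt_top] with r hr
  have hr' : S'.speed u' r ≠ ⊤ := LT.lt.ne hr
  have := young_le ψ (F r) (S'.speed u' r).toNNReal
  rwa [ENNReal.coe_toNNReal hr'] at this

/-- The fibers of the parametrization are optimal transitions. -/
theorem fiber_length_le_transitionCost
    (h : ParamApprox S S' ψn ψ L u G u' E₀ C ω τn σn θn vn τ σ θ)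
    (hS : S'.IsUpperGradient) (hE : S'.energy 0 (u' 0) = E₀) {p q r : ℝ} (hp : 0 ≤ p) (hpq : p ≤ q)
    (hq : q ≤ σ T) (hr : ∀ s ∈ Icc p q, τ s = r) :
    ∫⁻ s in Icc p q, max (S'.slope (τ s) (θ s)) L
      ≤ @transitionCost X S'.metric (fun x => S'.slope r x ⊔ (L : ℝ≥0∞)) (θ p) (θ q) := by
  let := S'.metric
  rcases hpq.eq_or_lt with rfl | hlt
  · simp
  have hrg := h.lip.mem_gaps_of_fiber hlt (hr p ⟨le_rfl, hpq⟩) (hr q ⟨hpq, le_rfl⟩)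
  -- A strictly cheaper transition is spliced into the fiber; the upper gradient inequality along
  -- the new curve is then compared with the limit inequality along `θ`.
  by_contra! hcon
  obtain ⟨η, hη, hη0, hηT, hηout, hηspeed, hηlt⟩ := h.lip.exists_replacement hp hlt hq le_rfl
    (fun x => S'.slope r x ⊔ (L : ℝ≥0∞)) _ hcon
  have hT : T ∈ Icc 0 T := ⟨h.T_pos.le, le_rfl⟩
  have hpb := h.powerBound hS hE
  obtain ⟨F, hF, hFs, hFL, hPm, hk⟩ := h.exists_limit_slope hpb
  obtain ⟨φ, hφ, e, hle, he⟩ := h.exists_energy_limit hT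
  have hlim := h.limit_ineq hpb hF hFL hPm hk hT hφ he
  have hZ := h.power_lintegral_ne_top hpb hFL (subset_refl (Icc 0 T)) measurableSet_Icc
  have hfin := ne_top_of_le_ne_top (ENNReal.add_ne_top.2 ⟨ENNReal.ofReal_ne_top, hZ⟩) hlim
  obtain ⟨hDM, -⟩ := ENNReal.add_ne_top.1 hfin
  obtain ⟨hD, hM⟩ := ENNReal.add_ne_top.1 hDM
  obtain ⟨hDC, -⟩ := ENNReal.add_ne_top.1 hD
  have hlow := coe_add_le_of_shifted (h.neg_le_of_tendsto hT he) h.neg_le_initial hZ hlim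
  have hup := hS.along h.lip hF hFs hFL hPm (hE ▸ EReal.coe_lt_top E₀) hT hM hη
    (hη0.trans h.initial_curve) (hηT.trans (h.lip.comp' hT)) fun s _ hg => by
      have hs : s ∉ Icc p q := fun hs => hg (by rw [hr s hs]; exact hrg)
      exact ⟨hηout hs, hηspeed s hs⟩
  rw [hE] at hup
  -- Both inequalities contain `E₀` plus the integrated power; with the final energy at most `e` the
  -- energies cancel and only dissipations are left.
  have hle' := coe_add_coe_le (hlow.trans (hup.trans (add_le_add hle le_rfl)))
  have hAm : MeasurableSet (Icc (σ 0) (σ T) ∩ τ ⁻¹' IsLipParam.gaps σ) :=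
    measurableSet_Icc.inter h.lip.measurableSet_preimage_gaps
  set A := Icc (σ 0) (σ T) ∩ τ ⁻¹' IsLipParam.gaps σ with hA
  have hinter : A ∩ Icc p q = Icc p q := inter_eq_right.2 fun s hs =>
    ⟨⟨h.lip.zero.trans_le (hp.trans hs.1), hs.2.trans hq⟩, by
      change τ s ∈ IsLipParam.gaps σ
      rw [hr s hs]; exact hrg⟩
  have hsplit : ∀ g : ℝ → ℝ≥0∞, ∫⁻ s in A, g s = (∫⁻ s in Icc p q, g s)
      + ∫⁻ s in A \ Icc p q, g s := fun g => by
    rw [← lintegral_inter_add_sdiff _ _ (measurableSet_Icc (a := p) (b := q)), hinter]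
  have hstrict : ∫⁻ s in A, max (S'.slope (τ s) (η s)) L * S'.speed η s
      < ∫⁻ s in A, max (S'.slope (τ s) (θ s)) L := by
    have hκ := h.fiber_length_ne_top hT
    rw [hsplit] at hκ
    rw [hsplit, hsplit (fun s => max (S'.slope (τ s) (θ s)) L)]
    refine ENNReal.add_lt_add_of_lt_of_le ?_ ?_ ?_
    · refine ne_top_of_le_ne_top (ENNReal.add_ne_top.1 hκ).2 ?_
      refine setLIntegral_mono' (hAm.diff measurableSet_Icc) fun s hs => ?_
      rw [hηout hs.2]
      exact mul_le_of_le_one_right zero_le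
        ((hηspeed s hs.2).trans_le (metricDeriv_le_one h.lip.edist_le s))
    · refine lt_of_eq_of_lt ?_ hηlt
      refine setLIntegral_congr_fun measurableSet_Icc fun s hs => ?_
      change max (S'.slope (τ s) (η s)) L * S'.speed η s = (S'.slope r (η s) ⊔ L) * S'.speed η s
      rw [hr s hs]
    · refine setLIntegral_mono' (hAm.diff measurableSet_Icc) fun s hs => ?_
      rw [hηout hs.2]
      exact mul_le_of_le_one_right zero_le
        ((hηspeed s hs.2).trans_le (metricDeriv_le_one h.lip.edist_le s))
  refine absurd hle' (not_le.2 ?_)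
  refine lt_of_le_of_lt (add_le_add (add_le_add (h.lintegral_mul_speed_le F hT) le_rfl) le_rfl) ?_
  exact ENNReal.add_lt_add_left hDC hstrict

/-- The jump functional is the weighted length of the fibers. -/
theorem jump_eq (h : ParamApprox S S' ψn ψ L u G u' E₀ C ω τn σn θn vn τ σ θ)
    (hS : S'.IsUpperGradient) (hE : S'.energy 0 (u' 0) = E₀) {a b : ℝ} (ha : 0 ≤ a) (hab : a ≤ b)
    (hb : b ≤ T) : S'.jump L u' a b
      = ∫⁻ s in Icc (σ a) (σ b) ∩ τ ⁻¹' IsLipParam.gaps σ, max (S'.slope (τ s) (θ s)) L := by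
  let := S'.metric
  refine le_antisymm (h.lip.jumpCost_le _ ha hb) ?_
  rcases hab.eq_or_lt with rfl | hlt
  · refine le_trans (le_of_eq ?_) zero_le
    exact setLIntegral_measure_zero _ _
      (measure_mono_null inter_subset_left (by simp))
  refine h.lip.le_jumpCost _ _ ha hlt hb (fun r har hrb => ?_) fun r har hrb => ?_
  · rw [h.lip.limL_eq, ← h.lip.comp' ⟨ha.trans har.le, hrb.trans hb⟩]
    refine h.fiber_length_le_transitionCost hS hE ?_ (h.lip.leftLim_le r)
      (h.lip.strictMono.monotone (hrb.trans hb))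
      fun s hs => h.lip.eq_iff.2 ⟨hs.1, hs.2.trans (h.lip.le_rightLim r)⟩
    have := h.lip.le_leftLim (lt_of_le_of_lt ha har)
    rwa [h.lip.zero] at this
  · rw [h.lip.limR_eq, ← h.lip.comp' ⟨ha.trans har, hrb.le.trans hb⟩]
    refine h.fiber_length_le_transitionCost hS hE ?_ (h.lip.le_rightLim r)
      (h.lip.rightLim_le (hrb.trans_le hb))
      fun s hs => h.lip.eq_iff.2 ⟨(h.lip.leftLim_le r).trans hs.1, hs.2⟩
    have := h.lip.strictMono.monotone (ha.trans har)
    rwa [h.lip.zero] at this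

/-- For an upper gradient system the limit curve satisfies the energy balance, and the energies
converge. -/
theorem exists_bvBalance (h : ParamApprox S S' ψn ψ L u G u' E₀ C ω τn σn θn vn τ σ θ)
    (hS : S'.IsUpperGradient) (hE : S'.energy 0 (u' 0) = E₀) :
    (∃ F, S'.BVBalance ψ L u' F) ∧ ∀ t ∈ Icc 0 T, ∀ (φ : ℕ → ℕ) (e : ℝ), StrictMono φ →
      Tendsto (fun n => (S (φ n)).energy t (u (φ n) t)) atTop (𝓝 (e : EReal)) →
      S'.energy t (u' t) = e := by
  let := S'.metric
  have hpb := h.powerBound hS hE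
  obtain ⟨F, hF, hFs, hFL, hPm, hk⟩ := h.exists_limit_slope hpb
  have hZ : ∀ t ∈ Icc 0 T, ∫⁻ r in Icc 0 t, (S'.power r (u' r) (F r)).toENNReal ≠ ⊤ := fun t ht =>
    h.power_lintegral_ne_top hpb hFL (Icc_subset_Icc_right ht.2) measurableSet_Icc
  have key : ∀ t ∈ Icc 0 T, ∀ (φ : ℕ → ℕ) (e : ℝ), StrictMono φ →
      Tendsto (fun n => (S (φ n)).energy t (u (φ n) t)) atTop (𝓝 (e : EReal)) →
      S'.energy t (u' t) = e ∧ S'.bvDissipation ψ L u' F 0 t ≠ ⊤ ∧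
        ∫⁻ r in Icc 0 t, (-S'.power r (u' r) (F r)).toENNReal ≠ ⊤ ∧
        (e : EReal) + (S'.bvDissipation ψ L u' F 0 t : EReal)
          = E₀ + eIntegral (Icc 0 t) (fun r => S'.power r (u' r) (F r)) := by
    intro t ht φ e hφ he
    have hlim := h.limit_ineq hpb hF hFL hPm hk ht hφ he
    have hlsc : S'.energy t (u' t) ≤ e :=
      (h.energy_lsc φ hφ t ht).trans_eq he.liminf_eq
    have hfin := ne_top_of_le_ne_top (ENNReal.add_ne_top.2 ⟨ENNReal.ofReal_ne_top, hZ t ht⟩) hlim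
    obtain ⟨hDM, -⟩ := ENNReal.add_ne_top.1 hfin
    obtain ⟨hD, hM⟩ := ENNReal.add_ne_top.1 hDM
    have hlow := coe_add_le_of_shifted (h.neg_le_of_tendsto ht he) h.neg_le_initial (hZ t ht) hlim
    have hup := hS.along h.lip hF hFs hFL hPm (hE ▸ EReal.coe_lt_top E₀) ht hM
      (h.lip.isTimeOrderedAC le_rfl (h.lip.strictMono.monotone ht.2)) h.initial_curve
      (h.lip.comp' ht) fun s _ _ => ⟨rfl, rfl⟩
    have hDeq : S'.bvDissipation ψ L u' F 0 t
        = (∫⁻ r in Icc 0 t, ((ψ (S'.speed u' r).toNNReal : ℝ≥0∞) + dual ψ (F r)))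
          + L * S'.cantor u' (Icc 0 t) + ∫⁻ s in Icc (σ 0) (σ t) ∩ τ ⁻¹' IsLipParam.gaps σ,
            max (S'.slope (τ s) (θ s)) L := by
      rw [← h.jump_eq hS hE le_rfl ht.1 ht.2]; rfl
    rw [← hDeq] at hlow hD
    have hup' : (E₀ : EReal) + eIntegral (Icc 0 t) (fun r => S'.power r (u' r) (F r))
        ≤ S'.energy t (u' t) + (S'.bvDissipation ψ L u' F 0 t : EReal) := by
      rw [hE] at hup
      refine hup.trans (add_le_add le_rfl (EReal.coe_ennreal_le_coe_ennreal_iff.2 ?_))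
      rw [hDeq]
      refine add_le_add (add_le_add (h.lintegral_mul_speed_le F ht) le_rfl)
        (lintegral_mono fun s => ?_)
      exact mul_le_of_le_one_right zero_le (metricDeriv_le_one h.lip.edist_le s)
    -- From `e + D ≤ E₀ + ∫ P ≤ E(t, u(t)) + D` with `D` finite.
    have hge : (e : EReal) ≤ S'.energy t (u' t) := le_of_add_coe_le hD (hlow.trans hup')
    have heq := le_antisymm hlsc hge
    refine ⟨heq, hD, hM, le_antisymm hlow ?_⟩
    rwa [heq] at hup'
  refine ⟨⟨F, h.bvAdmissible hE hpb hF hFs hFL hPm, fun t₁ t₂ h0 h12 h2 => ?_⟩,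
    fun t ht φ e hφ he => (key t ht φ e hφ he).1⟩
  have ht₁ : t₁ ∈ Icc 0 T := ⟨h0, h12.trans h2⟩
  have ht₂ : t₂ ∈ Icc 0 T := ⟨h0.trans h12, h2⟩
  obtain ⟨φ₁, hφ₁, e₁, -, he₁⟩ := h.exists_energy_limit ht₁
  obtain ⟨φ₂, hφ₂, e₂, -, he₂⟩ := h.exists_energy_limit ht₂
  obtain ⟨hE₁, -, -, hb₁⟩ := key t₁ ht₁ φ₁ e₁ hφ₁ he₁
  obtain ⟨hE₂, hD₂, hM₂, hb₂⟩ := key t₂ ht₂ φ₂ e₂ hφ₂ he₂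
  -- Additivity of the jump part comes from its representation by fibers, where the two half fibers
  -- at `t₁` go to different intervals.
  have hDadd : S'.bvDissipation ψ L u' F 0 t₂
      = S'.bvDissipation ψ L u' F 0 t₁ + S'.bvDissipation ψ L u' F t₁ t₂ := by
    unfold EvolutionSystem.bvDissipation
    rw [h.jump_eq hS hE le_rfl ht₂.1 h2, h.jump_eq hS hE le_rfl h0 ht₁.2, h.jump_eq hS hE h0 h12 h2,
      h.lip.setLIntegral_gaps_add _ h0 h12, setLIntegral_Icc_add_Icc _ h0 h12,
      show S'.cantor u' (Icc 0 t₂) = S'.cantor u' (Icc 0 t₁) + S'.cantor u' (Icc t₁ t₂) from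
        h.lip.cantorMeasure_Icc_add h0 h12]
    ring
  have hZ₂ := hZ t₂ ht₂
  rw [hDadd] at hD₂ hb₂
  unfold eIntegral at hb₁ hb₂ ⊢
  rw [setLIntegral_Icc_add_Icc _ h0 h12] at hZ₂ hM₂
  rw [setLIntegral_Icc_add_Icc _ h0 h12,
    setLIntegral_Icc_add_Icc (fun r => (-S'.power r (u' r) (F r)).toENNReal) h0 h12] at hb₂
  rw [hE₁, hE₂]
  exact balance_sub hD₂ hZ₂ hM₂ hb₁ hb₂

end ParamApprox

namespace Approx

/-- Every subsequence has a further one along which both the energies and the parametrizations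
converge; the balance identifies the limit independently of the choice. -/
theorem tendsto_energy (h : Approx S S' ψn ψ L u G u' E₀ C ω) (hS : S'.IsUpperGradient)
    (hE : S'.energy 0 (u' 0) = E₀) {t : ℝ} (ht : t ∈ Icc 0 T) :
    Tendsto (fun n => (S n).energy t (u n t)) atTop (𝓝 (S'.energy t (u' t))) := by
  refine tendsto_of_subseq_tendsto fun ns hns => ?_
  obtain ⟨φ, hφ, hφns⟩ := strictMono_subseq_of_tendsto_atTop hns
  obtain ⟨χ, hχ, e, -, he⟩ := (h.subseq hφns).exists_energy_limit ht
  obtain ⟨ξ, hξ, τn, σn, θn, vn, τ, σ, θ, hp⟩ := (h.subseq (hφns.comp hχ)).exists_paramApprox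
  have he' := he.comp hξ.tendsto_atTop
  have := (hp.exists_bvBalance hS hE).2 t ht id e strictMono_id he'
  rw [this]
  exact ⟨fun n => φ (χ n), he⟩

end Approx

end

noncomputable section

/-! ### Limits along infinite sets and along sequences -/

theorem along_range {φ : ℕ → ℕ} (hφ : StrictMono φ) : along (range φ) = map φ atTop := by
  rw [along, ← map_comap, comap_embedding_atTop (fun _ _ => hφ.le_iff_le)
    fun c => ⟨c, hφ.le_apply⟩]

theorem along_inter_Ici (H : Set ℕ) (N : ℕ) : along (H ∩ Ici N) = along H := by
  have : 𝓟 (Ici N) ⊓ atTop = (atTop : Filter ℕ) :=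
    inf_eq_right.2 (le_principal_iff.2 (Ici_mem_atTop N))
  rw [along, along, ← inf_principal, inf_comm (𝓟 H), ← inf_assoc, inf_comm atTop, this]

theorem exists_strictMono_range {H : Set ℕ} (hH : H.Infinite) :
    ∃ φ : ℕ → ℕ, StrictMono φ ∧ range φ = H :=
  ⟨Nat.nth (· ∈ H), Nat.nth_strictMono hH, Nat.range_nth_of_infinite hH⟩

theorem infinite_range {φ : ℕ → ℕ} (hφ : StrictMono φ) : (range φ).Infinite :=
  infinite_range_of_injective hφ.injective

section Conditions

variable {X : Type*} {T : ℝ} {S : ℕ → EvolutionSystem X T} {S' : EvolutionSystem X T}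
  {ubar : ℕ → X} {a b : ℝ}

/-- The conditions speak of families indexed by `ℕ`; a sequence along `φ` becomes one through
`Function.invFun φ`, whose values off the range do not matter. -/
theorem boundedAlong_range {φ : ℕ → ℕ} (hφ : StrictMono φ) {t : ℕ → ℝ} {x : ℕ → X} {C : ℝ}
    (ht : ∀ n, t n ∈ Icc 0 T) (hx : ∀ n, shiftedEnergy S ubar a b (φ n) (t n) (x n) ≤ C) :
    BoundedAlong S ubar a b (range φ) (fun h => t (Function.invFun φ h))
      (fun h => x (Function.invFun φ h)) := by
  have hinv := Function.leftInverse_invFun hφ.injective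
  refine ⟨?_, C, ?_⟩
  · rintro _ ⟨n, rfl⟩
    exact ht _
  · rintro _ ⟨n, rfl⟩
    simp only [hinv n]
    exact hx n

theorem tendsto_along_range {φ : ℕ → ℕ} (hφ : StrictMono φ) {Y : Type*} {l : Filter Y} {x : ℕ → Y}
    (hx : Tendsto x atTop l) :
    Tendsto (fun h => x (Function.invFun φ h)) (along (range φ)) l := by
  have hinv := Function.leftInverse_invFun hφ.injective
  rw [along_range hφ, tendsto_map'_iff]
  exact hx.congr fun n => by simp [hinv n]

variable [TopologicalSpace X]

theorem CondC2.seq (h : CondC2 S ubar a b) {φ : ℕ → ℕ} (hφ : StrictMono φ) {t : ℕ → ℝ}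
    {x : ℕ → X} {C : ℝ} (ht : ∀ n, t n ∈ Icc 0 T)
    (hx : ∀ n, shiftedEnergy S ubar a b (φ n) (t n) (x n) ≤ C) :
    ∃ χ : ℕ → ℕ, StrictMono χ ∧ ∃ y, Tendsto (fun n => x (χ n)) atTop (𝓝 y) := by
  have hinv := Function.leftInverse_invFun hφ.injective
  obtain ⟨H', hsub, hinf, -, y, -, hy⟩ := h _ _ _ (infinite_range hφ) (boundedAlong_range hφ ht hx)
  have hinf' : (φ ⁻¹' H').Infinite := hinf.preimage hsub
  obtain ⟨χ, hχ, hr⟩ := exists_strictMono_range hinf'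
  have hr' : range (φ ∘ χ) = H' := by
    rw [range_comp, hr, image_preimage_eq_of_subset hsub]
  rw [← hr', along_range (hφ.comp hχ), tendsto_map'_iff] at hy
  exact ⟨χ, hχ, y, hy.congr fun n => by simp [hinv (χ n)]⟩

theorem CondC3.seq (h : CondC3 S S' ubar a b) {φ : ℕ → ℕ} (hφ : StrictMono φ) {t₁ t₂ : ℕ → ℝ}
    {x₁ x₂ : ℕ → X} {s₁ s₂ : ℝ} {y₁ y₂ : X} {C : ℝ} (ht₁ : ∀ n, t₁ n ∈ Icc 0 T)
    (ht₂ : ∀ n, t₂ n ∈ Icc 0 T) (hx₁ : ∀ n, shiftedEnergy S ubar a b (φ n) (t₁ n) (x₁ n) ≤ C)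
    (hx₂ : ∀ n, shiftedEnergy S ubar a b (φ n) (t₂ n) (x₂ n) ≤ C)
    (hs₁ : Tendsto t₁ atTop (𝓝 s₁)) (hy₁ : Tendsto x₁ atTop (𝓝 y₁))
    (hs₂ : Tendsto t₂ atTop (𝓝 s₂)) (hy₂ : Tendsto x₂ atTop (𝓝 y₂)) :
    S'.dist y₁ y₂ ≤ liminf (fun n => (S (φ n)).dist (x₁ n) (x₂ n)) atTop := by
  have hinv := Function.leftInverse_invFun hφ.injective
  have := h _ _ _ _ _ _ _ _ _ (infinite_range hφ) (boundedAlong_range hφ ht₁ hx₁)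
    (boundedAlong_range hφ ht₂ hx₂) (tendsto_along_range hφ hs₁) (tendsto_along_range hφ hy₁)
    (tendsto_along_range hφ hs₂) (tendsto_along_range hφ hy₂)
  rw [along_range hφ, ← liminf_comp] at this
  refine this.trans_eq (congrArg (fun f => liminf f atTop) (funext fun n => ?_))
  simp [hinv n]

theorem CondC4E.seq (h : CondC4E S S' ubar a b) {φ : ℕ → ℕ} (hφ : StrictMono φ) {t : ℝ}
    {x : ℕ → X} {y : X} {C : ℝ} (ht : t ∈ Icc 0 T)
    (hx : ∀ n, shiftedEnergy S ubar a b (φ n) t (x n) ≤ C) (hy : Tendsto x atTop (𝓝 y)) :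
    S'.energy t y ≤ liminf (fun n => (S (φ n)).energy t (x n)) atTop := by
  have hinv := Function.leftInverse_invFun hφ.injective
  have := h _ t _ _ (infinite_range hφ) (boundedAlong_range hφ (fun _ => ht) hx)
    (tendsto_along_range hφ hy)
  rw [along_range hφ, ← liminf_comp] at this
  refine this.trans_eq (congrArg (fun f => liminf f atTop) (funext fun n => ?_))
  simp [hinv n]

theorem CondC4FP.seq (h : CondC4FP S S' ubar a b) {φ : ℕ → ℕ} (hφ : StrictMono φ) {t : ℝ}
    {x : ℕ → X} {y : X} {f : ℕ → ℝ≥0} {f' : ℝ≥0} {C : ℝ} (ht : t ∈ Icc 0 T)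
    (hx : ∀ n, shiftedEnergy S ubar a b (φ n) t (x n) ≤ C) (hy : Tendsto x atTop (𝓝 y))
    (hf : ∀ n, (S (φ n)).slope t (x n) ≤ f n) (hf' : Tendsto f atTop (𝓝 f')) :
    S'.slope t y ≤ f' ∧
      limsup (fun n => (S (φ n)).power t (x n) (f n)) atTop ≤ S'.power t y f' := by
  have hinv := Function.leftInverse_invFun hφ.injective
  have := h _ t _ _ (fun h => f (Function.invFun φ h)) _ (infinite_range hφ)
    (boundedAlong_range hφ (fun _ => ht) hx) (tendsto_along_range hφ hy)
    (by
      rintro _ ⟨n, rfl⟩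
      rw [hinv n]
      exact hf n) (tendsto_along_range hφ hf')
  rw [along_range hφ, ← limsup_comp] at this
  refine ⟨this.1, le_trans (le_of_eq ?_) this.2⟩
  refine congrArg (fun f => limsup f atTop) (funext fun n => ?_)
  simp [hinv n]

theorem CondC4F.seq (h : CondC4F S S' ubar a b) {φ : ℕ → ℕ} (hφ : StrictMono φ) {t : ℕ → ℝ}
    {x : ℕ → X} {s : ℝ} {y : X} {C : ℝ} (ht : ∀ n, t n ∈ Icc 0 T)
    (hx : ∀ n, shiftedEnergy S ubar a b (φ n) (t n) (x n) ≤ C)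
    (hE : ∀ n, (S (φ n)).energy (t n) (x n) ≤ C)
    (hs : Tendsto t atTop (𝓝 s)) (hy : Tendsto x atTop (𝓝 y)) :
    S'.slope s y ≤ liminf (fun n => (S (φ n)).slope (t n) (x n)) atTop := by
  have hinv := Function.leftInverse_invFun hφ.injective
  have := h _ _ _ _ _ (infinite_range hφ) (boundedAlong_range hφ ht hx)
    ⟨C, by
      rintro _ ⟨n, rfl⟩
      rw [hinv n]
      exact hE n⟩
    (tendsto_along_range hφ hs) (tendsto_along_range hφ hy)
  rw [along_range hφ, ← liminf_comp] at this
  refine this.trans_eq (congrArg (fun f => liminf f atTop) (funext fun n => ?_))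
  simp [hinv n]

end Conditions

/-! ### Equi-integrability -/

section EquiIntegrability

variable {H : Set ℕ} {T : ℝ} {g : ℕ → ℝ → ℝ≥0∞}

/-- `(0, T)` is covered by finitely many pieces of length `δ`, on each of which the integrals are at
most one. -/
theorem EquiIntegrable.exists_bound (h : EquiIntegrable H T g) :
    ∃ K : ℝ≥0, ∀ i ∈ H, ∫⁻ r in Icc 0 T, g i r ≤ K := by
  obtain ⟨δ, hδ, hle⟩ := h 1 one_pos
  have hstep : ∀ i ∈ H, ∀ n : ℕ, ∫⁻ r in Ioo 0 T ∩ Iic (n * δ : ℝ), g i r ≤ n := by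
    intro i hi n
    induction n with
    | zero =>
      have : Ioo 0 T ∩ Iic (((0 : ℕ) : ℝ) * δ) = ∅ := by
        ext r
        simp only [mem_inter_iff, mem_Ioo, mem_Iic, Nat.cast_zero, zero_mul, mem_empty_iff_false,
          iff_false]
        exact fun hr => not_lt.2 hr.2 hr.1.1
      rw [this]; simp
    | succ n ih =>
      have hsub : Ioo 0 T ∩ Iic (((n + 1 : ℕ) : ℝ) * δ) ⊆ (Ioo 0 T ∩ Iic (n * δ : ℝ))
          ∪ (Ioo 0 T ∩ Ioc (n * δ : ℝ) (n * δ + δ)) := by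
        intro r hr
        rcases le_or_gt r (n * δ) with h1 | h1
        · exact Or.inl ⟨hr.1, h1⟩
        · refine Or.inr ⟨hr.1, h1, ?_⟩
          have := hr.2
          simp only [mem_Iic, Nat.cast_add, Nat.cast_one] at this
          linarith
      refine (lintegral_mono_set hsub).trans ((lintegral_union_le _ _ _).trans ?_)
      rw [Nat.cast_add, Nat.cast_one]
      refine add_le_add ih ?_
      refine hle i hi _ (measurableSet_Ioo.inter measurableSet_Ioc) inter_subset_left ?_
      refine (measure_mono inter_subset_right).trans (le_of_eq ?_)
      rw [Real.volume_Ioc, add_sub_cancel_left, ENNReal.ofReal_coe_nnreal]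
  obtain ⟨n, hn⟩ := exists_nat_ge (T / δ)
  refine ⟨n, fun i hi => ?_⟩
  have : Ioo 0 T ⊆ Ioo 0 T ∩ Iic (n * δ : ℝ) := fun r hr => ⟨hr, by
    rw [div_le_iff₀ (by exact_mod_cast hδ)] at hn
    exact hr.2.le.trans hn⟩
  rw [← restrict_Ioo_eq_restrict_Icc]
  exact (lintegral_mono_set this).trans (by simpa using hstep i hi n)

/-- By Chebyshev's inequality the sets where `g i ≥ k` have measure at most `K / k` for all `i`, so
the integrals over them are uniformly small. -/
theorem EquiIntegrable.exists_modulus (h : EquiIntegrable H T g)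
    (hg : ∀ i ∈ H, AEMeasurable (g i) (volume.restrict (Icc 0 T))) :
    ∃ ω : ℕ → ℝ≥0, Tendsto ω atTop (𝓝 0) ∧
      ∀ i ∈ H, ∀ k : ℕ, ∫⁻ r in Icc 0 T, (g i r - k) ≤ ω k := by
  obtain ⟨K, hK⟩ := h.exists_bound
  set W : ℕ → ℝ≥0∞ := fun k => ⨆ i ∈ H, ∫⁻ r in Icc 0 T, (g i r - k) with hW
  have hWK : ∀ k, W k ≤ K := fun k => iSup₂_le fun i hi =>
    (lintegral_mono fun r => tsub_le_self).trans (hK i hi)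
  have hWtop : ∀ k, W k ≠ ⊤ := fun k => ne_top_of_le_ne_top ENNReal.coe_ne_top (hWK k)
  have hlim : Tendsto W atTop (𝓝 0) := by
    rw [ENNReal.tendsto_atTop_zero]
    intro ε hε
    rcases eq_or_ne ε ⊤ with rfl | hε'
    · exact ⟨0, fun _ _ => le_top⟩
    lift ε to ℝ≥0 using hε'
    obtain ⟨δ, hδ, hle⟩ := h ε (by exact_mod_cast hε)
    obtain ⟨n, hn⟩ := exists_nat_ge (K / δ)
    refine ⟨n + 1, fun k hk => iSup₂_le fun i hi => ?_⟩
    obtain ⟨f, hf, hfg⟩ := hg i hi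
    set A := Ioo 0 T ∩ {r | (k : ℝ≥0∞) ≤ f r} with hA
    have hAm : MeasurableSet A := measurableSet_Ioo.inter (measurableSet_le measurable_const hf)
    have hk0 : (k : ℝ≥0∞) ≠ 0 := by simp; omega
    have hvol : volume A ≤ δ := by
      have h1 : k * volume A ≤ K := by
        calc k * volume A = ∫⁻ r in A, (k : ℝ≥0∞) := (setLIntegral_const _ _).symm
          _ ≤ ∫⁻ r in A, f r := setLIntegral_mono' hAm fun r hr => hr.2
          _ ≤ ∫⁻ r in Icc 0 T, f r :=
              lintegral_mono_set (inter_subset_left.trans Ioo_subset_Icc_self)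
          _ = ∫⁻ r in Icc 0 T, g i r := (lintegral_congr_ae hfg).symm
          _ ≤ K := hK i hi
      have h2 : (K : ℝ≥0∞) ≤ k * δ := by
        have h3 : K ≤ n * δ := by rwa [div_le_iff₀ hδ] at hn
        have h4 : (n : ℝ≥0) * δ ≤ k * δ := by gcongr; omega
        exact_mod_cast h3.trans h4
      exact (ENNReal.mul_le_mul_iff_right hk0 (ENNReal.natCast_ne_top k)).1 (h1.trans h2)
    calc ∫⁻ r in Icc 0 T, (g i r - k) = ∫⁻ r in Ioo 0 T, (f r - k) := by
          rw [restrict_Ioo_eq_restrict_Icc]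
          exact lintegral_congr_ae (hfg.mono fun r hr => by simp only [hr])
      _ ≤ ∫⁻ r in Ioo 0 T, {r | (k : ℝ≥0∞) ≤ f r}.indicator f r := by
          refine lintegral_mono fun r => ?_
          by_cases hr : (k : ℝ≥0∞) ≤ f r
          · rw [indicator_of_mem (show r ∈ {r | (k : ℝ≥0∞) ≤ f r} from hr)]
            exact tsub_le_self
          · rw [tsub_eq_zero_of_le (not_le.1 hr).le]
            exact zero_le
      _ = ∫⁻ r in A, f r := by
          rw [setLIntegral_indicator (measurableSet_le measurable_const hf), inter_comm]
      _ = ∫⁻ r in A, g i r := lintegral_congr_ae (ae_restrict_of_ae_restrict_of_subset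
          (inter_subset_left.trans Ioo_subset_Icc_self) hfg.symm)
      _ ≤ ε := hle i hi A hAm inter_subset_left hvol
  refine ⟨fun k => (W k).toNNReal, ?_, fun i hi k => ?_⟩
  · exact (ENNReal.tendsto_toNNReal ENNReal.zero_ne_top).comp hlim
  · rw [ENNReal.coe_toNNReal (hWtop k)]
    exact le_iSup₂ (f := fun i (_ : i ∈ H) => ∫⁻ r in Icc 0 T, (g i r - k)) i hi

end EquiIntegrability

/-! ### A priori bounds -/

/-- The right side is below `∞`, and an infinite `M` would make it `-∞`, which the left side cannot
reach; so all terms are finite and the inequality is one between reals. -/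
theorem real_of_add_le {x y : EReal} {D Z M : ℝ≥0∞} (hx : x ≠ ⊥) (hy : y ≠ ⊥) (hy' : y < ⊤)
    (hZ : Z ≠ ⊤) (h : x + (D : EReal) ≤ y + ((Z : EReal) - (M : EReal))) :
    x ≠ ⊤ ∧ D ≠ ⊤ ∧ M ≠ ⊤ ∧ x.toReal + D.toReal + M.toReal ≤ y.toReal + Z.toReal := by
  lift y to ℝ using ⟨hy'.ne, hy⟩
  lift Z to ℝ≥0 using hZ
  have e1 : ∀ x : ℝ≥0, ((x : ℝ≥0∞) : EReal) = ((x : ℝ) : EReal) := fun _ => rfl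
  have hM : M ≠ ⊤ := by
    rintro rfl
    rw [e1, EReal.coe_ennreal_top, EReal.sub_top, EReal.add_bot, le_bot_iff,
      EReal.add_eq_bot_iff] at h
    exact h.elim hx (EReal.coe_ennreal_ne_bot D)
  lift M to ℝ≥0 using hM
  rw [e1, e1, ← EReal.coe_sub, ← EReal.coe_add] at h
  have hxt : x ≠ ⊤ := by
    rintro rfl
    rw [EReal.top_add_of_ne_bot (EReal.coe_ennreal_ne_bot D)] at h
    exact EReal.coe_ne_top _ (top_le_iff.1 h)
  lift x to ℝ using ⟨hxt, hx⟩
  have hD : D ≠ ⊤ := by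
    rintro rfl
    rw [EReal.coe_ennreal_top, EReal.coe_add_top] at h
    exact EReal.coe_ne_top _ (top_le_iff.1 h)
  lift D to ℝ≥0 using hD
  rw [e1, ← EReal.coe_add, EReal.coe_le_coe_iff] at h
  refine ⟨hxt, ENNReal.coe_ne_top, ENNReal.coe_ne_top, ?_⟩
  simp only [EReal.toReal_coe, ENNReal.coe_toReal]
  linarith

/-- For `y ≥ 0` both sides are `max k y`, for `y < 0` both are `k - y`. The last term is the excess
that equi-integrability makes small. -/
theorem toENNReal_natCast_sub_add (k : ℕ) (y : EReal) :
    (((k : ℝ) : EReal) - y).toENNReal + y.toENNReal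
      = (k : ℝ≥0∞) + (-y).toENNReal + (y.toENNReal - k) := by
  induction y with
  | bot => rw [EReal.coe_sub_bot]; simp
  | top => simp
  | coe y =>
    rw [← EReal.coe_sub, ← EReal.coe_neg, EReal.real_coe_toENNReal, EReal.real_coe_toENNReal,
      EReal.real_coe_toENNReal, ← ENNReal.ofReal_natCast]
    have hk : (0 : ℝ) ≤ k := by positivity
    rw [← ENNReal.ofReal_sub _ hk]
    rcases le_total y 0 with h1 | h1
    · rw [ENNReal.ofReal_of_nonpos h1, ENNReal.ofReal_of_nonpos (p := y - k) (by linarith), add_zero,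
        add_zero, ← ENNReal.ofReal_add hk (by linarith)]
      rfl
    · rw [ENNReal.ofReal_of_nonpos (p := -y) (by linarith), add_zero]
      rcases le_total y k with h2 | h2
      · rw [ENNReal.ofReal_of_nonpos (p := y - k) (by linarith), add_zero,
          ← ENNReal.ofReal_add (by linarith) h1, sub_add_cancel]
      · rw [ENNReal.ofReal_of_nonpos (p := k - y) (by linarith), zero_add,
          ← ENNReal.ofReal_add hk (by linarith), add_sub_cancel]

end

noncomputable section

/-! ### Consequences of a single energy-dissipation inequality -/

namespace EvolutionSystem.EnergyDissipation

variable {X : Type*} {T : ℝ} {S : EvolutionSystem X T} {ψ : ℝ≥0 → ℝ≥0} {u : ℝ → X} {F : ℝ → ℝ≥0∞}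

theorem power_int_Icc (h : S.EnergyDissipation ψ u F) {t : ℝ} (ht : t ∈ Icc 0 T) :
    ∫⁻ r in Icc 0 t, (S.power r (u r) (F r)).toENNReal ≠ ⊤ :=
  ne_top_of_le_ne_top h.power_int (lintegral_mono_set (Icc_subset_Icc_right ht.2))

theorem real_ineq (h : S.EnergyDissipation ψ u F) {t : ℝ} (ht : t ∈ Icc 0 T) :
    S.energy t (u t) ≠ ⊤ ∧
    ∫⁻ r in Icc 0 t, ((ψ (S.speed u r).toNNReal : ℝ≥0∞) + dual ψ (F r)) ≠ ⊤ ∧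
    ∫⁻ r in Icc 0 t, (-S.power r (u r) (F r)).toENNReal ≠ ⊤ ∧
    (S.energy t (u t)).toReal
        + (∫⁻ r in Icc 0 t, ((ψ (S.speed u r).toNNReal : ℝ≥0∞) + dual ψ (F r))).toReal
        + (∫⁻ r in Icc 0 t, (-S.power r (u r) (F r)).toENNReal).toReal
      ≤ (S.energy 0 (u 0)).toReal
        + (∫⁻ r in Icc 0 t, (S.power r (u r) (F r)).toENNReal).toReal :=
  real_of_add_le (S.energy_ne_bot t ht _) (S.energy_ne_bot 0 ⟨le_rfl, ht.1.trans ht.2⟩ _) h.initial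
    (h.power_int_Icc ht) (h.ineq t ht)

/-- The dual is infinite at `⊤` and has a finite integral along `F`, so `F` is finite almost
everywhere; then monotonicity and upper semicontinuity reduce the claim to constant slopes along the
graph. -/
theorem power_aemeasurable (h : S.EnergyDissipation ψ u F) (hT : 0 < T) :
    AEMeasurable (fun r => S.power r (u r) (F r)) (volume.restrict (Icc 0 T)) := by
  let := S.metric
  have hmem := ae_restrict_mem (μ := volume) (measurableSet_Icc (a := (0 : ℝ)) (b := T))
  have hcurve : IsTimeOrderedAC T (fun s => s) u 0 T :=
    { mem := fun s hs => hs
      mono := monotone_id.monotoneOn _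
      ac_time := IsAC.of_edist_le (fun s t hst => by
        rw [edist_comm, edist_dist, Real.dist_eq, abs_of_nonneg (sub_nonneg.2 hst)]) 0 T
      ac_space := h.ac }
  refine aemeasurable_of_monotone_usc (P := fun r => S.power r (u r))
    (fun f => S.power_meas f 0 T _ u hT.le hcurve)
    h.measurable.aemeasurable (hmem.mono fun r hr => S.power_mono r hr _)
    (hmem.mono fun r hr => S.power_usc r hr _) ?_
  have hD := (h.real_ineq ⟨hT.le, le_rfl⟩).2.1
  have hdual : ∫⁻ r in Icc 0 T, dual ψ (F r) ≠ ⊤ :=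
    ne_top_of_le_ne_top hD (lintegral_mono fun r => le_add_self)
  filter_upwards [ae_lt_top ((measurable_dual ψ).comp h.measurable) hdual] with r hr
  refine lt_top_iff_ne_top.2 fun htop => ?_
  have hle : (⊤ : ℝ≥0∞) * ((1 : ℝ≥0) : ℝ≥0∞) - (ψ 1 : ℝ≥0∞) ≤ dual ψ (F r) := by
    rw [htop]
    exact le_iSup (fun v : ℝ≥0 => (⊤ : ℝ≥0∞) * (v : ℝ≥0∞) - (ψ v : ℝ≥0∞)) 1
  rw [ENNReal.coe_one, mul_one, ENNReal.top_sub_coe] at hle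
  exact absurd (top_le_iff.1 hle) (LT.lt.ne hr)

/-- The integral of `(k - P)⁺` is added to both sides; together with that of `P⁺` it is `k t`, plus
that of `P⁻`, plus an excess of at most `ω`. -/
theorem truncated_ineq (h : S.EnergyDissipation ψ u F) {t : ℝ} (ht : t ∈ Icc 0 T) (hT : 0 < T)
    (k : ℕ) {ω : ℝ≥0} (hω : ∫⁻ r in Icc 0 T, ((S.power r (u r) (F r)).toENNReal - k) ≤ ω) :
    S.energy t (u t)
      + ((∫⁻ r in Icc 0 t, ((ψ (S.speed u r).toNNReal : ℝ≥0∞) + (dual ψ (F r)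
        + (((k : ℝ) : EReal) - S.power r (u r) (F r)).toENNReal)) : ℝ≥0∞) : EReal)
      ≤ S.energy 0 (u 0) + ((k * t + ω : ℝ) : EReal) := by
  obtain ⟨hE, hD, hM, hle⟩ := h.real_ineq ht
  have hZ := h.power_int_Icc ht
  have h0 : (0 : ℝ) ∈ Icc 0 T := ⟨le_rfl, hT.le⟩
  have hPm : AEMeasurable (fun r => S.power r (u r) (F r)) (volume.restrict (Icc 0 t)) :=
    (h.power_aemeasurable hT).mono_set (Icc_subset_Icc_right ht.2)
  have hm := EReal.continuous_toENNReal.measurable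
  have hPp : AEMeasurable (fun r => (S.power r (u r) (F r)).toENNReal)
      (volume.restrict (Icc 0 t)) := hm.comp_aemeasurable hPm
  have hPn : AEMeasurable (fun r => (-S.power r (u r) (F r)).toENNReal)
      (volume.restrict (Icc 0 t)) := hm.comp_aemeasurable hPm.neg
  have hRm : AEMeasurable (fun r => (((k : ℝ) : EReal) - S.power r (u r) (F r)).toENNReal)
      (volume.restrict (Icc 0 t)) :=
    (antitone_sub_toENNReal k).measurable.comp_aemeasurable hPm
  set D := ∫⁻ r in Icc 0 t, ((ψ (S.speed u r).toNNReal : ℝ≥0∞) + dual ψ (F r))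
  set M := ∫⁻ r in Icc 0 t, (-S.power r (u r) (F r)).toENNReal
  set Z := ∫⁻ r in Icc 0 t, (S.power r (u r) (F r)).toENNReal
  set R := ∫⁻ r in Icc 0 t, (((k : ℝ) : EReal) - S.power r (u r) (F r)).toENNReal
  set W := ∫⁻ r in Icc 0 t, ((S.power r (u r) (F r)).toENNReal - k)
  have hWω : W ≤ ω := (lintegral_mono_set (Icc_subset_Icc_right ht.2)).trans hω
  have hsum : (∫⁻ r in Icc 0 t, ((ψ (S.speed u r).toNNReal : ℝ≥0∞) + (dual ψ (F r)
        + (((k : ℝ) : EReal) - S.power r (u r) (F r)).toENNReal))) = D + R := by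
    rw [← lintegral_add_right' _ hRm]
    exact lintegral_congr fun r => (add_assoc _ _ _).symm
  have hRZ : R + Z = k * ENNReal.ofReal t + M + W := by
    have e1 : k * ENNReal.ofReal t = ∫⁻ r in Icc 0 t, (k : ℝ≥0∞) := by
      rw [setLIntegral_const, Real.volume_Icc, sub_zero]
    rw [e1, ← lintegral_add_left measurable_const, ← lintegral_add_left' (hPn.const_add _),
      ← lintegral_add_right' _ hPp]
    exact lintegral_congr fun r => toENNReal_natCast_sub_add k _
  rw [hsum]
  have hW : W ≠ ⊤ := ne_top_of_le_ne_top ENNReal.coe_ne_top hWω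
  have hkt : (k : ℝ≥0∞) * ENNReal.ofReal t ≠ ⊤ :=
    ENNReal.mul_ne_top (ENNReal.natCast_ne_top k) ENNReal.ofReal_ne_top
  have hR : R ≠ ⊤ := (ENNReal.add_ne_top.1 (hRZ ▸
    ENNReal.add_ne_top.2 ⟨ENNReal.add_ne_top.2 ⟨hkt, hM⟩, hW⟩)).1
  have hreal := congrArg ENNReal.toReal hRZ
  rw [ENNReal.toReal_add hR hZ, ENNReal.toReal_add (ENNReal.add_ne_top.2 ⟨hkt, hM⟩) hW,
    ENNReal.toReal_add hkt hM, ENNReal.toReal_mul, ENNReal.toReal_natCast,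
    ENNReal.toReal_ofReal ht.1] at hreal
  have hW' : W.toReal ≤ ω := ENNReal.toReal_le_coe_of_le_coe hWω
  rw [← EReal.coe_toReal hE (S.energy_ne_bot t ht _),
    ← EReal.coe_toReal h.initial.ne (S.energy_ne_bot 0 h0 _),
    ← EReal.coe_ennreal_toReal (ENNReal.add_ne_top.2 ⟨hD, hR⟩), ← EReal.coe_add, ← EReal.coe_add,
    EReal.coe_le_coe_iff, ENNReal.toReal_add hD hR]
  linarith

/-- A priori bounds from the energy-dissipation inequality and the lower bound of the shifted
energy. -/
theorem bounds (h : S.EnergyDissipation ψ u F) (hT : 0 < T) {κ c K : ℝ≥0} {a b e₀ B : ℝ}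
    (hκ : max a 0 < κ) (hψ : ∀ v, κ * v ≤ ψ v + c)
    (hK : ∫⁻ r in Icc 0 T, (S.power r (u r) (F r)).toENNReal ≤ K) (he : S.energy 0 (u 0) ≤ e₀)
    (hC1 : ∀ t ∈ Icc 0 T, ∀ x, 0 ≤ S.energy t x + (a : EReal) * (S.dist x (u 0) : EReal) + b)
    (hB : (e₀ + K + b + c * T) / (κ - max a 0) ≤ B) :
    ∫⁻ r in Icc 0 T, S.speed u r ≤ ENNReal.ofReal B ∧ ∀ t ∈ Icc 0 T,
      ((-(max a 0 * B + b) : ℝ) : EReal) ≤ S.energy t (u t) ∧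
      S.energy t (u t) ≤ ((e₀ + K : ℝ) : EReal) ∧
      S.energy t (u t) + (a : EReal) * (S.dist (u t) (u 0) : EReal) + b
        ≤ ((e₀ + K + (max a 0 * B + b) : ℝ) : EReal) := by
  let := S.metric
  have h0 : (0 : ℝ) ∈ Icc 0 T := ⟨le_rfl, hT.le⟩
  have hTm : T ∈ Icc 0 T := ⟨hT.le, le_rfl⟩
  have hI : ∫⁻ r in Icc 0 T, S.speed u r ≠ ⊤ := IsAC.lintegral_metricDeriv_ne_top h.ac
  set I := ∫⁻ r in Icc 0 T, S.speed u r with hIdef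
  have hdist : ∀ t ∈ Icc 0 T, S.dist (u t) (u 0) ≤ I := fun t ht => by
    have h1 := IsAC.edist_le_lintegral_metricDeriv h.ac le_rfl ht.1 ht.2
    rw [edist_comm] at h1
    exact h1.trans (lintegral_mono_set (Icc_subset_Icc_right ht.2))
  have hup : ∀ t ∈ Icc 0 T, (S.energy t (u t)).toReal
      + (∫⁻ r in Icc 0 t, ((ψ (S.speed u r).toNNReal : ℝ≥0∞) + dual ψ (F r))).toReal ≤ e₀ + K := by
    intro t ht
    obtain ⟨-, -, -, hle⟩ := h.real_ineq ht
    have h1 : (∫⁻ r in Icc 0 t, (S.power r (u r) (F r)).toENNReal).toReal ≤ K :=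
      ENNReal.toReal_le_coe_of_le_coe
        ((lintegral_mono_set (Icc_subset_Icc_right ht.2)).trans hK)
    have h2 : (S.energy 0 (u 0)).toReal ≤ e₀ := by
      rw [← EReal.coe_toReal h.initial.ne (S.energy_ne_bot 0 h0 _)] at he
      exact_mod_cast he
    have h3 : 0 ≤ (∫⁻ r in Icc 0 t, (-S.power r (u r) (F r)).toENNReal).toReal :=
      ENNReal.toReal_nonneg
    linarith
  have hcoe : ∀ t ∈ Icc 0 T, ((S.energy t (u t)).toReal : EReal) = S.energy t (u t) := fun t ht =>
    EReal.coe_toReal (h.real_ineq ht).1 (S.energy_ne_bot t ht _)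
  have hmax : (0 : ℝ) ≤ max a 0 := le_max_right _ _
  have had : ∀ t ∈ Icc 0 T, a * (S.dist (u t) (u 0)).toReal ≤ max a 0 * I.toReal := by
    intro t ht
    have h1 : (S.dist (u t) (u 0)).toReal ≤ I.toReal := ENNReal.toReal_mono hI (hdist t ht)
    exact (mul_le_mul_of_nonneg_right (le_max_left a 0) ENNReal.toReal_nonneg).trans
      (mul_le_mul_of_nonneg_left h1 hmax)
  have hshift : ∀ t ∈ Icc 0 T, S.energy t (u t) + (a : EReal) * (S.dist (u t) (u 0) : EReal) + b
      = (((S.energy t (u t)).toReal + a * (S.dist (u t) (u 0)).toReal + b : ℝ) : EReal) := by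
    intro t ht
    have h1 : S.dist (u t) (u 0) ≠ ⊤ := ne_top_of_le_ne_top hI (hdist t ht)
    rw [EReal.coe_add, EReal.coe_add, EReal.coe_mul, hcoe t ht, EReal.coe_ennreal_toReal h1]
  have hlow : ∀ t ∈ Icc 0 T, -(max a 0 * I.toReal + b) ≤ (S.energy t (u t)).toReal := by
    intro t ht
    have h1 := hC1 t ht (u t)
    rw [hshift t ht] at h1
    have h2 : 0 ≤ (S.energy t (u t)).toReal + a * (S.dist (u t) (u 0)).toReal + b := by
      exact_mod_cast h1
    linarith [had t ht]
  -- The length satisfies `κ I ≤ e₀ + K + c T - E(T)`, and the shifted energy bounds `-E(T)` by `max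
  -- a 0 * I + b`; as `max a 0 < κ`, the length is absorbed.
  have hIB : I.toReal ≤ B := by
    refine le_trans ?_ hB
    rw [le_div_iff₀ (by linarith)]
    obtain ⟨-, hD, -, -⟩ := h.real_ineq hTm
    have h1 : κ * I ≤ (∫⁻ r in Icc 0 T, ((ψ (S.speed u r).toNNReal : ℝ≥0∞) + dual ψ (F r)))
        + c * ENNReal.ofReal T := by
      have e1 : (c : ℝ≥0∞) * ENNReal.ofReal T = ∫⁻ r in Icc 0 T, (c : ℝ≥0∞) := by
        rw [setLIntegral_const, Real.volume_Icc, sub_zero]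
      rw [hIdef, e1, ← lintegral_const_mul' _ _ ENNReal.coe_ne_top,
        ← lintegral_add_right _ measurable_const]
      refine lintegral_mono_ae ?_
      filter_upwards [IsAC.metricDeriv_lt_top h.ac] with r hr
      have hr' : S.speed u r ≠ ⊤ := LT.lt.ne hr
      have h2 := hψ (S.speed u r).toNNReal
      have h3 : (κ : ℝ≥0∞) * S.speed u r ≤ ψ (S.speed u r).toNNReal + c := by
        conv_lhs => rw [← ENNReal.coe_toNNReal hr']
        exact_mod_cast h2
      exact h3.trans (add_le_add le_self_add le_rfl)
    have hcT : (c : ℝ≥0∞) * ENNReal.ofReal T ≠ ⊤ :=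
      ENNReal.mul_ne_top ENNReal.coe_ne_top ENNReal.ofReal_ne_top
    have h2 := ENNReal.toReal_mono (ENNReal.add_ne_top.2 ⟨hD, hcT⟩) h1
    rw [ENNReal.toReal_add hD hcT, ENNReal.toReal_mul, ENNReal.toReal_mul, ENNReal.coe_toReal,
      ENNReal.coe_toReal, ENNReal.toReal_ofReal hT.le] at h2
    linarith [hup T hTm, hlow T hTm, mul_sub I.toReal κ (max a 0), mul_comm I.toReal κ,
      mul_comm I.toReal (max a 0)]
  have hmul := mul_le_mul_of_nonneg_left hIB hmax
  refine ⟨?_, fun t ht => ⟨?_, ?_, ?_⟩⟩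
  · rw [← ENNReal.ofReal_toReal hI]
    exact ENNReal.ofReal_le_ofReal hIB
  · rw [← hcoe t ht, EReal.coe_le_coe_iff]
    linarith [hlow t ht]
  · rw [← hcoe t ht, EReal.coe_le_coe_iff]
    exact (le_add_of_nonneg_right ENNReal.toReal_nonneg).trans (hup t ht)
  · rw [hshift t ht, EReal.coe_le_coe_iff]
    have h1 := (le_add_of_nonneg_right ENNReal.toReal_nonneg).trans (hup t ht)
    linarith [had t ht]

end EvolutionSystem.EnergyDissipation

end

/-! ### From the hypotheses to an approximating sequence -/

noncomputable section

/-- Solutions of the approximating energy-dissipation inequalities form, after finitely many indices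
are dropped, an approximating sequence. -/
theorem exists_approx {X : Type*} [TopologicalSpace X] {T : ℝ} (hT : 0 < T)
    {S : ℕ → EvolutionSystem X T} {S' : EvolutionSystem X T} {ψh : ℕ → ℝ≥0 → ℝ≥0} {ψ : ℝ≥0 → ℝ≥0}
    {L : ℝ≥0} (hψh : ∀ h, ∃ Lh : ℝ≥0∞, IsMetricDissipation (ψh h) Lh)
    (hψ : IsMetricDissipation ψ (L : ℝ≥0∞))
    (hψlim : ∀ v, Tendsto (fun h => ψh h v) atTop (𝓝 (ψ v)))
    {ubar : ℕ → X} {ubar' : X} (hubar : Tendsto ubar atTop (𝓝 ubar'))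
    {a b : ℝ} (ha : a < (L : ℝ))
    (hC1 : CondC1 S ubar a b) (hC2 : CondC2 S ubar a b) (hC3 : CondC3 S S' ubar a b)
    (hC4E : CondC4E S S' ubar a b) (hC4FP : CondC4FP S S' ubar a b)
    (hC4F : CondC4F S S' ubar a b) {H : Set ℕ} (hH : H.Infinite)
    {u : ℕ → ℝ → X} {F : ℕ → ℝ → ℝ≥0∞} {u' : ℝ → X}
    (hED : ∀ h ∈ H, (S h).EnergyDissipation (ψh h) (u h) (F h))
    (hinit : ∀ h ∈ H, u h 0 = ubar h)
    (hlim : ∀ t ∈ Icc 0 T, Tendsto (fun h => u h t) (along H) (𝓝 (u' t)))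
    (hE0 : S'.energy 0 ubar' < ⊤)
    (hE : Tendsto (fun h => (S h).energy 0 (ubar h)) (along H) (𝓝 (S'.energy 0 ubar')))
    (hP : EquiIntegrable H T (fun h r => ((S h).power r (u h r) (F h r)).toENNReal)) :
    ∃ φ : ℕ → ℕ, StrictMono φ ∧ along H = map φ atTop ∧ ∃ (E₀ : ℝ) (C : ℝ≥0) (ω : ℕ → ℝ≥0),
      S'.energy 0 (u' 0) = E₀ ∧
      Approx (fun n => S (φ n)) S' (fun n => ψh (φ n)) ψ L (fun n => u (φ n)) (fun n => F (φ n)) u'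
        E₀ C ω := by
  choose Lh hLh using hψh
  have hTT : (0 : ℝ) ∈ Icc 0 T := ⟨le_rfl, hT.le⟩
  -- A growth rate of the dissipation strictly between the rate at which the energy may decrease
  -- with the distance and `L`; here `a < L` enters.
  obtain ⟨κ, hκa, hκL⟩ : ∃ κ : ℝ≥0, max a 0 < κ ∧ κ < L := by
    have hL : (0 : ℝ) < L := by
      have := hψ.slope_pos
      exact_mod_cast this
    obtain ⟨κ, h1, h2⟩ := exists_between (max_lt ha hL)
    lift κ to ℝ≥0 using (le_max_right a 0).trans h1.le
    exact ⟨κ, h1, by exact_mod_cast h2⟩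
  obtain ⟨c, hc⟩ := hψ.eventually_mul_le (fun n => (hLh n).convex) (fun n => (hLh n).zero) hψlim hκL
  obtain ⟨K, hK⟩ := hP.exists_bound
  obtain ⟨ω, hω, hωle⟩ := hP.exists_modulus fun h hh =>
    EReal.continuous_toENNReal.measurable.comp_aemeasurable ((hED h hh).power_aemeasurable hT)
  set E₀ := (S'.energy 0 ubar').toReal
  have hE₀ : S'.energy 0 ubar' = E₀ :=
    (EReal.coe_toReal hE0.ne (S'.energy_ne_bot 0 hTT _)).symm
  rw [hE₀] at hE
  have hEev : ∀ᶠ h in along H, (S h).energy 0 (ubar h) < ((E₀ + 1 : ℝ) : EReal) :=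
    (tendsto_order.1 hE).2 _ (EReal.coe_lt_coe_iff.2 (by linarith))
  rw [along, eventually_inf_principal] at hEev
  -- Beyond `N` the initial energies are below `E₀ + 1` and the linear lower bound on `ψh` holds.
  obtain ⟨N, hN⟩ := eventually_atTop.1 (hEev.and hc)
  have hinf : (H ∩ Ici N).Infinite := by
    have : H ∩ Ici N = H \ Iio N := by
      ext n; simp
    rw [this]
    exact hH.sdiff (finite_Iio N)
  obtain ⟨φ, hφ, hr⟩ := exists_strictMono_range hinf
  have halong : along H = map φ atTop := by rw [← along_inter_Ici H N, ← hr, along_range hφ]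
  have hφH : ∀ n, φ n ∈ H := fun n => (hr ▸ mem_range_self n : φ n ∈ H ∩ Ici N).1
  have hφN : ∀ n, N ≤ φ n := fun n => (hr ▸ mem_range_self n : φ n ∈ H ∩ Ici N).2
  rw [halong, tendsto_map'_iff] at hE
  have hlim' : ∀ t ∈ Icc 0 T, Tendsto (fun n => u (φ n) t) atTop (𝓝 (u' t)) := fun t ht => by
    have := hlim t ht
    rwa [halong, tendsto_map'_iff] at this
  set e₀ := E₀ + 1
  set B := (e₀ + K + b + c * T) / (κ - max a 0)
  have hbd := fun n => (hED (φ n) (hφH n)).bounds hT (e₀ := e₀) (b := b) hκa (hN _ (hφN n)).2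
    (hK _ (hφH n)) (by rw [hinit _ (hφH n)]; exact ((hN _ (hφN n)).1 (hφH n)).le)
    (by rw [hinit _ (hφH n)]; exact hC1 (φ n)) (le_refl B)
  set C₁ := max (e₀ + K + (max a 0 * B + b)) (e₀ + K)
  have hshift : ∀ n, ∀ t ∈ Icc 0 T, shiftedEnergy S ubar a b (φ n) t (u (φ n) t) ≤ C₁ := by
    intro n t ht
    have := ((hbd n).2 t ht).2.2
    rw [hinit _ (hφH n)] at this
    exact this.trans (EReal.coe_le_coe_iff.2 (le_max_left _ _))
  have hener : ∀ n, ∀ t ∈ Icc 0 T, (S (φ n)).energy t (u (φ n) t) ≤ C₁ := fun n t ht =>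
    ((hbd n).2 t ht).2.1.trans (EReal.coe_le_coe_iff.2 (le_max_right _ _))
  set C : ℝ≥0 := (max (max B (max a 0 * B + b)) (e₀ + K)).toNNReal
  have hC : max (max B (max a 0 * B + b)) (e₀ + K) ≤ C := Real.le_coe_toNNReal _
  -- The topology of `X` need not be Hausdorff; the lower limit inequality for the distances
  -- identifies the two limits of the initial values.
  have hstart : u' 0 = ubar' := by
    let := S'.metric
    have hubar'' : Tendsto (fun n => ubar (φ n)) atTop (𝓝 ubar') := hubar.comp hφ.tendsto_atTop
    have h1 := hC3.seq hφ (t₁ := fun _ => 0) (t₂ := fun _ => 0) (x₁ := fun n => u (φ n) 0)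
      (x₂ := fun n => ubar (φ n)) (fun _ => hTT) (fun _ => hTT) (fun n => hshift n 0 hTT)
      (fun n => by rw [← hinit _ (hφH n)]; exact hshift n 0 hTT) tendsto_const_nhds (hlim' 0 hTT)
      tendsto_const_nhds hubar''
    have h2 : (fun n => (S (φ n)).dist (u (φ n) 0) (ubar (φ n))) = fun _ => 0 := funext fun n => by
      let := (S (φ n)).metric
      rw [hinit _ (hφH n)]
      exact edist_self (ubar (φ n))
    rw [h2, liminf_const] at h1
    exact edist_le_zero.1 h1
  refine ⟨φ, hφ, halong, E₀, C, ω, hstart ▸ hE₀, ?_⟩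
  exact
    { T_pos := hT
      diss := hψ
      convex := fun n => (hLh _).convex
      zero := fun n => (hLh _).zero
      diss_lim := fun v => (hψlim v).comp hφ.tendsto_atTop
      ac := fun n => (hED _ (hφH n)).ac
      meas := fun n => (hED _ (hφH n)).measurable
      slope_le := fun n => (hED _ (hφH n)).slope_le
      lim := hlim'
      compact := fun χ t hχ ht => hC2.seq (hφ.comp hχ) ht fun n => hshift _ _ (ht n)
      dist_le := fun χ s t s' t' x y hχ hs ht hs' hx ht' hy => hC3.seq (hφ.comp hχ) hs ht
        (fun n => hshift _ _ (hs n)) (fun n => hshift _ _ (ht n)) hs' hx ht' hy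
      slope_lsc := fun χ t t' x hχ ht ht' hx => hC4F.seq (hφ.comp hχ) ht
        (fun n => hshift _ _ (ht n)) (fun n => hener _ _ (ht n)) ht' hx
      energy_lsc := fun χ hχ t ht => hC4E.seq (hφ.comp hχ) ht (fun n => hshift _ _ ht)
        ((hlim' t ht).comp hχ.tendsto_atTop)
      power_usc := fun χ f f' hχ t ht hf hf' => hC4FP.seq (hφ.comp hχ) ht (fun n => hshift _ _ ht)
        ((hlim' t ht).comp hχ.tendsto_atTop) hf hf'
      speed_le := fun n => by
        refine (hbd n).1.trans ?_
        rw [← ENNReal.ofReal_coe_nnreal]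
        exact ENNReal.ofReal_le_ofReal (((le_max_left _ _).trans (le_max_left _ _)).trans hC)
      power_meas := fun n => (hED _ (hφH n)).power_aemeasurable hT
      energy_ge := fun n t ht => le_trans (EReal.coe_le_coe_iff.2
        (neg_le_neg (((le_max_right _ _).trans (le_max_left _ _)).trans hC))) ((hbd n).2 t ht).1
      energy_le := fun n t ht => ((hbd n).2 t ht).2.1.trans
        (EReal.coe_le_coe_iff.2 ((le_max_right _ _).trans hC))
      initial := hE.congr fun n => by simp [hinit _ (hφH n)]
      modulus := hω
      ineq := fun n k t ht => (hED _ (hφH n)).truncated_ineq ht hT k (hωle _ (hφH n) k) }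

end

end Evolution

theorem theorem4p2 {X : Type*} [TopologicalSpace X] {T : ℝ} (hT : 0 < T)
    (S : ℕ → EvolutionSystem X T) (S' : EvolutionSystem X T)
    (ψh : ℕ → ℝ≥0 → ℝ≥0) (ψ : ℝ≥0 → ℝ≥0) (L : ℝ≥0)
    (hψh : ∀ h, ∃ Lh : ℝ≥0∞, IsMetricDissipation (ψh h) Lh)
    (hψ : IsMetricDissipation ψ (L : ℝ≥0∞))
    (hψlim : ∀ v, Tendsto (fun h => ψh h v) atTop (𝓝 (ψ v)))
    (ubar : ℕ → X) (ubar' : X) (hubar : Tendsto ubar atTop (𝓝 ubar'))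
    (a b : ℝ) (ha : a < (L : ℝ)) (hb : 0 ≤ b)
    (hC1 : CondC1 S ubar a b) (hC2 : CondC2 S ubar a b) (hC3 : CondC3 S S' ubar a b)
    (hC4E : CondC4E S S' ubar a b) (hC4FP : CondC4FP S S' ubar a b)
    (hC4F : CondC4F S S' ubar a b)
    (H : Set ℕ) (hH : H.Infinite)
    (u : ℕ → ℝ → X) (F : ℕ → ℝ → ℝ≥0∞) (u' : ℝ → X)
    (hED : ∀ h ∈ H, (S h).EnergyDissipation (ψh h) (u h) (F h))
    (hinit : ∀ h ∈ H, u h 0 = ubar h)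
    (hlim : ∀ t ∈ Icc 0 T, Tendsto (fun h => u h t) (along H) (𝓝 (u' t)))
    (hE0 : S'.energy 0 ubar' < ⊤)
    (hE : Tendsto (fun h => (S h).energy 0 (ubar h)) (along H) (𝓝 (S'.energy 0 ubar')))
    (hP : EquiIntegrable H T (fun h r => ((S h).power r (u h r) (F h r)).toENNReal)) :
    (S'.BV u' ∧ ∀ t ∈ Icc 0 T \ S'.jumps u', S'.slope t (u' t) ≤ (L : ℝ≥0∞)) ∧
    (S'.PowerBound L u' → ∃ F' : ℝ → ℝ≥0∞, S'.BVEnergyDissipation ψ L u' F') ∧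
    (S'.IsUpperGradient →
      S'.PowerBound L u' ∧ S'.IsBVSolution ψ L u' ∧
      ∀ t ∈ Icc 0 T,
        Tendsto (fun h => (S h).energy t (u h t)) (along H) (𝓝 (S'.energy t (u' t)))) := by
  obtain ⟨φ, hφ, halong, E₀, C, ω, hE', happ⟩ := exists_approx hT hψh hψ hψlim hubar ha hC1 hC2 hC3
    hC4E hC4FP hC4F hH hED hinit hlim hE0 hE hP
  -- A further subsequence does no harm to statements about `u'` alone; the convergence of the
  -- energies concerns the whole family and goes back to `happ`.
  obtain ⟨χ, hχ, τn, σn, θn, vn, τ, σ, θ, h⟩ := happ.exists_paramApprox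
  refine ⟨⟨@IsLipParam.boundedVariationOn X S'.metric T u' τ σ θ h.lip,
    fun t ht => h.slope_le_of_notMem_jumps ht.1 ht.2⟩, h.bvEnergyDissipation hE', fun hS =>
    ⟨h.powerBound hS hE', ⟨hS, (h.exists_bvBalance hS hE').1⟩, fun t ht => ?_⟩⟩
  rw [halong, tendsto_map'_iff]
  exact happ.tendsto_energy hS hE' ht
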